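/- Let $m\ge 3$, $0\le s\le m$, $k\in\mathbb N_0$. Let $\mathcal C\ell_m$ be either the real Clifford algebra $\mathbb R_{0,m}$ with generators $e_1,\dots,e_m$, $e_ie_j+e_je_i=-2\delta_{ij}$, or its complexification $\mathbb C_m$; scalars are real, resp. complex. Let $\mathcal C\ell_m^s$ be the space of $s$-vectors (spanned by the products $e_{i_1}\cdots e_{i_s}$, $i_1<\dots<i_s$), $\partial=\sum_{i=1}^m e_i\partial_{x_i}$, and let $\mathcal H^s_k(\mathbb R^m)$ be the space of $k$-homogeneous polynomials $P:\mathbb R^m\to\mathcal C\ell_m^s$ with $\partial P=0$. The inner product is $(f,g)=\int_{\mathbb B_m}[\bar f g]_0\,d\lambda^m$ over the unit ball, where $\bar a$ is the Clifford conjugate (complex coefficients being conjugated too) and $[a]_0$ the scalar part. $Pin(r)$ is the group of finite products of unit vectors of $\mathbb R^r=\mathrm{span}(e_1,\dots,e_r)$; for $r\le m$ it acts on polynomials by $[H(g)f](x)=g\,f(g^{-1}xg)\,g^{-1}$. For a 1-vector $u$ and an $s$-vector $v$ put $u\wedge v=\frac12(uv+(-1)^svu)$, $u\bullet v=\frac12(uv-(-1)^svu)$,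 extended linearly in $v$. *Embedding factors.* For $r\ge3$, $j,n\ge 0$, $x=(x_1,\dots,x_r)$ and $\underline x=x_1e_1+\dots+x_{r-1}e_{r-1}$ let $$F^{(n)}_{r,j}(x)=\frac{(j+1)_n}{(r-2+2j)_n}\,|x|^n\,C_n^{r/2+j-1}(x_r/|x|),\qquad C^a_n(z)=\sum_{i=0}^{[n/2]}\frac{(-1)^i(a)_{n-i}}{i!\,(n-2i)!}(2z)^{n-2i},$$ where $(a)_n=a(a+1)\cdots(a+n-1)$, and $$X^{(n)}_{r,j}=F^{(n)}_{r,j}+\frac{j+1}{r+2j-1}F^{(n-1)}_{r,j+1}\,\underline x\,e_r,\qquad F^{(-1)}_{r,j}=X^{(-1)}_{r,j}=0.$$ Let $N^{s,r}_k$ be the set of pairs $(t,j)\in\{0,\dots,r-1\}\times\{0,\dots,k\}$ with $t\in\{s-1,s\}$ and with $j=0$ whenever $t\in\{0,r-1\}$. For $(t,j)\in N^{s,r}_k$ define the operator $$X^{s,t,r}_{k,j}=X^{(k-j)}_{r,j}\,e_r^{s-t}+\alpha\,X^{(k-1-j)}_{r,j+1}\bigl(\beta^{t-s}(\underline x\,\wedge)+\beta^{t-s+1}(\underline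 x\,\bullet)\bigr)e_r^{s-t+1},$$ where $\alpha=-\frac{j+1}{r+2j-1}$ and $\beta=-\frac{j+r-1-t}{j+t}$ if $t\notin\{0,r-1\}$, while for $t\in\{0,r-1\}$ one has $\alpha=0$ and the second term is absent. *Dimension two.* Put $f^0_0=1$, $f^2_0=e_2e_1$ and, for $k\in\mathbb N_0$: if $\mathcal C\ell_m=\mathbb R_{0,m}$, $f^{1}_k=(x_1-e_1e_2x_2)^ke_1$ and $f^{-1}_k=(x_1-e_1e_2x_2)^ke_2$; if $\mathcal C\ell_m=\mathbb C_m$, $f^{\pm1}_k=(x_1\mp ix_2)^k(e_1\mp ie_2)$. *Indices.* Let $I^{s,m}_k$ be the set of pairs $(\nu,\mu)$ of integer sequences $\nu=(s_{m-1},\dots,s_3,t_2)$, $\mu=(k_{m-1},\dots,k_2)$ such that $(t_2,k_2)\in\{(0,0),(2,0)\}\cup\{(\pm1,l):l\in\mathbb N_0\}$ and $(s_{r-1},k_{r-1})\in N^{s_r,r}_{k_r}$ for $r=3,\dots,m$, where $s_m=s$, $k_m=k$, $s_2=|t_2|$. **Theorem.** If $1\le s\le m-1$ or $k=0$, then, for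 both choices of $\mathcal C\ell_m$, the polynomials $$f^{s,\nu}_{k,\mu}=X^{s,s_{m-1},m}_{k,k_{m-1}}X^{s_{m-1},s_{m-2},m-1}_{k_{m-1},k_{m-2}}\cdots X^{s_3,s_2,3}_{k_3,k_2}\,f^{t_2}_{k_2},\qquad(\nu,\mu)\in I^{s,m}_k,$$ form an orthogonal basis of $\mathcal H^s_k(\mathbb R^m)$, and this basis is a Gelfand–Tsetlin basis, i.e. it is adapted to the chain $Pin(m)\supset Pin(m-1)\supset\dots\supset Pin(2)$: $\mathcal H^s_k(\mathbb R^m)$ is $Pin(m)$-irreducible; it is the direct sum of pairwise inequivalent irreducible $Pin(m-1)$-submodules such that each basis element lies in one of them; the basis elements lying in a given submodule form a basis of it which is, recursively, adapted to $Pin(m-1)\supset\dots\supset Pin(2)$ (for $Pin(2)$: a basis of an irreducible module). In the remaining case $s\in\{0,m\}$, $k\ge1$, $\mathcal H^s_k(\mathbb R^m)=\{0\}$. -/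

import Mathlib

open scoped TensorProduct

namespace HodgeDeRham

noncomputable section

/-! ### The Clifford algebra -/

/-- The quadratic form `x ↦ -(x₁² + ⋯ + x_m²)` on `ℝ^m`. -/
def negForm (m : ℕ) : QuadraticForm ℝ (Fin m → ℝ) :=
  QuadraticMap.weightedSumSquares ℝ (fun _ : Fin m => (-1 : ℝ))

/-- The real Clifford algebra `ℝ_{0,m}`, in which `e_i e_j + e_j e_i = -2 δ_{ij}`. -/
abbrev RCl (m : ℕ) : Type := CliffordAlgebra (negForm m)

/-- The Clifford algebra with scalars `𝕂`: it is `ℝ_{0,m}` for `𝕂 = ℝ` and its complexification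
`ℂ_m` for `𝕂 = ℂ`. -/
abbrev Cl (𝕂 : Type) [RCLike 𝕂] (m : ℕ) : Type := 𝕂 ⊗[ℝ] RCl m

/-- The scalar part `[a]₀` of `a ∈ ℝ_{0,m}`. -/
def realScalarPart (m : ℕ) : RCl m →ₗ[ℝ] ℝ :=
  ExteriorAlgebra.algebraMapInv.toLinearMap ∘ₗ
    (CliffordAlgebra.equivExterior (negForm m)).toLinearMap

/-- The orthonormal basis vector `e_i` of `ℝ^m`, counted from `i = 1` (and `0` if there is no such
basis vector), as an element of `ℝ_{0,m}`. -/
def realE (m i : ℕ) : RCl m :=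
  if h : 1 ≤ i ∧ i ≤ m then CliffordAlgebra.ι (negForm m) (Pi.single ⟨i - 1, by omega⟩ 1) else 0

section

variable (𝕂 : Type) [RCLike 𝕂] (m : ℕ)

/-- The scalar part `[a]₀`. -/
def scalarPart : Cl 𝕂 m →ₗ[𝕂] 𝕂 :=
  (TensorProduct.AlgebraTensorModule.rid ℝ 𝕂 𝕂).toLinearMap ∘ₗ
    (realScalarPart m).baseChange 𝕂

/-- Clifford conjugation `a ↦ ā`: the anti-automorphism with `ē_i = -e_i`; for `𝕂 = ℂ` the
complex coefficients are conjugated as well. -/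
def cliffConj : Cl 𝕂 m →ₗ[ℝ] Cl 𝕂 m :=
  TensorProduct.map (RCLike.conjAe (K := 𝕂)).toLinearMap
    (CliffordAlgebra.reverse ∘ₗ (CliffordAlgebra.involute (Q := negForm m)).toLinearMap)

/-- The main involution, multiplication by `(-1)^s` on `s`-vectors. -/
def mainInvolution : Cl 𝕂 m →ₐ[𝕂] Cl 𝕂 m :=
  Algebra.TensorProduct.map (AlgHom.id 𝕂 𝕂) (CliffordAlgebra.involute (Q := negForm m))

/-- The space of `s`-vectors: the span of the products `e_{i₁} ⋯ e_{i_s}`,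
`1 ≤ i₁ < ⋯ < i_s ≤ m`. -/
def sVectors (s : ℕ) : Submodule 𝕂 (Cl 𝕂 m) :=
  Submodule.span 𝕂
    {a | ∃ S : Finset ℕ, S ⊆ Finset.Icc 1 m ∧ S.card = s ∧
      a = 1 ⊗ₜ[ℝ] ((S.sort (· ≤ ·)).map (realE m)).prod}

/-! ### Clifford algebra valued polynomials -/

/-- The algebra of polynomials on `ℝ^m` with values in the Clifford algebra. -/
abbrev Pol : Type := MvPolynomial (Fin m) 𝕂 ⊗[𝕂] Cl 𝕂 m

/-- Scalar polynomials as Clifford algebra valued polynomials. -/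
def ofScalar : MvPolynomial (Fin m) 𝕂 →ₐ[𝕂] Pol 𝕂 m := Algebra.TensorProduct.includeLeft

/-- Elements of `ℝ_{0,m}` as constant polynomials. -/
def const (a : RCl m) : Pol 𝕂 m := 1 ⊗ₜ[𝕂] (1 ⊗ₜ[ℝ] a)

/-- The coordinate `x_i`, counted from `i = 1`. -/
def coord (i : ℕ) : MvPolynomial (Fin m) 𝕂 :=
  if h : 1 ≤ i ∧ i ≤ m then MvPolynomial.X ⟨i - 1, by omega⟩ else 0

/-- `x_i` as a Clifford algebra valued polynomial. -/
def x (i : ℕ) : Pol 𝕂 m := ofScalar 𝕂 m (coord 𝕂 m i)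

/-- `e_i` as a constant polynomial. -/
def e (i : ℕ) : Pol 𝕂 m := const 𝕂 m (realE m i)

/-- The value of a polynomial at a point of `ℝ^m`. -/
def evalAt (p : EuclideanSpace ℝ (Fin m)) : Pol 𝕂 m →ₐ[𝕂] Cl 𝕂 m :=
  (Algebra.TensorProduct.lid 𝕂 (Cl 𝕂 m)).toAlgHom.comp
    (Algebra.TensorProduct.map (MvPolynomial.aeval fun i => algebraMap ℝ 𝕂 (p i))
      (AlgHom.id 𝕂 (Cl 𝕂 m)))

/-- The partial derivative `∂_{x_i}`, counted from `i = 1`. -/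
def partialD (i : ℕ) : Pol 𝕂 m →ₗ[𝕂] Pol 𝕂 m :=
  if h : 1 ≤ i ∧ i ≤ m then
    LinearMap.rTensor (Cl 𝕂 m) (MvPolynomial.pderiv (R := 𝕂) (⟨i - 1, by omega⟩ : Fin m)).toLinearMap
  else 0

/-- The Dirac operator `∂ = e₁ ∂_{x₁} + ⋯ + e_m ∂_{x_m}`. -/
def dirac : Pol 𝕂 m →ₗ[𝕂] Pol 𝕂 m :=
  ∑ i ∈ Finset.Icc 1 m, LinearMap.mulLeft 𝕂 (e 𝕂 m i) ∘ₗ partialD 𝕂 m i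

/-- The space `H^s_k(ℝ^m)` of `k`-homogeneous monogenic polynomials on `ℝ^m` with values in the
space of `s`-vectors. -/
def HdR (s k : ℕ) : Submodule 𝕂 (Pol 𝕂 m) where
  carrier := {f | (∀ (c : ℝ) (p : EuclideanSpace ℝ (Fin m)),
      evalAt 𝕂 m (c • p) f = algebraMap ℝ 𝕂 (c ^ k) • evalAt 𝕂 m p f) ∧
    (∀ p : EuclideanSpace ℝ (Fin m), evalAt 𝕂 m p f ∈ sVectors 𝕂 m s) ∧
    dirac 𝕂 m f = 0}
  add_mem' := by
    rintro f g ⟨hf1, hf2, hf3⟩ ⟨hg1, hg2, hg3⟩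
    refine ⟨fun c p => ?_, fun p => ?_, ?_⟩
    · rw [map_add, map_add, hf1, hg1, smul_add]
    · rw [map_add]
      exact add_mem (hf2 p) (hg2 p)
    · rw [map_add, hf3, hg3, add_zero]
  zero_mem' := by
    refine ⟨fun c p => ?_, fun p => ?_, ?_⟩
    · rw [map_zero, map_zero, smul_zero]
    · rw [map_zero]
      exact zero_mem _
    · rw [map_zero]
  smul_mem' := by
    rintro a f ⟨hf1, hf2, hf3⟩
    refine ⟨fun c p => ?_, fun p => ?_, ?_⟩
    · rw [map_smul, map_smul, hf1, smul_comm]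
    · rw [map_smul]
      exact Submodule.smul_mem _ _ (hf2 p)
    · rw [map_smul, hf3, smul_zero]

/-- The `L²`-inner product `(f, g) = ∫_{𝔹_m} [f̄ g]₀ dλ^m` over the unit ball. -/
def innerL2 (f g : Pol 𝕂 m) : 𝕂 :=
  ∫ p in Metric.ball (0 : EuclideanSpace ℝ (Fin m)) 1,
    scalarPart 𝕂 m (cliffConj 𝕂 m (evalAt 𝕂 m p f) * evalAt 𝕂 m p g)

/-- The family `f` is an orthogonal basis of `W`. -/
def IsOrthogonalBasis {I : Type} (f : I → Pol 𝕂 m) (W : Submodule 𝕂 (Pol 𝕂 m)) : Prop :=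
  LinearIndependent 𝕂 f ∧ Submodule.span 𝕂 (Set.range f) = W ∧
    ∀ i j, i ≠ j → innerL2 𝕂 m (f i) (f j) = 0

/-! ### The `H`-action of the Pin groups and Gelfand-Tsetlin bases -/

/-- The group `Pin(r)` inside `Pin(m)`, `r ≤ m`: the group of finite products of unit vectors of
`ℝ^r = span (e₁, …, e_r)`. The inverse of a unit vector `v` is the unit vector `-v`. -/
def Pin (r : ℕ) : Subgroup (RCl m)ˣ :=
  Subgroup.closure
    {u | ∃ v : Fin m → ℝ, ∑ i, v i ^ 2 = 1 ∧ (∀ i : Fin m, r ≤ i → v i = 0) ∧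
      (u : RCl m) = CliffordAlgebra.ι (negForm m) v}

/-- The `i`-th coordinate of the vector `g⁻¹ e_j g` (for a vector `a = ∑ a_i e_i` one has
`a_i = -[e_i a]₀`). -/
def rotCoeff (g : (RCl m)ˣ) (i j : Fin m) : ℝ :=
  -realScalarPart m (realE m (i + 1) * (((g⁻¹ : (RCl m)ˣ) : RCl m) * realE m (j + 1) * (g : RCl m)))

/-- The substitution `f(x) ↦ f(g⁻¹ x g)` on polynomials. -/
def substConj (g : (RCl m)ˣ) : Pol 𝕂 m →ₐ[𝕂] Pol 𝕂 m :=
  Algebra.TensorProduct.map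
    (MvPolynomial.aeval fun i : Fin m =>
      ∑ j : Fin m, MvPolynomial.C (algebraMap ℝ 𝕂 (rotCoeff m g i j)) * MvPolynomial.X j)
    (AlgHom.id 𝕂 (Cl 𝕂 m))

/-- The `H`-action `[H(g) f](x) = g f(g⁻¹ x g) g⁻¹`. -/
def actH (g : (RCl m)ˣ) : Pol 𝕂 m →ₗ[𝕂] Pol 𝕂 m :=
  LinearMap.mulLeft 𝕂 (const 𝕂 m (g : RCl m)) ∘ₗ
    LinearMap.mulRight 𝕂 (const 𝕂 m ((g⁻¹ : (RCl m)ˣ) : RCl m)) ∘ₗ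
      (substConj 𝕂 m g).toLinearMap

/-- `W` is invariant under the `H`-action of `Pin(r)`. -/
def IsInvariant (r : ℕ) (W : Submodule 𝕂 (Pol 𝕂 m)) : Prop :=
  ∀ g ∈ Pin m r, ∀ f ∈ W, actH 𝕂 m g f ∈ W

/-- `W` is an irreducible module under the `H`-action of `Pin(r)`. -/
def IsIrred (r : ℕ) (W : Submodule 𝕂 (Pol 𝕂 m)) : Prop :=
  IsInvariant 𝕂 m r W ∧ W ≠ ⊥ ∧
    ∀ U : Submodule 𝕂 (Pol 𝕂 m), U ≤ W → IsInvariant 𝕂 m r U → U = ⊥ ∨ U = W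

/-- The modules `U` and `W` are equivalent under the `H`-action of `Pin(r)`. -/
def AreEquivalent (r : ℕ) (U W : Submodule 𝕂 (Pol 𝕂 m)) : Prop :=
  ∃ φ : U ≃ₗ[𝕂] W, ∀ g ∈ Pin m r, ∀ u u' : U,
    (u' : Pol 𝕂 m) = actH 𝕂 m g u → (φ u' : Pol 𝕂 m) = actH 𝕂 m g (φ u)

/-- `IsGelfandTsetlin 𝕂 m f n J W`: the elements `f i`, `i ∈ J`, form a basis of the irreducible
`Pin(n+2)`-module `W` that is adapted to the chain `Pin(n+2) ⊃ Pin(n+1) ⊃ ⋯ ⊃ Pin(2)`: the module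
`W` has a multiplicity free decomposition into irreducible `Pin(n+1)`-modules `V`, each `f i` lies
in one of these, and those in `V` form, recursively, such a basis of `V`. -/
def IsGelfandTsetlin {I : Type} (f : I → Pol 𝕂 m) :
    ℕ → Set I → Submodule 𝕂 (Pol 𝕂 m) → Prop
  | 0, J, W => IsIrred 𝕂 m 2 W ∧ LinearIndepOn 𝕂 f J ∧ Submodule.span 𝕂 (f '' J) = W
  | n + 1, J, W => IsIrred 𝕂 m (n + 3) W ∧
      ∃ 𝒱 : Set (Submodule 𝕂 (Pol 𝕂 m)),
        sSupIndep 𝒱 ∧ sSup 𝒱 = W ∧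
        (∀ U ∈ 𝒱, ∀ V ∈ 𝒱, U ≠ V → ¬ AreEquivalent 𝕂 m (n + 2) U V) ∧
        (∀ i ∈ J, ∃ V ∈ 𝒱, f i ∈ V) ∧
        ∀ V ∈ 𝒱, IsGelfandTsetlin f n {i ∈ J | f i ∈ V} V

/-- The family `f` is a Gelfand-Tsetlin basis of the `Pin(m)`-module `W` (for `m ≥ 2`). -/
def IsGelfandTsetlinBasis {I : Type} (f : I → Pol 𝕂 m) (W : Submodule 𝕂 (Pol 𝕂 m)) : Prop :=
  IsGelfandTsetlin 𝕂 m f (m - 2) Set.univ W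

/-! ### The embedding factors -/

/-- The outer product `u ∧ v` of a 1-vector `u` and any `v`; it is `(uv + (-1)^s vu) / 2` if `v` is
`s`-vector valued. -/
def wedge (u v : Pol 𝕂 m) : Pol 𝕂 m :=
  (1 / 2 : 𝕂) • (u * v + LinearMap.lTensor _ (mainInvolution 𝕂 m).toLinearMap v * u)

/-- The inner product `u • v` of a 1-vector `u` and any `v`; it is `(uv - (-1)^s vu) / 2` if `v` is
`s`-vector valued. -/
def dot (u v : Pol 𝕂 m) : Pol 𝕂 m :=
  (1 / 2 : 𝕂) • (u * v - LinearMap.lTensor _ (mainInvolution 𝕂 m).toLinearMap v * u)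

/-- The Pochhammer symbol `(a)_n = a (a + 1) ⋯ (a + n - 1)`. -/
def poch (a : 𝕂) (n : ℕ) : 𝕂 := (ascPochhammer 𝕂 n).eval a

/-- `|x|^n C^a_n(x_r / |x|)` for `x = (x₁, …, x_r)`, with the Gegenbauer polynomial
`C^a_n(z) = ∑_{i ≤ n/2} (-1)^i (a)_{n-i} / (i! (n-2i)!) (2z)^{n-2i}`. -/
def homGegenbauer (r : ℕ) (a : 𝕂) (n : ℕ) : MvPolynomial (Fin m) 𝕂 :=
  ∑ i ∈ Finset.range (n / 2 + 1),
    MvPolynomial.C ((-1) ^ i * poch 𝕂 a (n - i) / (i.factorial * (n - 2 * i).factorial)) *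
      (2 * coord 𝕂 m r) ^ (n - 2 * i) * (∑ l ∈ Finset.Icc 1 r, coord 𝕂 m l ^ 2) ^ i

/-- `F^{(n)}_{r,j}(x) = (j+1)_n / (r-2+2j)_n |x|^n C^{r/2+j-1}_n(x_r / |x|)` for `n ≥ 0`,
and `0` for `n < 0`. -/
def F (r : ℕ) (n : ℤ) (j : ℕ) : Pol 𝕂 m :=
  if n < 0 then 0 else
    (poch 𝕂 ((j : 𝕂) + 1) n.toNat / poch 𝕂 ((r : 𝕂) - 2 + 2 * j) n.toNat) •
      ofScalar 𝕂 m (homGegenbauer 𝕂 m r ((r : 𝕂) / 2 + j - 1) n.toNat)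

/-- The vector variable `x₁ e₁ + ⋯ + x_{r-1} e_{r-1}` of `ℝ^{r-1}`. -/
def xUnder (r : ℕ) : Pol 𝕂 m := ∑ i ∈ Finset.Icc 1 (r - 1), x 𝕂 m i * e 𝕂 m i

/-- The embedding factors `X^{(n)}_{r,j}` of spherical monogenics (`0` for `n < 0`). -/
def XMon (r : ℕ) (n : ℤ) (j : ℕ) : Pol 𝕂 m :=
  if n < 0 then 0 else
    F 𝕂 m r n j +
      (((j : 𝕂) + 1) / ((r : 𝕂) + 2 * j - 1)) • (F 𝕂 m r (n - 1) (j + 1) * xUnder 𝕂 m r * e 𝕂 m r)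

/-- The constant `β = -(j + r - 1 - t) / (j + t)`. -/
def beta (t : ℤ) (r j : ℕ) : 𝕂 := -((j : 𝕂) + r - 1 - t) / ((j : 𝕂) + t)

/-- The constant `α`, equal to `0` if `t = 0, r - 1` and to `-(j+1) / (r+2j-1)` otherwise. -/
def alpha (t : ℤ) (r j : ℕ) : 𝕂 :=
  if t = 0 ∨ t = (r : ℤ) - 1 then 0 else -((j : 𝕂) + 1) / ((r : 𝕂) + 2 * j - 1)

/-- The embedding factor `X^{s,t,r}_{k,j}`, `t ∈ {s - 1, s}`, applied to the polynomial `f`. -/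
def embX (s t : ℤ) (r k j : ℕ) (f : Pol 𝕂 m) : Pol 𝕂 m :=
  XMon 𝕂 m r ((k : ℤ) - j) j * (e 𝕂 m r ^ (s - t).toNat * f) +
    alpha 𝕂 t r j • (XMon 𝕂 m r ((k : ℤ) - 1 - j) (j + 1) *
      (beta 𝕂 t r j ^ (t - s) • wedge 𝕂 m (xUnder 𝕂 m r) (e 𝕂 m r ^ (s - t + 1).toNat * f) +
        beta 𝕂 t r j ^ (t - s + 1) • dot 𝕂 m (xUnder 𝕂 m r) (e 𝕂 m r ^ (s - t + 1).toNat * f)))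

end

/-! ### The index sets and the basis elements -/

/-- The set `N^{s,r}_k` of pairs `(t, j) ∈ {0, …, r-1} × {0, …, k}` such that `t ∈ {s - 1, s}` and,
if `t ∈ {0, r-1}`, then `j = 0`. -/
def N (s : ℤ) (r k : ℕ) : Set (ℤ × ℕ) :=
  {p | 0 ≤ p.1 ∧ p.1 ≤ (r : ℤ) - 1 ∧ p.2 ≤ k ∧ (p.1 = s - 1 ∨ p.1 = s) ∧
    (p.1 = 0 ∨ p.1 = (r : ℤ) - 1 → p.2 = 0)}

/-- The entry `t₂` of `ν = (s_{m-1}, …, s₃, t₂)`. -/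
def tTwo (m : ℕ) (ν : Set.Ico 2 m → ℤ) : ℤ :=
  if h : 2 ∈ Set.Ico 2 m then ν ⟨2, h⟩ else 0

/-- The number `s_r`, `2 ≤ r ≤ m`, where `s_m = s`, `s₂ = |t₂|` and `s_r` is the `r`-th entry of `ν`
otherwise. -/
def sSeq (m s : ℕ) (ν : Set.Ico 2 m → ℤ) (r : ℕ) : ℤ :=
  if h : r ∈ Set.Ico 2 m then (if r = 2 then |ν ⟨r, h⟩| else ν ⟨r, h⟩) else s

/-- The number `k_r`, `2 ≤ r ≤ m`, where `k_m = k` and `k_r` is the `r`-th entry of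
`μ = (k_{m-1}, …, k₂)` otherwise. -/
def kSeq (m k : ℕ) (μ : Set.Ico 2 m → ℕ) (r : ℕ) : ℕ :=
  if h : r ∈ Set.Ico 2 m then μ ⟨r, h⟩ else k

/-- The index set `I^{s,m}_k`. -/
def indexSet (m s k : ℕ) : Set ((Set.Ico 2 m → ℤ) × (Set.Ico 2 m → ℕ)) :=
  {p | ((tTwo m p.1 = 0 ∧ kSeq m k p.2 2 = 0) ∨ (tTwo m p.1 = 2 ∧ kSeq m k p.2 2 = 0) ∨
      tTwo m p.1 = 1 ∨ tTwo m p.1 = -1) ∧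
    ∀ r, 3 ≤ r → r ≤ m →
      (sSeq m s p.1 (r - 1), kSeq m k p.2 (r - 1)) ∈ N (sSeq m s p.1 r) r (kSeq m k p.2 r)}

/-- The basis elements `f^t_k` in dimension two for real scalars: `f^0_0 = 1`, `f^2_0 = e₂ e₁`,
`f^1_k = (x₁ - e₁ e₂ x₂)^k e₁` and `f^{-1}_k = (x₁ - e₁ e₂ x₂)^k e₂`. -/
def planarReal (m : ℕ) (t : ℤ) (k : ℕ) : Pol ℝ m :=
  if t = 0 then 1
  else if t = 2 then e ℝ m 2 * e ℝ m 1
  else (x ℝ m 1 - e ℝ m 1 * e ℝ m 2 * x ℝ m 2) ^ k * (if t = 1 then e ℝ m 1 else e ℝ m 2)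

/-- The basis elements `f^t_k` in dimension two for complex scalars: `f^0_0 = 1`, `f^2_0 = e₂ e₁`
and `f^t_k = (x₁ - t i x₂)^k (e₁ - t i e₂)` for `t = ±1`. -/
def planarComplex (m : ℕ) (t : ℤ) (k : ℕ) : Pol ℂ m :=
  if t = 0 then 1
  else if t = 2 then e ℂ m 2 * e ℂ m 1
  else (x ℂ m 1 - ((t : ℂ) * Complex.I) • x ℂ m 2) ^ k *
    (e ℂ m 1 - ((t : ℂ) * Complex.I) • e ℂ m 2)

/-- `X^{s_{n+2},s_{n+1},n+2}_{k_{n+2},k_{n+1}} ⋯ X^{s₃,s₂,3}_{k₃,k₂} f₂`. -/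
def chain (𝕂 : Type) [RCLike 𝕂] (m : ℕ) (sq : ℕ → ℤ) (kq : ℕ → ℕ) (f₂ : Pol 𝕂 m) :
    ℕ → Pol 𝕂 m
  | 0 => f₂
  | n + 1 => embX 𝕂 m (sq (n + 3)) (sq (n + 2)) (n + 3) (kq (n + 3)) (kq (n + 2))
      (chain 𝕂 m sq kq f₂ n)

/-- The polynomial `f^{s,ν}_{k,μ}` on `ℝ^m`, built on the basis elements `planar t k` in dimension
two. -/
def gtElement (𝕂 : Type) [RCLike 𝕂] (m s k : ℕ) (planar : ℤ → ℕ → Pol 𝕂 m)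
    (i : indexSet m s k) : Pol 𝕂 m :=
  chain 𝕂 m (sSeq m s i.1.1) (kSeq m k i.1.2) (planar (tTwo m i.1.1) (kSeq m k i.1.2 2)) (m - 2)

end

end HodgeDeRham

open scoped TensorProduct

namespace HodgeDeRham

noncomputable section

variable {𝕂 : Type} [RCLike 𝕂] {m : ℕ}

/-! ### Generators and relations of the algebra of Clifford valued polynomials -/

/-! Algebra. Left multiplication by e_i is the sum of the outer and inner products `eps` and `kap`,
which satisfy the canonical anticommutation relations. Hence the Dirac operator is d + d* (`extD`
and `coD`), one part raising the grade and the other lowering it, and an s-vector valued f has ∂f =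
0 iff df = d*f = 0. The spaces of solutions on every ℝ^r, r ≤ m, are realised inside the polynomials
on ℝ^m as `Hr`, which is cut out by operator equations only: Euler and grade eigenvalues, d, d*, and
independence of the variables and vectors with index above r. `cHdR_eq` identifies `Hr` for r = m
with the space of the theorem.

Branching. The derivative in x_{n+1} maps solutions of degree k + 1 on ℝ^{n+1} to solutions of
degree k, and an element f of its kernel has the form a + e_{n+1} b with solutions a, b on ℝ^n
(`exists_of_pD_eq_zero`). The embedding factors form an Appell sequence for this derivative
(`pD_embL`) that starts with 1 or e_{n+1}. So they are injective (`embL_injective`), and their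
images span all solutions on ℝ^{n+1} by induction on the degree (`Hr_eq_embSum`). That they produce
solutions at all (`embL_mem`) rests on three facts: multiplication by `XM` preserves monogenicity,
by a contiguity relation of Gegenbauer polynomials (`cF_contiguous`, `dirc_XM_mul`); β is the number
for which x∧f + β x•f is monogenic (`dirc_zMap`); and α is the number for which the terms of wrong
grade cancel.

Separation. A unit vector of ℝ^n commutes with an embedding factor up to a sign (`sg_embL`). Hence
the Casimir operator of the rotations of ℝ^n, which is the scalar −2(j(j+n) + t(n−t)) on solutions
of grade t and degree j (`casimir_of_mem`), has the same value on the image. These values separate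
the branching components except for (s, j) and (s−1, j) with n = 2s − 1. There n is odd, and e_1⋯e_n
acts on the two components by opposite signs. So one symmetric operator `tOp`, built from both, has
distinct eigenvalues on the components (`tEig_injective`). This makes them pairwise orthogonal and
inequivalent, and every invariant subspace contains the components of its elements.

Irreducibility, by induction on the dimension from an explicit computation on the plane. An
invariant subspace U that misses the component (s, 0) vanishes: for f in U the polynomial x∧f is
zero at e_{n+1}, by invariance at every point of the sphere, so x∧f = 0; but d*(x∧f) is a nonzero
multiple of f (`eq_bot_of_not_le`). If a nonzero U were proper, then U and its orthogonal complement
would both contain that component, which is impossible for a definite form (`irr_Hr_succ`).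

Conclusion. A basis element is a product of embedding factors applied to a planar element. Two of
them are compared at the highest level where their indices differ: there they lie in different
branching components, pushed forward by the same sign-equivariant map, so `tOp` makes them
orthogonal (`iForm_cch`). If only the sign of t₂ differs, a reflection or an infinitesimal rotation
of the plane does so. The same recursion over levels yields the adapted decomposition
(`isGelfandTsetlin_pathSet`), and the spanning property follows from it. -/

theorem realE_of_mem {i : ℕ} (h : 1 ≤ i ∧ i ≤ m) :
    realE m i = CliffordAlgebra.ι (negForm m) (Pi.single ⟨i - 1, by omega⟩ 1) := dif_pos h

theorem realE_succ (i : Fin m) :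
    realE m (i + 1) = CliffordAlgebra.ι (negForm m) (Pi.single i 1) := by
  rw [realE_of_mem ⟨by omega, by omega⟩]; rfl

theorem negForm_apply (v : Fin m → ℝ) : negForm m v = -∑ i, v i ^ 2 := by
  simp [negForm, QuadraticMap.weightedSumSquares_apply, pow_two]

theorem polar_negForm (v w : Fin m → ℝ) :
    QuadraticMap.polar (negForm m) v w = -2 * ∑ i, v i * w i := by
  simp only [QuadraticMap.polar, negForm_apply, Pi.add_apply, Finset.mul_sum]
  rw [sub_neg_eq_add, sub_neg_eq_add, ← Finset.sum_neg_distrib, ← Finset.sum_add_distrib,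
    ← Finset.sum_add_distrib]
  exact Finset.sum_congr rfl fun i _ => by ring

theorem ι_eq_sum (v : Fin m → ℝ) :
    CliffordAlgebra.ι (negForm m) v = ∑ i : Fin m, v i • realE m (i + 1) := by
  conv_lhs => rw [pi_eq_sum_univ' v]
  rw [map_sum]
  refine Finset.sum_congr rfl fun i _ => ?_
  rw [map_smul, realE_succ]

theorem realE_mul_self {i : ℕ} (h : 1 ≤ i ∧ i ≤ m) : realE m i * realE m i = -1 := by
  rw [realE_of_mem h, CliffordAlgebra.ι_sq_scalar, negForm_apply]
  simp [Pi.single_apply]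

theorem realE_mul_realE {i j : ℕ} (h : i ≠ j) : realE m i * realE m j = -(realE m j * realE m i) := by
  by_cases hi : 1 ≤ i ∧ i ≤ m
  · by_cases hj : 1 ≤ j ∧ j ≤ m
    · rw [eq_neg_iff_add_eq_zero, realE_of_mem hi, realE_of_mem hj,
        CliffordAlgebra.ι_mul_ι_add_swap, polar_negForm]
      have : (⟨i - 1, by omega⟩ : Fin m) ≠ ⟨j - 1, by omega⟩ := by
        simp only [ne_eq, Fin.mk.injEq]; omega
      simp [Pi.single_apply, this.symm]
    · simp [realE, hj]
  · simp [realE, hi]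

/-- The inclusion of the constants as an algebra homomorphism. -/
def constHom (𝕂 : Type) [RCLike 𝕂] (m : ℕ) : RCl m →ₐ[ℝ] Pol 𝕂 m :=
  ((Algebra.TensorProduct.includeRight : Cl 𝕂 m →ₐ[𝕂] Pol 𝕂 m).restrictScalars ℝ).comp
    (Algebra.TensorProduct.includeRight : RCl m →ₐ[ℝ] Cl 𝕂 m)

theorem constHom_apply (a : RCl m) : constHom 𝕂 m a = const 𝕂 m a := rfl

theorem e_mul_self {i : ℕ} (h : 1 ≤ i ∧ i ≤ m) : e 𝕂 m i * e 𝕂 m i = -1 := by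
  rw [e, ← constHom_apply, ← map_mul, realE_mul_self h, map_neg, map_one]

theorem e_mul_e {i j : ℕ} (h : i ≠ j) : e 𝕂 m i * e 𝕂 m j = -(e 𝕂 m j * e 𝕂 m i) := by
  rw [e, e, ← constHom_apply, ← constHom_apply, ← map_mul, realE_mul_realE h, map_neg, map_mul]

theorem e_of_not_mem {i : ℕ} (h : ¬ (1 ≤ i ∧ i ≤ m)) : e 𝕂 m i = 0 := by
  rw [e, ← constHom_apply, realE, dif_neg h, map_zero]

theorem x_of_not_mem {i : ℕ} (h : ¬ (1 ≤ i ∧ i ≤ m)) : x 𝕂 m i = 0 := by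
  rw [x, coord, dif_neg h, map_zero]

theorem partialD_of_not_mem {i : ℕ} (h : ¬ (1 ≤ i ∧ i ≤ m)) : partialD 𝕂 m i = 0 := dif_neg h

theorem ofScalar_mul_comm (p : MvPolynomial (Fin m) 𝕂) (f : Pol 𝕂 m) :
    ofScalar 𝕂 m p * f = f * ofScalar 𝕂 m p := by
  induction f using TensorProduct.induction_on with
  | zero => simp
  | tmul q a => simp [ofScalar, mul_comm p q]
  | add f g hf hg => rw [mul_add, add_mul, hf, hg]

theorem x_mul_comm (i : ℕ) (f : Pol 𝕂 m) : x 𝕂 m i * f = f * x 𝕂 m i := ofScalar_mul_comm _ f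

/-- The algebra of Clifford valued polynomials is generated by the `x_i` and the `e_i`. -/
theorem pol_induction {C : Pol 𝕂 m → Prop} (f : Pol 𝕂 m)
    (scalar : ∀ c : 𝕂, C (algebraMap 𝕂 (Pol 𝕂 m) c))
    (x : ∀ i, 1 ≤ i → i ≤ m → C (x 𝕂 m i)) (e : ∀ i, 1 ≤ i → i ≤ m → C (e 𝕂 m i))
    (add : ∀ f g, C f → C g → C (f + g)) (mul : ∀ f g, C f → C g → C (f * g)) : C f := by
  have h1 : ∀ p : MvPolynomial (Fin m) 𝕂, C (ofScalar 𝕂 m p) := by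
    intro p
    induction p using MvPolynomial.induction_on with
    | C c => exact scalar c
    | add p q hp hq => rw [map_add]; exact add _ _ hp hq
    | mul_X p i hp =>
      rw [map_mul]
      refine mul _ _ hp ?_
      have := x (i + 1) (by omega) (by omega)
      rwa [HodgeDeRham.x, coord, dif_pos ⟨by omega, by omega⟩] at this
  have h2 : ∀ a : RCl m, C (constHom 𝕂 m a) := by
    intro a
    induction a using CliffordAlgebra.induction with
    | algebraMap r =>
      rw [AlgHom.commutes, IsScalarTower.algebraMap_apply ℝ 𝕂 (Pol 𝕂 m)]
      exact scalar _
    | ι v =>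
      rw [ι_eq_sum, map_sum]
      refine Finset.sum_induction _ C add (by simpa using scalar 0) fun i _ => ?_
      rw [Algebra.smul_def, map_mul, AlgHom.commutes, IsScalarTower.algebraMap_apply ℝ 𝕂 (Pol 𝕂 m)]
      exact mul _ _ (scalar _) (e (i + 1) (by omega) (by omega))
    | mul a b ha hb => rw [map_mul]; exact mul _ _ ha hb
    | add a b ha hb => rw [map_add]; exact add _ _ ha hb
  induction f using TensorProduct.induction_on with
  | zero => simpa using scalar 0
  | add f g hf hg => exact add _ _ hf hg
  | tmul p a =>
    induction a using TensorProduct.induction_on with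
    | zero => simpa using scalar 0
    | add a b ha hb => rw [TensorProduct.tmul_add]; exact add _ _ ha hb
    | tmul c a =>
      have : p ⊗ₜ[𝕂] (c ⊗ₜ[ℝ] a) =
          ofScalar 𝕂 m p * (algebraMap 𝕂 (Pol 𝕂 m) c * constHom 𝕂 m a) := by
        rw [← Algebra.smul_def, constHom_apply, const, ofScalar,
          Algebra.TensorProduct.includeLeft_apply, ← TensorProduct.tmul_smul,
          TensorProduct.smul_tmul', Algebra.TensorProduct.tmul_mul_tmul, smul_eq_mul, mul_one,
          mul_one, one_mul]
      rw [this]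
      exact mul _ _ (h1 p) (mul _ _ (scalar c) (h2 a))

theorem partialD_apply_tmul (i : Fin m) (p : MvPolynomial (Fin m) 𝕂) (a : Cl 𝕂 m) :
    partialD 𝕂 m (i + 1) (p ⊗ₜ[𝕂] a) = MvPolynomial.pderiv i p ⊗ₜ[𝕂] a := by
  rw [partialD, dif_pos ⟨by omega, by omega⟩]; rfl

theorem exists_fin {i : ℕ} (h : 1 ≤ i ∧ i ≤ m) : ∃ j : Fin m, i = j + 1 :=
  ⟨⟨i - 1, by omega⟩, by simp; omega⟩

theorem partialD_mul (i : ℕ) (f g : Pol 𝕂 m) :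
    partialD 𝕂 m i (f * g) = partialD 𝕂 m i f * g + f * partialD 𝕂 m i g := by
  by_cases h : 1 ≤ i ∧ i ≤ m
  · obtain ⟨i, rfl⟩ := exists_fin h
    induction f using TensorProduct.induction_on with
    | zero => simp
    | add f f' hf hf' => rw [add_mul, map_add, hf, hf', map_add, add_mul, add_mul]; abel
    | tmul p a =>
      induction g using TensorProduct.induction_on with
      | zero => simp
      | add f f' hf hf' => rw [mul_add, map_add, hf, hf', map_add, mul_add, mul_add]; abel
      | tmul q b =>
        simp only [Algebra.TensorProduct.tmul_mul_tmul, partialD_apply_tmul, Derivation.leibniz,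
          TensorProduct.add_tmul, smul_eq_mul]
        rw [add_comm, mul_comm q]
  · simp [partialD_of_not_mem h]

theorem partialD_x (i j : ℕ) :
    partialD 𝕂 m i (x 𝕂 m j) = if i = j ∧ 1 ≤ i ∧ i ≤ m then 1 else 0 := by
  by_cases h : 1 ≤ i ∧ i ≤ m
  · by_cases h' : 1 ≤ j ∧ j ≤ m
    · obtain ⟨i, rfl⟩ := exists_fin h
      obtain ⟨j, rfl⟩ := exists_fin h'
      have h1 : x 𝕂 m (j + 1) = (MvPolynomial.X j) ⊗ₜ[𝕂] 1 := by
        rw [x, coord, dif_pos ⟨by omega, by omega⟩]; rfl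
      rw [h1, partialD_apply_tmul, MvPolynomial.pderiv_X]
      by_cases hij : i = j
      · subst hij
        rw [if_pos ⟨rfl, h⟩, Pi.single_eq_same]; rfl
      · rw [if_neg (by rw [add_left_inj, Fin.val_inj]; tauto), Pi.single_apply, if_neg (Ne.symm hij),
          TensorProduct.zero_tmul]
    · rw [x_of_not_mem h', map_zero, if_neg (by rintro ⟨rfl, _⟩; exact h' h)]
  · rw [partialD_of_not_mem h, if_neg (by tauto)]; rfl

theorem partialD_const (i : ℕ) (a : RCl m) : partialD 𝕂 m i (const 𝕂 m a) = 0 := by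
  by_cases h : 1 ≤ i ∧ i ≤ m
  · obtain ⟨i, rfl⟩ := exists_fin h
    rw [const, partialD_apply_tmul, Derivation.map_one_eq_zero, TensorProduct.zero_tmul]
  · rw [partialD_of_not_mem h]; rfl

theorem partialD_e (i j : ℕ) : partialD 𝕂 m i (e 𝕂 m j) = 0 := partialD_const i _

theorem partialD_one (i : ℕ) : partialD 𝕂 m i 1 = 0 := partialD_const i (1 : RCl m)

theorem partialD_algebraMap (i : ℕ) (c : 𝕂) : partialD 𝕂 m i (algebraMap 𝕂 _ c) = 0 := by
  rw [Algebra.algebraMap_eq_smul_one, map_smul, partialD_one, smul_zero]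

/-- The main involution on polynomials. -/
def invo (𝕂 : Type) [RCLike 𝕂] (m : ℕ) : Pol 𝕂 m →ₐ[𝕂] Pol 𝕂 m :=
  Algebra.TensorProduct.map (AlgHom.id 𝕂 _) (mainInvolution 𝕂 m)

theorem invo_ofScalar (p : MvPolynomial (Fin m) 𝕂) : invo 𝕂 m (ofScalar 𝕂 m p) = ofScalar 𝕂 m p := by
  simp [invo, ofScalar]

theorem invo_x (i : ℕ) : invo 𝕂 m (x 𝕂 m i) = x 𝕂 m i := invo_ofScalar _

theorem invo_const (a : RCl m) :
    invo 𝕂 m (const 𝕂 m a) = const 𝕂 m (CliffordAlgebra.involute a) := by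
  simp [invo, const, mainInvolution]

theorem invo_e (i : ℕ) : invo 𝕂 m (e 𝕂 m i) = -e 𝕂 m i := by
  rw [e, invo_const, ← constHom_apply, ← constHom_apply, ← map_neg]
  congr 1
  by_cases h : 1 ≤ i ∧ i ≤ m
  · rw [realE_of_mem h, CliffordAlgebra.involute_ι]
  · simp [realE, h]

theorem pol_algHom_ext {A : Type*} [Semiring A] [Algebra 𝕂 A] {φ ψ : Pol 𝕂 m →ₐ[𝕂] A}
    (hx : ∀ i, 1 ≤ i → i ≤ m → φ (x 𝕂 m i) = ψ (x 𝕂 m i))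
    (he : ∀ i, 1 ≤ i → i ≤ m → φ (e 𝕂 m i) = ψ (e 𝕂 m i)) : φ = ψ := by
  refine AlgHom.ext fun f => ?_
  induction f using pol_induction with
  | scalar c => rw [AlgHom.commutes, AlgHom.commutes]
  | x i h h' => exact hx i h h'
  | e i h h' => exact he i h h'
  | add f g hf hg => rw [map_add, map_add, hf, hg]
  | mul f g hf hg => rw [map_mul, map_mul, hf, hg]

theorem invo_invo (f : Pol 𝕂 m) : invo 𝕂 m (invo 𝕂 m f) = f := by
  have : (invo 𝕂 m).comp (invo 𝕂 m) = AlgHom.id 𝕂 _ :=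
    pol_algHom_ext (by simp [invo_x]) (by simp [invo_e])
  exact DFunLike.congr_fun this f

theorem partialD_invo (i : ℕ) (f : Pol 𝕂 m) :
    partialD 𝕂 m i (invo 𝕂 m f) = invo 𝕂 m (partialD 𝕂 m i f) := by
  induction f using pol_induction with
  | scalar c => rw [AlgHom.commutes, partialD_algebraMap, map_zero]
  | x j h h' => rw [invo_x, partialD_x]; split_ifs <;> simp
  | e j h h' => rw [invo_e, map_neg, partialD_e, map_zero, neg_zero]
  | add f g hf hg => simp only [map_add, hf, hg]
  | mul f g hf hg => simp only [map_mul, partialD_mul, map_add, hf, hg]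

theorem partialD_comm (i j : ℕ) (f : Pol 𝕂 m) :
    partialD 𝕂 m i (partialD 𝕂 m j f) = partialD 𝕂 m j (partialD 𝕂 m i f) := by
  induction f using pol_induction with
  | scalar c => simp only [partialD_algebraMap, map_zero]
  | x l h h' =>
    rw [partialD_x, partialD_x]; split_ifs <;> simp [partialD_one]
  | e l h h' => simp only [partialD_e, map_zero]
  | add f g hf hg => simp only [map_add, hf, hg]
  | mul f g hf hg => simp only [partialD_mul, map_add, hf, hg]; abel

/-! ### A type synonym with short instances -/

/-- The algebra of Clifford valued polynomials, as a type whose only structure is that of an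
algebra over `𝕂`. -/
def CPol (𝕂 : Type) [RCLike 𝕂] (m : ℕ) : Type := Pol 𝕂 m

instance : Ring (CPol 𝕂 m) := inferInstanceAs (Ring (Pol 𝕂 m))

instance : Algebra 𝕂 (CPol 𝕂 m) := inferInstanceAs (Algebra 𝕂 (Pol 𝕂 m))

variable (𝕂 m) in
/-- The coordinate `x_i`. -/
def vx (i : ℕ) : CPol 𝕂 m := x 𝕂 m i

variable (𝕂 m) in
/-- The basis vector `e_i`. -/
def ve (i : ℕ) : CPol 𝕂 m := e 𝕂 m i

variable (𝕂 m) in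
/-- The main involution. -/
def inv : CPol 𝕂 m →ₐ[𝕂] CPol 𝕂 m := invo 𝕂 m

variable (𝕂 m) in
/-- The partial derivative as an element of the ring of endomorphisms. -/
def pD (i : ℕ) : Module.End 𝕂 (CPol 𝕂 m) := partialD 𝕂 m i

theorem ve_mul_self {i : ℕ} (h : 1 ≤ i ∧ i ≤ m) : ve 𝕂 m i * ve 𝕂 m i = -1 := e_mul_self h

theorem ve_mul_ve {i j : ℕ} (h : i ≠ j) : ve 𝕂 m i * ve 𝕂 m j = -(ve 𝕂 m j * ve 𝕂 m i) := e_mul_e h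

theorem ve_of_not_mem {i : ℕ} (h : ¬ (1 ≤ i ∧ i ≤ m)) : ve 𝕂 m i = 0 := e_of_not_mem h

theorem vx_of_not_mem {i : ℕ} (h : ¬ (1 ≤ i ∧ i ≤ m)) : vx 𝕂 m i = 0 := x_of_not_mem h

theorem pD_of_not_mem {i : ℕ} (h : ¬ (1 ≤ i ∧ i ≤ m)) : pD 𝕂 m i = 0 := partialD_of_not_mem h

theorem vx_mul_comm (i : ℕ) (f : CPol 𝕂 m) : vx 𝕂 m i * f = f * vx 𝕂 m i := x_mul_comm i f

theorem cpol_induction {C : CPol 𝕂 m → Prop} (f : CPol 𝕂 m)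
    (scalar : ∀ c : 𝕂, C (algebraMap 𝕂 (CPol 𝕂 m) c))
    (x : ∀ i, 1 ≤ i → i ≤ m → C (vx 𝕂 m i)) (e : ∀ i, 1 ≤ i → i ≤ m → C (ve 𝕂 m i))
    (add : ∀ f g, C f → C g → C (f + g)) (mul : ∀ f g, C f → C g → C (f * g)) : C f :=
  pol_induction (C := C) f scalar x e add mul

theorem cpol_algHom_ext {A : Type*} [Semiring A] [Algebra 𝕂 A] {φ ψ : CPol 𝕂 m →ₐ[𝕂] A}
    (hx : ∀ i, 1 ≤ i → i ≤ m → φ (vx 𝕂 m i) = ψ (vx 𝕂 m i))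
    (he : ∀ i, 1 ≤ i → i ≤ m → φ (ve 𝕂 m i) = ψ (ve 𝕂 m i)) : φ = ψ :=
  pol_algHom_ext (φ := φ) (ψ := ψ) hx he

theorem pD_mul (i : ℕ) (f g : CPol 𝕂 m) :
    pD 𝕂 m i (f * g) = pD 𝕂 m i f * g + f * pD 𝕂 m i g := partialD_mul i f g

theorem pD_vx (i j : ℕ) :
    pD 𝕂 m i (vx 𝕂 m j) = if i = j ∧ 1 ≤ i ∧ i ≤ m then 1 else 0 := partialD_x i j

theorem pD_ve (i j : ℕ) : pD 𝕂 m i (ve 𝕂 m j) = 0 := partialD_e i j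

theorem pD_one (i : ℕ) : pD 𝕂 m i 1 = 0 := partialD_one i

theorem inv_vx (i : ℕ) : inv 𝕂 m (vx 𝕂 m i) = vx 𝕂 m i := invo_x i

theorem inv_ve (i : ℕ) : inv 𝕂 m (ve 𝕂 m i) = -ve 𝕂 m i := invo_e i

theorem inv_inv (f : CPol 𝕂 m) : inv 𝕂 m (inv 𝕂 m f) = f := invo_invo f

theorem pD_inv (i : ℕ) (f : CPol 𝕂 m) : pD 𝕂 m i (inv 𝕂 m f) = inv 𝕂 m (pD 𝕂 m i f) :=
  partialD_invo i f

theorem pD_comm (i j : ℕ) (f : CPol 𝕂 m) :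
    pD 𝕂 m i (pD 𝕂 m j f) = pD 𝕂 m j (pD 𝕂 m i f) := partialD_comm i j f

variable (𝕂 m) in
/-- The outer product with a 1-vector. -/
def cWedge (u v : CPol 𝕂 m) : CPol 𝕂 m := (1 / 2 : 𝕂) • (u * v + inv 𝕂 m v * u)

variable (𝕂 m) in
/-- The inner product with a 1-vector. -/
def cDot (u v : CPol 𝕂 m) : CPol 𝕂 m := (1 / 2 : 𝕂) • (u * v - inv 𝕂 m v * u)

/-! ### Creation and annihilation operators -/

/-- The Kronecker symbol of the valid indices. -/
def kron (𝕂 : Type) [RCLike 𝕂] (m i j : ℕ) : 𝕂 := if i = j ∧ 1 ≤ i ∧ i ≤ m then 1 else 0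

theorem kron_comm (i j : ℕ) : kron 𝕂 m i j = kron 𝕂 m j i := by
  unfold kron; congr 1; rw [eq_iff_iff]; constructor <;> rintro ⟨rfl, h⟩ <;> exact ⟨rfl, h⟩

theorem kron_self {i : ℕ} (h : 1 ≤ i) (h' : i ≤ m) : kron 𝕂 m i i = 1 := if_pos ⟨rfl, h, h'⟩

theorem kron_of_ne {i j : ℕ} (h : i ≠ j) : kron 𝕂 m i j = 0 := if_neg fun h' => h h'.1

/-- The symbol `kron` vanishes at indices outside 1, …, m, where e_i is zero by definition, so the
Clifford relation needs no range conditions. -/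
theorem ve_mul_ve_add (i j : ℕ) :
    ve 𝕂 m i * ve 𝕂 m j + ve 𝕂 m j * ve 𝕂 m i = (-2 * kron 𝕂 m i j) • 1 := by
  by_cases h : i = j
  · subst h
    by_cases hi : 1 ≤ i ∧ i ≤ m
    · rw [kron_self hi.1 hi.2, ve_mul_self hi, mul_one, neg_smul, two_smul, neg_add]
    · rw [ve_of_not_mem hi, kron, if_neg (by tauto)]; simp
  · rw [ve_mul_ve h, kron_of_ne h]; simp

theorem wedge_add (u f g : CPol 𝕂 m) : cWedge 𝕂 m u (f + g) = cWedge 𝕂 m u f + cWedge 𝕂 m u g := by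
  simp only [cWedge, map_add, mul_add, add_mul, smul_add]; abel

theorem wedge_smul (u : CPol 𝕂 m) (c : 𝕂) (f : CPol 𝕂 m) :
    cWedge 𝕂 m u (c • f) = c • cWedge 𝕂 m u f := by
  simp only [cWedge, map_smul, mul_smul_comm, smul_mul_assoc, ← smul_add, smul_comm c]

theorem dot_add (u f g : CPol 𝕂 m) : cDot 𝕂 m u (f + g) = cDot 𝕂 m u f + cDot 𝕂 m u g := by
  simp only [cDot, map_add, mul_add, add_mul, smul_add, smul_sub]; abel

theorem dot_smul (u : CPol 𝕂 m) (c : 𝕂) (f : CPol 𝕂 m) :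
    cDot 𝕂 m u (c • f) = c • cDot 𝕂 m u f := by
  simp only [cDot, map_smul, mul_smul_comm, smul_mul_assoc, ← smul_sub, smul_comm c]

variable (𝕂 m) in
/-- Outer multiplication by `e_i`. -/
def eps (i : ℕ) : Module.End 𝕂 (CPol 𝕂 m) where
  toFun := cWedge 𝕂 m (ve 𝕂 m i)
  map_add' := wedge_add _
  map_smul' := wedge_smul _

variable (𝕂 m) in
/-- Inner multiplication by `e_i`. -/
def kap (i : ℕ) : Module.End 𝕂 (CPol 𝕂 m) where
  toFun := cDot 𝕂 m (ve 𝕂 m i)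
  map_add' := dot_add _
  map_smul' := dot_smul _

variable (𝕂 m) in
/-- Multiplication by `x_i`. -/
def mulX (i : ℕ) : Module.End 𝕂 (CPol 𝕂 m) := LinearMap.mulLeft 𝕂 (vx 𝕂 m i)

theorem eps_apply (i : ℕ) (f : CPol 𝕂 m) :
    eps 𝕂 m i f = (1 / 2 : 𝕂) • (ve 𝕂 m i * f + inv 𝕂 m f * ve 𝕂 m i) := rfl

theorem kap_apply (i : ℕ) (f : CPol 𝕂 m) :
    kap 𝕂 m i f = (1 / 2 : 𝕂) • (ve 𝕂 m i * f - inv 𝕂 m f * ve 𝕂 m i) := rfl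

theorem mulX_apply (i : ℕ) (f : CPol 𝕂 m) : mulX 𝕂 m i f = vx 𝕂 m i * f := rfl

/-- Clifford multiplication is creation plus annihilation. Every statement about the Dirac operator
is turned by this identity into one about d and d*. -/
theorem ve_mul_eq (i : ℕ) (f : CPol 𝕂 m) : ve 𝕂 m i * f = eps 𝕂 m i f + kap 𝕂 m i f := by
  rw [eps_apply, kap_apply]; module

theorem inv_mul_ve_eq (i : ℕ) (f : CPol 𝕂 m) :
    inv 𝕂 m f * ve 𝕂 m i = eps 𝕂 m i f - kap 𝕂 m i f := by
  rw [eps_apply, kap_apply]; module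

/-- Let L_i be left multiplication by e_i and R_i the twisted right multiplication by e_i. The L_i
satisfy the Clifford relations for −δ, the R_i those for +δ, and L_i anticommutes with R_j. The
relations of the half sum and the half difference follow, here and in the next two lemmas. -/
theorem eps_mul_eps (i j : ℕ) : eps 𝕂 m i * eps 𝕂 m j + eps 𝕂 m j * eps 𝕂 m i = 0 := by
  refine LinearMap.ext fun f => ?_
  have h := ve_mul_ve_add (𝕂 := 𝕂) (m := m) i j
  have h1 := congrArg (· * f) h
  have h2 := congrArg (f * ·) h
  simp only [add_mul, mul_add, smul_mul_assoc, one_mul, mul_smul_comm, mul_one] at h1 h2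
  simp only [LinearMap.add_apply, Module.End.mul_apply, eps_apply, map_smul, map_add, map_mul,
    inv_inv, inv_ve, mul_add, add_mul, mul_smul_comm, smul_mul_assoc, neg_mul, mul_neg,
    LinearMap.zero_apply, mul_assoc] at h1 h2 ⊢
  linear_combination (norm := module) (1 / 4 : 𝕂) • h1 - (1 / 4 : 𝕂) • h2

theorem kap_mul_kap (i j : ℕ) : kap 𝕂 m i * kap 𝕂 m j + kap 𝕂 m j * kap 𝕂 m i = 0 := by
  refine LinearMap.ext fun f => ?_
  have h := ve_mul_ve_add (𝕂 := 𝕂) (m := m) i j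
  have h1 := congrArg (· * f) h
  have h2 := congrArg (f * ·) h
  simp only [add_mul, mul_add, smul_mul_assoc, one_mul, mul_smul_comm, mul_one] at h1 h2
  simp only [LinearMap.add_apply, Module.End.mul_apply, kap_apply, map_smul, map_sub, map_mul,
    inv_inv, inv_ve, mul_sub, sub_mul, mul_smul_comm, smul_mul_assoc, neg_mul, mul_neg,
    LinearMap.zero_apply, mul_assoc] at h1 h2 ⊢
  linear_combination (norm := module) (1 / 4 : 𝕂) • h1 - (1 / 4 : 𝕂) • h2

theorem eps_mul_kap (i j : ℕ) :
    eps 𝕂 m i * kap 𝕂 m j + kap 𝕂 m j * eps 𝕂 m i = -(kron 𝕂 m i j • 1) := by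
  refine LinearMap.ext fun f => ?_
  have h := ve_mul_ve_add (𝕂 := 𝕂) (m := m) i j
  have h1 := congrArg (· * f) h
  have h2 := congrArg (f * ·) h
  simp only [add_mul, mul_add, smul_mul_assoc, one_mul, mul_smul_comm, mul_one] at h1 h2
  simp only [LinearMap.add_apply, Module.End.mul_apply, kap_apply, eps_apply, map_smul, map_sub,
    map_add, map_mul,
    inv_inv, inv_ve, mul_sub, sub_mul, mul_add, add_mul, mul_smul_comm, smul_mul_assoc, neg_mul,
    mul_neg, LinearMap.smul_apply, LinearMap.neg_apply,
    Module.End.one_apply, mul_assoc] at h1 h2 ⊢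
  linear_combination (norm := module) (1 / 4 : 𝕂) • h1 + (1 / 4 : 𝕂) • h2

theorem pD_mul_mulX (i j : ℕ) :
    pD 𝕂 m i * mulX 𝕂 m j = mulX 𝕂 m j * pD 𝕂 m i + kron 𝕂 m i j • 1 := by
  refine LinearMap.ext fun f => ?_
  simp only [LinearMap.add_apply, Module.End.mul_apply, mulX_apply, pD_mul,
    pD_vx, LinearMap.smul_apply, Module.End.one_apply, kron]
  split_ifs <;> simp [add_comm]

theorem commute_pD_pD (i j : ℕ) : Commute (pD 𝕂 m i) (pD 𝕂 m j) :=
  LinearMap.ext fun f => pD_comm i j f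

theorem commute_mulX_mulX (i j : ℕ) : Commute (mulX 𝕂 m i) (mulX 𝕂 m j) :=
  LinearMap.ext fun f => by
    simp only [Module.End.mul_apply, mulX_apply, ← mul_assoc, vx_mul_comm i (vx 𝕂 m j)]

theorem commute_pD_eps (i j : ℕ) : Commute (pD 𝕂 m i) (eps 𝕂 m j) :=
  LinearMap.ext fun f => by
    simp only [Module.End.mul_apply, eps_apply, map_smul, map_add, pD_mul,
      pD_ve, pD_inv, zero_mul, mul_zero, zero_add, add_zero]

theorem commute_pD_kap (i j : ℕ) : Commute (pD 𝕂 m i) (kap 𝕂 m j) :=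
  LinearMap.ext fun f => by
    simp only [Module.End.mul_apply, kap_apply, map_smul, map_sub, pD_mul,
      pD_ve, pD_inv, zero_mul, mul_zero, zero_add, add_zero]

theorem commute_mulX_eps (i j : ℕ) : Commute (mulX 𝕂 m i) (eps 𝕂 m j) :=
  LinearMap.ext fun f => by
    simp only [Module.End.mul_apply, mulX_apply, eps_apply, mul_smul_comm, map_mul, inv_vx, mul_add,
      ← mul_assoc, vx_mul_comm i (ve 𝕂 m j)]

theorem commute_mulX_kap (i j : ℕ) : Commute (mulX 𝕂 m i) (kap 𝕂 m j) :=
  LinearMap.ext fun f => by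
    simp only [Module.End.mul_apply, mulX_apply, kap_apply, mul_smul_comm, map_mul, inv_vx, mul_sub,
      ← mul_assoc, vx_mul_comm i (ve 𝕂 m j)]

/-! ### The operators of Hodge-de Rham theory on `ℝ^r` -/

section

variable (𝕂 m) (r : ℕ)

/-- The exterior derivative. -/
def extD : Module.End 𝕂 (CPol 𝕂 m) := ∑ i ∈ Finset.Icc 1 r, eps 𝕂 m i * pD 𝕂 m i

/-- The coderivative. -/
def coD : Module.End 𝕂 (CPol 𝕂 m) := ∑ i ∈ Finset.Icc 1 r, kap 𝕂 m i * pD 𝕂 m i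

/-- Outer multiplication by the vector variable. -/
def xWedge : Module.End 𝕂 (CPol 𝕂 m) := ∑ i ∈ Finset.Icc 1 r, mulX 𝕂 m i * eps 𝕂 m i

/-- Inner multiplication by the vector variable. -/
def xDot : Module.End 𝕂 (CPol 𝕂 m) := ∑ i ∈ Finset.Icc 1 r, mulX 𝕂 m i * kap 𝕂 m i

/-- The Euler operator. -/
def euler : Module.End 𝕂 (CPol 𝕂 m) := ∑ i ∈ Finset.Icc 1 r, mulX 𝕂 m i * pD 𝕂 m i

/-- The operator with eigenvalue `s` on `s`-vectors. -/
def grade : Module.End 𝕂 (CPol 𝕂 m) := -∑ i ∈ Finset.Icc 1 r, eps 𝕂 m i * kap 𝕂 m i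

/-- The Laplace operator. -/
def lapl : Module.End 𝕂 (CPol 𝕂 m) := ∑ i ∈ Finset.Icc 1 r, pD 𝕂 m i * pD 𝕂 m i

end

theorem sum_kron_smul {M : Type*} [AddCommGroup M] [Module 𝕂 M] {r : ℕ} (hr : r ≤ m) {i : ℕ}
    (hi : i ∈ Finset.Icc 1 r) (g : ℕ → M) :
    ∑ j ∈ Finset.Icc 1 r, kron 𝕂 m i j • g j = g i := by
  rw [Finset.sum_eq_single i]
  · rw [Finset.mem_Icc] at hi
    rw [kron_self hi.1 (hi.2.trans hr), one_smul]
  · intro j _ hj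
    rw [kron_of_ne hj.symm, zero_smul]
  · exact fun h => (h hi).elim

/-- Moving ∂_i past x_j leaves the term Σ a_i b_i. The rest contains only the anticommutators of a_i
with b_j, and these contract to the Euler operator. The four relations between d, d* and x∧, x• are
instances. -/
theorem anticomm_sum {r : ℕ} (hr : r ≤ m) (a b : ℕ → Module.End 𝕂 (CPol 𝕂 m)) (c : 𝕂)
    (ha : ∀ i j, Commute (mulX 𝕂 m i) (a j)) (hb : ∀ i j, Commute (pD 𝕂 m i) (b j))
    (h : ∀ i j, a i * b j + b j * a i = (c * kron 𝕂 m i j) • 1) :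
    (∑ i ∈ Finset.Icc 1 r, a i * pD 𝕂 m i) * (∑ i ∈ Finset.Icc 1 r, mulX 𝕂 m i * b i) +
      (∑ i ∈ Finset.Icc 1 r, mulX 𝕂 m i * b i) * (∑ i ∈ Finset.Icc 1 r, a i * pD 𝕂 m i) =
    c • euler 𝕂 m r + ∑ i ∈ Finset.Icc 1 r, a i * b i := by
  rw [Finset.sum_mul_sum, Finset.sum_mul_sum, Finset.sum_comm (f := fun i j => _ * b i * _),
    ← Finset.sum_add_distrib, euler, Finset.smul_sum, ← Finset.sum_add_distrib]
  refine Finset.sum_congr rfl fun i hi => ?_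
  rw [← Finset.sum_add_distrib, ← sum_kron_smul (𝕂 := 𝕂) hr hi (fun j => c • (mulX 𝕂 m j * pD 𝕂 m i) + a i * b j)]
  refine Finset.sum_congr rfl fun j _ => ?_
  have h1 : a i * pD 𝕂 m i * (mulX 𝕂 m j * b j) =
      mulX 𝕂 m j * (a i * b j) * pD 𝕂 m i + kron 𝕂 m i j • (a i * b j) := by
    rw [mul_assoc, ← mul_assoc (pD 𝕂 m i), pD_mul_mulX, add_mul, mul_add, mul_assoc, hb,
      ← mul_assoc, ← (ha j i).eq]
    simp only [mul_assoc, smul_mul_assoc, one_mul, mul_smul_comm]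
  have h2 : mulX 𝕂 m j * b j * (a i * pD 𝕂 m i) = mulX 𝕂 m j * (b j * a i) * pD 𝕂 m i := by
    simp only [mul_assoc]
  rw [h1, h2, add_right_comm, ← add_mul, ← mul_add, h, mul_smul_comm, mul_one, smul_mul_assoc,
    smul_add, smul_smul, mul_comm c]

theorem extD_xDot {r : ℕ} (hr : r ≤ m) :
    extD 𝕂 m r * xDot 𝕂 m r + xDot 𝕂 m r * extD 𝕂 m r = -(grade 𝕂 m r + euler 𝕂 m r) := by
  rw [extD, xDot, anticomm_sum hr _ _ (-1) commute_mulX_eps commute_pD_kap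
    (fun i j => by rw [eps_mul_kap]; module), grade]
  module

theorem coD_xWedge {r : ℕ} (hr : r ≤ m) :
    coD 𝕂 m r * xWedge 𝕂 m r + xWedge 𝕂 m r * coD 𝕂 m r =
      grade 𝕂 m r - (r : 𝕂) • 1 - euler 𝕂 m r := by
  rw [coD, xWedge, anticomm_sum hr _ _ (-1) commute_mulX_kap commute_pD_eps
    (fun i j => by rw [add_comm, eps_mul_kap, kron_comm]; module), grade]
  -- Each reordering of inner and outer product costs −1; the r of them are the source of the
  -- dimension in the relation.
  have : ∀ i ∈ Finset.Icc 1 r, kap 𝕂 m i * eps 𝕂 m i = - (eps 𝕂 m i * kap 𝕂 m i) - 1 := by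
    intro i hi
    rw [Finset.mem_Icc] at hi
    have := eps_mul_kap (𝕂 := 𝕂) (m := m) i i
    rw [kron_self hi.1 (by omega), one_smul] at this
    rw [eq_sub_iff_add_eq, ← sub_eq_zero, ← sub_eq_zero.2 this]; abel
  rw [Finset.sum_congr rfl this, Finset.sum_sub_distrib, Finset.sum_neg_distrib, Finset.sum_const,
    Nat.card_Icc, Nat.add_sub_cancel, ← Nat.cast_smul_eq_nsmul 𝕂]
  module

theorem extD_xWedge {r : ℕ} (hr : r ≤ m) :
    extD 𝕂 m r * xWedge 𝕂 m r + xWedge 𝕂 m r * extD 𝕂 m r = 0 := by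
  rw [extD, xWedge, anticomm_sum hr _ _ 0 commute_mulX_eps commute_pD_eps
    (fun i j => by rw [eps_mul_eps, zero_mul, zero_smul]), zero_smul, zero_add]
  refine Finset.sum_eq_zero fun i _ => ?_
  simpa [← two_smul 𝕂] using eps_mul_eps (𝕂 := 𝕂) (m := m) i i

theorem coD_xDot {r : ℕ} (hr : r ≤ m) :
    coD 𝕂 m r * xDot 𝕂 m r + xDot 𝕂 m r * coD 𝕂 m r = 0 := by
  rw [coD, xDot, anticomm_sum hr _ _ 0 commute_mulX_kap commute_pD_kap
    (fun i j => by rw [kap_mul_kap, zero_mul, zero_smul]), zero_smul, zero_add]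
  refine Finset.sum_eq_zero fun i _ => ?_
  simpa [← two_smul 𝕂] using kap_mul_kap (𝕂 := 𝕂) (m := m) i i

theorem extD_coD {r : ℕ} (hr : r ≤ m) :
    extD 𝕂 m r * coD 𝕂 m r + coD 𝕂 m r * extD 𝕂 m r = -lapl 𝕂 m r := by
  rw [extD, coD, lapl, Finset.sum_mul_sum, Finset.sum_mul_sum,
    Finset.sum_comm (f := fun i j => kap 𝕂 m i * _ * _),
    ← Finset.sum_add_distrib, ← Finset.sum_neg_distrib]
  refine Finset.sum_congr rfl fun i hi => ?_
  rw [← Finset.sum_add_distrib, ← sum_kron_smul (𝕂 := 𝕂) hr hi (fun j => -(pD 𝕂 m i * pD 𝕂 m j))]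
  refine Finset.sum_congr rfl fun j _ => ?_
  have h1 : eps 𝕂 m i * pD 𝕂 m i * (kap 𝕂 m j * pD 𝕂 m j) =
      eps 𝕂 m i * kap 𝕂 m j * (pD 𝕂 m i * pD 𝕂 m j) := by
    rw [mul_assoc, ← mul_assoc (pD 𝕂 m i), (commute_pD_kap i j).eq]; simp only [mul_assoc]
  have h2 : kap 𝕂 m j * pD 𝕂 m j * (eps 𝕂 m i * pD 𝕂 m i) =
      kap 𝕂 m j * eps 𝕂 m i * (pD 𝕂 m i * pD 𝕂 m j) := by
    rw [mul_assoc, ← mul_assoc (pD 𝕂 m j), (commute_pD_eps j i).eq, (commute_pD_pD i j).eq]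
    simp only [mul_assoc]
  rw [h1, h2, ← add_mul, eps_mul_kap]
  exact LinearMap.ext fun f => by simp

/-! ### Relations in applied form -/

theorem eps_eps (i j : ℕ) (f : CPol 𝕂 m) :
    eps 𝕂 m i (eps 𝕂 m j f) = -eps 𝕂 m j (eps 𝕂 m i f) :=
  eq_neg_of_add_eq_zero_left (LinearMap.congr_fun (eps_mul_eps i j) f)

theorem kap_kap (i j : ℕ) (f : CPol 𝕂 m) :
    kap 𝕂 m i (kap 𝕂 m j f) = -kap 𝕂 m j (kap 𝕂 m i f) :=
  eq_neg_of_add_eq_zero_left (LinearMap.congr_fun (kap_mul_kap i j) f)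

theorem kap_eps (i j : ℕ) (f : CPol 𝕂 m) :
    kap 𝕂 m i (eps 𝕂 m j f) = -eps 𝕂 m j (kap 𝕂 m i f) - kron 𝕂 m j i • f := by
  have : eps 𝕂 m j (kap 𝕂 m i f) + kap 𝕂 m i (eps 𝕂 m j f) = -(kron 𝕂 m j i • f) :=
    LinearMap.congr_fun (eps_mul_kap j i) f
  rw [← sub_eq_zero, ← sub_eq_zero.2 this]; abel

theorem eq_zero_of_eq_neg {f : CPol 𝕂 m} (h : f = -f) : f = 0 := by
  have : (2 : 𝕂) • f = 0 := by rw [two_smul]; nth_rw 2 [h]; exact add_neg_cancel f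
  exact (smul_eq_zero.1 this).resolve_left two_ne_zero

theorem eps_eps_self (i : ℕ) (f : CPol 𝕂 m) : eps 𝕂 m i (eps 𝕂 m i f) = 0 :=
  eq_zero_of_eq_neg (eps_eps i i f)

theorem kap_kap_self (i : ℕ) (f : CPol 𝕂 m) : kap 𝕂 m i (kap 𝕂 m i f) = 0 :=
  eq_zero_of_eq_neg (kap_kap i i f)

theorem kap_eps_self {i : ℕ} (h : 1 ≤ i) (h' : i ≤ m) (f : CPol 𝕂 m) :
    kap 𝕂 m i (eps 𝕂 m i f) = -eps 𝕂 m i (kap 𝕂 m i f) - f := by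
  rw [kap_eps, kron_self h h', one_smul]

theorem kap_eps_of_ne {i j : ℕ} (h : i ≠ j) (f : CPol 𝕂 m) :
    kap 𝕂 m i (eps 𝕂 m j f) = -eps 𝕂 m j (kap 𝕂 m i f) := by
  rw [kap_eps, kron_of_ne h.symm, zero_smul, sub_zero]

theorem pD_eps (i j : ℕ) (f : CPol 𝕂 m) :
    pD 𝕂 m i (eps 𝕂 m j f) = eps 𝕂 m j (pD 𝕂 m i f) := LinearMap.congr_fun (commute_pD_eps i j) f

theorem pD_kap (i j : ℕ) (f : CPol 𝕂 m) :
    pD 𝕂 m i (kap 𝕂 m j f) = kap 𝕂 m j (pD 𝕂 m i f) := LinearMap.congr_fun (commute_pD_kap i j) f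

theorem mulX_eps (i j : ℕ) (f : CPol 𝕂 m) :
    mulX 𝕂 m i (eps 𝕂 m j f) = eps 𝕂 m j (mulX 𝕂 m i f) :=
  LinearMap.congr_fun (commute_mulX_eps i j) f

theorem mulX_kap (i j : ℕ) (f : CPol 𝕂 m) :
    mulX 𝕂 m i (kap 𝕂 m j f) = kap 𝕂 m j (mulX 𝕂 m i f) :=
  LinearMap.congr_fun (commute_mulX_kap i j) f

theorem pD_mulX (i j : ℕ) (f : CPol 𝕂 m) :
    pD 𝕂 m i (mulX 𝕂 m j f) = mulX 𝕂 m j (pD 𝕂 m i f) + kron 𝕂 m i j • f :=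
  LinearMap.congr_fun (pD_mul_mulX i j) f

theorem extD_apply (r : ℕ) (f : CPol 𝕂 m) :
    extD 𝕂 m r f = ∑ i ∈ Finset.Icc 1 r, eps 𝕂 m i (pD 𝕂 m i f) := by
  simp [extD, LinearMap.sum_apply]

theorem coD_apply (r : ℕ) (f : CPol 𝕂 m) :
    coD 𝕂 m r f = ∑ i ∈ Finset.Icc 1 r, kap 𝕂 m i (pD 𝕂 m i f) := by
  simp [coD, LinearMap.sum_apply]

theorem xWedge_apply (r : ℕ) (f : CPol 𝕂 m) :
    xWedge 𝕂 m r f = ∑ i ∈ Finset.Icc 1 r, mulX 𝕂 m i (eps 𝕂 m i f) := by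
  simp [xWedge, LinearMap.sum_apply]

theorem xDot_apply (r : ℕ) (f : CPol 𝕂 m) :
    xDot 𝕂 m r f = ∑ i ∈ Finset.Icc 1 r, mulX 𝕂 m i (kap 𝕂 m i f) := by
  simp [xDot, LinearMap.sum_apply]

theorem euler_apply (r : ℕ) (f : CPol 𝕂 m) :
    euler 𝕂 m r f = ∑ i ∈ Finset.Icc 1 r, mulX 𝕂 m i (pD 𝕂 m i f) := by
  simp [euler, LinearMap.sum_apply]

theorem grade_apply (r : ℕ) (f : CPol 𝕂 m) :
    grade 𝕂 m r f = -∑ i ∈ Finset.Icc 1 r, eps 𝕂 m i (kap 𝕂 m i f) := by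
  simp [grade, LinearMap.sum_apply]

theorem extD_succ (n : ℕ) (f : CPol 𝕂 m) :
    extD 𝕂 m (n + 1) f = extD 𝕂 m n f + eps 𝕂 m (n + 1) (pD 𝕂 m (n + 1) f) := by
  rw [extD_apply, extD_apply, Finset.sum_Icc_succ_top (by omega)]

theorem coD_succ (n : ℕ) (f : CPol 𝕂 m) :
    coD 𝕂 m (n + 1) f = coD 𝕂 m n f + kap 𝕂 m (n + 1) (pD 𝕂 m (n + 1) f) := by
  rw [coD_apply, coD_apply, Finset.sum_Icc_succ_top (by omega)]

theorem euler_succ (n : ℕ) (f : CPol 𝕂 m) :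
    euler 𝕂 m (n + 1) f = euler 𝕂 m n f + mulX 𝕂 m (n + 1) (pD 𝕂 m (n + 1) f) := by
  rw [euler_apply, euler_apply, Finset.sum_Icc_succ_top (by omega)]

theorem grade_succ (n : ℕ) (f : CPol 𝕂 m) :
    grade 𝕂 m (n + 1) f = grade 𝕂 m n f - eps 𝕂 m (n + 1) (kap 𝕂 m (n + 1) f) := by
  rw [grade_apply, grade_apply, Finset.sum_Icc_succ_top (by omega)]; abel

theorem grade_eps {r i : ℕ} (hr : r ≤ m) (hi : i ∈ Finset.Icc 1 r) (f : CPol 𝕂 m) :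
    grade 𝕂 m r (eps 𝕂 m i f) = eps 𝕂 m i (grade 𝕂 m r f) + eps 𝕂 m i f := by
  have h : ∀ j ∈ Finset.Icc 1 r, eps 𝕂 m j (kap 𝕂 m j (eps 𝕂 m i f)) =
      eps 𝕂 m i (eps 𝕂 m j (kap 𝕂 m j f)) - kron 𝕂 m i j • eps 𝕂 m j f := fun j _ => by
    rw [kap_eps, map_sub, map_neg, eps_eps, neg_neg, map_smul]
  simp only [grade_apply, Finset.sum_congr rfl h, Finset.sum_sub_distrib, map_neg, map_sum,
    sum_kron_smul hr hi]
  abel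

theorem grade_kap {r i : ℕ} (hr : r ≤ m) (hi : i ∈ Finset.Icc 1 r) (f : CPol 𝕂 m) :
    grade 𝕂 m r (kap 𝕂 m i f) = kap 𝕂 m i (grade 𝕂 m r f) - kap 𝕂 m i f := by
  have h : ∀ j ∈ Finset.Icc 1 r, kap 𝕂 m i (eps 𝕂 m j (kap 𝕂 m j f)) =
      eps 𝕂 m j (kap 𝕂 m j (kap 𝕂 m i f)) - kron 𝕂 m i j • kap 𝕂 m j f := fun j _ => by
    rw [kap_eps, kap_kap, map_neg, neg_neg, kron_comm]
  simp only [grade_apply, map_neg, map_sum, Finset.sum_congr rfl h, Finset.sum_sub_distrib,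
    sum_kron_smul hr hi]
  abel

theorem grade_pD (r i : ℕ) (f : CPol 𝕂 m) :
    grade 𝕂 m r (pD 𝕂 m i f) = pD 𝕂 m i (grade 𝕂 m r f) := by
  simp only [grade_apply, map_neg, map_sum, pD_eps, pD_kap]

theorem grade_mulX (r i : ℕ) (f : CPol 𝕂 m) :
    grade 𝕂 m r (mulX 𝕂 m i f) = mulX 𝕂 m i (grade 𝕂 m r f) := by
  simp only [grade_apply, map_neg, map_sum, mulX_eps, mulX_kap]

theorem euler_eps (r i : ℕ) (f : CPol 𝕂 m) :
    euler 𝕂 m r (eps 𝕂 m i f) = eps 𝕂 m i (euler 𝕂 m r f) := by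
  simp only [euler_apply, map_sum, pD_eps, mulX_eps]

theorem euler_kap (r i : ℕ) (f : CPol 𝕂 m) :
    euler 𝕂 m r (kap 𝕂 m i f) = kap 𝕂 m i (euler 𝕂 m r f) := by
  simp only [euler_apply, map_sum, pD_kap, mulX_kap]

theorem euler_mul (r : ℕ) (f g : CPol 𝕂 m) :
    euler 𝕂 m r (f * g) = euler 𝕂 m r f * g + f * euler 𝕂 m r g := by
  simp only [euler_apply, Finset.sum_mul, Finset.mul_sum, ← Finset.sum_add_distrib]
  refine Finset.sum_congr rfl fun i _ => ?_
  rw [pD_mul, map_add, mulX_apply, mulX_apply, mulX_apply, mulX_apply, mul_assoc, ← mul_assoc f,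
    ← vx_mul_comm i f, mul_assoc]

theorem pD_euler {r i : ℕ} (hr : r ≤ m) (hi : i ∈ Finset.Icc 1 r) (f : CPol 𝕂 m) :
    euler 𝕂 m r (pD 𝕂 m i f) = pD 𝕂 m i (euler 𝕂 m r f) - pD 𝕂 m i f := by
  simp only [euler_apply, map_sum, pD_mulX, Finset.sum_add_distrib, sum_kron_smul hr hi, pD_comm i]
  abel

theorem extD_eps_of_lt (r i : ℕ) (f : CPol 𝕂 m) :
    extD 𝕂 m r (eps 𝕂 m i f) = -eps 𝕂 m i (extD 𝕂 m r f) := by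
  simp only [extD_apply, map_sum, ← Finset.sum_neg_distrib, pD_eps]
  exact Finset.sum_congr rfl fun j _ => eps_eps _ _ _

theorem coD_kap_of_lt (r i : ℕ) (f : CPol 𝕂 m) :
    coD 𝕂 m r (kap 𝕂 m i f) = -kap 𝕂 m i (coD 𝕂 m r f) := by
  simp only [coD_apply, map_sum, ← Finset.sum_neg_distrib, pD_kap]
  exact Finset.sum_congr rfl fun j _ => kap_kap _ _ _

theorem extD_kap_of_lt {r i : ℕ} (h : r < i) (f : CPol 𝕂 m) :
    extD 𝕂 m r (kap 𝕂 m i f) = -kap 𝕂 m i (extD 𝕂 m r f) := by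
  simp only [extD_apply, map_sum, ← Finset.sum_neg_distrib, pD_kap]
  refine Finset.sum_congr rfl fun j hj => ?_
  rw [Finset.mem_Icc] at hj
  rw [kap_eps_of_ne (by omega), neg_neg]

theorem coD_eps_of_lt {r i : ℕ} (h : r < i) (f : CPol 𝕂 m) :
    coD 𝕂 m r (eps 𝕂 m i f) = -eps 𝕂 m i (coD 𝕂 m r f) := by
  simp only [coD_apply, map_sum, ← Finset.sum_neg_distrib, pD_eps]
  refine Finset.sum_congr rfl fun j hj => ?_
  rw [Finset.mem_Icc] at hj
  rw [kap_eps_of_ne (by omega)]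

theorem extD_pD (r i : ℕ) (f : CPol 𝕂 m) :
    extD 𝕂 m r (pD 𝕂 m i f) = pD 𝕂 m i (extD 𝕂 m r f) := by
  simp only [extD_apply, map_sum, pD_eps, pD_comm i]

theorem coD_pD (r i : ℕ) (f : CPol 𝕂 m) :
    coD 𝕂 m r (pD 𝕂 m i f) = pD 𝕂 m i (coD 𝕂 m r f) := by
  simp only [coD_apply, map_sum, pD_kap, pD_comm i]

/-- The eigenvalues of the grade operator on `ℝ^r` are `0, …, r`. -/
theorem grade_eigenvalue {r : ℕ} (hr : r ≤ m) {t : ℤ} {f : CPol 𝕂 m}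
    (h : grade 𝕂 m r f = (t : 𝕂) • f) (hf : f ≠ 0) : 0 ≤ t ∧ t ≤ r := by
  induction r generalizing t f with
  | zero =>
    simp only [grade_apply, Finset.Icc_eq_empty_of_lt zero_lt_one, Finset.sum_empty, neg_zero] at h
    have := (smul_eq_zero.1 h.symm).resolve_right hf
    rw [Int.cast_eq_zero] at this
    simp [this]
  | succ r ih =>
    -- The last direction is either empty or occupied: if g = 0, then f is already an eigenvector on
    -- ℝ^r for t, and otherwise g is one for t − 1.
    set g := kap 𝕂 m (r + 1) f with hg
    have hmem : r + 1 ∈ Finset.Icc 1 (r + 1) := by simp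
    by_cases h0 : g = 0
    · rw [grade_succ, ← hg, h0, map_zero, sub_zero] at h
      have := ih (by omega) h hf
      push_cast
      omega
    · have h1 : grade 𝕂 m r g = ((t - 1 : ℤ) : 𝕂) • g := by
        have := grade_kap hr hmem f
        rw [h, map_smul, ← hg, grade_succ] at this
        rw [hg, kap_kap_self, map_zero, sub_zero, ← hg] at this
        rw [this]; push_cast; module
      have := ih (by omega) h1 h0
      push_cast
      omega

/-! ### The spaces of homogeneous solutions of the Hodge-de Rham system on `ℝ^r` -/

variable (𝕂 m) in
/-- The `k`-homogeneous `t`-vector valued solutions of the Hodge-de Rham system on `ℝ^r`, as a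
subspace of the polynomials on `ℝ^m`. -/
def Hr (r : ℕ) (t : ℤ) (k : ℕ) : Submodule 𝕂 (CPol 𝕂 m) where
  carrier := {f | (∀ i, r < i → pD 𝕂 m i f = 0 ∧ kap 𝕂 m i f = 0) ∧
    euler 𝕂 m r f = (k : 𝕂) • f ∧ grade 𝕂 m r f = (t : 𝕂) • f ∧
    extD 𝕂 m r f = 0 ∧ coD 𝕂 m r f = 0}
  add_mem' := by
    rintro f g ⟨h1, h2, h3, h4, h5⟩ ⟨g1, g2, g3, g4, g5⟩
    refine ⟨fun i hi => ⟨?_, ?_⟩, ?_, ?_, ?_, ?_⟩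
    · rw [map_add, (h1 i hi).1, (g1 i hi).1, add_zero]
    · rw [map_add, (h1 i hi).2, (g1 i hi).2, add_zero]
    · rw [map_add, h2, g2, smul_add]
    · rw [map_add, h3, g3, smul_add]
    · rw [map_add, h4, g4, add_zero]
    · rw [map_add, h5, g5, add_zero]
  zero_mem' := by simp
  smul_mem' := by
    rintro c f ⟨h1, h2, h3, h4, h5⟩
    refine ⟨fun i hi => ⟨?_, ?_⟩, ?_, ?_, ?_, ?_⟩
    · rw [map_smul, (h1 i hi).1, smul_zero]
    · rw [map_smul, (h1 i hi).2, smul_zero]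
    · rw [map_smul, h2, smul_comm]
    · rw [map_smul, h3, smul_comm]
    · rw [map_smul, h4, smul_zero]
    · rw [map_smul, h5, smul_zero]

theorem mem_Hr {r : ℕ} {t : ℤ} {k : ℕ} {f : CPol 𝕂 m} :
    f ∈ Hr 𝕂 m r t k ↔ (∀ i, r < i → pD 𝕂 m i f = 0 ∧ kap 𝕂 m i f = 0) ∧
    euler 𝕂 m r f = (k : 𝕂) • f ∧ grade 𝕂 m r f = (t : 𝕂) • f ∧
    extD 𝕂 m r f = 0 ∧ coD 𝕂 m r f = 0 := Iff.rfl

theorem Hr_grade {r : ℕ} (hr : r ≤ m) {t : ℤ} {k : ℕ} {f : CPol 𝕂 m} (h : f ∈ Hr 𝕂 m r t k)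
    (hf : f ≠ 0) : 0 ≤ t ∧ t ≤ r := grade_eigenvalue hr h.2.2.1 hf

/-- On a solution one of the two terms of the anticommutator vanishes, and the other side is a
scalar. -/
theorem coD_xWedge_of_mem {r : ℕ} (hr : r ≤ m) {t : ℤ} {k : ℕ} {f : CPol 𝕂 m}
    (h : f ∈ Hr 𝕂 m r t k) :
    coD 𝕂 m r (xWedge 𝕂 m r f) = ((t : 𝕂) - r - k) • f := by
  have := LinearMap.congr_fun (coD_xWedge (𝕂 := 𝕂) hr) f
  simp only [LinearMap.add_apply, Module.End.mul_apply, LinearMap.sub_apply, LinearMap.smul_apply,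
    Module.End.one_apply, h.2.1, h.2.2.1, h.2.2.2.2, map_zero, add_zero] at this
  rw [this]; module

theorem extD_xDot_of_mem {r : ℕ} (hr : r ≤ m) {t : ℤ} {k : ℕ} {f : CPol 𝕂 m}
    (h : f ∈ Hr 𝕂 m r t k) :
    extD 𝕂 m r (xDot 𝕂 m r f) = -((t : 𝕂) + k) • f := by
  have := LinearMap.congr_fun (extD_xDot (𝕂 := 𝕂) hr) f
  simp only [LinearMap.add_apply, Module.End.mul_apply, LinearMap.neg_apply,
    h.2.1, h.2.2.1, h.2.2.2.1, map_zero, add_zero] at this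
  rw [this]; module

theorem extD_xWedge_of_mem {r : ℕ} (hr : r ≤ m) {t : ℤ} {k : ℕ} {f : CPol 𝕂 m}
    (h : f ∈ Hr 𝕂 m r t k) : extD 𝕂 m r (xWedge 𝕂 m r f) = 0 := by
  have := LinearMap.congr_fun (extD_xWedge (𝕂 := 𝕂) hr) f
  simpa only [LinearMap.zero_apply, LinearMap.add_apply, Module.End.mul_apply, h.2.2.2.1, map_zero, add_zero] using this

theorem coD_xDot_of_mem {r : ℕ} (hr : r ≤ m) {t : ℤ} {k : ℕ} {f : CPol 𝕂 m}
    (h : f ∈ Hr 𝕂 m r t k) : coD 𝕂 m r (xDot 𝕂 m r f) = 0 := by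
  have := LinearMap.congr_fun (coD_xDot (𝕂 := 𝕂) hr) f
  simpa only [LinearMap.zero_apply, LinearMap.add_apply, Module.End.mul_apply, h.2.2.2.2, map_zero, add_zero] using this

theorem grade_xWedge {r : ℕ} (hr : r ≤ m) {t : 𝕂} {f : CPol 𝕂 m}
    (h : grade 𝕂 m r f = t • f) :
    grade 𝕂 m r (xWedge 𝕂 m r f) = (t + 1) • xWedge 𝕂 m r f := by
  rw [xWedge_apply, map_sum, Finset.smul_sum]
  refine Finset.sum_congr rfl fun i hi => ?_
  rw [grade_mulX, grade_eps hr hi, h]; simp only [map_smul, map_add]; module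

theorem grade_xDot {r : ℕ} (hr : r ≤ m) {t : 𝕂} {f : CPol 𝕂 m}
    (h : grade 𝕂 m r f = t • f) :
    grade 𝕂 m r (xDot 𝕂 m r f) = (t - 1) • xDot 𝕂 m r f := by
  rw [xDot_apply, map_sum, Finset.smul_sum]
  refine Finset.sum_congr rfl fun i hi => ?_
  rw [grade_mulX, grade_kap hr hi, h]; simp only [map_smul, map_sub]; module

theorem xWedge_eq_zero_of_top {r : ℕ} (hr : r ≤ m) {k : ℕ} {f : CPol 𝕂 m}
    (h : f ∈ Hr 𝕂 m r r k) : xWedge 𝕂 m r f = 0 := by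
  by_contra h0
  have h1 : grade 𝕂 m r (xWedge 𝕂 m r f) = ((r + 1 : ℤ) : 𝕂) • xWedge 𝕂 m r f := by
    rw [grade_xWedge hr h.2.2.1]; push_cast; rfl
  have := grade_eigenvalue hr h1 h0
  omega

theorem xDot_eq_zero_of_bot {r : ℕ} (hr : r ≤ m) {k : ℕ} {f : CPol 𝕂 m}
    (h : f ∈ Hr 𝕂 m r 0 k) : xDot 𝕂 m r f = 0 := by
  by_contra h0
  have h1 : grade 𝕂 m r (xDot 𝕂 m r f) = ((-1 : ℤ) : 𝕂) • xDot 𝕂 m r f := by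
    rw [grade_xDot hr h.2.2.1]; push_cast; rw [zero_sub]
  have := grade_eigenvalue hr h1 h0
  omega

/-- In grade 0 the product x•f vanishes for lack of grade, yet d(x•f) = −kf. In the top grade the
same happens with x∧f and d*. -/
theorem Hr_eq_zero_of_extreme {r : ℕ} (hr : r ≤ m) {t : ℤ} {k : ℕ} {f : CPol 𝕂 m}
    (h : f ∈ Hr 𝕂 m r t k) (ht : t = 0 ∨ t = r) (hk : k ≠ 0) : f = 0 := by
  have hk' : (k : 𝕂) ≠ 0 := Nat.cast_ne_zero.2 hk
  rcases ht with rfl | rfl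
  · have := extD_xDot_of_mem hr h
    rw [xDot_eq_zero_of_bot hr h, map_zero, Int.cast_zero, zero_add] at this
    exact (smul_eq_zero.1 this.symm).resolve_left (neg_ne_zero.2 hk')
  · have := coD_xWedge_of_mem hr h
    rw [xWedge_eq_zero_of_top hr h, map_zero, Int.cast_natCast, sub_self, zero_sub] at this
    exact (smul_eq_zero.1 this.symm).resolve_left (neg_ne_zero.2 hk')

theorem Hr_le_succ {n : ℕ} {t : ℤ} {k : ℕ} : Hr 𝕂 m n t k ≤ Hr 𝕂 m (n + 1) t k := by
  rintro f ⟨h1, h2, h3, h4, h5⟩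
  obtain ⟨hD, hK⟩ := h1 (n + 1) (by omega)
  refine ⟨fun i hi => h1 i (by omega), ?_, ?_, ?_, ?_⟩
  · rw [euler_succ, hD, map_zero, add_zero, h2]
  · rw [grade_succ, hK, map_zero, sub_zero, h3]
  · rw [extD_succ, hD, map_zero, add_zero, h4]
  · rw [coD_succ, hD, map_zero, add_zero, h5]

theorem ve_mul_of_kap {i : ℕ} {f : CPol 𝕂 m} (h : kap 𝕂 m i f = 0) :
    ve 𝕂 m i * f = eps 𝕂 m i f := by
  rw [ve_mul_eq, h, add_zero]

theorem eps_mem_Hr_succ {n : ℕ} (hn : n + 1 ≤ m) {t : ℤ} {k : ℕ} {f : CPol 𝕂 m}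
    (h : f ∈ Hr 𝕂 m n t k) : eps 𝕂 m (n + 1) f ∈ Hr 𝕂 m (n + 1) (t + 1) k := by
  have hs := Hr_le_succ h
  obtain ⟨h1, h2, h3, h4, h5⟩ := h
  obtain ⟨hD, hK⟩ := h1 (n + 1) (by omega)
  refine ⟨fun i hi => ⟨?_, ?_⟩, ?_, ?_, ?_, ?_⟩
  · rw [pD_eps, (h1 i (by omega)).1, map_zero]
  · rw [kap_eps_of_ne (by omega), (h1 i (by omega)).2, map_zero, neg_zero]
  · rw [euler_eps, hs.2.1, map_smul]
  · rw [grade_eps hn (by simp), hs.2.2.1, map_smul]; push_cast; module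
  · rw [extD_succ, extD_eps_of_lt, h4, pD_eps, hD, map_zero, map_zero, neg_zero, zero_add]
  · rw [coD_succ, coD_eps_of_lt (by omega), h5, pD_eps, hD, map_zero, map_zero, neg_zero,
      zero_add]

theorem ve_mul_mem_Hr_succ {n : ℕ} (hn : n + 1 ≤ m) {t : ℤ} {k : ℕ} {f : CPol 𝕂 m}
    (h : f ∈ Hr 𝕂 m n t k) : ve 𝕂 m (n + 1) * f ∈ Hr 𝕂 m (n + 1) (t + 1) k := by
  rw [ve_mul_of_kap (h.1 (n + 1) (by omega)).2]
  exact eps_mem_Hr_succ hn h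

theorem pD_mem_Hr {r : ℕ} (hr : r ≤ m) {i : ℕ} (hi : i ∈ Finset.Icc 1 r) {t : ℤ} {k : ℕ}
    {f : CPol 𝕂 m} (h : f ∈ Hr 𝕂 m r t (k + 1)) : pD 𝕂 m i f ∈ Hr 𝕂 m r t k := by
  obtain ⟨h1, h2, h3, h4, h5⟩ := h
  refine ⟨fun j hj => ⟨?_, ?_⟩, ?_, ?_, ?_, ?_⟩
  · rw [pD_comm, (h1 j hj).1, map_zero]
  · rw [← pD_kap, (h1 j hj).2, map_zero]
  · rw [pD_euler hr hi, h2, map_smul]; push_cast; module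
  · rw [grade_pD, h3, map_smul]
  · rw [extD_pD, h4, map_zero]
  · rw [coD_pD, h5, map_zero]

/-- The relation between `kap` and `eps` at index n + 1 splits f into the part free of e_{n+1} and
the part divisible by it. Both inherit the equations on ℝ^n, because the derivative in x_{n+1} drops
out of all operators. -/
theorem exists_of_pD_eq_zero {n : ℕ} (hn : n + 1 ≤ m) {s : ℤ} {k : ℕ} {f : CPol 𝕂 m}
    (h : f ∈ Hr 𝕂 m (n + 1) s k) (hD : pD 𝕂 m (n + 1) f = 0) :
    ∃ a ∈ Hr 𝕂 m n s k, ∃ b ∈ Hr 𝕂 m n (s - 1) k, f = a + ve 𝕂 m (n + 1) * b := by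
  obtain ⟨h1, h2, h3, h4, h5⟩ := h
  have hmem : n + 1 ∈ Finset.Icc 1 (n + 1) := by simp
  have g2 : euler 𝕂 m n f = (k : 𝕂) • f := by rw [← h2, euler_succ, hD, map_zero, add_zero]
  have g4 : extD 𝕂 m n f = 0 := by rw [← h4, extD_succ, hD, map_zero, add_zero]
  have g5 : coD 𝕂 m n f = 0 := by rw [← h5, coD_succ, hD, map_zero, add_zero]
  have hb : kap 𝕂 m (n + 1) (-kap 𝕂 m (n + 1) f) = 0 := by rw [map_neg, kap_kap_self, neg_zero]
  refine ⟨-kap 𝕂 m (n + 1) (eps 𝕂 m (n + 1) f), ?_, -kap 𝕂 m (n + 1) f, ?_, ?_⟩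
  · refine neg_mem ⟨fun i hi => ⟨?_, ?_⟩, ?_, ?_, ?_, ?_⟩
    · rcases (Nat.succ_le_of_lt hi).eq_or_lt with rfl | hi
      · rw [pD_kap, pD_eps, Nat.succ_eq_add_one, hD, map_zero, map_zero]
      · rw [pD_kap, pD_eps, (h1 i hi).1, map_zero, map_zero]
    · rcases (Nat.succ_le_of_lt hi).eq_or_lt with rfl | hi
      · rw [Nat.succ_eq_add_one, kap_kap_self]
      · rw [kap_kap, kap_eps_of_ne (by omega), (h1 i hi).2, map_zero, neg_zero, map_zero, neg_zero]
    · rw [euler_kap, euler_eps, g2, map_smul, map_smul]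
    · have : grade 𝕂 m (n + 1) (kap 𝕂 m (n + 1) (eps 𝕂 m (n + 1) f)) =
          (s : 𝕂) • kap 𝕂 m (n + 1) (eps 𝕂 m (n + 1) f) := by
        rw [grade_kap hn hmem, grade_eps hn hmem, h3]; simp only [map_add, map_smul]; module
      rw [← this, grade_succ, kap_kap_self, map_zero, sub_zero]
    · rw [extD_kap_of_lt (by omega), extD_eps_of_lt, g4]; simp
    · rw [coD_kap_of_lt, coD_eps_of_lt (by omega), g5]; simp
  · refine neg_mem ⟨fun i hi => ⟨?_, ?_⟩, ?_, ?_, ?_, ?_⟩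
    · rcases (Nat.succ_le_of_lt hi).eq_or_lt with rfl | hi
      · rw [pD_kap, Nat.succ_eq_add_one, hD, map_zero]
      · rw [pD_kap, (h1 i hi).1, map_zero]
    · rcases (Nat.succ_le_of_lt hi).eq_or_lt with rfl | hi
      · rw [Nat.succ_eq_add_one, kap_kap_self]
      · rw [kap_kap, (h1 i hi).2, map_zero, neg_zero]
    · rw [euler_kap, g2, map_smul]
    · have : grade 𝕂 m (n + 1) (kap 𝕂 m (n + 1) f) =
          ((s - 1 : ℤ) : 𝕂) • kap 𝕂 m (n + 1) f := by
        rw [grade_kap hn hmem, h3, map_smul]; push_cast; module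
      rw [← this, grade_succ, kap_kap_self, map_zero, sub_zero]
    · rw [extD_kap_of_lt (by omega), g4]; simp
    · rw [coD_kap_of_lt, g5]; simp
  · rw [ve_mul_of_kap hb, kap_eps_self (by omega) hn, map_neg]; abel

/-! ### Homogenized Gegenbauer polynomials -/

theorem poch_succ (a : 𝕂) (n : ℕ) : poch 𝕂 a (n + 1) = poch 𝕂 a n * (a + n) :=
  ascPochhammer_succ_eval n a

theorem poch_succ_left (a : 𝕂) (n : ℕ) : poch 𝕂 a (n + 1) = a * poch 𝕂 (a + 1) n := by
  simp [poch, ascPochhammer_succ_left, Polynomial.eval_comp]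

theorem poch_zero (a : 𝕂) : poch 𝕂 a 0 = 1 := by simp [poch]

/-- The coefficients of the Gegenbauer polynomials. -/
def gegCoeff (a : 𝕂) (n i : ℕ) : 𝕂 :=
  if 2 * i ≤ n then (-1) ^ i * poch 𝕂 a (n - i) / (i.factorial * (n - 2 * i).factorial) else 0

/-- The derivative of the homogenised polynomial C^a_{n+2} with respect to |x|² is −a C^{a+1}_n;
this is that identity for the coefficients. -/
theorem gegCoeff_succ_succ (a : 𝕂) (n i : ℕ) :
    (i + 1) * gegCoeff a (n + 2) (i + 1) = -a * gegCoeff (a + 1) n i := by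
  unfold gegCoeff
  by_cases h : 2 * i ≤ n
  · rw [if_pos h, if_pos (by omega), show n + 2 - (i + 1) = n - i + 1 by omega,
      show n + 2 - 2 * (i + 1) = n - 2 * i by omega, poch_succ_left, Nat.factorial_succ]
    have h1 : (i.factorial : 𝕂) ≠ 0 := Nat.cast_ne_zero.2 i.factorial_ne_zero
    have h2 : ((n - 2 * i).factorial : 𝕂) ≠ 0 := Nat.cast_ne_zero.2 (Nat.factorial_ne_zero _)
    have h3 : (i : 𝕂) + 1 ≠ 0 := Nat.cast_add_one_ne_zero i
    push_cast
    field_simp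
    ring
  · rw [if_neg h, if_neg (by omega), mul_zero, mul_zero]

/-- Coefficient form of the rule that the derivative along the last axis maps C^a_{n+1} to (n + 2a)
C^a_n. The first term comes from the power of 2x_r, the second from the power of |x|². -/
theorem gegCoeff_appell (a : 𝕂) (n i : ℕ) :
    2 * ((n + 1 - 2 * i : ℕ) : 𝕂) * gegCoeff a (n + 1) i + (i + 1) * gegCoeff a (n + 1) (i + 1) =
      (n + 2 * a) * gegCoeff a n i := by
  unfold gegCoeff
  by_cases h : 2 * i ≤ n
  · have h1 : (i.factorial : 𝕂) ≠ 0 := Nat.cast_ne_zero.2 i.factorial_ne_zero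
    have h3 : (i : 𝕂) + 1 ≠ 0 := Nat.cast_add_one_ne_zero i
    rw [if_pos h, if_pos (by omega)]
    obtain ⟨l, rfl⟩ := Nat.exists_eq_add_of_le h
    rw [show 2 * i + l + 1 - i = i + l + 1 by omega, show 2 * i + l + 1 - 2 * i = l + 1 by omega,
      show 2 * i + l - i = i + l by omega, show 2 * i + l - 2 * i = l by omega]
    -- For n = 2i the coefficient with index i + 1 lies beyond the range of the Gegenbauer sum and
    -- is zero.
    rcases l with - | l
    · rw [if_neg (by omega)]
      simp only [add_zero, poch_succ, Nat.factorial_zero, Nat.factorial_succ]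
      push_cast
      field_simp
      ring
    · rw [if_pos (by omega), show 2 * i + (l + 1) + 1 - (i + 1) = i + l + 1 by omega,
        show 2 * i + (l + 1) + 1 - 2 * (i + 1) = l by omega]
      have h2 : (l.factorial : 𝕂) ≠ 0 := Nat.cast_ne_zero.2 l.factorial_ne_zero
      have h4 : (l : 𝕂) + 1 ≠ 0 := Nat.cast_add_one_ne_zero l
      have h5 : (l : 𝕂) + 1 + 1 ≠ 0 := by exact_mod_cast Nat.cast_add_one_ne_zero (R := 𝕂) (l + 1)
      rw [show i + (l + 1) + 1 = i + l + 1 + 1 by ring, poch_succ a (i + l + 1),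
        show i + (l + 1) = i + l + 1 by ring, Nat.factorial_succ (l + 1), Nat.factorial_succ l,
        Nat.factorial_succ i]
      push_cast
      field_simp
      ring
  · rw [if_neg h, if_neg (show ¬ 2 * (i + 1) ≤ n + 1 by omega), mul_zero, mul_zero, add_zero]
    by_cases h' : 2 * i ≤ n + 1
    · rw [show n + 1 - 2 * i = 0 by omega]; simp
    · simp [h']

section

variable (𝕂 m)

/-- `|x|²` on `ℝ^r`. -/
def normSq (r : ℕ) : MvPolynomial (Fin m) 𝕂 := ∑ l ∈ Finset.Icc 1 r, coord 𝕂 m l ^ 2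

end

/-- Since `gegCoeff` is zero beyond the range, the sum may be taken over any longer range. Sums of
different degree can then be compared termwise. -/
theorem homGegenbauer_eq (r : ℕ) (a : 𝕂) (n N : ℕ) (hN : n / 2 < N) :
    homGegenbauer 𝕂 m r a n = ∑ i ∈ Finset.range N,
      MvPolynomial.C (gegCoeff a n i) * (2 * coord 𝕂 m r) ^ (n - 2 * i) * normSq 𝕂 m r ^ i := by
  rw [homGegenbauer, ← Finset.sum_subset (Finset.range_subset_range.2 (Nat.succ_le_of_lt hN))]
  · refine Finset.sum_congr rfl fun i hi => ?_
    rw [Finset.mem_range] at hi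
    rw [gegCoeff, if_pos (by omega)]; rfl
  · intro i _ hi
    rw [Finset.mem_range] at hi
    rw [gegCoeff, if_neg (by omega)]; simp

/-- A derivation applied to a homogenized Gegenbauer polynomial. -/
theorem derivation_homGegenbauer (D : Derivation 𝕂 (MvPolynomial (Fin m) 𝕂) (MvPolynomial (Fin m) 𝕂))
    (r : ℕ) (a : 𝕂) (n : ℕ) :
    D (homGegenbauer 𝕂 m r a n) =
      2 * D (coord 𝕂 m r) * (∑ i ∈ Finset.range (n + 1),
        MvPolynomial.C (((n - 2 * i : ℕ) : 𝕂) * gegCoeff a n i) *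
          (2 * coord 𝕂 m r) ^ (n - 2 * i - 1) * normSq 𝕂 m r ^ i) +
      D (normSq 𝕂 m r) * (∑ i ∈ Finset.range n,
        MvPolynomial.C ((i + 1) * gegCoeff a n (i + 1)) *
          (2 * coord 𝕂 m r) ^ (n - 2 * (i + 1)) * normSq 𝕂 m r ^ i) := by
  have h2 : D 2 = 0 := by
    have := D.map_natCast 2
    simpa using this
  have key : ∀ i : ℕ, D (MvPolynomial.C (gegCoeff a n i) * (2 * coord 𝕂 m r) ^ (n - 2 * i) *
      normSq 𝕂 m r ^ i) = 2 * D (coord 𝕂 m r) * (MvPolynomial.C (((n - 2 * i : ℕ) : 𝕂) * gegCoeff a n i) *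
          (2 * coord 𝕂 m r) ^ (n - 2 * i - 1) * normSq 𝕂 m r ^ i) +
        D (normSq 𝕂 m r) * (MvPolynomial.C (i * gegCoeff a n i) *
          (2 * coord 𝕂 m r) ^ (n - 2 * i) * normSq 𝕂 m r ^ (i - 1)) := by
    intro i
    simp only [Derivation.leibniz, Derivation.leibniz_pow, MvPolynomial.derivation_C, h2, smul_eq_mul,
      map_mul, map_natCast, nsmul_eq_mul]
    ring
  rw [homGegenbauer_eq r a n (n + 1) (by omega), map_sum, Finset.sum_congr rfl fun i _ => key i,
    Finset.sum_add_distrib, ← Finset.mul_sum, ← Finset.mul_sum]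
  congr 2
  -- The term i = 0 does not contain |x|² and drops out of the second sum; the others are shifted by
  -- one.
  rw [Finset.sum_range_succ']
  simp

/-- Only the dependence on |x|² contributes. This covers the derivatives along the axes other than
the last one. -/
theorem derivation_homGegenbauer_of_coord {D : Derivation 𝕂 (MvPolynomial (Fin m) 𝕂) (MvPolynomial (Fin m) 𝕂)}
    {r : ℕ} (a : 𝕂) (n : ℕ) (hD : D (coord 𝕂 m r) = 0) :
    D (homGegenbauer 𝕂 m r a (n + 2)) =
      -MvPolynomial.C a * D (normSq 𝕂 m r) * homGegenbauer 𝕂 m r (a + 1) n := by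
  rw [derivation_homGegenbauer, hD, homGegenbauer_eq r (a + 1) n (n + 2) (by omega)]
  simp only [mul_zero, zero_mul, zero_add, Finset.mul_sum, Finset.sum_const_zero]
  refine Finset.sum_congr rfl fun i _ => ?_
  rw [gegCoeff_succ_succ, show n + 2 - 2 * (i + 1) = n - 2 * i by omega]
  simp only [map_mul, map_neg]
  ring

theorem derivation_homGegenbauer_small {D : Derivation 𝕂 (MvPolynomial (Fin m) 𝕂) (MvPolynomial (Fin m) 𝕂)}
    {r : ℕ} (a : 𝕂) {n : ℕ} (hn : n < 2) (hD : D (coord 𝕂 m r) = 0) :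
    D (homGegenbauer 𝕂 m r a n) = 0 := by
  rw [derivation_homGegenbauer, hD, mul_zero, zero_mul, zero_add]
  refine mul_eq_zero_of_right _ (Finset.sum_eq_zero fun i _ => ?_)
  rw [gegCoeff, if_neg (by omega)]; simp

theorem derivation_homGegenbauer_appell {D : Derivation 𝕂 (MvPolynomial (Fin m) 𝕂) (MvPolynomial (Fin m) 𝕂)}
    {r : ℕ} (a : 𝕂) (n : ℕ) (hD : D (coord 𝕂 m r) = 1)
    (hD' : D (normSq 𝕂 m r) = 2 * coord 𝕂 m r) :
    D (homGegenbauer 𝕂 m r a (n + 1)) = MvPolynomial.C (n + 2 * a) * homGegenbauer 𝕂 m r a n := by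
  rw [derivation_homGegenbauer, hD, hD', homGegenbauer_eq r a n (n + 1) (by omega),
    Finset.sum_range_succ _ (n + 1)]
  rw [show n + 1 - 2 * (n + 1) = 0 by omega]
  simp only [Nat.cast_zero, zero_mul, map_zero, add_zero, Finset.mul_sum, ← Finset.sum_add_distrib]
  refine Finset.sum_congr rfl fun i _ => ?_
  -- The factor 2x_r raises the exponent by one. Where the subtraction in the exponent is truncated,
  -- the coefficient is zero.
  have : (2 * coord 𝕂 m r) * (MvPolynomial.C ((i + 1) * gegCoeff a (n + 1) (i + 1)) *
      (2 * coord 𝕂 m r) ^ (n + 1 - 2 * (i + 1)) * normSq 𝕂 m r ^ i) =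
      MvPolynomial.C ((i + 1) * gegCoeff a (n + 1) (i + 1)) *
      (2 * coord 𝕂 m r) ^ (n - 2 * i) * normSq 𝕂 m r ^ i := by
    by_cases h : 2 * (i + 1) ≤ n + 1
    · rw [show n - 2 * i = n + 1 - 2 * (i + 1) + 1 by omega]; ring
    · rw [gegCoeff, if_neg h]; simp
  rw [this, show n + 1 - 2 * i - 1 = n - 2 * i by omega, ← mul_assoc (MvPolynomial.C _),
    ← mul_assoc (MvPolynomial.C _), ← map_mul, ← gegCoeff_appell]
  simp only [map_mul, map_add, map_ofNat]
  ring

theorem derivation_homGegenbauer_euler {D : Derivation 𝕂 (MvPolynomial (Fin m) 𝕂) (MvPolynomial (Fin m) 𝕂)}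
    {r : ℕ} (a : 𝕂) (n : ℕ) (hD : D (coord 𝕂 m r) = coord 𝕂 m r)
    (hD' : D (normSq 𝕂 m r) = 2 * normSq 𝕂 m r) :
    D (homGegenbauer 𝕂 m r a n) = MvPolynomial.C (n : 𝕂) * homGegenbauer 𝕂 m r a n := by
  have h2 : D 2 = 0 := by
    have := D.map_natCast 2
    simpa using this
  rw [homGegenbauer_eq r a n (n / 2 + 1) (by omega), map_sum, Finset.mul_sum]
  refine Finset.sum_congr rfl fun i hi => ?_
  rw [Finset.mem_range] at hi
  obtain ⟨l, hl⟩ := Nat.exists_eq_add_of_le (show 2 * i ≤ n by omega)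
  have e1 : n - 2 * i = l := by omega
  have hp : ∀ (f : MvPolynomial (Fin m) 𝕂) (c : 𝕂) (q : ℕ), D f = MvPolynomial.C c * f →
      D (f ^ q) = MvPolynomial.C (q * c) * f ^ q := by
    intro f c q h
    rcases q with - | q
    · simp
    · rw [Derivation.leibniz_pow, h]
      simp only [Nat.add_sub_cancel, nsmul_eq_mul, smul_eq_mul, map_mul, map_natCast]; ring
  rw [e1, Derivation.leibniz, Derivation.leibniz, MvPolynomial.derivation_C,
    hp (2 * coord 𝕂 m r) 1 l (by rw [Derivation.leibniz, h2, hD]; simp),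
    hp (normSq 𝕂 m r) 2 i (by rw [hD', map_ofNat]), hl]
  simp only [smul_eq_mul, map_mul, map_natCast, mul_zero, map_one, map_ofNat]
  push_cast
  ring

theorem homGegenbauer_zero (r : ℕ) (a : 𝕂) : homGegenbauer 𝕂 m r a 0 = 1 := by
  simp [homGegenbauer, poch_zero]

/-! ### The scalar factors -/

variable (𝕂 m) in
/-- Scalar polynomials as Clifford valued polynomials. -/
def ofS : MvPolynomial (Fin m) 𝕂 →ₐ[𝕂] CPol 𝕂 m := ofScalar 𝕂 m

theorem ofS_mul_comm (p : MvPolynomial (Fin m) 𝕂) (f : CPol 𝕂 m) : ofS 𝕂 m p * f = f * ofS 𝕂 m p :=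
  ofScalar_mul_comm p f

theorem inv_ofS (p : MvPolynomial (Fin m) 𝕂) : inv 𝕂 m (ofS 𝕂 m p) = ofS 𝕂 m p := invo_ofScalar p

theorem ofS_coord (i : ℕ) : ofS 𝕂 m (coord 𝕂 m i) = vx 𝕂 m i := rfl

variable (𝕂 m) in
/-- The partial derivative of scalar polynomials, counted from `i = 1`. -/
def pdC (i : ℕ) : Derivation 𝕂 (MvPolynomial (Fin m) 𝕂) (MvPolynomial (Fin m) 𝕂) :=
  if h : 1 ≤ i ∧ i ≤ m then MvPolynomial.pderiv ⟨i - 1, by omega⟩ else 0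

theorem pD_ofS (i : ℕ) (p : MvPolynomial (Fin m) 𝕂) :
    pD 𝕂 m i (ofS 𝕂 m p) = ofS 𝕂 m (pdC 𝕂 m i p) := by
  by_cases h : 1 ≤ i ∧ i ≤ m
  · obtain ⟨i, rfl⟩ := exists_fin h
    rw [pdC, dif_pos h]
    exact partialD_apply_tmul i p 1
  · rw [pdC, dif_neg h, pD_of_not_mem h]; simp

theorem pdC_coord (i j : ℕ) : pdC 𝕂 m i (coord 𝕂 m j) = MvPolynomial.C (kron 𝕂 m i j) := by
  by_cases h : 1 ≤ i ∧ i ≤ m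
  · by_cases h' : 1 ≤ j ∧ j ≤ m
    · rw [pdC, dif_pos h, coord, dif_pos h', MvPolynomial.pderiv_X]
      by_cases hij : i = j
      · subst hij
        simp [kron_self h.1 h.2]
      · rw [kron_of_ne hij, map_zero, Pi.single_apply, if_neg]
        simp only [Fin.mk.injEq]; omega
    · rw [coord, dif_neg h', map_zero, kron, if_neg (by rintro ⟨rfl, _⟩; exact h' h), map_zero]
  · rw [pdC, dif_neg h, kron, if_neg (by tauto)]; simp

theorem pdC_normSq (i r : ℕ) (hr : r ≤ m) :
    pdC 𝕂 m i (normSq 𝕂 m r) = if i ∈ Finset.Icc 1 r then 2 * coord 𝕂 m i else 0 := by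
  have : ∀ l ∈ Finset.Icc 1 r, pdC 𝕂 m i (coord 𝕂 m l ^ 2) =
      kron 𝕂 m i l • (2 * coord 𝕂 m l) := fun l _ => by
    rw [Derivation.leibniz_pow, pdC_coord, MvPolynomial.smul_eq_C_mul]
    simp only [nsmul_eq_mul, smul_eq_mul, pow_one, Nat.cast_ofNat]; ring
  rw [normSq, map_sum, Finset.sum_congr rfl this]
  split_ifs with h
  · exact sum_kron_smul hr h _
  · refine Finset.sum_eq_zero fun l hl => ?_
    rw [kron_of_ne (by rintro rfl; exact h hl), zero_smul]

variable (𝕂 m) in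
/-- The factors `F^{(n)}_{r,j}`. -/
def cF (r : ℕ) (n : ℤ) (j : ℕ) : CPol 𝕂 m := F 𝕂 m r n j

theorem cF_of_neg (r : ℕ) {n : ℤ} (h : n < 0) (j : ℕ) : cF 𝕂 m r n j = 0 := if_pos h

theorem cF_natCast (r n j : ℕ) : cF 𝕂 m r n j =
    (poch 𝕂 ((j : 𝕂) + 1) n / poch 𝕂 ((r : 𝕂) - 2 + 2 * j) n) •
      ofS 𝕂 m (homGegenbauer 𝕂 m r ((r : 𝕂) / 2 + j - 1) n) := by
  rw [cF, F, if_neg (by omega)]; rfl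

theorem cF_zero (r j : ℕ) : cF 𝕂 m r 0 j = 1 := by
  have := cF_natCast (𝕂 := 𝕂) (m := m) r 0 j
  rw [Nat.cast_zero] at this
  rw [this, homGegenbauer_zero, map_one, poch_zero, poch_zero, div_one, one_smul]

theorem cF_eq_ofS (r : ℕ) (n : ℤ) (j : ℕ) : ∃ p, cF 𝕂 m r n j = ofS 𝕂 m p := by
  rcases lt_or_ge n 0 with h | h
  · exact ⟨0, by rw [cF_of_neg r h, map_zero]⟩
  · lift n to ℕ using h
    exact ⟨_, by rw [cF_natCast, ← map_smul]⟩

theorem cF_mul_comm (r : ℕ) (n : ℤ) (j : ℕ) (f : CPol 𝕂 m) :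
    cF 𝕂 m r n j * f = f * cF 𝕂 m r n j := by
  obtain ⟨p, hp⟩ := cF_eq_ofS (𝕂 := 𝕂) (m := m) r n j
  rw [hp, ofS_mul_comm]

theorem inv_cF (r : ℕ) (n : ℤ) (j : ℕ) : inv 𝕂 m (cF 𝕂 m r n j) = cF 𝕂 m r n j := by
  obtain ⟨p, hp⟩ := cF_eq_ofS (𝕂 := 𝕂) (m := m) r n j
  rw [hp, inv_ofS]

theorem poch_natCast_ne_zero {N : ℕ} (hN : 1 ≤ N) (n : ℕ) : poch 𝕂 (N : 𝕂) n ≠ 0 := by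
  induction n with
  | zero => rw [poch_zero]; exact one_ne_zero
  | succ n ih =>
    rw [poch_succ]
    refine mul_ne_zero ih ?_
    exact_mod_cast (by omega : N + n ≠ 0)

/-- The factor produced by differentiating the Gegenbauer polynomial is the last factor of the
Pochhammer symbol in the denominator; the last factor of the numerator remains. The denominators are
nonzero because r − 2 + 2j ≥ 1. -/
theorem pD_cF {r : ℕ} (h3 : 3 ≤ r) (hr : r ≤ m) (n : ℤ) (j : ℕ) :
    pD 𝕂 m r (cF 𝕂 m r n j) = ((n : 𝕂) + j) • cF 𝕂 m r (n - 1) j := by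
  rcases lt_trichotomy n 0 with h | rfl | h
  · rw [cF_of_neg r h, cF_of_neg r (by omega), map_zero, smul_zero]
  · rw [cF_zero, cF_of_neg r (by omega), pD_one, smul_zero]
  · obtain ⟨n, rfl⟩ : ∃ l : ℕ, n = (l + 1 : ℕ) := ⟨(n - 1).toNat, by omega⟩
    have hmem : r ∈ Finset.Icc 1 r := by simp; omega
    rw [cF_natCast, show ((n + 1 : ℕ) : ℤ) - 1 = n by omega, cF_natCast, map_smul, pD_ofS,
      derivation_homGegenbauer_appell _ _ (by rw [pdC_coord, kron_self (by omega) hr, map_one])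
        (by rw [pdC_normSq _ _ hr, if_pos hmem]), MvPolynomial.C_mul', map_smul, smul_smul, smul_smul]
    congr 1
    obtain ⟨q, rfl⟩ := Nat.exists_eq_add_of_le h3
    have e1 : ((3 + q : ℕ) : 𝕂) - 2 + 2 * j = ((1 + q + 2 * j : ℕ) : 𝕂) := by push_cast; ring
    have h1 := poch_natCast_ne_zero (𝕂 := 𝕂) (N := 1 + q + 2 * j) (by omega) n
    have h2 : ((1 + q + 2 * j : ℕ) : 𝕂) + n ≠ 0 := by exact_mod_cast (by omega)
    have e6 : 2 * (((3 + q : ℕ) : 𝕂) / 2 + j - 1) = ((1 + q + 2 * j : ℕ) : 𝕂) := by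
      push_cast; ring
    rw [e1, e6, poch_succ, poch_succ]
    generalize ((1 + q + 2 * j : ℕ) : 𝕂) = A at *
    generalize poch 𝕂 A n = B at *
    push_cast
    field_simp
    ring

/-- The quotient `(j + 1) / (r + 2 j - 1)`. -/
def cc (𝕂 : Type) [RCLike 𝕂] (r j : ℕ) : 𝕂 := ((j : 𝕂) + 1) / ((r : 𝕂) + 2 * j - 1)

/-- A derivative along another axis lowers the degree by two and raises the Gegenbauer parameter by
one, which is the passage from j to j + 1. The constant is what is left of the two normalisations.
-/
theorem pD_cF_of_ne {r : ℕ} (h3 : 3 ≤ r) (hr : r ≤ m) {i : ℕ} (hi : i ∈ Finset.Icc 1 r) (hir : i ≠ r)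
    (n : ℤ) (j : ℕ) :
    pD 𝕂 m i (cF 𝕂 m r n j) =
      -(cc 𝕂 r j * ((j : 𝕂) + n)) • (vx 𝕂 m i * cF 𝕂 m r (n - 2) (j + 1)) := by
  have hD : pdC 𝕂 m i (coord 𝕂 m r) = 0 := by rw [pdC_coord, kron_of_ne hir, map_zero]
  rcases lt_or_ge n 2 with h | h
  · rw [cF_of_neg r (n := n - 2) (by omega), mul_zero, smul_zero]
    rcases lt_or_ge n 0 with h' | h'
    · rw [cF_of_neg r h', map_zero]
    · lift n to ℕ using h'
      rw [cF_natCast, map_smul, pD_ofS, derivation_homGegenbauer_small _ (by omega) hD, map_zero,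
        smul_zero]
  · obtain ⟨n, rfl⟩ : ∃ l : ℕ, n = (l + 2 : ℕ) := ⟨(n - 2).toNat, by omega⟩
    rw [cF_natCast, show ((n + 2 : ℕ) : ℤ) - 2 = n by omega, cF_natCast, map_smul, pD_ofS,
      derivation_homGegenbauer_of_coord _ _ hD, pdC_normSq _ _ hr, if_pos hi,
      show (r : 𝕂) / 2 + (j + 1 : ℕ) - 1 = (r : 𝕂) / 2 + j - 1 + 1 by push_cast; ring,
      show ∀ (a : 𝕂) (y p : MvPolynomial (Fin m) 𝕂), -MvPolynomial.C a * (2 * y) * p =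
        (-(2 * a)) • (y * p) by
          intro a y p
          rw [MvPolynomial.smul_eq_C_mul, map_neg, map_mul, map_ofNat]; ring,
      map_smul, map_mul, ofS_coord, mul_smul_comm, smul_smul, smul_smul]
    congr 1
    obtain ⟨q, rfl⟩ := Nat.exists_eq_add_of_le h3
    have e1 : ((3 + q : ℕ) : 𝕂) - 2 + 2 * j = ((1 + q + 2 * j : ℕ) : 𝕂) := by push_cast; ring
    have e2 : ((3 + q : ℕ) : 𝕂) - 2 + 2 * (j + 1 : ℕ) = ((1 + q + 2 * j + 2 : ℕ) : 𝕂) := by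
      push_cast; ring
    have e3 : ((1 + q + 2 * j : ℕ) : 𝕂) + 1 + 1 = ((1 + q + 2 * j + 2 : ℕ) : 𝕂) := by
      push_cast; ring
    have h1 := poch_natCast_ne_zero (𝕂 := 𝕂) (N := 1 + q + 2 * j + 2) (by omega) n
    have h2 : ((1 + q + 2 * j : ℕ) : 𝕂) ≠ 0 := by exact_mod_cast (by omega)
    have h4 : ((1 + q + 2 * j : ℕ) : 𝕂) + 1 ≠ 0 := Nat.cast_add_one_ne_zero _
    have e5 : ((3 + q : ℕ) : 𝕂) + 2 * j - 1 = ((1 + q + 2 * j : ℕ) : 𝕂) + 1 := by push_cast; ring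
    have e6 : 2 * (((3 + q : ℕ) : 𝕂) / 2 + j - 1) = ((1 + q + 2 * j : ℕ) : 𝕂) := by
      push_cast; ring
    rw [cc, e1, e2, e5, e6, poch_succ_left _ (n + 1), poch_succ_left _ (n + 1), poch_succ _ n,
      poch_succ_left _ n, e3, Nat.cast_succ j]
    generalize poch 𝕂 ((1 + q + 2 * j + 2 : ℕ) : 𝕂) n = B at *
    generalize ((1 + q + 2 * j : ℕ) : 𝕂) = A at *
    push_cast
    field_simp
    ring

theorem pD_cF_of_lt {r : ℕ} (hr : r ≤ m) {i : ℕ} (hi : r < i) (n : ℤ) (j : ℕ) :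
    pD 𝕂 m i (cF 𝕂 m r n j) = 0 := by
  rcases lt_or_ge n 0 with h' | h'
  · rw [cF_of_neg r h', map_zero]
  · lift n to ℕ using h'
    rw [cF_natCast, map_smul, pD_ofS, derivation_homGegenbauer, pdC_coord, pdC_normSq _ _ hr,
      kron_of_ne (by omega), if_neg (by rw [Finset.mem_Icc]; omega)]
    simp

theorem euler_cF {r : ℕ} (h1 : 1 ≤ r) (hr : r ≤ m) (n : ℤ) (j : ℕ) :
    euler 𝕂 m r (cF 𝕂 m r n j) = (n : 𝕂) • cF 𝕂 m r n j := by
  rcases lt_or_ge n 0 with h' | h'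
  · rw [cF_of_neg r h', map_zero, smul_zero]
  · lift n to ℕ using h'
    set D : Derivation 𝕂 (MvPolynomial (Fin m) 𝕂) (MvPolynomial (Fin m) 𝕂) :=
      ∑ i ∈ Finset.Icc 1 r, coord 𝕂 m i • pdC 𝕂 m i with hD
    have hDa : ∀ p, D p = ∑ i ∈ Finset.Icc 1 r, coord 𝕂 m i * pdC 𝕂 m i p := by
      intro p
      rw [hD, ← Derivation.coeFnAddMonoidHom_apply, map_sum, Finset.sum_apply]
      rfl
    have hE : ∀ p, euler 𝕂 m r (ofS 𝕂 m p) = ofS 𝕂 m (D p) := by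
      intro p
      rw [euler_apply, hDa, map_sum]
      refine Finset.sum_congr rfl fun i _ => ?_
      rw [pD_ofS, map_mul, ofS_coord, mulX_apply]
    rw [cF_natCast, map_smul, hE, derivation_homGegenbauer_euler, MvPolynomial.C_mul', map_smul,
      smul_comm, Int.cast_natCast]
    · rw [hDa, Finset.sum_eq_single r]
      · rw [pdC_coord, kron_self h1 hr, map_one, mul_one]
      · intro i _ hi
        rw [pdC_coord, kron_of_ne hi, map_zero, mul_zero]
      · intro h; simp at h; omega
    · rw [hDa, normSq, Finset.mul_sum]
      refine Finset.sum_congr rfl fun i hi => ?_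
      have := pdC_normSq (𝕂 := 𝕂) i r hr
      rw [if_pos hi, normSq] at this
      rw [this]; ring

/-! ### The vector variable -/

variable (𝕂 m) in
/-- The vector variable `x₁ e₁ + ⋯ + x_n e_n`. -/
def xv (n : ℕ) : CPol 𝕂 m := ∑ i ∈ Finset.Icc 1 n, vx 𝕂 m i * ve 𝕂 m i

theorem cWedge_xv (n : ℕ) (f : CPol 𝕂 m) : cWedge 𝕂 m (xv 𝕂 m n) f = xWedge 𝕂 m n f := by
  rw [xWedge_apply, cWedge, xv, Finset.sum_mul, Finset.mul_sum, ← Finset.sum_add_distrib,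
    Finset.smul_sum]
  refine Finset.sum_congr rfl fun i _ => ?_
  rw [mulX_apply, eps_apply, mul_smul_comm, mul_add, ← mul_assoc (inv 𝕂 m f), ← vx_mul_comm]
  simp only [mul_assoc]

theorem cDot_xv (n : ℕ) (f : CPol 𝕂 m) : cDot 𝕂 m (xv 𝕂 m n) f = xDot 𝕂 m n f := by
  rw [xDot_apply, cDot, xv, Finset.sum_mul, Finset.mul_sum, ← Finset.sum_sub_distrib,
    Finset.smul_sum]
  refine Finset.sum_congr rfl fun i _ => ?_
  rw [mulX_apply, kap_apply, mul_smul_comm, mul_sub, ← mul_assoc (inv 𝕂 m f), ← vx_mul_comm]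
  simp only [mul_assoc]

theorem xv_mul (n : ℕ) (f : CPol 𝕂 m) : xv 𝕂 m n * f = xWedge 𝕂 m n f + xDot 𝕂 m n f := by
  rw [← cWedge_xv, ← cDot_xv, cWedge, cDot]; module

theorem xv_mul_ve {n i : ℕ} (h : n < i) : xv 𝕂 m n * ve 𝕂 m i = -(ve 𝕂 m i * xv 𝕂 m n) := by
  rw [xv, Finset.sum_mul, Finset.mul_sum, ← Finset.sum_neg_distrib]
  refine Finset.sum_congr rfl fun l hl => ?_
  rw [Finset.mem_Icc] at hl
  rw [mul_assoc, ve_mul_ve (by omega), ← mul_assoc (ve 𝕂 m i), ← vx_mul_comm, mul_neg, mul_assoc]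

theorem xWedge_xWedge (n : ℕ) (f : CPol 𝕂 m) : xWedge 𝕂 m n (xWedge 𝕂 m n f) = 0 := by
  refine eq_zero_of_eq_neg (𝕂 := 𝕂) ?_
  simp only [xWedge_apply, map_sum, ← Finset.sum_neg_distrib]
  rw [Finset.sum_comm]
  refine Finset.sum_congr rfl fun i _ => Finset.sum_congr rfl fun j _ => ?_
  rw [← mulX_eps, ← mulX_eps, eps_eps, map_neg, map_neg]
  congr 1
  exact LinearMap.congr_fun (commute_mulX_mulX (𝕂 := 𝕂) (m := m) i j).eq _

theorem xDot_xDot (n : ℕ) (f : CPol 𝕂 m) : xDot 𝕂 m n (xDot 𝕂 m n f) = 0 := by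
  refine eq_zero_of_eq_neg (𝕂 := 𝕂) ?_
  simp only [xDot_apply, map_sum, ← Finset.sum_neg_distrib]
  rw [Finset.sum_comm]
  refine Finset.sum_congr rfl fun i _ => Finset.sum_congr rfl fun j _ => ?_
  rw [← mulX_kap, ← mulX_kap, kap_kap, map_neg, map_neg]
  congr 1
  exact LinearMap.congr_fun (commute_mulX_mulX (𝕂 := 𝕂) (m := m) i j).eq _

variable (𝕂 m) in
/-- `x₁² + ⋯ + x_n²`. -/
def rho (n : ℕ) : CPol 𝕂 m := ∑ i ∈ Finset.Icc 1 n, vx 𝕂 m i * vx 𝕂 m i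

theorem xv_mul_xv {n : ℕ} (hn : n ≤ m) : xv 𝕂 m n * xv 𝕂 m n = -rho 𝕂 m n := by
  have h1 : ∀ i j, vx 𝕂 m i * ve 𝕂 m i * (vx 𝕂 m j * ve 𝕂 m j) =
      vx 𝕂 m i * vx 𝕂 m j * (ve 𝕂 m i * ve 𝕂 m j) := fun i j => by
    rw [mul_assoc, ← mul_assoc (ve 𝕂 m i), ← vx_mul_comm]; simp only [mul_assoc]
  have h2 : (2 : 𝕂) • (xv 𝕂 m n * xv 𝕂 m n) = (2 : 𝕂) • -rho 𝕂 m n := by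
    rw [two_smul, xv, Finset.sum_mul_sum]
    nth_rw 2 [Finset.sum_comm]
    rw [← Finset.sum_add_distrib, rho, smul_neg, ← neg_smul, Finset.smul_sum]
    refine Finset.sum_congr rfl fun i hi => ?_
    rw [← Finset.sum_add_distrib, ← sum_kron_smul (𝕂 := 𝕂) hn hi
      (fun j => (-2 : 𝕂) • (vx 𝕂 m i * vx 𝕂 m j))]
    refine Finset.sum_congr rfl fun j _ => ?_
    rw [h1, h1, vx_mul_comm j, ← mul_add, ve_mul_ve_add, mul_smul_comm, mul_one, smul_smul, mul_comm]
  have := congrArg (fun f => (1 / 2 : 𝕂) • f) h2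
  simpa only [smul_smul, one_div, inv_mul_cancel₀ (two_ne_zero' 𝕂), one_smul] using this

theorem pD_rho {n : ℕ} (hn : n ≤ m) (i : ℕ) :
    pD 𝕂 m i (rho 𝕂 m n) = if i ∈ Finset.Icc 1 n then (2 : 𝕂) • vx 𝕂 m i else 0 := by
  have : rho 𝕂 m n = ofS 𝕂 m (normSq 𝕂 m n) := by
    simp only [rho, normSq, map_sum, pow_two, map_mul, ofS_coord]
  rw [this, pD_ofS, pdC_normSq _ _ hn]
  split_ifs
  · rw [map_mul, ofS_coord, map_ofNat, two_smul, two_mul]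
  · rw [map_zero]

theorem vx_rho_comm (n : ℕ) (f : CPol 𝕂 m) : rho 𝕂 m n * f = f * rho 𝕂 m n := by
  rw [rho, Finset.sum_mul, Finset.mul_sum]
  refine Finset.sum_congr rfl fun i _ => ?_
  rw [mul_assoc, vx_mul_comm i f, ← mul_assoc, vx_mul_comm i f, mul_assoc]

/-! ### Polynomials on `ℝ^r` with values in the Clifford algebra of `ℝ^r` -/

/-- A Clifford element contains no e_i iff it commutes with e_i up to the main involution. In this
form the condition is visibly stable under products. -/
theorem kap_eq_zero_iff {i : ℕ} {f : CPol 𝕂 m} :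
    kap 𝕂 m i f = 0 ↔ ve 𝕂 m i * f = inv 𝕂 m f * ve 𝕂 m i := by
  rw [kap_apply, smul_eq_zero, sub_eq_zero]
  exact ⟨fun h => h.resolve_left (by norm_num), Or.inr⟩

variable (𝕂 m) in
/-- The polynomials on `ℝ^r` with values in the Clifford algebra of `ℝ^r`. -/
def polSub (r : ℕ) : Subalgebra 𝕂 (CPol 𝕂 m) where
  carrier := {f | ∀ i, r < i → pD 𝕂 m i f = 0 ∧ kap 𝕂 m i f = 0}
  mul_mem' := by
    intro f g hf hg i hi
    refine ⟨?_, ?_⟩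
    · rw [pD_mul, (hf i hi).1, (hg i hi).1, zero_mul, mul_zero, add_zero]
    · rw [kap_eq_zero_iff, ← mul_assoc, kap_eq_zero_iff.1 (hf i hi).2, mul_assoc,
        kap_eq_zero_iff.1 (hg i hi).2, map_mul, mul_assoc]
  add_mem' := by
    intro f g hf hg i hi
    rw [map_add, map_add, (hf i hi).1, (hg i hi).1, (hf i hi).2, (hg i hi).2]
    simp
  algebraMap_mem' := by
    intro c i _
    refine ⟨?_, ?_⟩
    · rw [Algebra.algebraMap_eq_smul_one, map_smul, pD_one, smul_zero]
    · rw [kap_eq_zero_iff, AlgHom.commutes, Algebra.commutes]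

theorem polSub_mono {r r' : ℕ} (h : r ≤ r') : polSub 𝕂 m r ≤ polSub 𝕂 m r' :=
  fun _ hf i hi => hf i (lt_of_le_of_lt h hi)

theorem Hr_le_polSub {r : ℕ} {t : ℤ} {k : ℕ} {f : CPol 𝕂 m} (h : f ∈ Hr 𝕂 m r t k) :
    f ∈ polSub 𝕂 m r := h.1

theorem kap_ofS (i : ℕ) (p : MvPolynomial (Fin m) 𝕂) : kap 𝕂 m i (ofS 𝕂 m p) = 0 := by
  rw [kap_eq_zero_iff, inv_ofS, ofS_mul_comm]

theorem vx_mem_polSub {r i : ℕ} (h : i ≤ r) : vx 𝕂 m i ∈ polSub 𝕂 m r := by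
  intro l hl
  refine ⟨?_, kap_ofS _ _⟩
  rw [pD_vx, if_neg (by omega)]

theorem ve_mem_polSub {r i : ℕ} (h : i ≤ r) : ve 𝕂 m i ∈ polSub 𝕂 m r := by
  intro l hl
  refine ⟨pD_ve _ _, ?_⟩
  rw [kap_eq_zero_iff, inv_ve, neg_mul, ve_mul_ve (by omega)]

theorem xv_mem_polSub {r n : ℕ} (h : n ≤ r) : xv 𝕂 m n ∈ polSub 𝕂 m r :=
  Subalgebra.sum_mem _ fun i hi => by
    rw [Finset.mem_Icc] at hi
    exact Subalgebra.mul_mem _ (vx_mem_polSub (by omega)) (ve_mem_polSub (by omega))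

theorem cF_mem_polSub {r : ℕ} (hr : r ≤ m) (n : ℤ) (j : ℕ) : cF 𝕂 m r n j ∈ polSub 𝕂 m r := by
  intro i hi
  refine ⟨pD_cF_of_lt hr hi n j, ?_⟩
  obtain ⟨p, hp⟩ := cF_eq_ofS (𝕂 := 𝕂) (m := m) r n j
  rw [hp, kap_ofS]

theorem inv_mem_polSub {r : ℕ} {f : CPol 𝕂 m} (h : f ∈ polSub 𝕂 m r) :
    inv 𝕂 m f ∈ polSub 𝕂 m r := by
  intro i hi
  refine ⟨by rw [pD_inv, (h i hi).1, map_zero], ?_⟩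
  have := congrArg (inv 𝕂 m) (kap_eq_zero_iff.1 (h i hi).2)
  rw [map_mul, map_mul, inv_ve, neg_mul, mul_neg, neg_inj] at this
  rw [kap_eq_zero_iff, this]

theorem xWedge_mem_polSub {r n : ℕ} (h : n ≤ r) {f : CPol 𝕂 m} (hf : f ∈ polSub 𝕂 m r) :
    xWedge 𝕂 m n f ∈ polSub 𝕂 m r := by
  rw [← cWedge_xv, cWedge]
  exact Subalgebra.smul_mem _ (Subalgebra.add_mem _
    (Subalgebra.mul_mem _ (xv_mem_polSub h) hf)
    (Subalgebra.mul_mem _ (inv_mem_polSub hf) (xv_mem_polSub h))) _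

theorem xDot_mem_polSub {r n : ℕ} (h : n ≤ r) {f : CPol 𝕂 m} (hf : f ∈ polSub 𝕂 m r) :
    xDot 𝕂 m n f ∈ polSub 𝕂 m r := by
  rw [← cDot_xv, cDot]
  exact Subalgebra.smul_mem _ (Subalgebra.sub_mem _
    (Subalgebra.mul_mem _ (xv_mem_polSub h) hf)
    (Subalgebra.mul_mem _ (inv_mem_polSub hf) (xv_mem_polSub h))) _

/-! ### The Dirac operator -/

variable (𝕂 m) in
/-- The Dirac operator on `ℝ^r`. -/
def dirc (r : ℕ) : Module.End 𝕂 (CPol 𝕂 m) := extD 𝕂 m r + coD 𝕂 m r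

theorem dirc_apply (r : ℕ) (f : CPol 𝕂 m) :
    dirc 𝕂 m r f = ∑ i ∈ Finset.Icc 1 r, ve 𝕂 m i * pD 𝕂 m i f := by
  rw [dirc, LinearMap.add_apply, extD_apply, coD_apply, ← Finset.sum_add_distrib]
  exact Finset.sum_congr rfl fun i _ => (ve_mul_eq _ _).symm

theorem dirc_succ (n : ℕ) (f : CPol 𝕂 m) :
    dirc 𝕂 m (n + 1) f = dirc 𝕂 m n f + ve 𝕂 m (n + 1) * pD 𝕂 m (n + 1) f := by
  rw [dirc_apply, dirc_apply, Finset.sum_Icc_succ_top (by omega)]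

theorem dirc_of_mem {r : ℕ} {t : ℤ} {k : ℕ} {f : CPol 𝕂 m} (h : f ∈ Hr 𝕂 m r t k) :
    dirc 𝕂 m r f = 0 := by
  rw [dirc, LinearMap.add_apply, h.2.2.2.1, h.2.2.2.2, add_zero]

theorem dirc_ve_mul {n : ℕ} {f : CPol 𝕂 m} (h : dirc 𝕂 m n f = 0) :
    dirc 𝕂 m n (ve 𝕂 m (n + 1) * f) = 0 := by
  have : dirc 𝕂 m n (ve 𝕂 m (n + 1) * f) = -(ve 𝕂 m (n + 1) * dirc 𝕂 m n f) := by
    rw [dirc_apply, dirc_apply, Finset.mul_sum, ← Finset.sum_neg_distrib]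
    refine Finset.sum_congr rfl fun i hi => ?_
    rw [Finset.mem_Icc] at hi
    rw [pD_mul, pD_ve, zero_mul, zero_add, ← mul_assoc, ve_mul_ve (by omega), neg_mul, mul_assoc]
  rw [this, h, mul_zero, neg_zero]

/-- The four anticommutators add up to ∂x + x∂ = −(n + 2E), where E is the Euler operator. -/
theorem dirc_xv_mul {n : ℕ} (hn : n ≤ m) {c : 𝕂} {f : CPol 𝕂 m} (h : dirc 𝕂 m n f = 0)
    (hE : euler 𝕂 m n f = c • f) : dirc 𝕂 m n (xv 𝕂 m n * f) = -(n + 2 * c) • f := by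
  have h1 := LinearMap.congr_fun (coD_xWedge (𝕂 := 𝕂) hn) f
  have h2 := LinearMap.congr_fun (extD_xDot (𝕂 := 𝕂) hn) f
  have h3 := LinearMap.congr_fun (extD_xWedge (𝕂 := 𝕂) hn) f
  have h4 := LinearMap.congr_fun (coD_xDot (𝕂 := 𝕂) hn) f
  simp only [LinearMap.add_apply, Module.End.mul_apply, LinearMap.neg_apply, LinearMap.sub_apply,
    LinearMap.smul_apply, Module.End.one_apply, hE, LinearMap.zero_apply] at h1 h2 h3 h4
  rw [dirc, LinearMap.add_apply] at h
  have h5 := congrArg (xWedge 𝕂 m n) h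
  have h6 := congrArg (xDot 𝕂 m n) h
  rw [map_add, map_zero] at h5 h6
  rw [xv_mul, dirc, LinearMap.add_apply, map_add, map_add]
  linear_combination (norm := module) h1 + h2 + h3 + h4 - h5 - h6

/-- A solution of the Dirac equation of pure grade solves the Hodge-de Rham system. -/
theorem extD_coD_of_dirc {r : ℕ} (hr : r ≤ m) {t : 𝕂} {f : CPol 𝕂 m}
    (hg : grade 𝕂 m r f = t • f) (h : dirc 𝕂 m r f = 0) :
    extD 𝕂 m r f = 0 ∧ coD 𝕂 m r f = 0 := by
  have h1 : grade 𝕂 m r (extD 𝕂 m r f) = (t + 1) • extD 𝕂 m r f := by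
    rw [extD_apply, map_sum, Finset.smul_sum]
    refine Finset.sum_congr rfl fun i hi => ?_
    rw [grade_eps hr hi, grade_pD, hg, map_smul, map_smul]; module
  have h2 : grade 𝕂 m r (coD 𝕂 m r f) = (t - 1) • coD 𝕂 m r f := by
    rw [coD_apply, map_sum, Finset.smul_sum]
    refine Finset.sum_congr rfl fun i hi => ?_
    rw [grade_kap hr hi, grade_pD, hg, map_smul, map_smul]; module
  rw [dirc, LinearMap.add_apply] at h
  -- The two summands have grades differing by two, so the equation and its image under the grade
  -- operator determine each of them.
  have h3 := congrArg (grade 𝕂 m r) h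
  rw [map_add, h1, h2, map_zero] at h3
  have h4 : extD 𝕂 m r f = 0 := by
    linear_combination (norm := module) (1 / 2 : 𝕂) • h3 - ((t - 1) / 2) • h
  exact ⟨h4, by rwa [h4, zero_add] at h⟩

/-! ### The embedding factors of spherical monogenics -/

theorem rho_succ_euler {n : ℕ} (hn : n + 1 ≤ m) :
    euler 𝕂 m (n + 1) (rho 𝕂 m n) = (2 : 𝕂) • rho 𝕂 m n := by
  rw [euler_succ, pD_rho (by omega), if_neg (by simp), map_zero, add_zero, euler_apply, rho,
    Finset.smul_sum]
  refine Finset.sum_congr rfl fun i hi => ?_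
  rw [← rho, pD_rho (by omega), if_pos hi, map_smul, mulX_apply]

theorem cc_succ {n : ℕ} (hn : 1 ≤ n) (j : ℕ) : ((n : 𝕂) + 2 * j) * cc 𝕂 (n + 1) j = j + 1 := by
  have h : (n : 𝕂) + 2 * j ≠ 0 := by exact_mod_cast (by omega : n + 2 * j ≠ 0)
  rw [cc, show ((n + 1 : ℕ) : 𝕂) + 2 * j - 1 = n + 2 * j by push_cast; ring, mul_div_cancel₀ _ h]

/-- A contiguity relation between the scalar factors. -/
theorem cF_contiguous {n : ℕ} (hn : 2 ≤ n) (hm : n + 1 ≤ m) (q : ℤ) (j : ℕ) :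
    ((j : 𝕂) + 1) • cF 𝕂 m (n + 1) q (j + 1) -
      (cc 𝕂 (n + 1) j * cc 𝕂 (n + 1) (j + 1) * (j + q + 1)) •
        (rho 𝕂 m n * cF 𝕂 m (n + 1) (q - 2) (j + 2)) =
    ((j : 𝕂) + q + 1) • cF 𝕂 m (n + 1) q j := by
  rcases lt_or_ge q 0 with h | h
  · simp [cF_of_neg _ h, cF_of_neg (n + 1) (show q - 2 < 0 by omega)]
  lift q to ℕ using h
  -- A homogeneous polynomial of positive degree is zero if its gradient is zero. The derivative
  -- along the last axis of the relation is the relation for q − 1, and the other derivatives lead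
  -- to the one for q − 2 and j + 1.
  induction q using Nat.strong_induction_on generalizing j with
  | _ q ih =>
  have ih' : ∀ (p : ℤ) (j : ℕ), p < q → ((j : 𝕂) + 1) • cF 𝕂 m (n + 1) p (j + 1) -
      (cc 𝕂 (n + 1) j * cc 𝕂 (n + 1) (j + 1) * (j + p + 1)) •
        (rho 𝕂 m n * cF 𝕂 m (n + 1) (p - 2) (j + 2)) =
      ((j : 𝕂) + p + 1) • cF 𝕂 m (n + 1) p j := by
    intro p j hp
    rcases lt_or_ge p 0 with h | h
    · simp [cF_of_neg _ h, cF_of_neg (n + 1) (show p - 2 < 0 by omega)]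
    · lift p to ℕ using h
      exact ih p (by omega) j
  rcases Nat.eq_zero_or_pos q with rfl | hq
  · simp [cF_zero, cF_of_neg (n + 1) (show (-2 : ℤ) < 0 by omega)]
  rw [← sub_eq_zero]
  set u := ((j : 𝕂) + 1) • cF 𝕂 m (n + 1) q (j + 1) -
      (cc 𝕂 (n + 1) j * cc 𝕂 (n + 1) (j + 1) * (j + (q : ℤ) + 1)) •
        (rho 𝕂 m n * cF 𝕂 m (n + 1) (q - 2) (j + 2)) - ((j : 𝕂) + (q : ℤ) + 1) • cF 𝕂 m (n + 1) q j
    with hu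
  have hE : euler 𝕂 m (n + 1) u = (q : 𝕂) • u := by
    rw [hu]
    simp only [map_sub, map_smul, euler_cF (by omega : 1 ≤ n + 1) hm, euler_mul, rho_succ_euler hm,
      smul_mul_assoc, mul_smul_comm]
    push_cast
    module
  have hD : ∀ i ∈ Finset.Icc 1 (n + 1), pD 𝕂 m i u = 0 := by
    intro i hi
    by_cases hin : i = n + 1
    · subst hin
      have := ih' (q - 1) j (by omega)
      rw [hu]
      simp only [map_sub, map_smul, pD_mul, pD_cF (by omega : 3 ≤ n + 1) hm, pD_rho (by omega : n ≤ m)]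
      rw [if_neg (by simp), zero_mul, zero_add, mul_smul_comm]
      rw [show (q : ℤ) - 1 - 2 = q - 2 - 1 by ring] at this
      push_cast at this ⊢
      linear_combination (norm := module) ((j : 𝕂) + q + 1) • this
    · have hin' : i ∈ Finset.Icc 1 n := by rw [Finset.mem_Icc] at hi ⊢; omega
      have := congrArg (vx 𝕂 m i * ·) (ih' (q - 2) (j + 1) (by omega))
      simp only [mul_sub, mul_smul_comm, ← mul_assoc] at this
      rw [hu]
      simp only [map_sub, map_smul, pD_mul, pD_cF_of_ne (by omega : 3 ≤ n + 1) hm hi hin,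
        pD_rho (by omega : n ≤ m)]
      rw [if_pos hin', mul_smul_comm, ← mul_assoc (rho 𝕂 m n), vx_rho_comm n (vx 𝕂 m i),
        smul_mul_assoc]
      have e1 := cc_succ (𝕂 := 𝕂) (n := n) (by omega) j
      have e2 := cc_succ (𝕂 := 𝕂) (n := n) (by omega) (j + 1)
      -- The two contributions to the derivative, from the scalar factors and from x₁² + ⋯ + x_n²,
      -- match because of this identity between consecutive constants.
      have e3 : ((j : 𝕂) + 2) * cc 𝕂 (n + 1) j - (j + 1) * cc 𝕂 (n + 1) (j + 1) -
          2 * cc 𝕂 (n + 1) j * cc 𝕂 (n + 1) (j + 1) = 0 := by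
        push_cast at e2
        linear_combination -cc 𝕂 (n + 1) j * e2 + cc 𝕂 (n + 1) (j + 1) * e1
      have e4 := congrArg (· • (vx 𝕂 m i * cF 𝕂 m (n + 1) (q - 2) (j + 2))) e3
      rw [show j + 1 + 2 = j + 2 + 1 by ring, show j + 1 + 1 = j + 2 by ring] at this
      push_cast at this ⊢
      linear_combination (norm := module) (-(((j : 𝕂) + q + 1) * cc 𝕂 (n + 1) j)) • this +
        ((j : 𝕂) + q + 1) • e4
  have hz : euler 𝕂 m (n + 1) u = 0 := by
    rw [euler_apply]
    exact Finset.sum_eq_zero fun i hi => by rw [hD i hi, map_zero]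
  rw [hz] at hE
  exact (smul_eq_zero.1 hE.symm).resolve_left (Nat.cast_ne_zero.2 hq.ne')

variable (𝕂 m) in
/-- The embedding factors of spherical monogenics on `ℝ^{n+1}`. -/
def XM (n : ℕ) (p : ℤ) (j : ℕ) : CPol 𝕂 m := XMon 𝕂 m (n + 1) p j

theorem XM_eq (n : ℕ) (p : ℤ) (j : ℕ) : XM 𝕂 m n p j = cF 𝕂 m (n + 1) p j +
    cc 𝕂 (n + 1) j • (cF 𝕂 m (n + 1) (p - 1) (j + 1) * (xv 𝕂 m n * ve 𝕂 m (n + 1))) := by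
  rcases lt_or_ge p 0 with h | h
  · rw [cF_of_neg _ h, cF_of_neg _ (by omega), zero_mul, smul_zero, add_zero]
    exact if_pos h
  · rw [← mul_assoc]
    exact if_neg (by omega)

theorem XM_of_neg (n : ℕ) {p : ℤ} (h : p < 0) (j : ℕ) : XM 𝕂 m n p j = 0 := if_pos h

theorem XM_zero (n j : ℕ) : XM 𝕂 m n 0 j = 1 := by
  rw [XM_eq, cF_zero, cF_of_neg _ (by omega), zero_mul, smul_zero, add_zero]

theorem pD_xv {n i : ℕ} (h : n < i) : pD 𝕂 m i (xv 𝕂 m n) = 0 :=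
  ((xv_mem_polSub le_rfl) i h).1

theorem pD_XM {n : ℕ} (hn : 2 ≤ n) (hm : n + 1 ≤ m) (p : ℤ) (j : ℕ) :
    pD 𝕂 m (n + 1) (XM 𝕂 m n p j) = ((p : 𝕂) + j) • XM 𝕂 m n (p - 1) j := by
  rw [XM_eq, XM_eq]
  simp only [map_add, map_smul, pD_mul, pD_ve, pD_xv (Nat.lt_succ_self n), pD_cF (by omega : 3 ≤ n + 1) hm,
    zero_mul, mul_zero, add_zero, smul_mul_assoc]
  push_cast
  module

theorem euler_xv {n r : ℕ} (hnr : n ≤ r) (hr : r ≤ m) : euler 𝕂 m r (xv 𝕂 m n) = xv 𝕂 m n := by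
  have hve : ∀ i, euler 𝕂 m r (ve 𝕂 m i) = 0 := fun i => by
    rw [euler_apply]; exact Finset.sum_eq_zero fun l _ => by rw [pD_ve, map_zero]
  rw [xv, map_sum]
  refine Finset.sum_congr rfl fun i hi => ?_
  rw [euler_mul, hve, mul_zero, add_zero]
  congr 1
  rw [Finset.mem_Icc] at hi
  have : ∀ l ∈ Finset.Icc 1 r, mulX 𝕂 m l (pD 𝕂 m l (vx 𝕂 m i)) = kron 𝕂 m i l • vx 𝕂 m l := by
    intro l hl
    rw [Finset.mem_Icc] at hl
    rw [pD_vx]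
    by_cases h : l = i
    · subst h
      rw [if_pos ⟨rfl, by omega, by omega⟩, kron_self (by omega) (by omega), one_smul, mulX_apply,
        mul_one]
    · rw [if_neg (by tauto), kron_of_ne (Ne.symm h), zero_smul, map_zero]
  rw [euler_apply, Finset.sum_congr rfl this]
  exact sum_kron_smul hr (by rw [Finset.mem_Icc]; omega) _

theorem euler_ve (r i : ℕ) : euler 𝕂 m r (ve 𝕂 m i) = 0 := by
  rw [euler_apply]; exact Finset.sum_eq_zero fun l _ => by rw [pD_ve, map_zero]

theorem euler_XM {n : ℕ} (hm : n + 1 ≤ m) (p : ℤ) (j : ℕ) :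
    euler 𝕂 m (n + 1) (XM 𝕂 m n p j) = (p : 𝕂) • XM 𝕂 m n p j := by
  rw [XM_eq]
  simp only [map_add, map_smul, euler_mul, euler_ve, euler_xv (Nat.le_succ n) hm,
    euler_cF (by omega : 1 ≤ n + 1) hm, mul_zero, add_zero, smul_mul_assoc]
  push_cast
  module

theorem XM_mem_polSub {n : ℕ} (hm : n + 1 ≤ m) (p : ℤ) (j : ℕ) :
    XM 𝕂 m n p j ∈ polSub 𝕂 m (n + 1) := by
  rw [XM_eq]
  exact Subalgebra.add_mem _ (cF_mem_polSub hm _ _) (Subalgebra.smul_mem _ (Subalgebra.mul_mem _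
    (cF_mem_polSub hm _ _) (Subalgebra.mul_mem _ (xv_mem_polSub (by omega)) (ve_mem_polSub le_rfl))) _)

theorem dirc_cF_mul {n : ℕ} (hn : 2 ≤ n) (hm : n + 1 ≤ m) (p : ℤ) (j : ℕ) (h : CPol 𝕂 m) :
    dirc 𝕂 m n (cF 𝕂 m (n + 1) p j * h) =
      -(cc 𝕂 (n + 1) j * (j + p)) • (cF 𝕂 m (n + 1) (p - 2) (j + 1) * (xv 𝕂 m n * h)) +
        cF 𝕂 m (n + 1) p j * dirc 𝕂 m n h := by
  rw [dirc_apply, dirc_apply, xv, Finset.sum_mul, Finset.mul_sum, Finset.mul_sum, Finset.smul_sum,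
    ← Finset.sum_add_distrib]
  refine Finset.sum_congr rfl fun i hi => ?_
  rw [Finset.mem_Icc] at hi
  rw [pD_mul, pD_cF_of_ne (by omega) hm (by rw [Finset.mem_Icc]; omega) (by omega), mul_add,
    ← mul_assoc _ (cF 𝕂 m (n + 1) p j), ← cF_mul_comm _ _ _ (ve 𝕂 m i),
    mul_assoc (cF 𝕂 m (n + 1) p j)]
  congr 1
  have key : ve 𝕂 m i * (vx 𝕂 m i * cF 𝕂 m (n + 1) (p - 2) (j + 1) * h) =
      cF 𝕂 m (n + 1) (p - 2) (j + 1) * (vx 𝕂 m i * ve 𝕂 m i * h) := by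
    rw [vx_mul_comm i (cF 𝕂 m _ _ _), mul_assoc, ← mul_assoc (ve 𝕂 m i), ← cF_mul_comm, mul_assoc,
      ← mul_assoc (ve 𝕂 m i), vx_mul_comm]
  rw [smul_mul_assoc, mul_smul_comm, key]

/-- Multiplication by the embedding factor maps solutions of the Dirac equation on `ℝ^n` to
solutions on `ℝ^{n+1}`. -/
theorem dirc_XM_mul {n : ℕ} (hn : 2 ≤ n) (hm : n + 1 ≤ m) (p : ℤ) (j : ℕ) {h : CPol 𝕂 m}
    (h1 : dirc 𝕂 m n h = 0) (h2 : euler 𝕂 m n h = (j : 𝕂) • h) (h3 : pD 𝕂 m (n + 1) h = 0) :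
    dirc 𝕂 m (n + 1) (XM 𝕂 m n p j * h) = 0 := by
  have g1 := dirc_ve_mul h1
  have g2 : euler 𝕂 m n (ve 𝕂 m (n + 1) * h) = (j : 𝕂) • (ve 𝕂 m (n + 1) * h) := by
    rw [euler_mul, euler_ve, zero_mul, zero_add, h2, mul_smul_comm]
  have g3 := dirc_xv_mul (by omega) g1 g2
  have hee : ve 𝕂 m (n + 1) * ve 𝕂 m (n + 1) = -1 := ve_mul_self ⟨by omega, hm⟩
  have hxe : ve 𝕂 m (n + 1) * (xv 𝕂 m n * (ve 𝕂 m (n + 1) * h)) = xv 𝕂 m n * h := by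
    rw [← mul_assoc, ← neg_eq_iff_eq_neg.2 (xv_mul_ve (Nat.lt_succ_self n)), neg_mul, mul_assoc,
      ← mul_assoc (ve 𝕂 m _), hee, neg_mul, one_mul, mul_neg, neg_neg]
  have hxx : xv 𝕂 m n * (xv 𝕂 m n * (ve 𝕂 m (n + 1) * h)) =
      -(rho 𝕂 m n * (ve 𝕂 m (n + 1) * h)) := by
    rw [← mul_assoc, xv_mul_xv (by omega), neg_mul]
  -- The terms containing x h cancel in pairs. Those containing e_{n+1} h cancel by the contiguity
  -- relation of degree p − 1.
  have hc := congrArg (· * (ve 𝕂 m (n + 1) * h)) (cF_contiguous (𝕂 := 𝕂) hn hm (p - 1) j)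
  have e1 := cc_succ (𝕂 := 𝕂) (n := n) (by omega) j
  have e2 := congrArg (· • (cF 𝕂 m (n + 1) (p - 1) (j + 1) * (ve 𝕂 m (n + 1) * h))) e1
  have hsw : cF 𝕂 m (n + 1) (p - 1 - 2) (j + 2) * (rho 𝕂 m n * (ve 𝕂 m (n + 1) * h)) =
      rho 𝕂 m n * (cF 𝕂 m (n + 1) (p - 1 - 2) (j + 2) * (ve 𝕂 m (n + 1) * h)) := by
    rw [← mul_assoc, cF_mul_comm, mul_assoc]
  simp only [sub_mul, smul_mul_assoc] at hc
  rw [mul_assoc (rho 𝕂 m n)] at hc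
  rw [dirc_succ, pD_mul, pD_XM hn hm, h3, mul_zero, add_zero, XM_eq, XM_eq]
  simp only [add_mul, smul_mul_assoc, mul_assoc, map_add, map_smul, dirc_cF_mul hn hm, h1, mul_zero,
    add_zero, g3, mul_add, mul_smul_comm, hxx]
  rw [← mul_assoc (ve 𝕂 m (n + 1)), ← cF_mul_comm, ← mul_assoc (ve 𝕂 m (n + 1)), ← cF_mul_comm,
    mul_assoc, mul_assoc, hxe]
  rw [mul_neg, show j + 1 + 1 = j + 2 from rfl, hsw, show p - 2 = p - 1 - 1 by ring]
  push_cast at hc ⊢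
  linear_combination (norm := module) -hc - e2

/-! ### The embedding factors as linear maps -/

theorem xWedge_ve_mul {n i : ℕ} (h : n < i) (f : CPol 𝕂 m) :
    xWedge 𝕂 m n (ve 𝕂 m i * f) = -(ve 𝕂 m i * xWedge 𝕂 m n f) := by
  rw [xWedge_apply, xWedge_apply, Finset.mul_sum, ← Finset.sum_neg_distrib]
  refine Finset.sum_congr rfl fun l hl => ?_
  rw [Finset.mem_Icc] at hl
  rw [ve_mul_eq, map_add, eps_eps, ve_mul_eq, map_add, map_neg,
    eq_neg_iff_add_eq_zero.2 (show eps 𝕂 m l (kap 𝕂 m i f) + kap 𝕂 m i (eps 𝕂 m l f) = 0 by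
      rw [kap_eps_of_ne (by omega)]; abel), map_neg, mulX_eps l i, mulX_kap l i]
  abel

theorem xDot_ve_mul {n i : ℕ} (h : n < i) (f : CPol 𝕂 m) :
    xDot 𝕂 m n (ve 𝕂 m i * f) = -(ve 𝕂 m i * xDot 𝕂 m n f) := by
  rw [xDot_apply, xDot_apply, Finset.mul_sum, ← Finset.sum_neg_distrib]
  refine Finset.sum_congr rfl fun l hl => ?_
  rw [Finset.mem_Icc] at hl
  rw [ve_mul_eq, map_add, kap_eps_of_ne (by omega), kap_kap, ve_mul_eq, map_add, map_neg, map_neg,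
    mulX_eps l i, mulX_kap l i]
  abel

variable (𝕂 m) in
/-- The combination of `x ∧` and `x •` that preserves solutions of the Dirac equation. -/
def zMap (t : ℤ) (n j : ℕ) : Module.End 𝕂 (CPol 𝕂 m) :=
  xWedge 𝕂 m n + beta 𝕂 t (n + 1) j • xDot 𝕂 m n

theorem zMap_apply (t : ℤ) (n j : ℕ) (f : CPol 𝕂 m) :
    zMap 𝕂 m t n j f = xWedge 𝕂 m n f + beta 𝕂 t (n + 1) j • xDot 𝕂 m n f := rfl

variable (𝕂 m) in
/-- The embedding factor as a linear map. -/
def embL (s t : ℤ) (n k j : ℕ) : Module.End 𝕂 (CPol 𝕂 m) :=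
  LinearMap.mulLeft 𝕂 (XM 𝕂 m n ((k : ℤ) - j) j * ve 𝕂 m (n + 1) ^ (s - t).toNat) +
    alpha 𝕂 t (n + 1) j • (LinearMap.mulLeft 𝕂 (XM 𝕂 m n ((k : ℤ) - 1 - j) (j + 1)) *
      (beta 𝕂 t (n + 1) j ^ (t - s) • xWedge 𝕂 m n + beta 𝕂 t (n + 1) j ^ (t - s + 1) • xDot 𝕂 m n) *
        LinearMap.mulLeft 𝕂 (ve 𝕂 m (n + 1) ^ (s - t + 1).toNat))

theorem embL_apply (s t : ℤ) (n k j : ℕ) (f : CPol 𝕂 m) :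
    embL 𝕂 m s t n k j f = XM 𝕂 m n ((k : ℤ) - j) j * (ve 𝕂 m (n + 1) ^ (s - t).toNat * f) +
      alpha 𝕂 t (n + 1) j • (XM 𝕂 m n ((k : ℤ) - 1 - j) (j + 1) *
        (beta 𝕂 t (n + 1) j ^ (t - s) •
            xWedge 𝕂 m n (ve 𝕂 m (n + 1) ^ (s - t + 1).toNat * f) +
          beta 𝕂 t (n + 1) j ^ (t - s + 1) •
            xDot 𝕂 m n (ve 𝕂 m (n + 1) ^ (s - t + 1).toNat * f))) := by
  rw [← mul_assoc]; rfl

theorem embX_eq_embL (s t : ℤ) (n k j : ℕ) (f : CPol 𝕂 m) :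
    embX 𝕂 m s t (n + 1) k j f = embL 𝕂 m s t n k j f := by
  rw [embL_apply, ← cWedge_xv, ← cDot_xv]; rfl

/-- The vector e_{n+1} anticommutes with x∧ and x• on ℝ^n, so it can be pulled out and the bracket
becomes `zMap`. Monogenicity is read off from this form. -/
theorem embL_self (t : ℤ) (n k j : ℕ) (f : CPol 𝕂 m) :
    embL 𝕂 m t t n k j f = XM 𝕂 m n ((k : ℤ) - j) j * f -
      alpha 𝕂 t (n + 1) j • (XM 𝕂 m n ((k : ℤ) - 1 - j) (j + 1) *
        (ve 𝕂 m (n + 1) * zMap 𝕂 m t n j f)) := by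
  rw [embL_apply, zMap_apply]
  simp only [sub_self, zero_add, Int.toNat_zero, Int.toNat_one, pow_zero, one_mul, pow_one, zpow_zero,
    zpow_one, one_smul, xWedge_ve_mul (Nat.lt_succ_self n), xDot_ve_mul (Nat.lt_succ_self n),
    mul_add, mul_smul_comm, mul_neg, smul_neg]
  module

theorem beta_ne_zero {t : ℤ} {n : ℕ} (h0 : 0 ≤ t) (hn : t < n) (j : ℕ) (h : t ≠ 0 ∨ j ≠ 0) :
    beta 𝕂 t (n + 1) j ≠ 0 := by
  have h1 : ((j : ℤ) + n - t : ℤ) ≠ 0 := by omega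
  have h2 : ((j : ℤ) + t : ℤ) ≠ 0 := by omega
  have h1' : ((j : 𝕂) + n - t) ≠ 0 := by exact_mod_cast h1
  have h2' : ((j : 𝕂) + t) ≠ 0 := by exact_mod_cast h2
  rw [beta]
  push_cast
  refine div_ne_zero (neg_ne_zero.2 ?_) h2'
  intro h; apply h1'; linear_combination h

theorem alpha_of_extreme {t : ℤ} {n : ℕ} (j : ℕ) (h : t = 0 ∨ t = n) : alpha 𝕂 t (n + 1) j = 0 :=
  if_pos (by push_cast; rcases h with h | h <;> omega)

theorem alpha_of_ne {t : ℤ} {n : ℕ} (j : ℕ) (h : ¬ (t = 0 ∨ t = n)) :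
    alpha 𝕂 t (n + 1) j = -cc 𝕂 (n + 1) j := by
  rw [alpha, if_neg (by push_cast; omega), cc, neg_div]

/-- Here the bracket carries the powers −1 and 0 of β; extracting the inverse of β turns it into
`zMap`, and e_{n+1}² = −1 gives the sign. For extreme t the constant β may be zero, but then α = 0.
-/
theorem embL_succ {t : ℤ} {n : ℕ} (hm : n + 1 ≤ m) (h0 : 0 ≤ t) (hn : t ≤ n) (k j : ℕ)
    (f : CPol 𝕂 m) :
    embL 𝕂 m (t + 1) t n k j f = XM 𝕂 m n ((k : ℤ) - j) j * (ve 𝕂 m (n + 1) * f) -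
      (alpha 𝕂 t (n + 1) j * (beta 𝕂 t (n + 1) j)⁻¹) • (XM 𝕂 m n ((k : ℤ) - 1 - j) (j + 1) *
        zMap 𝕂 m t n j f) := by
  have hee : ve 𝕂 m (n + 1) ^ 2 = -1 := by rw [pow_two, ve_mul_self ⟨by omega, hm⟩]
  rw [embL_apply, zMap_apply, show t + 1 - t = 1 by ring, show t - (t + 1) = -1 by ring]
  norm_num
  by_cases h : t = 0 ∨ t = n
  · rw [alpha_of_extreme j h]; simp
  · have hb := beta_ne_zero (𝕂 := 𝕂) (j := j) h0 (by omega : t < n) (by omega)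
    rw [show Int.toNat 2 = 2 from rfl, hee]
    simp only [neg_mul, one_mul, map_neg, mul_add, mul_smul_comm, mul_neg, smul_neg, smul_add,
      smul_smul, mul_assoc, inv_mul_cancel₀ hb, mul_one]
    module

theorem Hr_euler_succ {n : ℕ} {t : ℤ} {j : ℕ} {f : CPol 𝕂 m} (hf : f ∈ Hr 𝕂 m n t j) :
    euler 𝕂 m (n + 1) f = (j : 𝕂) • f := (Hr_le_succ hf).2.1

theorem euler_xWedge {r : ℕ} (hr : r ≤ m) (f : CPol 𝕂 m) :
    euler 𝕂 m r (xWedge 𝕂 m r f) = xWedge 𝕂 m r (euler 𝕂 m r f) + xWedge 𝕂 m r f := by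
  have : ∀ i ∈ Finset.Icc 1 r, euler 𝕂 m r (mulX 𝕂 m i (eps 𝕂 m i f)) =
      mulX 𝕂 m i (eps 𝕂 m i (euler 𝕂 m r f)) + mulX 𝕂 m i (eps 𝕂 m i f) := by
    intro i hi
    rw [mulX_eps, euler_eps, mulX_eps, ← map_add]
    congr 1
    rw [euler_apply, euler_apply]
    simp only [pD_mulX, map_add, map_smul, Finset.sum_add_distrib]
    rw [map_sum, Finset.sum_congr rfl fun l (_ : l ∈ Finset.Icc 1 r) =>
      show kron 𝕂 m l i • mulX 𝕂 m l f = kron 𝕂 m i l • mulX 𝕂 m l f by rw [kron_comm],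
      sum_kron_smul hr hi fun l => mulX 𝕂 m l f]
    congr 1
    exact Finset.sum_congr rfl fun l _ => LinearMap.congr_fun (commute_mulX_mulX l i) _
  rw [xWedge_apply, xWedge_apply, map_sum, Finset.sum_congr rfl this, Finset.sum_add_distrib]

theorem euler_xDot {r : ℕ} (hr : r ≤ m) (f : CPol 𝕂 m) :
    euler 𝕂 m r (xDot 𝕂 m r f) = xDot 𝕂 m r (euler 𝕂 m r f) + xDot 𝕂 m r f := by
  have h1 := congrArg (euler 𝕂 m r) (xv_mul r f)
  rw [euler_mul, euler_xv le_rfl hr, xv_mul, xv_mul, map_add, euler_xWedge hr] at h1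
  linear_combination (norm := module) -h1

theorem zMap_euler {n : ℕ} (hn : n ≤ m) {t : ℤ} {j : ℕ} {f : CPol 𝕂 m} (hf : f ∈ Hr 𝕂 m n t j) :
    euler 𝕂 m n (zMap 𝕂 m t n j f) = ((j + 1 : ℕ) : 𝕂) • zMap 𝕂 m t n j f := by
  rw [zMap_apply, map_add, map_smul, euler_xWedge hn, euler_xDot hn, hf.2.1, map_smul, map_smul]
  push_cast
  module

theorem zMap_mem_polSub {n : ℕ} {t : ℤ} {j : ℕ} {f : CPol 𝕂 m} (hf : f ∈ Hr 𝕂 m n t j) :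
    zMap 𝕂 m t n j f ∈ polSub 𝕂 m n :=
  Subalgebra.add_mem _ (xWedge_mem_polSub le_rfl (Hr_le_polSub hf))
    (Subalgebra.smul_mem _ (xDot_mem_polSub le_rfl (Hr_le_polSub hf)) _)

/-- This determines β: the contribution d*(x∧f) = (t − n − j) f has to cancel β d(x•f) = −β(t + j)
f. -/
theorem dirc_zMap {n : ℕ} (hn : n ≤ m) {t : ℤ} {j : ℕ} {f : CPol 𝕂 m} (hf : f ∈ Hr 𝕂 m n t j)
    (ht : 0 < t) : dirc 𝕂 m n (zMap 𝕂 m t n j f) = 0 := by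
  have h2 : ((j : 𝕂) + t) ≠ 0 := by exact_mod_cast (by omega : ((j : ℤ) + t : ℤ) ≠ 0)
  have hb : beta 𝕂 t (n + 1) j * (t + j) = t - n - j := by
    rw [beta, add_comm (t : 𝕂), div_mul_cancel₀ _ h2]; push_cast; ring
  have hb' := congrArg (· • f) hb
  rw [dirc, LinearMap.add_apply, zMap_apply, map_add, map_add, map_smul, map_smul,
    coD_xWedge_of_mem hn hf, coD_xDot_of_mem hn hf, extD_xWedge_of_mem hn hf,
    extD_xDot_of_mem hn hf]
  linear_combination (norm := module) -hb'

theorem embL_diag_self (t : ℤ) (n j : ℕ) (f : CPol 𝕂 m) : embL 𝕂 m t t n j j f = f := by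
  rw [embL_self, sub_self, XM_zero, XM_of_neg _ (by omega), zero_mul, smul_zero, one_mul, sub_zero]

theorem embL_diag_succ {t : ℤ} {n : ℕ} (hm : n + 1 ≤ m) (h0 : 0 ≤ t) (hn : t ≤ n) (j : ℕ)
    (f : CPol 𝕂 m) : embL 𝕂 m (t + 1) t n j j f = ve 𝕂 m (n + 1) * f := by
  rw [embL_succ hm h0 hn, sub_self, XM_zero, XM_of_neg _ (by omega), zero_mul, smul_zero, one_mul,
    sub_zero]

/-- The Appell property. Both summands produce the same factor, since degree of the monogenic factor
plus its second index is k + 1 in each. -/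
theorem pD_embL {n : ℕ} (hn : 2 ≤ n) (hm : n + 1 ≤ m) (s t : ℤ) (k j : ℕ) {f : CPol 𝕂 m}
    (hf : f ∈ polSub 𝕂 m n) : pD 𝕂 m (n + 1) (embL 𝕂 m s t n (k + 1) j f) =
      ((k : 𝕂) + 1) • embL 𝕂 m s t n k j f := by
  have h1 : ∀ g ∈ polSub 𝕂 m n, ∀ d, pD 𝕂 m (n + 1) (ve 𝕂 m (n + 1) ^ d * g) = 0 := by
    intro g hg d
    induction d with
    | zero => rw [pow_zero, one_mul]; exact (hg _ (Nat.lt_succ_self n)).1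
    | succ d ih => rw [pow_succ', mul_assoc, pD_mul, ih, pD_ve, zero_mul, mul_zero, add_zero]
  have h2 : ∀ g : CPol 𝕂 m, pD 𝕂 m (n + 1) (xWedge 𝕂 m n g) = xWedge 𝕂 m n (pD 𝕂 m (n + 1) g) := by
    intro g
    rw [← cWedge_xv, ← cWedge_xv, cWedge, cWedge, map_smul, map_add, pD_mul, pD_mul,
      pD_xv (Nat.lt_succ_self n), zero_mul, mul_zero, pD_inv, zero_add, add_zero]
  have h3 : ∀ g : CPol 𝕂 m, pD 𝕂 m (n + 1) (xDot 𝕂 m n g) = xDot 𝕂 m n (pD 𝕂 m (n + 1) g) := by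
    intro g
    rw [← cDot_xv, ← cDot_xv, cDot, cDot, map_smul, map_sub, pD_mul, pD_mul,
      pD_xv (Nat.lt_succ_self n), zero_mul, mul_zero, pD_inv, zero_add, add_zero]
  rw [embL_apply, embL_apply]
  simp only [map_add, map_smul, pD_mul (n + 1) (XM 𝕂 m n _ _), pD_XM hn hm, h2, h3, h1 f hf,
    map_zero, smul_zero, mul_zero, add_zero, smul_mul_assoc]
  rw [show ((k + 1 : ℕ) : ℤ) - j - 1 = k - j by push_cast; ring,
    show ((k + 1 : ℕ) : ℤ) - 1 - j - 1 = k - 1 - j by push_cast; ring]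
  push_cast
  module

/-! ### The image of an embedding factor -/

theorem eps_cF_mul (i r : ℕ) (p : ℤ) (j : ℕ) (f : CPol 𝕂 m) :
    eps 𝕂 m i (cF 𝕂 m r p j * f) = cF 𝕂 m r p j * eps 𝕂 m i f := by
  rw [eps_apply, eps_apply, map_mul, inv_cF, ← mul_assoc, ← cF_mul_comm, mul_smul_comm, mul_add]
  simp only [mul_assoc]

theorem kap_cF_mul (i r : ℕ) (p : ℤ) (j : ℕ) (f : CPol 𝕂 m) :
    kap 𝕂 m i (cF 𝕂 m r p j * f) = cF 𝕂 m r p j * kap 𝕂 m i f := by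
  rw [kap_apply, kap_apply, map_mul, inv_cF, ← mul_assoc, ← cF_mul_comm, mul_smul_comm, mul_sub]
  simp only [mul_assoc]

theorem grade_cF_mul {l r : ℕ} {p : ℤ} {j : ℕ} {c : 𝕂} {f : CPol 𝕂 m}
    (h : grade 𝕂 m l f = c • f) :
    grade 𝕂 m l (cF 𝕂 m r p j * f) = c • (cF 𝕂 m r p j * f) := by
  rw [grade_apply] at h ⊢
  simp only [kap_cF_mul, eps_cF_mul]
  rw [← Finset.mul_sum, ← mul_neg, h, mul_smul_comm]

theorem grade_succ_of_polSub {n : ℕ} {f : CPol 𝕂 m} (hf : f ∈ polSub 𝕂 m n) :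
    grade 𝕂 m (n + 1) f = grade 𝕂 m n f := by
  rw [grade_succ, (hf _ (Nat.lt_succ_self n)).2, map_zero, sub_zero]

theorem grade_ve_mul {n : ℕ} (hm : n + 1 ≤ m) {c : 𝕂} {f : CPol 𝕂 m} (hf : f ∈ polSub 𝕂 m n)
    (h : grade 𝕂 m n f = c • f) :
    grade 𝕂 m (n + 1) (ve 𝕂 m (n + 1) * f) = (c + 1) • (ve 𝕂 m (n + 1) * f) := by
  rw [ve_mul_of_kap (hf _ (Nat.lt_succ_self n)).2,
    grade_eps hm (by rw [Finset.mem_Icc]; omega), grade_succ_of_polSub hf, h, map_smul, add_smul,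
    one_smul]

variable (𝕂 m) in
/-- The composition of `x` with the modified vector multiplication. -/
def qMap (t : ℤ) (n j : ℕ) : Module.End 𝕂 (CPol 𝕂 m) :=
  xDot 𝕂 m n * xWedge 𝕂 m n + beta 𝕂 t (n + 1) j • (xWedge 𝕂 m n * xDot 𝕂 m n)

theorem xv_mul_zMap (t : ℤ) (n j : ℕ) (f : CPol 𝕂 m) :
    xv 𝕂 m n * zMap 𝕂 m t n j f = qMap 𝕂 m t n j f := by
  rw [xv_mul, zMap_apply, map_add, map_add, xWedge_xWedge, map_smul, map_smul, xDot_xDot, smul_zero,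
    zero_add, add_zero, add_comm]
  rfl

theorem XM_mul {n : ℕ} (p : ℤ) (j : ℕ) (h : CPol 𝕂 m) :
    XM 𝕂 m n p j * h = cF 𝕂 m (n + 1) p j * h -
      cc 𝕂 (n + 1) j • (cF 𝕂 m (n + 1) (p - 1) (j + 1) * (ve 𝕂 m (n + 1) * (xv 𝕂 m n * h))) := by
  rw [XM_eq, xv_mul_ve (Nat.lt_succ_self n), add_mul, mul_neg, smul_neg, neg_mul, smul_mul_assoc,
    mul_assoc, mul_assoc, ← sub_eq_add_neg]

theorem XM_mul_ve_mul {n : ℕ} (hm : n + 1 ≤ m) (p : ℤ) (j : ℕ) (h : CPol 𝕂 m) :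
    XM 𝕂 m n p j * (ve 𝕂 m (n + 1) * h) = cF 𝕂 m (n + 1) p j * (ve 𝕂 m (n + 1) * h) -
      cc 𝕂 (n + 1) j • (cF 𝕂 m (n + 1) (p - 1) (j + 1) * (xv 𝕂 m n * h)) := by
  have hee : ve 𝕂 m (n + 1) * ve 𝕂 m (n + 1) = -1 := ve_mul_self ⟨by omega, hm⟩
  rw [XM_eq, add_mul, smul_mul_assoc, mul_assoc, mul_assoc, ← mul_assoc (ve 𝕂 m (n + 1)), hee,
    neg_mul, one_mul, mul_neg, mul_neg, smul_neg, ← sub_eq_add_neg]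

/-- With α = −`cc` the terms with e_{n+1}(x∧f), of grade t + 2, cancel between the two summands. The
three remaining terms all have grade t. -/
theorem embL_self_expand {n : ℕ} (hm : n + 1 ≤ m) {t : ℤ} (ht : ¬ (t = 0 ∨ t = n)) (k j : ℕ)
    (f : CPol 𝕂 m) : embL 𝕂 m t t n k j f = cF 𝕂 m (n + 1) ((k : ℤ) - j) j * f +
      (cc 𝕂 (n + 1) j * (beta 𝕂 t (n + 1) j - 1)) •
        (cF 𝕂 m (n + 1) ((k : ℤ) - 1 - j) (j + 1) * (ve 𝕂 m (n + 1) * xDot 𝕂 m n f)) -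
      (cc 𝕂 (n + 1) j * cc 𝕂 (n + 1) (j + 1)) •
        (cF 𝕂 m (n + 1) ((k : ℤ) - 1 - j - 1) (j + 2) * qMap 𝕂 m t n j f) := by
  rw [embL_self, XM_mul, XM_mul_ve_mul hm, xv_mul_zMap, alpha_of_ne j ht, zMap_apply, xv_mul,
    show (k : ℤ) - j - 1 = k - 1 - j by ring]
  simp only [mul_add, mul_smul_comm]
  module

/-- Here the terms with x•f, of grade t − 1, cancel, which uses that β is invertible. The remaining
terms have grade t + 1. -/
theorem embL_succ_expand {n : ℕ} (hm : n + 1 ≤ m) {t : ℤ} (h0 : 0 ≤ t) (hn : t ≤ n)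
    (ht : ¬ (t = 0 ∨ t = n)) (k j : ℕ) (f : CPol 𝕂 m) :
    embL 𝕂 m (t + 1) t n k j f = cF 𝕂 m (n + 1) ((k : ℤ) - j) j * (ve 𝕂 m (n + 1) * f) +
      (cc 𝕂 (n + 1) j * ((beta 𝕂 t (n + 1) j)⁻¹ - 1)) •
        (cF 𝕂 m (n + 1) ((k : ℤ) - 1 - j) (j + 1) * xWedge 𝕂 m n f) -
      (cc 𝕂 (n + 1) j * cc 𝕂 (n + 1) (j + 1) * (beta 𝕂 t (n + 1) j)⁻¹) •
        (cF 𝕂 m (n + 1) ((k : ℤ) - 1 - j - 1) (j + 2) *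
          (ve 𝕂 m (n + 1) * qMap 𝕂 m t n j f)) := by
  have hb := beta_ne_zero (𝕂 := 𝕂) (j := j) h0 (by omega : t < n) (by omega)
  rw [embL_succ hm h0 hn, XM_mul_ve_mul hm, XM_mul, xv_mul_zMap, alpha_of_ne j ht, zMap_apply,
    xv_mul, show (k : ℤ) - j - 1 = k - 1 - j by ring]
  simp only [mul_add, mul_smul_comm, smul_add, smul_sub, smul_smul, mul_assoc]
  have h2 : (cc 𝕂 (n + 1) j * ((beta 𝕂 t (n + 1) j)⁻¹ * beta 𝕂 t (n + 1) j)) = cc 𝕂 (n + 1) j := by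
    rw [inv_mul_cancel₀ hb, mul_one]
  have h3 := congrArg (· • (cF 𝕂 m (n + 1) ((k : ℤ) - 1 - j) (j + 1) * xDot 𝕂 m n f)) h2
  linear_combination (norm := module) h3

theorem qMap_mem_polSub {n : ℕ} {t : ℤ} {j : ℕ} {f : CPol 𝕂 m} (hf : f ∈ polSub 𝕂 m n) :
    qMap 𝕂 m t n j f ∈ polSub 𝕂 m n :=
  Subalgebra.add_mem _ (xDot_mem_polSub le_rfl (xWedge_mem_polSub le_rfl hf))
    (Subalgebra.smul_mem _ (xWedge_mem_polSub le_rfl (xDot_mem_polSub le_rfl hf)) _)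

theorem grade_qMap {n : ℕ} (hn : n ≤ m) {t : ℤ} {j : ℕ} {c : 𝕂} {f : CPol 𝕂 m}
    (h : grade 𝕂 m n f = c • f) :
    grade 𝕂 m n (qMap 𝕂 m t n j f) = c • qMap 𝕂 m t n j f := by
  have h1 := grade_xDot hn (grade_xWedge hn h)
  have h2 := grade_xWedge hn (grade_xDot hn h)
  change grade 𝕂 m n (xDot 𝕂 m n (xWedge 𝕂 m n f) + beta 𝕂 t (n + 1) j •
    xWedge 𝕂 m n (xDot 𝕂 m n f)) = c • (xDot 𝕂 m n (xWedge 𝕂 m n f) + beta 𝕂 t (n + 1) j •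
    xWedge 𝕂 m n (xDot 𝕂 m n f))
  rw [map_add, map_smul, h1, h2]
  module

theorem mem_N_succ {s t : ℤ} {n k j : ℕ} : (t, j) ∈ N s (n + 1) k ↔
    0 ≤ t ∧ t ≤ n ∧ j ≤ k ∧ (t = s - 1 ∨ t = s) ∧ (t = 0 ∨ t = n → j = 0) := by
  simp [N]

/-- Apart from extreme t, each term of the expansions above has the right grade. In the extreme
cases α = 0, and the term that would need to be cancelled is already zero. -/
theorem grade_embL {n : ℕ} (hn : 2 ≤ n) (hm : n + 1 ≤ m) {s t : ℤ} {k j : ℕ}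
    (hN : (t, j) ∈ N s (n + 1) k) (hs : ¬ ((s = 0 ∨ s = n + 1) ∧ 1 ≤ k)) {f : CPol 𝕂 m}
    (hf : f ∈ Hr 𝕂 m n t j) :
    grade 𝕂 m (n + 1) (embL 𝕂 m s t n k j f) = (s : 𝕂) • embL 𝕂 m s t n k j f := by
  obtain ⟨h0, h1, hj, hst, hext⟩ := mem_N_succ.1 hN
  have hp := Hr_le_polSub hf
  have hg := hf.2.2.1
  have hD := grade_ve_mul hm (xDot_mem_polSub le_rfl hp) (grade_xDot (by omega) hg)
  have hW := grade_xWedge (by omega : n ≤ m) hg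
  rw [← grade_succ_of_polSub (xWedge_mem_polSub le_rfl hp)] at hW
  have hq := grade_qMap (by omega) (t := t) (j := j) hg
  have hq' := grade_ve_mul hm (qMap_mem_polSub (t := t) (j := j) hp) hq
  rw [← grade_succ_of_polSub (qMap_mem_polSub hp)] at hq
  have hf' := grade_ve_mul hm hp hg
  rw [← grade_succ_of_polSub hp] at hg
  rcases hst with rfl | rfl
  · obtain ⟨t, rfl⟩ : ∃ t', s = t' + 1 := ⟨s - 1, by ring⟩
    rw [show t + 1 - 1 = t by ring] at *
    push_cast
    by_cases ht : t = 0 ∨ t = n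
    · obtain rfl := hext ht
      rcases Nat.eq_zero_or_pos k with rfl | hk
      · rw [embL_diag_succ hm h0 h1, hf']
      -- The case t = n would give s = n + 1 with positive degree, which is excluded. For t = 0 the
      -- product x•f, the term of wrong grade, vanishes.
      · have ht0 : t = 0 := by omega
        subst ht0
        rw [embL_succ hm h0 h1, alpha_of_extreme _ ht, zero_mul, zero_smul, sub_zero,
          XM_mul_ve_mul hm, xv_mul, xDot_eq_zero_of_bot (by omega) hf, add_zero, map_sub, map_smul,
          grade_cF_mul hf', grade_cF_mul hW]
        module
    · rw [embL_succ_expand hm h0 h1 ht]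
      simp only [map_add, map_sub, map_smul, grade_cF_mul hf', grade_cF_mul hW, grade_cF_mul hq']
      module
  · by_cases ht : t = 0 ∨ t = n
    · obtain rfl := hext ht
      rcases Nat.eq_zero_or_pos k with rfl | hk
      · rw [embL_diag_self, hg]
      -- Symmetrically, t = 0 is excluded here, and for t = n the product x∧f vanishes.
      · have ht0 : t = n := by omega
        subst ht0
        rw [embL_self, alpha_of_extreme _ ht, zero_smul, sub_zero,
          XM_mul, xv_mul, xWedge_eq_zero_of_top (by omega) hf, zero_add (xDot 𝕂 m n f), map_sub, map_smul,
          grade_cF_mul hg, grade_cF_mul hD]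
        module
    · rw [embL_self_expand hm ht]
      simp only [map_add, map_sub, map_smul, grade_cF_mul hg, grade_cF_mul hD, grade_cF_mul hq]
      module

theorem pD_mul_ve_eq_zero {n : ℕ} {f : CPol 𝕂 m} (hf : f ∈ polSub 𝕂 m n) :
    pD 𝕂 m (n + 1) (ve 𝕂 m (n + 1) * f) = 0 := by
  rw [pD_mul, (hf _ (Nat.lt_succ_self n)).1, pD_ve, zero_mul, mul_zero, add_zero]

theorem euler_ve_mul {r i : ℕ} {c : 𝕂} {f : CPol 𝕂 m} (h : euler 𝕂 m r f = c • f) :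
    euler 𝕂 m r (ve 𝕂 m i * f) = c • (ve 𝕂 m i * f) := by
  rw [euler_mul, euler_ve, zero_mul, zero_add, h, mul_smul_comm]

/-- The embedding factors map solutions of the Hodge-de Rham system on `ℝ^n` to solutions
on `ℝ^{n+1}`. -/
theorem embL_mem {n : ℕ} (hn : 2 ≤ n) (hm : n + 1 ≤ m) {s t : ℤ} {k j : ℕ}
    (hN : (t, j) ∈ N s (n + 1) k) (hs : ¬ ((s = 0 ∨ s = n + 1) ∧ 1 ≤ k)) {f : CPol 𝕂 m}
    (hf : f ∈ Hr 𝕂 m n t j) : embL 𝕂 m s t n k j f ∈ Hr 𝕂 m (n + 1) s k := by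
  have hgr := grade_embL hn hm hN hs hf
  obtain ⟨h0, h1, hj, hst, hext⟩ := mem_N_succ.1 hN
  have hp := Hr_le_polSub hf
  have hp' : f ∈ polSub 𝕂 m (n + 1) := polSub_mono (Nat.le_succ n) hp
  have hz := zMap_mem_polSub hf
  have hz' := polSub_mono (Nat.le_succ n) hz
  have hve : ve 𝕂 m (n + 1) ∈ polSub 𝕂 m (n + 1) := ve_mem_polSub le_rfl
  have hE := Hr_euler_succ hf
  have hEz : euler 𝕂 m (n + 1) (zMap 𝕂 m t n j f) = ((j + 1 : ℕ) : 𝕂) • zMap 𝕂 m t n j f := by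
    rw [euler_succ, (hz _ (Nat.lt_succ_self n)).1, map_zero, add_zero, zMap_euler (by omega) hf]
  -- It is enough to solve the Dirac equation: since the grade is already known to be pure, this
  -- implies both equations of the system.
  have key : embL 𝕂 m s t n k j f ∈ polSub 𝕂 m (n + 1) ∧
      euler 𝕂 m (n + 1) (embL 𝕂 m s t n k j f) = (k : 𝕂) • embL 𝕂 m s t n k j f ∧
      dirc 𝕂 m (n + 1) (embL 𝕂 m s t n k j f) = 0 := by
    rcases hst with rfl | rfl
    · obtain ⟨t, rfl⟩ : ∃ t', s = t' + 1 := ⟨s - 1, by ring⟩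
      rw [show t + 1 - 1 = t by ring] at *
      rw [embL_succ hm h0 h1]
      refine ⟨Subalgebra.sub_mem _ (Subalgebra.mul_mem _ (XM_mem_polSub hm _ _)
        (Subalgebra.mul_mem _ hve hp')) (Subalgebra.smul_mem _ (Subalgebra.mul_mem _
          (XM_mem_polSub hm _ _) hz') _), ?_, ?_⟩
      · rw [map_sub, map_smul, euler_mul, euler_mul _ (XM 𝕂 m n _ _), euler_XM hm, euler_XM hm, hEz,
          euler_ve_mul hE]
        simp only [smul_mul_assoc, mul_smul_comm]
        push_cast
        module
      · rw [map_sub, map_smul, dirc_XM_mul hn hm _ _ (dirc_ve_mul (dirc_of_mem hf))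
          (euler_ve_mul hf.2.1) (pD_mul_ve_eq_zero hp)]
        by_cases ht : t = 0 ∨ t = n
        · rw [alpha_of_extreme _ ht, zero_mul, zero_smul, sub_zero]
        · rw [dirc_XM_mul hn hm _ _ (dirc_zMap (by omega) hf (by omega)) (zMap_euler (by omega) hf)
            (hz _ (Nat.lt_succ_self n)).1, smul_zero, sub_zero]
    · rw [embL_self]
      refine ⟨Subalgebra.sub_mem _ (Subalgebra.mul_mem _ (XM_mem_polSub hm _ _) hp')
        (Subalgebra.smul_mem _ (Subalgebra.mul_mem _
          (XM_mem_polSub hm _ _) (Subalgebra.mul_mem _ hve hz')) _), ?_, ?_⟩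
      · rw [map_sub, map_smul, euler_mul, euler_mul _ (XM 𝕂 m n _ _), euler_XM hm, euler_XM hm, hE,
          euler_ve_mul hEz]
        simp only [smul_mul_assoc, mul_smul_comm]
        push_cast
        module
      · rw [map_sub, map_smul, dirc_XM_mul hn hm _ _ (dirc_of_mem hf)
          hf.2.1 (hp _ (Nat.lt_succ_self n)).1]
        by_cases ht : t = 0 ∨ t = n
        · rw [alpha_of_extreme _ ht, zero_smul, sub_zero]
        · rw [dirc_XM_mul hn hm _ _ (dirc_ve_mul (dirc_zMap (by omega) hf (by omega)))
            (euler_ve_mul (zMap_euler (by omega) hf)) (pD_mul_ve_eq_zero hz), smul_zero, sub_zero]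
  obtain ⟨k1, k2, k3⟩ := key
  exact ⟨k1, k2, hgr, extD_coD_of_dirc hm hgr k3⟩

/-! ### Injectivity of the embedding factors -/

theorem ve_mul_eq_zero {i : ℕ} (h : 1 ≤ i ∧ i ≤ m) {f : CPol 𝕂 m} (hf : ve 𝕂 m i * f = 0) :
    f = 0 := by
  have := congrArg (ve 𝕂 m i * ·) hf
  simp only [← mul_assoc, ve_mul_self h, neg_mul, one_mul, mul_zero] at this
  exact neg_eq_zero.1 this

/-- Differentiating k − j times along the last axis reduces the embedding factor to a nonzero
multiple of multiplication by 1 or e_{n+1}. -/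
theorem embL_injective {n : ℕ} (hn : 2 ≤ n) (hm : n + 1 ≤ m) {s t : ℤ} {k j : ℕ}
    (hN : (t, j) ∈ N s (n + 1) k) {f : CPol 𝕂 m} (hf : f ∈ polSub 𝕂 m n)
    (h : embL 𝕂 m s t n k j f = 0) : f = 0 := by
  obtain ⟨h0, h1, hj, hst, hext⟩ := mem_N_succ.1 hN
  obtain ⟨d, rfl⟩ := Nat.exists_eq_add_of_le hj
  clear hN hext
  induction d with
  | zero =>
    rw [add_zero] at h
    rcases hst with rfl | rfl
    · obtain ⟨t, rfl⟩ : ∃ t', s = t' + 1 := ⟨s - 1, by ring⟩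
      rw [show t + 1 - 1 = t by ring] at *
      rw [embL_diag_succ hm h0 h1] at h
      exact ve_mul_eq_zero ⟨by omega, hm⟩ h
    · rwa [embL_diag_self] at h
  | succ d ih =>
    refine ih ?_ (by omega)
    have := congrArg (pD 𝕂 m (n + 1)) h
    rw [← add_assoc, pD_embL hn hm _ _ _ _ hf, map_zero] at this
    exact (smul_eq_zero.1 this).resolve_left (by exact_mod_cast Nat.succ_ne_zero (j + d))

/-! ### The Euler operator is diagonalizable -/

theorem euler_m_vx {i : ℕ} (h1 : 1 ≤ i) (h2 : i ≤ m) : euler 𝕂 m m (vx 𝕂 m i) = vx 𝕂 m i := by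
  have : ∀ l ∈ Finset.Icc 1 m, mulX 𝕂 m l (pD 𝕂 m l (vx 𝕂 m i)) = kron 𝕂 m i l • vx 𝕂 m l := by
    intro l hl
    rw [Finset.mem_Icc] at hl
    rw [pD_vx]
    by_cases h : l = i
    · subst h
      rw [if_pos ⟨rfl, by omega, by omega⟩, kron_self (by omega) (by omega), one_smul, mulX_apply,
        mul_one]
    · rw [if_neg (by tauto), kron_of_ne (Ne.symm h), zero_smul, map_zero]
  rw [euler_apply, Finset.sum_congr rfl this]
  exact sum_kron_smul le_rfl (by rw [Finset.mem_Icc]; omega) _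

theorem euler_algebraMap (r : ℕ) (c : 𝕂) : euler 𝕂 m r (algebraMap 𝕂 (CPol 𝕂 m) c) = 0 := by
  rw [Algebra.algebraMap_eq_smul_one, map_smul, euler_apply,
    Finset.sum_eq_zero fun l _ => by rw [pD_one, map_zero], smul_zero]

/-- The generators are eigenvectors with eigenvalues 0 and 1, and the Euler operator is a
derivation, so products of eigenvectors are eigenvectors. -/
theorem iSup_euler_eigenspace :
    ⨆ k : ℕ, Module.End.eigenspace (euler 𝕂 m m) (k : 𝕂) = ⊤ := by
  rw [eq_top_iff]
  rintro f -
  have le : ∀ (k : ℕ) {f : CPol 𝕂 m}, euler 𝕂 m m f = (k : 𝕂) • f →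
      f ∈ ⨆ k : ℕ, Module.End.eigenspace (euler 𝕂 m m) (k : 𝕂) := fun k f h =>
    Submodule.mem_iSup_of_mem k (Module.End.mem_eigenspace_iff.2 h)
  induction f using cpol_induction with
  | scalar c => exact le 0 (by rw [euler_algebraMap, Nat.cast_zero, zero_smul])
  | x i h1 h2 => exact le 1 (by rw [euler_m_vx h1 h2, Nat.cast_one, one_smul])
  | e i h1 h2 => exact le 0 (by rw [euler_ve, Nat.cast_zero, zero_smul])
  | add f g hf hg => exact add_mem hf hg
  | mul f g hf hg =>
    induction hf using Submodule.iSup_induction' with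
    | mem k f hf =>
      induction hg using Submodule.iSup_induction' with
      | mem l g hg =>
        refine le (k + l) ?_
        rw [euler_mul, Module.End.mem_eigenspace_iff.1 hf, Module.End.mem_eigenspace_iff.1 hg,
          smul_mul_assoc, mul_smul_comm]
        push_cast
        module
      | zero => rw [mul_zero]; exact zero_mem _
      | add g g' _ _ h h' => rw [mul_add]; exact add_mem h h'
    | zero => rw [zero_mul]; exact zero_mem _
    | add f f' _ _ h h' => rw [add_mul]; exact add_mem h h'

theorem eq_zero_of_euler {c : 𝕂} (hc : ∀ k : ℕ, c ≠ k) {f : CPol 𝕂 m}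
    (h : euler 𝕂 m m f = c • f) : f = 0 := by
  have h1 : f ∈ Module.End.eigenspace (euler 𝕂 m m) c := Module.End.mem_eigenspace_iff.2 h
  have h2 := (Module.End.eigenspaces_iSupIndep (euler 𝕂 m m)) c
  have h3 : (⨆ μ, ⨆ (_ : μ ≠ c), Module.End.eigenspace (euler 𝕂 m m) μ) = ⊤ := by
    rw [eq_top_iff, ← iSup_euler_eigenspace]
    exact iSup_le fun k => le_iSup₂_of_le (k : 𝕂) (hc k).symm le_rfl
  rw [h3, disjoint_top] at h2
  rw [h2] at h1
  exact (Submodule.mem_bot _).1 h1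

theorem euler_eq_of_polSub {r : ℕ} (hr : r ≤ m) {f : CPol 𝕂 m} (hf : f ∈ polSub 𝕂 m r) :
    euler 𝕂 m m f = euler 𝕂 m r f := by
  rw [euler_apply, euler_apply]
  refine (Finset.sum_subset (Finset.Icc_subset_Icc_right hr) fun i hi hi' => ?_).symm
  rw [Finset.mem_Icc] at hi hi'
  rw [(hf i (by omega)).1, map_zero]

/-- A derivative of f would be an eigenvector of the Euler operator for −1, which is not an
eigenvalue. -/
theorem pD_eq_zero_of_degree_zero {r : ℕ} (hr : r ≤ m) {f : CPol 𝕂 m} (hf : f ∈ polSub 𝕂 m r)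
    (h : euler 𝕂 m r f = 0) (i : ℕ) : pD 𝕂 m i f = 0 := by
  by_cases hi : 1 ≤ i ∧ i ≤ m
  · refine eq_zero_of_euler (c := -1) (fun k hk => ?_) ?_
    · have : ((-1 : ℤ) : 𝕂) = ((k : ℤ) : 𝕂) := by push_cast; exact hk
      have := Int.cast_injective this
      omega
    · rw [pD_euler le_rfl (Finset.mem_Icc.2 hi), euler_eq_of_polSub hr hf, h, map_zero]
      module
  · rw [pD_of_not_mem hi]; rfl

/-! ### The embedding factors span -/

variable (𝕂 m) in
/-- The sum of the images of the embedding factors. -/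
def embSum (n : ℕ) (s : ℤ) (k : ℕ) : Submodule 𝕂 (CPol 𝕂 m) :=
  ⨆ p ∈ N s (n + 1) k, (Hr 𝕂 m n p.1 p.2).map (embL 𝕂 m s p.1 n k p.2)

theorem embL_mem_embSum {n : ℕ} {s : ℤ} {k : ℕ} {t : ℤ} {j : ℕ} (hN : (t, j) ∈ N s (n + 1) k)
    {f : CPol 𝕂 m} (hf : f ∈ Hr 𝕂 m n t j) : embL 𝕂 m s t n k j f ∈ embSum 𝕂 m n s k :=
  Submodule.mem_iSup_of_mem (t, j) (Submodule.mem_iSup_of_mem hN (Submodule.mem_map_of_mem hf))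

theorem N_mono {s : ℤ} {r k : ℕ} {p : ℤ × ℕ} (h : p ∈ N s r k) : p ∈ N s r (k + 1) :=
  ⟨h.1, h.2.1, h.2.2.1.trans (Nat.le_succ k), h.2.2.2⟩

theorem embSum_le {n : ℕ} (hn : 2 ≤ n) (hm : n + 1 ≤ m) {s : ℤ} {k : ℕ}
    (hs : ¬ ((s = 0 ∨ s = n + 1) ∧ 1 ≤ k)) : embSum 𝕂 m n s k ≤ Hr 𝕂 m (n + 1) s k :=
  iSup₂_le fun _ hp => Submodule.map_le_iff_le_comap.2 fun _ hf => embL_mem hn hm hp hs hf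

/-- The kernel of the derivative is covered by the embedding factors with j = k, which are 1 and
e_{n+1}. The side condition in `N` holds for each nonzero part, because solutions of extreme grade
and positive degree vanish. -/
theorem mem_embSum_of_pD {n : ℕ} (hm : n + 1 ≤ m) {s : ℤ} {k : ℕ}
    {f : CPol 𝕂 m} (hf : f ∈ Hr 𝕂 m (n + 1) s k) (hD : pD 𝕂 m (n + 1) f = 0) :
    f ∈ embSum 𝕂 m n s k := by
  obtain ⟨a, ha, b, hb, rfl⟩ := exists_of_pD_eq_zero hm hf hD
  refine add_mem ?_ ?_
  · by_cases h : a = 0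
    · rw [h]; exact zero_mem _
    · obtain ⟨h0, h1⟩ := Hr_grade (by omega) ha h
      have := embL_mem_embSum (k := k) (mem_N_succ.2 ⟨h0, h1, le_rfl, .inr rfl, fun he => by
        by_contra hk; exact h (Hr_eq_zero_of_extreme (by omega) ha he hk)⟩) ha
      rwa [embL_diag_self] at this
  · by_cases h : b = 0
    · rw [h, mul_zero]; exact zero_mem _
    · obtain ⟨t, rfl⟩ : ∃ t', s = t' + 1 := ⟨s - 1, by ring⟩
      rw [show t + 1 - 1 = t by ring] at *
      obtain ⟨h0, h1⟩ := Hr_grade (by omega) hb h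
      have := embL_mem_embSum (s := t + 1) (k := k) (mem_N_succ.2 ⟨h0, h1, le_rfl, .inl (by ring),
        fun he => by
          by_contra hk; exact h (Hr_eq_zero_of_extreme (by omega) hb he hk)⟩) hb
      rwa [embL_diag_succ hm h0 h1] at this

/-- Integration along the last axis: by induction the derivative of f is a combination of embedding
factors, the Appell property lifts it to degree k + 1, and the lift differs from f by an element of
the kernel. -/
theorem Hr_eq_embSum {n : ℕ} (hn : 2 ≤ n) (hm : n + 1 ≤ m) {s : ℤ} {k : ℕ}
    (hs : ¬ ((s = 0 ∨ s = n + 1) ∧ 1 ≤ k)) : Hr 𝕂 m (n + 1) s k = embSum 𝕂 m n s k := by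
  refine le_antisymm ?_ (embSum_le hn hm hs)
  induction k with
  | zero =>
    intro f hf
    refine mem_embSum_of_pD hm hf (pD_eq_zero_of_degree_zero hm (Hr_le_polSub hf) ?_ _)
    rw [hf.2.1, Nat.cast_zero, zero_smul]
  | succ k ih =>
    have hs' : ¬ ((s = 0 ∨ s = n + 1) ∧ 1 ≤ k) := fun h => hs ⟨h.1, by omega⟩
    have hD : embSum 𝕂 m n s k ≤ (embSum 𝕂 m n s (k + 1)).map (pD 𝕂 m (n + 1)) := by
      refine iSup₂_le fun p hp => Submodule.map_le_iff_le_comap.2 fun f hf => ?_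
      refine ⟨((k : 𝕂) + 1)⁻¹ • embL 𝕂 m s p.1 n (k + 1) p.2 f,
        Submodule.smul_mem _ _ (embL_mem_embSum (N_mono hp) hf), ?_⟩
      rw [map_smul, pD_embL hn hm _ _ _ _ (Hr_le_polSub hf), smul_smul, inv_mul_cancel₀, one_smul]
      exact_mod_cast Nat.succ_ne_zero k
    intro f hf
    obtain ⟨g, hg, hfg⟩ := hD (ih hs' (pD_mem_Hr hm (i := n + 1) (by rw [Finset.mem_Icc]; omega) hf))
    have h1 : f - g ∈ embSum 𝕂 m n s (k + 1) := by
      refine mem_embSum_of_pD hm (sub_mem hf (embSum_le hn hm hs hg)) ?_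
      rw [map_sub, hfg, sub_self]
    simpa using add_mem h1 hg

/-! ### Unit vectors and the action of the Pin groups -/

theorem sum_fin_eq_sum_Icc {M : Type*} [AddCommMonoid M] (m : ℕ) (g : ℕ → M) :
    ∑ i : Fin m, g (i + 1) = ∑ i ∈ Finset.Icc 1 m, g i := by
  rw [← Finset.sum_range fun i => g (i + 1), Finset.range_eq_Ico, Finset.sum_Ico_add' g 0 m 1]
  rfl

/-- The unit vectors of `ℝ^r`, as sequences indexed from `1`. -/
def IsUVec (r : ℕ) (v : ℕ → ℝ) : Prop :=
  (∀ i, i ∉ Finset.Icc 1 r → v i = 0) ∧ ∑ i ∈ Finset.Icc 1 r, v i ^ 2 = 1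

theorem IsUVec.sum_eq {M : Type*} [AddCommMonoid M] {r r' : ℕ} {v : ℕ → ℝ} (h : IsUVec r v)
    (hr : r ≤ r') (g : ℕ → M) (hg : ∀ i, v i = 0 → g i = 0) :
    ∑ i ∈ Finset.Icc 1 r', g i = ∑ i ∈ Finset.Icc 1 r, g i :=
  (Finset.sum_subset (Finset.Icc_subset_Icc_right hr) fun i _ hi => hg i (h.1 i hi)).symm

theorem IsUVec.mono {r r' : ℕ} {v : ℕ → ℝ} (h : IsUVec r v) (hr : r ≤ r') : IsUVec r' v :=
  ⟨fun i hi => h.1 i fun hi' => hi (Finset.Icc_subset_Icc_right hr hi'),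
    by rw [h.sum_eq hr _ fun i hi => by rw [hi, zero_pow two_ne_zero], h.2]⟩

/-- The vector `∑ v_i e_i` in the Clifford algebra. -/
def clVec (m : ℕ) (v : ℕ → ℝ) : RCl m := CliffordAlgebra.ι (negForm m) fun i => v (i + 1)

theorem clVec_eq_sum (v : ℕ → ℝ) : clVec m v = ∑ i ∈ Finset.Icc 1 m, v i • realE m i := by
  rw [clVec, ι_eq_sum]
  exact sum_fin_eq_sum_Icc m fun i => v i • realE m i

theorem clVec_mul_self {v : ℕ → ℝ} (h : IsUVec m v) : clVec m v * clVec m v = -1 := by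
  rw [clVec, CliffordAlgebra.ι_sq_scalar, negForm_apply, sum_fin_eq_sum_Icc m fun i => v i ^ 2, h.2,
    map_neg, map_one]

theorem realE_mul_clVec {v : ℕ → ℝ} {j : ℕ} (hj : 1 ≤ j ∧ j ≤ m) :
    realE m j * clVec m v + clVec m v * realE m j = algebraMap ℝ _ (-2 * v j) := by
  rw [realE_of_mem hj, clVec, CliffordAlgebra.ι_mul_ι_add_swap, polar_negForm]
  congr 2
  obtain ⟨j, rfl⟩ := exists_fin hj
  simp [Pi.single_apply]

/-- Since v⁻¹ = −v, conjugation by a unit vector fixes v and changes the sign of the orthogonal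
complement. -/
theorem clVec_conj {v : ℕ → ℝ} (h : IsUVec m v) {j : ℕ} (hj : 1 ≤ j ∧ j ≤ m) :
    clVec m v * realE m j * -clVec m v = (2 * v j) • clVec m v - realE m j := by
  have h1 := realE_mul_clVec (v := v) hj
  have h2 : realE m j * clVec m v = algebraMap ℝ _ (-2 * v j) - clVec m v * realE m j := by
    rw [← h1]; abel
  have h3 : clVec m v * algebraMap ℝ _ (-2 * v j) = (-2 * v j) • clVec m v := by
    rw [← Algebra.commutes, ← Algebra.smul_def]
  rw [mul_neg, mul_assoc, h2, mul_sub, ← mul_assoc, clVec_mul_self h, h3, neg_one_mul]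
  module

open Classical in
/-- The unit vector `∑ v_i e_i` as an element of the group of units. -/
def uVec (m : ℕ) (v : ℕ → ℝ) : (RCl m)ˣ :=
  if h : IsUVec m v then ⟨clVec m v, -clVec m v, by rw [mul_neg, clVec_mul_self h, neg_neg],
    by rw [neg_mul, clVec_mul_self h, neg_neg]⟩ else 1

theorem uVec_val {v : ℕ → ℝ} (h : IsUVec m v) : (uVec m v : RCl m) = clVec m v := by
  rw [uVec, dif_pos h]

theorem uVec_inv_val {v : ℕ → ℝ} (h : IsUVec m v) :
    (((uVec m v)⁻¹ : (RCl m)ˣ) : RCl m) = -clVec m v := by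
  rw [uVec, dif_pos h]; rfl

theorem uVec_conj {v : ℕ → ℝ} (h : IsUVec m v) {j : ℕ} (hj : 1 ≤ j ∧ j ≤ m) :
    (uVec m v : RCl m) * realE m j * (((uVec m v)⁻¹ : (RCl m)ˣ) : RCl m) =
      (2 * v j) • clVec m v - realE m j := by
  rw [uVec_val h, uVec_inv_val h, clVec_conj h hj]

theorem uVec_conj' {v : ℕ → ℝ} (h : IsUVec m v) {j : ℕ} (hj : 1 ≤ j ∧ j ≤ m) :
    (((uVec m v)⁻¹ : (RCl m)ˣ) : RCl m) * realE m j * (uVec m v : RCl m) =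
      (2 * v j) • clVec m v - realE m j := by
  rw [uVec_val h, uVec_inv_val h, ← clVec_conj h hj, neg_mul, neg_mul, mul_neg]

/-- Under the linear isomorphism with the exterior algebra, the product vw becomes v∧w − (v, w), and
the projection to scalars kills v∧w. -/
theorem realScalarPart_ι_mul_ι (v w : Fin m → ℝ) :
    realScalarPart m (CliffordAlgebra.ι (negForm m) v * CliffordAlgebra.ι (negForm m) w) =
      -∑ i, v i * w i := by
  have hp := polar_negForm v w
  rw [realScalarPart, LinearMap.comp_apply, LinearEquiv.coe_coe, CliffordAlgebra.equivExterior,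
    CliffordAlgebra.changeFormEquiv_apply, CliffordAlgebra.changeForm_ι_mul_ι,
    AlgHom.toLinearMap_apply, map_sub, map_mul]
  have h1 : ExteriorAlgebra.algebraMapInv (CliffordAlgebra.ι (0 : QuadraticForm ℝ (Fin m → ℝ)) v) =
      (0 : ℝ) := by
    rw [ExteriorAlgebra.algebraMapInv]
    exact ExteriorAlgebra.lift_ι_apply ℝ _ _ v
  have h2 := ExteriorAlgebra.algebraMap_leftInverse (R := ℝ) (Fin m → ℝ)
    (QuadraticMap.associated (R := ℝ) (-negForm m) v w)
  have h3 : QuadraticMap.associated (R := ℝ) (-negForm m) v w = ∑ i, v i * w i := by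
    rw [map_neg, LinearMap.neg_apply, LinearMap.neg_apply, QuadraticMap.associated_apply,
      ← QuadraticMap.polar, hp]
    simp
  rw [h1, zero_mul, zero_sub, ← h3]
  congr 1

theorem realScalarPart_realE_mul_clVec {v : ℕ → ℝ} {j : ℕ} (hj : 1 ≤ j ∧ j ≤ m) :
    realScalarPart m (realE m j * clVec m v) = -v j := by
  rw [realE_of_mem hj, clVec, realScalarPart_ι_mul_ι]
  obtain ⟨j, rfl⟩ := exists_fin hj
  simp [Pi.single_apply]

theorem realE_eq_clVec (j : ℕ) : realE m j = clVec m fun i => if i = j then 1 else 0 := by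
  rw [clVec_eq_sum]
  simp only [ite_smul, one_smul, zero_smul, Finset.sum_ite_eq', Finset.mem_Icc]
  split_ifs with h
  · rfl
  · rw [realE, dif_neg h]

theorem rotCoeff_uVec {v : ℕ → ℝ} (h : IsUVec m v) (i j : Fin m) :
    rotCoeff m (uVec m v) i j = 2 * v (i + 1) * v (j + 1) - if i = j then 1 else 0 := by
  rw [rotCoeff, uVec_conj' h ⟨by omega, by omega⟩, mul_sub, mul_smul_comm, map_sub, map_smul,
    realScalarPart_realE_mul_clVec ⟨by omega, by omega⟩, realE_eq_clVec (j + 1),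
    realScalarPart_realE_mul_clVec ⟨by omega, by omega⟩, smul_eq_mul]
  by_cases hij : i = j
  · subst hij; simp; ring
  · rw [if_neg (by rw [add_left_inj, Fin.val_inj]; exact hij), if_neg hij]; ring

/-- The action of a unit of the Clifford algebra is by algebra homomorphisms. -/
def actA (𝕂 : Type) [RCLike 𝕂] (m : ℕ) (g : (RCl m)ˣ) : Pol 𝕂 m →ₐ[𝕂] Pol 𝕂 m :=
  AlgHom.ofLinearMap (actH 𝕂 m g)
    (by
      change const 𝕂 m g * (substConj 𝕂 m g 1 * const 𝕂 m _) = 1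
      rw [map_one, one_mul, ← constHom_apply, ← constHom_apply, ← map_mul, Units.mul_inv, map_one])
    (by
      intro f f'
      change const 𝕂 m g * (substConj 𝕂 m g (f * f') * const 𝕂 m _) =
        const 𝕂 m g * (substConj 𝕂 m g f * const 𝕂 m _) *
          (const 𝕂 m g * (substConj 𝕂 m g f' * const 𝕂 m _))
      have : const 𝕂 m ((g⁻¹ : (RCl m)ˣ) : RCl m) * const 𝕂 m g = 1 := by
        rw [← constHom_apply, ← constHom_apply, ← map_mul, Units.inv_mul, map_one]
      rw [map_mul]
      simp only [mul_assoc]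
      rw [← mul_assoc (const 𝕂 m ((g⁻¹ : (RCl m)ˣ) : RCl m)), this, one_mul])

theorem substConj_const (g : (RCl m)ˣ) (a : RCl m) :
    substConj 𝕂 m g (const 𝕂 m a) = const 𝕂 m a := by
  rw [substConj, const, Algebra.TensorProduct.map_tmul, map_one]; rfl

theorem actA_const (g : (RCl m)ˣ) (a : RCl m) :
    actA 𝕂 m g (const 𝕂 m a) = const 𝕂 m (g * a * ((g⁻¹ : (RCl m)ˣ) : RCl m)) := by
  change const 𝕂 m g * (substConj 𝕂 m g (const 𝕂 m a) * const 𝕂 m _) = _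
  rw [substConj_const]
  simp only [← constHom_apply, map_mul, mul_assoc]

theorem actA_x (g : (RCl m)ˣ) (i : Fin m) :
    actA 𝕂 m g (x 𝕂 m (i + 1)) =
      ∑ j : Fin m, algebraMap ℝ 𝕂 (rotCoeff m g i j) • x 𝕂 m (j + 1) := by
  change const 𝕂 m g * (substConj 𝕂 m g (x 𝕂 m (i + 1)) * const 𝕂 m _) = _
  have h1 : ∀ j : Fin m, x 𝕂 m (j + 1) = (MvPolynomial.X j) ⊗ₜ[𝕂] 1 := fun j => by
    rw [x, coord, dif_pos ⟨by omega, by omega⟩]; rfl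
  have h2 : substConj 𝕂 m g (x 𝕂 m (i + 1)) =
      ofScalar 𝕂 m (∑ j : Fin m, MvPolynomial.C (algebraMap ℝ 𝕂 (rotCoeff m g i j)) *
        MvPolynomial.X j) := by
    rw [h1, substConj, Algebra.TensorProduct.map_tmul, MvPolynomial.aeval_X, map_one]; rfl
  rw [h2, ofScalar_mul_comm, ← mul_assoc, ← constHom_apply, ← constHom_apply, ← map_mul,
    Units.mul_inv, map_one, one_mul, map_sum]
  refine Finset.sum_congr rfl fun j _ => ?_
  rw [h1, ← MvPolynomial.smul_eq_C_mul, map_smul]; rfl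

/-- For an arbitrary unit g the conjugate of a vector need not be a vector, and `rotCoeff` records
only its vector coefficients. The hypothesis on g excludes this and makes the substitutions compose.
-/
theorem actA_mul (g h : (RCl m)ˣ)
    (hg : ∀ j : Fin m, ((g⁻¹ : (RCl m)ˣ) : RCl m) * realE m (j + 1) * (g : RCl m) =
      ∑ i : Fin m, rotCoeff m g i j • realE m (i + 1)) (f : Pol 𝕂 m) :
    actA 𝕂 m (g * h) f = actA 𝕂 m g (actA 𝕂 m h f) := by
  suffices H : actA 𝕂 m (g * h) = (actA 𝕂 m g).comp (actA 𝕂 m h) from DFunLike.congr_fun H f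
  refine pol_algHom_ext (fun i h1 h2 => ?_) (fun i h1 h2 => ?_)
  · obtain ⟨i, rfl⟩ := exists_fin ⟨h1, h2⟩
    rw [AlgHom.comp_apply, actA_x, actA_x, map_sum]
    simp only [map_smul, actA_x, Finset.smul_sum, smul_smul]
    rw [Finset.sum_comm]
    refine Finset.sum_congr rfl fun l _ => ?_
    rw [← Finset.sum_smul]
    congr 1
    simp only [← map_mul, ← map_sum]
    congr 1
    have h3 : ((((g * h)⁻¹ : (RCl m)ˣ) : RCl m) * realE m (l + 1) * ((g * h : (RCl m)ˣ) : RCl m)) =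
        ∑ j : Fin m, rotCoeff m g j l •
          (((h⁻¹ : (RCl m)ˣ) : RCl m) * realE m (j + 1) * (h : RCl m)) := by
      rw [mul_inv_rev, Units.val_mul, Units.val_mul,
        show (((h⁻¹ : (RCl m)ˣ) : RCl m) * ((g⁻¹ : (RCl m)ˣ) : RCl m) * realE m (l + 1) *
          ((g : RCl m) * (h : RCl m))) = ((h⁻¹ : (RCl m)ˣ) : RCl m) *
          (((g⁻¹ : (RCl m)ˣ) : RCl m) * realE m (l + 1) * (g : RCl m)) * (h : RCl m) by
            simp only [mul_assoc], hg, Finset.mul_sum, Finset.sum_mul]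
      simp only [mul_smul_comm, smul_mul_assoc]
    rw [rotCoeff, h3, Finset.mul_sum, map_sum, ← Finset.sum_neg_distrib]
    refine Finset.sum_congr rfl fun j _ => ?_
    rw [mul_smul_comm, map_smul, smul_eq_mul, rotCoeff, rotCoeff]
    ring
  · rw [AlgHom.comp_apply, e, actA_const, actA_const, actA_const, mul_inv_rev, Units.val_mul,
      Units.val_mul]
    simp only [mul_assoc]

theorem actA_uVec_mul {v : ℕ → ℝ} (hv : IsUVec m v) (h : (RCl m)ˣ) (f : Pol 𝕂 m) :
    actA 𝕂 m (uVec m v * h) f = actA 𝕂 m (uVec m v) (actA 𝕂 m h f) := by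
  refine actA_mul _ _ (fun j => ?_) f
  rw [uVec_conj' hv ⟨by omega, by omega⟩, clVec, ι_eq_sum]
  simp only [rotCoeff_uVec hv, sub_smul, Finset.sum_sub_distrib, ite_smul, one_smul, zero_smul,
    Finset.sum_ite_eq', Finset.mem_univ, if_true, Finset.smul_sum, smul_smul]
  congr 1
  exact Finset.sum_congr rfl fun i _ => by rw [mul_right_comm]

theorem actA_one (f : Pol 𝕂 m) : actA 𝕂 m 1 f = f := by
  suffices H : actA 𝕂 m 1 = AlgHom.id 𝕂 _ from DFunLike.congr_fun H f
  refine pol_algHom_ext (fun i h1 h2 => ?_) (fun i h1 h2 => ?_)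
  · obtain ⟨i, rfl⟩ := exists_fin ⟨h1, h2⟩
    rw [actA_x, AlgHom.id_apply]
    have : ∀ j : Fin m, rotCoeff m 1 i j = if i = j then 1 else 0 := fun j => by
      rw [rotCoeff, inv_one, Units.val_one, one_mul, mul_one, realE_eq_clVec (j + 1),
        realScalarPart_realE_mul_clVec ⟨by omega, by omega⟩, neg_neg]
      simp [Fin.val_inj]
    simp [this]
  · rw [e, actA_const, inv_one, Units.val_one, one_mul, mul_one]; rfl

theorem exists_uVec {r : ℕ} (hr : r ≤ m) {u : (RCl m)ˣ}
    (hu : ∃ v : Fin m → ℝ, ∑ i, v i ^ 2 = 1 ∧ (∀ i : Fin m, r ≤ i → v i = 0) ∧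
      (u : RCl m) = CliffordAlgebra.ι (negForm m) v) : ∃ v, IsUVec r v ∧ u = uVec m v := by
  obtain ⟨v, h1, h2, h3⟩ := hu
  let w : ℕ → ℝ := fun i => if h : 1 ≤ i ∧ i ≤ m then v ⟨i - 1, by omega⟩ else 0
  have hw : ∀ i : Fin m, w (i + 1) = v i := fun i => dif_pos ⟨by omega, by omega⟩
  have h4 : ∀ i, i ∉ Finset.Icc 1 r → w i = 0 := by
    intro i hi
    rw [Finset.mem_Icc] at hi
    by_cases h : 1 ≤ i ∧ i ≤ m
    · obtain ⟨i, rfl⟩ := exists_fin h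
      rw [hw]; exact h2 i (by omega)
    · exact dif_neg h
  have h5 : IsUVec r w := by
    refine ⟨h4, ?_⟩
    rw [Finset.sum_subset (Finset.Icc_subset_Icc_right hr) fun i _ hi => by
      rw [h4 i hi, zero_pow two_ne_zero], ← sum_fin_eq_sum_Icc m fun i => w i ^ 2]
    simp only [hw]; exact h1
  refine ⟨w, h5, Units.ext ?_⟩
  rw [h3, uVec_val (h5.mono hr), clVec]
  simp only [hw]

theorem IsUVec.neg {r : ℕ} {v : ℕ → ℝ} (h : IsUVec r v) : IsUVec r (-v) :=
  ⟨fun i hi => by rw [Pi.neg_apply, h.1 i hi, neg_zero], by simpa using h.2⟩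

theorem uVec_inv {v : ℕ → ℝ} (h : IsUVec m v) : (uVec m v)⁻¹ = uVec m (-v) := by
  refine Units.ext ?_
  rw [uVec_inv_val h, uVec_val h.neg, clVec, clVec, ← map_neg]; rfl

theorem uVec_mem_Pin {r : ℕ} (hr : r ≤ m) {v : ℕ → ℝ} (h : IsUVec r v) : uVec m v ∈ Pin m r := by
  refine Subgroup.subset_closure ⟨fun i => v (i + 1), ?_, fun i hi => h.1 _ ?_, ?_⟩
  · rw [sum_fin_eq_sum_Icc m fun i => v i ^ 2, (h.mono hr).2]
  · rw [Finset.mem_Icc]; omega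
  · rw [uVec_val (h.mono hr), clVec]

variable (𝕂 m) in
/-- The action of the unit vector `∑ v_i e_i`. -/
def sg (v : ℕ → ℝ) : CPol 𝕂 m →ₐ[𝕂] CPol 𝕂 m := actA 𝕂 m (uVec m v)

/-- Invariance under the Pin group can be checked on unit vectors. -/
theorem isInvariant_iff {r : ℕ} (hr : r ≤ m) {W : Submodule 𝕂 (CPol 𝕂 m)} :
    IsInvariant 𝕂 m r W ↔ ∀ v, IsUVec r v → ∀ f ∈ W, sg 𝕂 m v f ∈ W := by
  refine ⟨fun h v hv f hf => h _ (uVec_mem_Pin hr hv) f hf, fun h g hg => ?_⟩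
  have key : ∀ g ∈ Submonoid.closure {u : (RCl m)ˣ | ∃ v, IsUVec r v ∧ u = uVec m v},
      ∀ f ∈ W, (actA 𝕂 m g f : CPol 𝕂 m) ∈ W := by
    intro g hg
    induction hg using Submonoid.closure_induction_left with
    | one => exact fun f hf => (actA_one (m := m) (𝕂 := 𝕂) f).symm ▸ hf
    | mul_left u hu g _ ih =>
      obtain ⟨v, hv, rfl⟩ := hu
      intro f hf
      have h1 : (actA 𝕂 m (uVec m v * g) f : CPol 𝕂 m) = sg 𝕂 m v (actA 𝕂 m g f) :=
        actA_uVec_mul (hv.mono hr) g f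
      exact h1 ▸ h v hv _ (ih f hf)
  refine key g ?_
  -- The inverse of a unit vector v is the unit vector −v, so the unit vectors generate the group
  -- already as a monoid.
  rw [Pin, ← Subgroup.mem_toSubmonoid, Subgroup.closure_toSubmonoid] at hg
  refine Submonoid.closure_mono ?_ hg
  rintro u (hu | hu)
  · exact exists_uVec hr hu
  · obtain ⟨v, hv, h'⟩ := exists_uVec hr hu
    refine ⟨-v, hv.neg, ?_⟩
    rw [← uVec_inv (hv.mono hr), ← h', _root_.inv_inv]

/-! ### Covariance of the operators -/

variable (𝕂) in
/-- The combination `∑ v_i A_i`, `1 ≤ i ≤ r`. -/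
def vComb {M : Type*} [AddCommMonoid M] [Module 𝕂 M] (r : ℕ) (v : ℕ → ℝ) (A : ℕ → M) : M :=
  ∑ i ∈ Finset.Icc 1 r, (v i : 𝕂) • A i

theorem IsUVec.vComb_eq {M : Type*} [AddCommMonoid M] [Module 𝕂 M] {r r' : ℕ} {v : ℕ → ℝ}
    (h : IsUVec r v) (hr : r ≤ r') (A : ℕ → M) : vComb 𝕂 r' v A = vComb 𝕂 r v A :=
  h.sum_eq hr _ fun i hi => by rw [hi, RCLike.ofReal_zero, zero_smul]

theorem IsUVec.sum_sq {r : ℕ} {v : ℕ → ℝ} (h : IsUVec r v) :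
    ∑ i ∈ Finset.Icc 1 r, (v i : 𝕂) * (v i : 𝕂) = 1 := by
  have := congrArg (RCLike.ofReal (K := 𝕂)) h.2
  rw [RCLike.ofReal_one] at this
  rw [← this, RCLike.ofReal_sum]
  exact Finset.sum_congr rfl fun i _ => by rw [pow_two, RCLike.ofReal_mul]

theorem IsUVec.vComb_reflect {M : Type*} [AddCommGroup M] [Module 𝕂 M] {r : ℕ} {v : ℕ → ℝ}
    (h : IsUVec r v) (B : M) (A : ℕ → M) :
    vComb 𝕂 r v (fun i => (2 * (v i : 𝕂)) • B - A i) = (2 : 𝕂) • B - vComb 𝕂 r v A := by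
  simp only [vComb, smul_sub, Finset.sum_sub_distrib, smul_smul]
  rw [← Finset.sum_smul]
  congr 2
  rw [Finset.sum_congr rfl fun i _ => mul_left_comm _ _ _, ← Finset.mul_sum, h.sum_sq, mul_one]

theorem map_vComb {M N : Type*} [AddCommMonoid M] [Module 𝕂 M] [AddCommMonoid N] [Module 𝕂 N]
    (φ : M →ₗ[𝕂] N) (r : ℕ) (v : ℕ → ℝ) (A : ℕ → M) :
    φ (vComb 𝕂 r v A) = vComb 𝕂 r v fun i => φ (A i) := by
  simp only [vComb, map_sum, map_smul]

theorem sg_vx {r : ℕ} (hr : r ≤ m) {v : ℕ → ℝ} (h : IsUVec r v) (i : ℕ) :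
    sg 𝕂 m v (vx 𝕂 m i) = (2 * (v i : 𝕂)) • vComb 𝕂 r v (vx 𝕂 m) - vx 𝕂 m i := by
  by_cases hi : 1 ≤ i ∧ i ≤ m
  · obtain ⟨i, rfl⟩ := exists_fin hi
    refine (actA_x (uVec m v) i).trans ?_
    rw [← h.vComb_eq hr, vComb, ← sum_fin_eq_sum_Icc m fun i => (v i : 𝕂) • vx 𝕂 m i]
    change ∑ j : Fin m, algebraMap ℝ 𝕂 (rotCoeff m (uVec m v) i j) • vx 𝕂 m (j + 1) = _
    simp only [rotCoeff_uVec (h.mono hr), map_sub, map_mul, sub_smul, Finset.sum_sub_distrib]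
    rw [Finset.smul_sum]
    congr 1
    · refine Finset.sum_congr rfl fun j _ => ?_
      rw [smul_smul, map_ofNat]
    · simp [apply_ite (algebraMap ℝ 𝕂), ite_smul]
  · rw [vx_of_not_mem hi, map_zero, h.1 i (by rw [Finset.mem_Icc]; omega), RCLike.ofReal_zero,
      mul_zero, zero_smul, sub_zero]

theorem sg_ve {r : ℕ} (hr : r ≤ m) {v : ℕ → ℝ} (h : IsUVec r v) (i : ℕ) :
    sg 𝕂 m v (ve 𝕂 m i) = (2 * (v i : 𝕂)) • vComb 𝕂 r v (ve 𝕂 m) - ve 𝕂 m i := by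
  by_cases hi : 1 ≤ i ∧ i ≤ m
  · refine (actA_const (uVec m v) (realE m i)).trans ?_
    have hs : ∀ (c : ℝ) (a : RCl m), (constHom 𝕂 m (c • a) : CPol 𝕂 m) =
        (c : 𝕂) • (constHom 𝕂 m a : CPol 𝕂 m) := by
      intro c a
      rw [map_smul]
      exact (algebraMap_smul 𝕂 c (constHom 𝕂 m a)).symm
    have hsub : ∀ a b : RCl m, (constHom 𝕂 m (a - b) : CPol 𝕂 m) =
        (constHom 𝕂 m a : CPol 𝕂 m) - (constHom 𝕂 m b : CPol 𝕂 m) := fun a b => map_sub _ a b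
    have hsum : (constHom 𝕂 m (clVec m v) : CPol 𝕂 m) =
        ∑ i ∈ Finset.Icc 1 m, (constHom 𝕂 m (v i • realE m i) : CPol 𝕂 m) := by
      rw [clVec_eq_sum]; exact map_sum _ _ _
    rw [uVec_conj (h.mono hr) hi, ← constHom_apply]
    refine (hsub _ _).trans ?_
    rw [hs, hsum, ← h.vComb_eq hr, vComb]
    rw [Finset.sum_congr rfl fun j _ => hs (v j) (realE m j), RCLike.ofReal_mul, RCLike.ofReal_ofNat]
    rfl
  · rw [ve_of_not_mem hi, map_zero, h.1 i (by rw [Finset.mem_Icc]; omega), RCLike.ofReal_zero,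
      mul_zero, zero_smul, sub_zero]

theorem sg_inv {r : ℕ} (hr : r ≤ m) {v : ℕ → ℝ} (h : IsUVec r v) (f : CPol 𝕂 m) :
    sg 𝕂 m v (inv 𝕂 m f) = inv 𝕂 m (sg 𝕂 m v f) := by
  suffices H : (sg 𝕂 m v).comp (inv 𝕂 m) = (inv 𝕂 m).comp (sg 𝕂 m v) from DFunLike.congr_fun H f
  refine cpol_algHom_ext (fun i _ _ => ?_) (fun i _ _ => ?_)
  · rw [AlgHom.comp_apply, AlgHom.comp_apply, inv_vx, sg_vx hr h, map_sub, map_smul, inv_vx,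
      ← AlgHom.toLinearMap_apply (inv 𝕂 m), map_vComb]
    simp only [AlgHom.toLinearMap_apply, inv_vx]
  · rw [AlgHom.comp_apply, AlgHom.comp_apply, inv_ve, map_neg, sg_ve hr h, map_sub, map_smul, inv_ve,
      ← AlgHom.toLinearMap_apply (inv 𝕂 m), map_vComb]
    simp only [AlgHom.toLinearMap_apply, inv_ve, vComb, smul_neg, Finset.sum_neg_distrib]
    abel

theorem sg_sg {r : ℕ} (hr : r ≤ m) {v : ℕ → ℝ} (h : IsUVec r v) (f : CPol 𝕂 m) :
    sg 𝕂 m v (sg 𝕂 m v f) = f := by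
  suffices H : (sg 𝕂 m v).comp (sg 𝕂 m v) = AlgHom.id 𝕂 _ from DFunLike.congr_fun H f
  refine cpol_algHom_ext (fun i _ _ => ?_) (fun i _ _ => ?_)
  · rw [AlgHom.comp_apply, sg_vx hr h, map_sub, map_smul, sg_vx hr h,
      ← AlgHom.toLinearMap_apply (sg 𝕂 m v), map_vComb]
    simp only [AlgHom.toLinearMap_apply, sg_vx hr h]
    rw [h.vComb_reflect, AlgHom.id_apply]
    module
  · rw [AlgHom.comp_apply, sg_ve hr h, map_sub, map_smul, sg_ve hr h,
      ← AlgHom.toLinearMap_apply (sg 𝕂 m v), map_vComb]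
    simp only [AlgHom.toLinearMap_apply, sg_ve hr h]
    rw [h.vComb_reflect, AlgHom.id_apply]
    module

/-- The family of operators `A` transforms like a vector under the action of `v`. -/
def Covariant (r : ℕ) (v : ℕ → ℝ) (A : ℕ → Module.End 𝕂 (CPol 𝕂 m)) : Prop :=
  ∀ l f, sg 𝕂 m v (A l f) =
    (2 * (v l : 𝕂)) • vComb 𝕂 r v (fun i => A i (sg 𝕂 m v f)) - A l (sg 𝕂 m v f)

theorem covariant_mulX {r : ℕ} (hr : r ≤ m) {v : ℕ → ℝ} (h : IsUVec r v) :
    Covariant r v (mulX 𝕂 m) := by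
  intro l f
  rw [mulX_apply, map_mul, sg_vx hr h, sub_mul, smul_mul_assoc, vComb, Finset.sum_mul]
  simp only [smul_mul_assoc]
  rfl

theorem covariant_eps {r : ℕ} (hr : r ≤ m) {v : ℕ → ℝ} (h : IsUVec r v) :
    Covariant r v (eps 𝕂 m) := by
  intro l f
  simp only [vComb, eps_apply, map_smul, map_add, map_mul, sg_ve hr h, sg_inv hr h, sub_mul, mul_sub,
    smul_mul_assoc, mul_smul_comm, Finset.sum_mul, Finset.mul_sum, smul_add, Finset.sum_add_distrib,
    smul_comm _ (1 / 2 : 𝕂), ← Finset.smul_sum]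
  module

theorem covariant_kap {r : ℕ} (hr : r ≤ m) {v : ℕ → ℝ} (h : IsUVec r v) :
    Covariant r v (kap 𝕂 m) := by
  intro l f
  simp only [vComb, kap_apply, map_smul, map_sub, map_mul, sg_ve hr h, sg_inv hr h, sub_mul, mul_sub,
    smul_mul_assoc, mul_smul_comm, Finset.sum_mul, Finset.mul_sum, smul_sub, Finset.sum_sub_distrib,
    smul_comm _ (1 / 2 : 𝕂), ← Finset.smul_sum]
  module

theorem pD_vx_kron (i j : ℕ) : pD 𝕂 m i (vx 𝕂 m j) = kron 𝕂 m i j • 1 := by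
  rw [pD_vx, kron]; split_ifs <;> simp

theorem IsUVec.vComb_kron {r : ℕ} (hr : r ≤ m) {v : ℕ → ℝ} (h : IsUVec r v) (i : ℕ) :
    ∑ l ∈ Finset.Icc 1 r, (v l : 𝕂) * kron 𝕂 m i l = v i := by
  by_cases hi : i ∈ Finset.Icc 1 r
  · rw [Finset.sum_congr rfl fun l _ => mul_comm _ _]
    exact sum_kron_smul (𝕂 := 𝕂) hr hi fun l => (v l : 𝕂)
  · rw [h.1 i hi, RCLike.ofReal_zero]
    refine Finset.sum_eq_zero fun l hl => ?_
    rw [kron_of_ne (by rintro rfl; exact hi hl), mul_zero]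

/-- The chain rule for a linear substitution, checked on the generators and extended to products by
the Leibniz rule. -/
theorem covariant_pD {r : ℕ} (hr : r ≤ m) {v : ℕ → ℝ} (h : IsUVec r v) :
    Covariant r v (pD 𝕂 m) := by
  have hx : ∀ i j, pD 𝕂 m i (sg 𝕂 m v (vx 𝕂 m j)) =
      (2 * (v i : 𝕂)) • ((v j : 𝕂) • (1 : CPol 𝕂 m)) - kron 𝕂 m i j • 1 := by
    intro i j
    rw [sg_vx hr h, map_sub, map_smul, map_vComb]
    simp only [pD_vx_kron, vComb, smul_smul]
    rw [← Finset.sum_smul, h.vComb_kron hr, smul_smul]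
    congr 2
    ring
  intro l f
  induction f using cpol_induction generalizing l with
  | scalar c =>
    simp only [AlgHom.commutes, Algebra.algebraMap_eq_smul_one, map_smul, pD_one, smul_zero, map_zero,
      map_one, vComb, Finset.sum_const_zero, sub_zero]
  | x j _ _ =>
    rw [pD_vx_kron, map_smul, map_one, hx]
    simp only [hx]
    have := h.vComb_reflect (𝕂 := 𝕂) ((v j : 𝕂) • (1 : CPol 𝕂 m)) fun i => kron 𝕂 m i j • 1
    rw [this]
    have h2 : vComb 𝕂 r v (fun i => kron 𝕂 m i j • (1 : CPol 𝕂 m)) = (v j : 𝕂) • 1 := by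
      simp only [vComb, smul_smul, kron_comm _ j]
      rw [← Finset.sum_smul, h.vComb_kron hr]
    rw [h2]
    module
  | e j _ _ =>
    simp only [sg_ve hr h, pD_ve, map_zero, map_sub, map_smul, map_sum, vComb, smul_zero,
      Finset.sum_const_zero, sub_zero]
  | add f g hf hg =>
    simp only [map_add, hf, hg, vComb, smul_add, Finset.sum_add_distrib]
    module
  | mul f g hf hg =>
    simp only [pD_mul, map_add, map_mul, hf, hg, vComb, smul_add, Finset.sum_add_distrib, sub_mul,
      mul_sub, smul_mul_assoc, mul_smul_comm, Finset.sum_mul, Finset.mul_sum]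
    module

/-- The matrix 2vvᵀ − 1 is orthogonal, so contracting two families that transform like vectors gives
an invariant operator. The operators d, d*, x∧, x• and the Euler operator have this form, and so
does the grade up to sign. -/
theorem sg_comm_sum {r : ℕ} {v : ℕ → ℝ} (h : IsUVec r v)
    {A B : ℕ → Module.End 𝕂 (CPol 𝕂 m)} (hA : Covariant r v A) (hB : Covariant r v B)
    (f : CPol 𝕂 m) :
    sg 𝕂 m v (∑ i ∈ Finset.Icc 1 r, A i (B i f)) =
      ∑ i ∈ Finset.Icc 1 r, A i (B i (sg 𝕂 m v f)) := by
  set g := sg 𝕂 m v f with hg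
  set b := vComb 𝕂 r v fun i => B i g with hb
  have h2 : ∀ l, sg 𝕂 m v (A l (B l f)) = (4 * ((v l : 𝕂) * v l)) • vComb 𝕂 r v (fun i => A i b) -
      (2 : 𝕂) • ((v l : 𝕂) • vComb 𝕂 r v (fun i => A i (B l g))) - (2 : 𝕂) • ((v l : 𝕂) • A l b) +
        A l (B l g) := by
    intro l
    have h1 : vComb 𝕂 r v (fun i => A i ((2 * (v l : 𝕂)) • b - B l g)) =
        (2 * (v l : 𝕂)) • vComb 𝕂 r v (fun i => A i b) - vComb 𝕂 r v (fun i => A i (B l g)) := by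
      simp only [vComb, Finset.smul_sum, ← Finset.sum_sub_distrib]
      exact Finset.sum_congr rfl fun i _ => by rw [map_sub, map_smul]; module
    rw [hA, hB, ← hg, ← hb, h1, map_sub, map_smul]
    module
  rw [map_sum, Finset.sum_congr rfl fun l _ => h2 l, Finset.sum_add_distrib, Finset.sum_sub_distrib,
    Finset.sum_sub_distrib, ← Finset.sum_smul, ← Finset.mul_sum, h.sum_sq, ← Finset.smul_sum,
    ← Finset.smul_sum]
  have h3 : ∑ l ∈ Finset.Icc 1 r, (v l : 𝕂) • vComb 𝕂 r v (fun i => A i (B l g)) =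
      vComb 𝕂 r v (fun i => A i b) := by
    simp only [vComb, Finset.smul_sum, hb, map_sum, map_smul]
    rw [Finset.sum_comm]
    exact Finset.sum_congr rfl fun i _ => Finset.sum_congr rfl fun l _ => smul_comm _ _ _
  rw [h3]
  change _ - (2 : 𝕂) • vComb 𝕂 r v (fun i => A i b) + _ = _
  module

section

variable {r : ℕ} (hr : r ≤ m) {v : ℕ → ℝ} (h : IsUVec r v) (f : CPol 𝕂 m)

include hr h

theorem sg_extD : sg 𝕂 m v (extD 𝕂 m r f) = extD 𝕂 m r (sg 𝕂 m v f) := by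
  rw [extD_apply, extD_apply]; exact sg_comm_sum h (covariant_eps hr h) (covariant_pD hr h) f

theorem sg_coD : sg 𝕂 m v (coD 𝕂 m r f) = coD 𝕂 m r (sg 𝕂 m v f) := by
  rw [coD_apply, coD_apply]; exact sg_comm_sum h (covariant_kap hr h) (covariant_pD hr h) f

theorem sg_xWedge : sg 𝕂 m v (xWedge 𝕂 m r f) = xWedge 𝕂 m r (sg 𝕂 m v f) := by
  rw [xWedge_apply, xWedge_apply]; exact sg_comm_sum h (covariant_mulX hr h) (covariant_eps hr h) f

theorem sg_xDot : sg 𝕂 m v (xDot 𝕂 m r f) = xDot 𝕂 m r (sg 𝕂 m v f) := by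
  rw [xDot_apply, xDot_apply]; exact sg_comm_sum h (covariant_mulX hr h) (covariant_kap hr h) f

theorem sg_euler : sg 𝕂 m v (euler 𝕂 m r f) = euler 𝕂 m r (sg 𝕂 m v f) := by
  rw [euler_apply, euler_apply]; exact sg_comm_sum h (covariant_mulX hr h) (covariant_pD hr h) f

theorem sg_grade : sg 𝕂 m v (grade 𝕂 m r f) = grade 𝕂 m r (sg 𝕂 m v f) := by
  rw [grade_apply, grade_apply, map_neg]
  exact congrArg _ (sg_comm_sum h (covariant_eps hr h) (covariant_kap hr h) f)

end

theorem Covariant.of_lt {r : ℕ} {v : ℕ → ℝ} (h : IsUVec r v)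
    {A : ℕ → Module.End 𝕂 (CPol 𝕂 m)} (hA : Covariant r v A) {i : ℕ} (hi : r < i) (f : CPol 𝕂 m) :
    A i (sg 𝕂 m v f) = -sg 𝕂 m v (A i f) := by
  rw [hA, h.1 i (by rw [Finset.mem_Icc]; omega), RCLike.ofReal_zero, mul_zero, zero_smul, zero_sub,
    neg_neg]

theorem sg_mem_polSub {r : ℕ} (hr : r ≤ m) {v : ℕ → ℝ} (h : IsUVec r v) {f : CPol 𝕂 m}
    (hf : f ∈ polSub 𝕂 m r) : sg 𝕂 m v f ∈ polSub 𝕂 m r := by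
  intro i hi
  rw [(covariant_pD hr h).of_lt h hi, (covariant_kap hr h).of_lt h hi, (hf i hi).1, (hf i hi).2,
    map_zero, neg_zero]
  exact ⟨rfl, rfl⟩

theorem sg_mem_Hr {r : ℕ} (hr : r ≤ m) {v : ℕ → ℝ} (h : IsUVec r v) {t : ℤ} {k : ℕ} {f : CPol 𝕂 m}
    (hf : f ∈ Hr 𝕂 m r t k) : sg 𝕂 m v f ∈ Hr 𝕂 m r t k := by
  refine ⟨sg_mem_polSub hr h (Hr_le_polSub hf), ?_, ?_, ?_, ?_⟩
  · rw [← sg_euler hr h, hf.2.1, map_smul]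
  · rw [← sg_grade hr h, hf.2.2.1, map_smul]
  · rw [← sg_extD hr h, hf.2.2.2.1, map_zero]
  · rw [← sg_coD hr h, hf.2.2.2.2, map_zero]

/-! ### Equivariance of the embedding factors up to sign -/

theorem sg_vx_of_lt {r : ℕ} (hr : r ≤ m) {v : ℕ → ℝ} (h : IsUVec r v) {i : ℕ} (hi : r < i) :
    sg 𝕂 m v (vx 𝕂 m i) = -vx 𝕂 m i := by
  rw [sg_vx hr h, h.1 i (by rw [Finset.mem_Icc]; omega), RCLike.ofReal_zero, mul_zero, zero_smul,
    zero_sub]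

theorem sg_ve_of_lt {r : ℕ} (hr : r ≤ m) {v : ℕ → ℝ} (h : IsUVec r v) {i : ℕ} (hi : r < i) :
    sg 𝕂 m v (ve 𝕂 m i) = -ve 𝕂 m i := by
  rw [sg_ve hr h, h.1 i (by rw [Finset.mem_Icc]; omega), RCLike.ofReal_zero, mul_zero, zero_smul,
    zero_sub]

theorem xv_eq_xWedge_one (n : ℕ) : xv 𝕂 m n = xWedge 𝕂 m n 1 + xDot 𝕂 m n 1 := by
  rw [← xv_mul, mul_one]

theorem sg_xv {r : ℕ} (hr : r ≤ m) {v : ℕ → ℝ} (h : IsUVec r v) :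
    sg 𝕂 m v (xv 𝕂 m r) = xv 𝕂 m r := by
  rw [xv_eq_xWedge_one, map_add, sg_xWedge hr h, sg_xDot hr h, map_one]

theorem sg_rho {r : ℕ} (hr : r ≤ m) {v : ℕ → ℝ} (h : IsUVec r v) :
    sg 𝕂 m v (rho 𝕂 m r) = rho 𝕂 m r := by
  have h1 := xv_mul_xv (𝕂 := 𝕂) hr
  have h2 := congrArg (sg 𝕂 m v) h1
  rw [map_mul, sg_xv hr h, h1, map_neg, neg_inj] at h2
  exact h2.symm

theorem ofS_normSq (r : ℕ) : ofS 𝕂 m (normSq 𝕂 m r) = rho 𝕂 m r := by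
  rw [normSq, rho, map_sum]
  exact Finset.sum_congr rfl fun i _ => by rw [map_pow, pow_two, ofS_coord]

theorem rho_succ (n : ℕ) : rho 𝕂 m (n + 1) = rho 𝕂 m n + vx 𝕂 m (n + 1) * vx 𝕂 m (n + 1) := by
  rw [rho, rho, Finset.sum_Icc_succ_top (by omega)]

/-- A unit vector of ℝ^n fixes |x|² and changes the sign of x_{n+1}; each monomial contains x_{n+1}
to a power of the parity of p. -/
theorem sg_cF {n : ℕ} (hm : n + 1 ≤ m) {v : ℕ → ℝ} (h : IsUVec n v) (p : ℤ) (j : ℕ) :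
    sg 𝕂 m v (cF 𝕂 m (n + 1) p j) = ((-1 : 𝕂) ^ p) • cF 𝕂 m (n + 1) p j := by
  rcases lt_or_ge p 0 with hp | hp
  · rw [cF_of_neg _ hp, map_zero, smul_zero]
  · obtain ⟨p, rfl⟩ := Int.eq_ofNat_of_zero_le hp
    rw [cF_natCast, map_smul, smul_comm, zpow_natCast]
    congr 1
    rw [homGegenbauer, map_sum, map_sum, Finset.smul_sum]
    refine Finset.sum_congr rfl fun i hi => ?_
    rw [Finset.mem_range] at hi
    have hC : ∀ c : 𝕂, ofS 𝕂 m (MvPolynomial.C c) = algebraMap 𝕂 _ c := fun c =>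
      (ofS 𝕂 m).commutes c
    have hN : ofS 𝕂 m (∑ l ∈ Finset.Icc 1 (n + 1), coord 𝕂 m l ^ 2) = rho 𝕂 m (n + 1) :=
      ofS_normSq (n + 1)
    have hr : sg 𝕂 m v (rho 𝕂 m (n + 1)) = rho 𝕂 m (n + 1) := by
      rw [rho_succ, map_add, sg_rho (by omega) h, map_mul, sg_vx_of_lt (by omega) h (by omega),
        neg_mul_neg]
    simp only [map_mul, map_pow, hC, hN, hr, AlgHom.commutes, ofS_coord,
      sg_vx_of_lt (by omega : n ≤ m) h (by omega : n < n + 1), map_ofNat, mul_neg]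
    rw [neg_pow (2 * vx 𝕂 m (n + 1)), ← Algebra.smul_def, ← Algebra.smul_def]
    have h1 : ((-1 : CPol 𝕂 m)) ^ (p - 2 * i) = (-1 : 𝕂) ^ p • 1 := by
      have h2 : ((-1 : CPol 𝕂 m)) ^ (p - 2 * i) = (-1) ^ p := by
        obtain ⟨q, rfl⟩ : ∃ q, p = q + 2 * i := ⟨p - 2 * i, by omega⟩
        rw [Nat.add_sub_cancel, pow_add, pow_mul, neg_one_sq, one_pow, mul_one]
      have h3 : (-1 : CPol 𝕂 m) = algebraMap 𝕂 _ (-1) := by rw [map_neg, map_one]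
      rw [h2, h3, ← map_pow, Algebra.algebraMap_eq_smul_one]
    rw [h1]
    simp only [smul_mul_assoc, one_mul]
    rw [smul_comm]

theorem sg_XM {n : ℕ} (hm : n + 1 ≤ m) {v : ℕ → ℝ} (h : IsUVec n v) (p : ℤ) (j : ℕ) :
    sg 𝕂 m v (XM 𝕂 m n p j) = ((-1 : 𝕂) ^ p) • XM 𝕂 m n p j := by
  rw [XM_eq, map_add, map_smul, map_mul, map_mul, sg_cF hm h, sg_cF hm h, sg_xv (by omega) h,
    sg_ve_of_lt (by omega) h (by omega), zpow_sub_one₀ (by norm_num)]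
  simp only [mul_neg, smul_mul_assoc]
  norm_num
  module

/-- The factors `XM` and the powers of e_{n+1} contribute signs, the operators x∧ and x• none. The
second summand has both the degree of `XM` and the power of e_{n+1} shifted by one, so both summands
carry the same sign. -/
theorem sg_embL {n : ℕ} (hm : n + 1 ≤ m) {v : ℕ → ℝ} (h : IsUVec n v) {s t : ℤ} {k j : ℕ}
    (hst : t = s - 1 ∨ t = s) (f : CPol 𝕂 m) : sg 𝕂 m v (embL 𝕂 m s t n k j f) =
      ((-1 : 𝕂) ^ ((k : ℤ) - j + (s - t))) • embL 𝕂 m s t n k j (sg 𝕂 m v f) := by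
  have he : ∀ d : ℕ, sg 𝕂 m v (ve 𝕂 m (n + 1) ^ d * f) =
      (-1 : 𝕂) ^ d • (ve 𝕂 m (n + 1) ^ d * sg 𝕂 m v f) := by
    intro d
    rw [map_mul, map_pow, sg_ve_of_lt (by omega) h (by omega), neg_pow,
      ← neg_one_smul 𝕂 (1 : CPol 𝕂 m), smul_pow, one_pow, smul_mul_assoc, one_mul, smul_mul_assoc]
  have hz : (-1 : 𝕂) ≠ 0 := by norm_num
  have h1 : (-1 : 𝕂) ^ (s - t).toNat = (-1) ^ (s - t) := by
    rw [← zpow_natCast, Int.toNat_of_nonneg (by omega)]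
  have h2 : (-1 : 𝕂) ^ (s - t + 1).toNat = (-1) ^ (s - t + 1) := by
    rw [← zpow_natCast, Int.toNat_of_nonneg (by omega)]
  have h3 : (-1 : 𝕂) ^ ((k : ℤ) - 1 - j) = -(-1) ^ ((k : ℤ) - j) := by
    rw [show (k : ℤ) - 1 - j = k - j - 1 by ring, zpow_sub_one₀ hz]; norm_num
  have h4 : (-1 : 𝕂) ^ (s - t + 1) = -(-1) ^ (s - t) := by rw [zpow_add_one₀ hz]; norm_num
  rw [embL_apply, embL_apply]
  simp only [map_add, map_smul, map_mul (sg 𝕂 m v) (XM 𝕂 m n _ _), sg_XM hm h, he, sg_xWedge (by omega : n ≤ m) h,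
    sg_xDot (by omega : n ≤ m) h, smul_mul_assoc, mul_smul_comm, h1, h2, h3, h4, mul_add,
    zpow_add₀ hz]
  module

/-! ### Derivatives of curves with finitely many components -/

/-- The curve `c` lies in a finite-dimensional subspace, and its derivative at `0` is `c'`. -/
def IsDeriv (𝕂 : Type) [RCLike 𝕂] {M : Type} [AddCommGroup M] [Module 𝕂 M] (c : ℝ → M) (c' : M) :
    Prop :=
  ∃ (ι : Type) (_ : Fintype ι) (φ : ι → ℝ → ℝ) (φ' : ι → ℝ) (a : ι → M),
    (∀ l, HasDerivAt (φ l) (φ' l) 0) ∧ (∀ θ, c θ = ∑ l, ((φ l θ : ℝ) : 𝕂) • a l) ∧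
      c' = ∑ l, ((φ' l : ℝ) : 𝕂) • a l

namespace IsDeriv

variable {M N P : Type} [AddCommGroup M] [Module 𝕂 M] [AddCommGroup N] [Module 𝕂 N]
  [AddCommGroup P] [Module 𝕂 P]

theorem smul_const {φ : ℝ → ℝ} {φ' : ℝ} (h : HasDerivAt φ φ' 0) (a : M) :
    IsDeriv 𝕂 (fun θ => (φ θ : 𝕂) • a) ((φ' : 𝕂) • a) :=
  ⟨Unit, inferInstance, fun _ => φ, fun _ => φ', fun _ => a, fun _ => h, fun θ => by simp, by simp⟩

theorem const (a : M) : IsDeriv 𝕂 (fun _ => a) (0 : M) := by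
  have := smul_const (𝕂 := 𝕂) (hasDerivAt_const (0 : ℝ) (1 : ℝ)) a
  simpa using this

theorem add {c d : ℝ → M} {c' d' : M} (hc : IsDeriv 𝕂 c c') (hd : IsDeriv 𝕂 d d') :
    IsDeriv 𝕂 (fun θ => c θ + d θ) (c' + d') := by
  obtain ⟨ι, _, φ, φ', a, h1, h2, h3⟩ := hc
  obtain ⟨κ, _, ψ, ψ', b, g1, g2, g3⟩ := hd
  refine ⟨ι ⊕ κ, inferInstance, Sum.elim φ ψ, Sum.elim φ' ψ', Sum.elim a b, ?_, ?_, ?_⟩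
  · rintro (l | l)
    · exact h1 l
    · exact g1 l
  · intro θ
    rw [Fintype.sum_sum_type]
    exact congrArg₂ (· + ·) (h2 θ) (g2 θ)
  · rw [Fintype.sum_sum_type, h3, g3]; rfl

theorem map {c : ℝ → M} {c' : M} (hc : IsDeriv 𝕂 c c') (F : M →+ N)
    (hF : ∀ (r : ℝ) a, F ((r : 𝕂) • a) = (r : 𝕂) • F a) : IsDeriv 𝕂 (fun θ => F (c θ)) (F c') := by
  obtain ⟨ι, _, φ, φ', a, h1, h2, h3⟩ := hc
  refine ⟨ι, inferInstance, φ, φ', fun l => F (a l), h1, fun θ => ?_, ?_⟩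
  · change F (c θ) = _
    rw [h2, map_sum]; exact Finset.sum_congr rfl fun l _ => hF _ _
  · rw [h3, map_sum]; exact Finset.sum_congr rfl fun l _ => hF _ _

theorem linMap {c : ℝ → M} {c' : M} (hc : IsDeriv 𝕂 c c') (F : M →ₗ[𝕂] N) :
    IsDeriv 𝕂 (fun θ => F (c θ)) (F c') :=
  hc.map F.toAddMonoidHom fun r a => F.map_smul _ a

theorem bilin {c : ℝ → M} {c' : M} {d : ℝ → N} {d' : N} (hc : IsDeriv 𝕂 c c') (hd : IsDeriv 𝕂 d d')
    (b : M →+ N →+ P) (hl : ∀ (r : ℝ) x y, b ((r : 𝕂) • x) y = (r : 𝕂) • b x y)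
    (hr : ∀ (r : ℝ) x y, b x ((r : 𝕂) • y) = (r : 𝕂) • b x y) :
    IsDeriv 𝕂 (fun θ => b (c θ) (d θ)) (b c' (d 0) + b (c 0) d') := by
  obtain ⟨ι, _, φ, φ', a, h1, h2, h3⟩ := hc
  obtain ⟨κ, _, ψ, ψ', a', g1, g2, g3⟩ := hd
  have key : ∀ (f : ι → ℝ) (g : κ → ℝ), b (∑ l, (f l : 𝕂) • a l) (∑ l, (g l : 𝕂) • a' l) =
      ∑ p : ι × κ, ((f p.1 * g p.2 : ℝ) : 𝕂) • b (a p.1) (a' p.2) := by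
    intro f g
    rw [map_sum b, AddMonoidHom.finsetSum_apply, Fintype.sum_prod_type]
    refine Finset.sum_congr rfl fun i _ => ?_
    rw [map_sum]
    refine Finset.sum_congr rfl fun j _ => ?_
    rw [hl, hr, smul_smul, RCLike.ofReal_mul]
  refine ⟨ι × κ, inferInstance, fun p θ => φ p.1 θ * ψ p.2 θ,
    fun p => φ' p.1 * ψ p.2 0 + φ p.1 0 * ψ' p.2, fun p => b (a p.1) (a' p.2),
    fun p => (h1 p.1).mul (g1 p.2), fun θ => ?_, ?_⟩
  · change b (c θ) (d θ) = _
    rw [h2, g2, key]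
  · rw [h3, g3, h2, g2, key, key, ← Finset.sum_add_distrib]
    exact Finset.sum_congr rfl fun p _ => by rw [RCLike.ofReal_add, add_smul]

theorem hasDerivAt {c : ℝ → M} {c' : M} (hc : IsDeriv 𝕂 c c') (ψ : M →ₗ[𝕂] 𝕂) :
    HasDerivAt (fun θ => ψ (c θ)) (ψ c') 0 := by
  obtain ⟨ι, _, φ, φ', a, h1, h2, h3⟩ := hc
  simp only [h2, h3, map_sum, map_smul, smul_eq_mul]
  refine HasDerivAt.fun_sum fun l _ => ?_
  have := ((h1 l).smul_const (ψ (a l)))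
  simpa [RCLike.real_smul_eq_coe_mul] using this

/-- Linear functionals reduce the claim to ordinary derivatives and separate the points of the
space, so no topology on it is needed. -/
theorem unique {c : ℝ → M} {c' c'' : M} (h : IsDeriv 𝕂 c c') (h' : IsDeriv 𝕂 c c'') : c' = c'' := by
  rw [← sub_eq_zero, ← Module.forall_dual_apply_eq_zero_iff 𝕂]
  intro ψ
  rw [map_sub, (h.hasDerivAt ψ).unique (h'.hasDerivAt ψ), sub_self]

/-- In the quotient by W the curve is constantly zero, and so is its derivative. -/
theorem mem {c : ℝ → M} {c' : M} (h : IsDeriv 𝕂 c c') {W : Submodule 𝕂 M} (hW : ∀ θ, c θ ∈ W) :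
    c' ∈ W := by
  rw [← Submodule.Quotient.mk_eq_zero, ← Submodule.mkQ_apply]
  refine (h.linMap W.mkQ).unique ?_
  have : (fun θ => W.mkQ (c θ)) = fun _ => 0 := funext fun θ =>
    (Submodule.Quotient.mk_eq_zero W).2 (hW θ)
  rw [this]
  exact const 0

end IsDeriv

/-! ### The infinitesimal rotations -/

variable (𝕂 m) in
/-- The infinitesimal rotation in the plane of `e_i` and `e_j`. -/
def lie (i j : ℕ) : Module.End 𝕂 (CPol 𝕂 m) :=
  mulX 𝕂 m j * pD 𝕂 m i - mulX 𝕂 m i * pD 𝕂 m j + eps 𝕂 m i * kap 𝕂 m j - eps 𝕂 m j * kap 𝕂 m i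

theorem lie_apply (i j : ℕ) (f : CPol 𝕂 m) : lie 𝕂 m i j f =
    mulX 𝕂 m j (pD 𝕂 m i f) - mulX 𝕂 m i (pD 𝕂 m j f) + eps 𝕂 m i (kap 𝕂 m j f) -
      eps 𝕂 m j (kap 𝕂 m i f) := rfl

/-- The part acting on values is half the commutator with e_i e_j. Hence the operator is a
derivation, which its expression by `eps` and `kap` does not show; that expression is the convenient
one for the Casimir operator. -/
theorem lie_eq {i j : ℕ} (h : i ≠ j) (f : CPol 𝕂 m) : lie 𝕂 m i j f =
    vx 𝕂 m j * pD 𝕂 m i f - vx 𝕂 m i * pD 𝕂 m j f +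
      (1 / 2 : 𝕂) • (ve 𝕂 m i * ve 𝕂 m j * f - f * (ve 𝕂 m i * ve 𝕂 m j)) := by
  have h1 : ve 𝕂 m i * ve 𝕂 m j * f = eps 𝕂 m i (eps 𝕂 m j f) + eps 𝕂 m i (kap 𝕂 m j f) +
      kap 𝕂 m i (eps 𝕂 m j f) + kap 𝕂 m i (kap 𝕂 m j f) := by
    rw [mul_assoc, ve_mul_eq j, ve_mul_eq i, map_add, map_add]; abel
  have h2 : -(f * (ve 𝕂 m i * ve 𝕂 m j)) = eps 𝕂 m j (eps 𝕂 m i f) - eps 𝕂 m j (kap 𝕂 m i f) -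
      kap 𝕂 m j (eps 𝕂 m i f) + kap 𝕂 m j (kap 𝕂 m i f) := by
    have := inv_mul_ve_eq j (inv 𝕂 m f * ve 𝕂 m i)
    rw [map_mul, inv_inv, inv_ve, inv_mul_ve_eq i f, map_sub, map_sub] at this
    rw [← mul_assoc]
    simp only [mul_neg, neg_mul] at this
    rw [this]; abel
  rw [lie_apply, mulX_apply, mulX_apply, sub_eq_add_neg (ve 𝕂 m i * ve 𝕂 m j * f), h1, h2,
    eps_eps i j, kap_kap i j, kap_eps_of_ne h, kap_eps_of_ne (Ne.symm h)]
  module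

theorem lie_mul {i j : ℕ} (h : i ≠ j) (f g : CPol 𝕂 m) :
    lie 𝕂 m i j (f * g) = lie 𝕂 m i j f * g + f * lie 𝕂 m i j g := by
  simp only [lie_eq h, pD_mul, mul_add, add_mul, sub_mul, mul_sub, smul_mul_assoc, mul_smul_comm]
  simp only [← mul_assoc, vx_mul_comm _ f]
  module

theorem lie_one {i j : ℕ} (h : i ≠ j) : lie 𝕂 m i j 1 = 0 := by
  rw [lie_eq h, pD_one, pD_one]; simp

theorem lie_vx {i j : ℕ} (h : i ≠ j) (l : ℕ) :
    lie 𝕂 m i j (vx 𝕂 m l) = kron 𝕂 m i l • vx 𝕂 m j - kron 𝕂 m j l • vx 𝕂 m i := by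
  rw [lie_eq h, pD_vx_kron, pD_vx_kron, ← vx_mul_comm, sub_self, smul_zero, add_zero, mul_smul_comm,
    mul_smul_comm, mul_one, mul_one]

theorem lie_ve {i j : ℕ} (h : i ≠ j) (l : ℕ) :
    lie 𝕂 m i j (ve 𝕂 m l) = kron 𝕂 m i l • ve 𝕂 m j - kron 𝕂 m j l • ve 𝕂 m i := by
  have h1 := ve_mul_ve_add (𝕂 := 𝕂) (m := m) j l
  have h2 := ve_mul_ve_add (𝕂 := 𝕂) (m := m) i l
  have h3 : ve 𝕂 m i * ve 𝕂 m j * ve 𝕂 m l - ve 𝕂 m l * (ve 𝕂 m i * ve 𝕂 m j) =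
      ve 𝕂 m i * (ve 𝕂 m j * ve 𝕂 m l + ve 𝕂 m l * ve 𝕂 m j) -
        (ve 𝕂 m i * ve 𝕂 m l + ve 𝕂 m l * ve 𝕂 m i) * ve 𝕂 m j := by noncomm_ring
  rw [lie_eq h, pD_ve, pD_ve, mul_zero, mul_zero, sub_zero, zero_add, h3, h1, h2, mul_smul_comm,
    smul_mul_assoc, mul_one, one_mul]
  module

/-- The unit vector `cos θ e_i + sin θ e_j`. -/
def rv (i j : ℕ) (θ : ℝ) (l : ℕ) : ℝ := if l = i then Real.cos θ else if l = j then Real.sin θ else 0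

theorem sum_rv {M : Type*} [AddCommMonoid M] {r i j : ℕ} (hi : i ∈ Finset.Icc 1 r)
    (hj : j ∈ Finset.Icc 1 r) (h : i ≠ j) (g : ℕ → M) (hg : ∀ l, l ≠ i → l ≠ j → g l = 0) :
    ∑ l ∈ Finset.Icc 1 r, g l = g i + g j := by
  rw [← Finset.sum_pair h]
  refine (Finset.sum_subset ?_ fun l _ hl => hg l ?_ ?_).symm
  · intro l hl
    rw [Finset.mem_insert, Finset.mem_singleton] at hl
    rcases hl with rfl | rfl <;> assumption
  · rintro rfl; simp at hl
  · rintro rfl; simp at hl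

theorem rv_left (i j : ℕ) (θ : ℝ) : rv i j θ i = Real.cos θ := if_pos rfl

theorem rv_right {i j : ℕ} (h : i ≠ j) (θ : ℝ) : rv i j θ j = Real.sin θ := by
  rw [rv, if_neg (Ne.symm h), if_pos rfl]

theorem rv_of_ne {i j l : ℕ} (h : l ≠ i) (h' : l ≠ j) (θ : ℝ) : rv i j θ l = 0 := by
  rw [rv, if_neg h, if_neg h']

theorem isUVec_rv {r i j : ℕ} (hi : i ∈ Finset.Icc 1 r) (hj : j ∈ Finset.Icc 1 r) (h : i ≠ j)
    (θ : ℝ) : IsUVec r (rv i j θ) := by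
  refine ⟨fun l hl => rv_of_ne (by rintro rfl; exact hl hi) (by rintro rfl; exact hl hj) θ, ?_⟩
  rw [sum_rv hi hj h _ fun l h1 h2 => by rw [rv_of_ne h1 h2, zero_pow two_ne_zero], rv_left,
    rv_right h, Real.cos_sq_add_sin_sq]

theorem vComb_rv {M : Type*} [AddCommMonoid M] [Module 𝕂 M] {r i j : ℕ} (hi : i ∈ Finset.Icc 1 r)
    (hj : j ∈ Finset.Icc 1 r) (h : i ≠ j) (θ : ℝ) (A : ℕ → M) :
    vComb 𝕂 r (rv i j θ) A = (Real.cos θ : 𝕂) • A i + (Real.sin θ : 𝕂) • A j := by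
  rw [vComb, sum_rv hi hj h _ fun l h1 h2 => by rw [rv_of_ne h1 h2, RCLike.ofReal_zero, zero_smul],
    rv_left, rv_right h]

variable (𝕂 m) in
/-- The rotation by the angle `2 θ` in the plane of `e_i` and `e_j`. -/
def rot (i j : ℕ) (θ : ℝ) : CPol 𝕂 m →ₐ[𝕂] CPol 𝕂 m :=
  (sg 𝕂 m (rv i j θ)).comp (sg 𝕂 m (rv i j 0))

/-- The product of two reflections whose axes enclose the angle θ is the rotation by 2θ. Its entries
are explicit trigonometric functions, and the doubled angle gives the factor 2 in the derivative. -/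
theorem isDeriv_rot_generator {r i j : ℕ} (hi : i ∈ Finset.Icc 1 r)
    (hj : j ∈ Finset.Icc 1 r) (h : i ≠ j) (hr : r ≤ m) (A : ℕ → CPol 𝕂 m)
    (hA : ∀ θ l, sg 𝕂 m (rv i j θ) (A l) =
      (2 * (rv i j θ l : 𝕂)) • vComb 𝕂 r (rv i j θ) A - A l) (l : ℕ) :
    IsDeriv 𝕂 (fun θ => rot 𝕂 m i j θ (A l))
      ((2 : 𝕂) • (kron 𝕂 m i l • A j - kron 𝕂 m j l • A i)) := by
  have him : 1 ≤ i ∧ i ≤ m := by rw [Finset.mem_Icc] at hi; omega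
  have hjm : 1 ≤ j ∧ j ≤ m := by rw [Finset.mem_Icc] at hj; omega
  have hcc : HasDerivAt (fun θ : ℝ => 2 * (Real.cos θ * Real.cos θ) - 1) 0 0 := by
    have := (((Real.hasDerivAt_cos 0).mul (Real.hasDerivAt_cos 0)).const_mul 2).sub_const 1
    simpa using this
  have hcs : HasDerivAt (fun θ : ℝ => 2 * (Real.cos θ * Real.sin θ)) 2 0 := by
    have := (((Real.hasDerivAt_cos 0).mul (Real.hasDerivAt_sin 0)).const_mul 2)
    simpa using this
  have hss : HasDerivAt (fun θ : ℝ => 1 - 2 * (Real.sin θ * Real.sin θ)) 0 0 := by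
    have := (((Real.hasDerivAt_sin 0).mul (Real.hasDerivAt_sin 0)).const_mul 2).const_sub 1
    simpa using this
  by_cases hli : l = i
  · subst hli
    have h1 : (fun θ => rot 𝕂 m l j θ (A l)) = fun θ =>
        ((2 * (Real.cos θ * Real.cos θ) - 1 : ℝ) : 𝕂) • A l +
          ((2 * (Real.cos θ * Real.sin θ) : ℝ) : 𝕂) • A j := by
      funext θ
      rw [rot, AlgHom.comp_apply, hA 0, vComb_rv hi hj h, rv_left, Real.cos_zero, Real.sin_zero,
        RCLike.ofReal_one, RCLike.ofReal_zero, zero_smul, add_zero, one_smul, mul_one, map_sub,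
        map_smul, hA θ, vComb_rv hi hj h, rv_left]
      push_cast
      module
    rw [h1, kron_self him.1 him.2, kron_of_ne (Ne.symm h)]
    have := (IsDeriv.smul_const (𝕂 := 𝕂) hcc (A l)).add (IsDeriv.smul_const (𝕂 := 𝕂) hcs (A j))
    rw [RCLike.ofReal_zero, zero_smul, zero_add, RCLike.ofReal_ofNat] at this
    rwa [one_smul, zero_smul, sub_zero]
  · by_cases hlj : l = j
    · subst hlj
      have h1 : (fun θ => rot 𝕂 m i l θ (A l)) = fun θ =>
          ((1 - 2 * (Real.sin θ * Real.sin θ) : ℝ) : 𝕂) • A l +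
            ((2 * (Real.cos θ * Real.sin θ) : ℝ) : 𝕂) • (-A i) := by
        funext θ
        rw [rot, AlgHom.comp_apply, hA 0, rv_right h, Real.sin_zero,
          RCLike.ofReal_zero, mul_zero, zero_smul, zero_sub, map_neg, hA θ, vComb_rv hi hj h,
          rv_right h]
        push_cast
        module
      rw [h1, kron_self hjm.1 hjm.2, kron_of_ne h]
      have := (IsDeriv.smul_const (𝕂 := 𝕂) hss (A l)).add (IsDeriv.smul_const (𝕂 := 𝕂) hcs (-A i))
      rw [RCLike.ofReal_zero, zero_smul, zero_add, RCLike.ofReal_ofNat] at this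
      rwa [one_smul, zero_smul, zero_sub]
    · have h1 : (fun θ => rot 𝕂 m i j θ (A l)) = fun θ => A l := by
        funext θ
        rw [rot, AlgHom.comp_apply, hA 0, rv_of_ne hli hlj, RCLike.ofReal_zero, mul_zero, zero_smul,
          zero_sub, map_neg, hA θ, rv_of_ne hli hlj, RCLike.ofReal_zero, mul_zero, zero_smul,
          zero_sub, neg_neg]
      rw [h1, kron_of_ne (Ne.symm hli), kron_of_ne (Ne.symm hlj), zero_smul, zero_smul, sub_zero,
        smul_zero]
      exact IsDeriv.const _

theorem rot_zero {r i j : ℕ} (hi : i ∈ Finset.Icc 1 r) (hj : j ∈ Finset.Icc 1 r) (h : i ≠ j)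
    (hr : r ≤ m) (f : CPol 𝕂 m) : rot 𝕂 m i j 0 f = f := sg_sg hr (isUVec_rv hi hj h 0) f

/-- Rotations are algebra homomorphisms and infinitesimal rotations are derivations, so the product
rule reduces the claim to the generators. -/
theorem isDeriv_rot {r i j : ℕ} (hi : i ∈ Finset.Icc 1 r) (hj : j ∈ Finset.Icc 1 r) (h : i ≠ j)
    (hr : r ≤ m) (f : CPol 𝕂 m) :
    IsDeriv 𝕂 (fun θ => rot 𝕂 m i j θ f) ((2 : 𝕂) • lie 𝕂 m i j f) := by
  induction f using cpol_induction with
  | scalar c =>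
    simp only [Algebra.algebraMap_eq_smul_one, map_smul, map_one, lie_one h, smul_zero]
    exact IsDeriv.const (𝕂 := 𝕂) (c • (1 : CPol 𝕂 m))
  | x l _ _ =>
    rw [lie_vx h]
    exact isDeriv_rot_generator hi hj h hr _ (fun θ => sg_vx hr (isUVec_rv hi hj h θ)) l
  | e l _ _ =>
    rw [lie_ve h]
    exact isDeriv_rot_generator hi hj h hr _ (fun θ => sg_ve hr (isUVec_rv hi hj h θ)) l
  | add f g hf hg =>
    simp only [map_add, smul_add]
    exact hf.add hg
  | mul f g hf hg =>
    have := hf.bilin hg (AddMonoidHom.mul (R := CPol 𝕂 m)) (fun r x y => smul_mul_assoc _ x y)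
      (fun r x y => mul_smul_comm _ x y)
    simp only [AddMonoidHom.mul_apply, rot_zero hi hj h hr] at this
    simp only [map_mul, lie_mul h]
    rw [smul_add, ← smul_mul_assoc, ← mul_smul_comm (2 : 𝕂) f]
    exact this

/-- Invariant subspaces are stable under the infinitesimal rotations. -/
theorem lie_mem {r i j : ℕ} (hi : i ∈ Finset.Icc 1 r) (hj : j ∈ Finset.Icc 1 r)
    (hr : r ≤ m) {W : Submodule 𝕂 (CPol 𝕂 m)} (hW : ∀ v, IsUVec r v → ∀ f ∈ W, sg 𝕂 m v f ∈ W)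
    {f : CPol 𝕂 m} (hf : f ∈ W) : lie 𝕂 m i j f ∈ W := by
  by_cases h : i = j
  · subst h
    rw [show lie 𝕂 m i i f = 0 by rw [lie_apply]; abel]
    exact zero_mem _
  · have := (isDeriv_rot hi hj h hr f).mem (W := W) fun θ =>
      hW _ (isUVec_rv hi hj h θ) _ (hW _ (isUVec_rv hi hj h 0) _ hf)
    simpa using W.smul_mem (2⁻¹ : 𝕂) this

/-! ### The Casimir operator -/

variable (𝕂 m) in
/-- The Casimir operator of the rotations of `ℝ^r`. -/
def casimir (r : ℕ) : Module.End 𝕂 (CPol 𝕂 m) :=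
  ∑ i ∈ Finset.Icc 1 r, ∑ j ∈ Finset.Icc 1 r, lie 𝕂 m i j * lie 𝕂 m i j

theorem casimir_apply (r : ℕ) (f : CPol 𝕂 m) : casimir 𝕂 m r f =
    ∑ i ∈ Finset.Icc 1 r, ∑ j ∈ Finset.Icc 1 r, lie 𝕂 m i j (lie 𝕂 m i j f) := by
  simp only [casimir, LinearMap.sum_apply, Module.End.mul_apply]

variable (𝕂 m) in
/-- Half of an infinitesimal rotation. -/
def gl (i j : ℕ) : Module.End 𝕂 (CPol 𝕂 m) := mulX 𝕂 m j * pD 𝕂 m i + eps 𝕂 m i * kap 𝕂 m j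

theorem gl_apply (i j : ℕ) (f : CPol 𝕂 m) :
    gl 𝕂 m i j f = mulX 𝕂 m j (pD 𝕂 m i f) + eps 𝕂 m i (kap 𝕂 m j f) := rfl

theorem lie_eq_gl (i j : ℕ) (f : CPol 𝕂 m) : lie 𝕂 m i j f = gl 𝕂 m i j f - gl 𝕂 m j i f := by
  rw [lie_apply, gl_apply, gl_apply]; abel

theorem casimir_eq_gl (r : ℕ) (f : CPol 𝕂 m) : casimir 𝕂 m r f =
    (2 : 𝕂) • (∑ i ∈ Finset.Icc 1 r, ∑ j ∈ Finset.Icc 1 r, gl 𝕂 m i j (gl 𝕂 m i j f) -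
      ∑ i ∈ Finset.Icc 1 r, ∑ j ∈ Finset.Icc 1 r, gl 𝕂 m i j (gl 𝕂 m j i f)) := by
  have h1 : ∑ i ∈ Finset.Icc 1 r, ∑ j ∈ Finset.Icc 1 r, gl 𝕂 m j i (gl 𝕂 m j i f) =
      ∑ i ∈ Finset.Icc 1 r, ∑ j ∈ Finset.Icc 1 r, gl 𝕂 m i j (gl 𝕂 m i j f) := Finset.sum_comm
  have h2 : ∑ i ∈ Finset.Icc 1 r, ∑ j ∈ Finset.Icc 1 r, gl 𝕂 m j i (gl 𝕂 m i j f) =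
      ∑ i ∈ Finset.Icc 1 r, ∑ j ∈ Finset.Icc 1 r, gl 𝕂 m i j (gl 𝕂 m j i f) := Finset.sum_comm
  rw [casimir_apply]
  simp only [lie_eq_gl, map_sub, Finset.sum_sub_distrib]
  rw [h1, h2]
  module

section

variable {r : ℕ} (hr : r ≤ m) {t : ℤ} {k : ℕ} {f : CPol 𝕂 m} (hf : f ∈ Hr 𝕂 m r t k)

include hr hf

theorem lapl_of_mem : ∑ i ∈ Finset.Icc 1 r, pD 𝕂 m i (pD 𝕂 m i f) = 0 := by
  have h := LinearMap.congr_fun (extD_coD (𝕂 := 𝕂) hr) f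
  simp only [LinearMap.add_apply, Module.End.mul_apply, hf.2.2.2.1, hf.2.2.2.2, map_zero, add_zero,
    LinearMap.neg_apply] at h
  rw [zero_eq_neg] at h
  simpa [lapl, LinearMap.sum_apply, Module.End.mul_apply] using h

/-- This and the following five lemmas evaluate on a solution the contractions that occur when the
squares in the Casimir operator are expanded: orbital terms, spin terms and mixed terms. Here the
Laplace equation removes the second order part. -/
theorem sum_xdxd : ∑ i ∈ Finset.Icc 1 r, ∑ j ∈ Finset.Icc 1 r,
    mulX 𝕂 m j (pD 𝕂 m i (mulX 𝕂 m j (pD 𝕂 m i f))) = (k : 𝕂) • f := by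
  simp only [pD_mulX, map_add, map_smul, Finset.sum_add_distrib]
  rw [Finset.sum_comm]
  simp only [← map_sum, lapl_of_mem hr hf, map_zero, Finset.sum_const_zero, zero_add]
  rw [← hf.2.1, euler_apply]
  exact Finset.sum_congr rfl fun i hi => sum_kron_smul hr hi fun j => mulX 𝕂 m j (pD 𝕂 m i f)

theorem sum_xdxd' : ∑ i ∈ Finset.Icc 1 r, ∑ j ∈ Finset.Icc 1 r,
    mulX 𝕂 m j (pD 𝕂 m i (mulX 𝕂 m i (pD 𝕂 m j f))) = ((k : 𝕂) * k - k + r * k) • f := by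
  simp only [pD_mulX, map_add, map_smul, Finset.sum_add_distrib]
  have h1 : ∀ j ∈ Finset.Icc 1 r, ∑ i ∈ Finset.Icc 1 r, mulX 𝕂 m j (mulX 𝕂 m i (pD 𝕂 m i (pD 𝕂 m j f))) =
      ((k : 𝕂) - 1) • mulX 𝕂 m j (pD 𝕂 m j f) := by
    intro j hj
    rw [← map_sum, ← euler_apply, pD_euler hr hj, hf.2.1, map_smul, map_sub, map_smul]
    module
  have h2 : ∀ i ∈ Finset.Icc 1 r, ∑ j ∈ Finset.Icc 1 r, kron 𝕂 m i i • mulX 𝕂 m j (pD 𝕂 m j f) =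
      (k : 𝕂) • f := by
    intro i hi
    rw [Finset.mem_Icc] at hi
    rw [← Finset.smul_sum, ← euler_apply, kron_self (by omega) (by omega), one_smul, hf.2.1]
  rw [Finset.sum_comm, Finset.sum_congr rfl h1, Finset.sum_congr rfl h2, ← Finset.smul_sum,
    ← euler_apply, hf.2.1, Finset.sum_const, Nat.card_Icc, Nat.add_sub_cancel, ← Nat.cast_smul_eq_nsmul 𝕂]
  module

theorem sum_ekek : ∑ i ∈ Finset.Icc 1 r, ∑ j ∈ Finset.Icc 1 r,
    eps 𝕂 m i (kap 𝕂 m j (eps 𝕂 m i (kap 𝕂 m j f))) = (t : 𝕂) • f := by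
  have h1 : ∀ i ∈ Finset.Icc 1 r, ∑ j ∈ Finset.Icc 1 r,
      eps 𝕂 m i (kap 𝕂 m j (eps 𝕂 m i (kap 𝕂 m j f))) = -eps 𝕂 m i (kap 𝕂 m i f) := by
    intro i hi
    rw [← sum_kron_smul (𝕂 := 𝕂) hr hi fun j => eps 𝕂 m i (kap 𝕂 m j f), ← Finset.sum_neg_distrib]
    refine Finset.sum_congr rfl fun j _ => ?_
    rw [kap_eps, map_sub, map_neg, eps_eps_self, map_smul]
    abel
  rw [← hf.2.2.1, grade_apply, ← Finset.sum_neg_distrib]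
  exact Finset.sum_congr rfl h1

theorem sum_ekek' : ∑ i ∈ Finset.Icc 1 r, ∑ j ∈ Finset.Icc 1 r,
    eps 𝕂 m i (kap 𝕂 m j (eps 𝕂 m j (kap 𝕂 m i f))) = (-(t : 𝕂) * t + t + r * t) • f := by
  have h1 : ∀ i ∈ Finset.Icc 1 r, ∑ j ∈ Finset.Icc 1 r,
      eps 𝕂 m i (kap 𝕂 m j (eps 𝕂 m j (kap 𝕂 m i f))) =
        ((t : 𝕂) - 1 - r) • eps 𝕂 m i (kap 𝕂 m i f) := by
    intro i hi
    have h2 : ∀ j ∈ Finset.Icc 1 r, eps 𝕂 m i (kap 𝕂 m j (eps 𝕂 m j (kap 𝕂 m i f))) =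
        -eps 𝕂 m i (eps 𝕂 m j (kap 𝕂 m j (kap 𝕂 m i f))) - eps 𝕂 m i (kap 𝕂 m i f) := by
      intro j hj
      rw [Finset.mem_Icc] at hj
      rw [kap_eps_self (by omega) (by omega), map_sub, map_neg]
    rw [Finset.sum_congr rfl h2, Finset.sum_sub_distrib, Finset.sum_neg_distrib, ← map_sum, ← map_neg,
      ← grade_apply, grade_kap hr hi, hf.2.2.1, Finset.sum_const, Nat.card_Icc, Nat.add_sub_cancel,
      ← Nat.cast_smul_eq_nsmul 𝕂, map_smul, map_sub, map_smul]
    module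
  have h3 : ∑ i ∈ Finset.Icc 1 r, eps 𝕂 m i (kap 𝕂 m i f) = -((t : 𝕂) • f) := by
    rw [← hf.2.2.1, grade_apply, neg_neg]
  rw [Finset.sum_congr rfl h1, ← Finset.smul_sum, h3]
  module

theorem sum_xdek : ∑ i ∈ Finset.Icc 1 r, ∑ j ∈ Finset.Icc 1 r,
    mulX 𝕂 m j (pD 𝕂 m i (eps 𝕂 m i (kap 𝕂 m j f))) = -(k : 𝕂) • f := by
  have h1 : ∀ i ∈ Finset.Icc 1 r, eps 𝕂 m i (pD 𝕂 m i (xDot 𝕂 m r f)) =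
      ∑ j ∈ Finset.Icc 1 r, mulX 𝕂 m j (pD 𝕂 m i (eps 𝕂 m i (kap 𝕂 m j f))) +
        eps 𝕂 m i (kap 𝕂 m i f) := by
    intro i hi
    rw [xDot_apply, map_sum, map_sum, ← sum_kron_smul (𝕂 := 𝕂) hr hi fun j => eps 𝕂 m i (kap 𝕂 m j f),
      ← Finset.sum_add_distrib]
    refine Finset.sum_congr rfl fun j _ => ?_
    rw [pD_mulX, map_add, map_smul, pD_eps, mulX_eps]
  have h2 := extD_xDot_of_mem hr hf
  have h3 : ∑ i ∈ Finset.Icc 1 r, eps 𝕂 m i (kap 𝕂 m i f) = -((t : 𝕂) • f) := by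
    rw [← hf.2.2.1, grade_apply, neg_neg]
  rw [extD_apply, Finset.sum_congr rfl h1, Finset.sum_add_distrib, h3] at h2
  linear_combination (norm := module) h2

theorem sum_xdek' : ∑ i ∈ Finset.Icc 1 r, ∑ j ∈ Finset.Icc 1 r,
    mulX 𝕂 m j (pD 𝕂 m i (eps 𝕂 m j (kap 𝕂 m i f))) = 0 := by
  rw [Finset.sum_comm]
  refine Finset.sum_eq_zero fun j _ => ?_
  simp only [pD_eps, pD_kap]
  rw [← map_sum, ← map_sum, ← coD_apply, hf.2.2.2.2, map_zero, map_zero]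

/-- The squares gl_ij gl_ij contribute k − 2k + t. The products gl_ij gl_ji contribute k² − k + rk −
t² + t + rt, with no mixed term because d*f = 0. Twice the difference is the eigenvalue. -/
theorem casimir_of_mem :
    casimir 𝕂 m r f = (-2 * ((k : 𝕂) * (k + r) + t * (r - t))) • f := by
  have hc : ∀ i j a b, eps 𝕂 m i (kap 𝕂 m j (mulX 𝕂 m a (pD 𝕂 m b f))) =
      mulX 𝕂 m a (pD 𝕂 m b (eps 𝕂 m i (kap 𝕂 m j f))) := by
    intro i j a b
    rw [pD_eps, pD_kap, mulX_eps, mulX_kap]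
  have h1 := sum_xdek' hr hf
  have h2 : ∑ i ∈ Finset.Icc 1 r, ∑ j ∈ Finset.Icc 1 r,
      mulX 𝕂 m i (pD 𝕂 m j (eps 𝕂 m i (kap 𝕂 m j f))) = 0 := by rw [Finset.sum_comm]; exact h1
  rw [casimir_eq_gl]
  simp only [gl_apply, map_add, hc, Finset.sum_add_distrib]
  rw [h1, h2, sum_xdxd hr hf, sum_xdxd' hr hf, sum_ekek hr hf, sum_ekek' hr hf, sum_xdek hr hf]
  module

end

/-! ### The reflection-like element that distinguishes equivalent rotation modules -/

/-- The basis vector `e_i` as a sequence. -/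
def bv (i l : ℕ) : ℝ := if l = i then 1 else 0

theorem isUVec_bv {r i : ℕ} (hi : i ∈ Finset.Icc 1 r) : IsUVec r (bv i) := by
  refine ⟨fun l hl => if_neg (by rintro rfl; exact hl hi), ?_⟩
  rw [Finset.sum_eq_single_of_mem i hi fun l _ hl => by rw [bv, if_neg hl, zero_pow two_ne_zero],
    bv, if_pos rfl, one_pow]

variable (𝕂 m) in
/-- The action of `e_1 ⋯ e_r`. -/
def omg : ℕ → (CPol 𝕂 m →ₐ[𝕂] CPol 𝕂 m)
  | 0 => AlgHom.id 𝕂 _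
  | r + 1 => (omg r).comp (sg 𝕂 m (bv (r + 1)))

theorem omg_mem {r n : ℕ} (hrn : r ≤ n) {W : Submodule 𝕂 (CPol 𝕂 m)}
    (hW : ∀ v, IsUVec n v → ∀ f ∈ W, sg 𝕂 m v f ∈ W) {f : CPol 𝕂 m} (hf : f ∈ W) :
    omg 𝕂 m r f ∈ W := by
  induction r generalizing f with
  | zero => exact hf
  | succ r ih =>
    exact ih (by omega) (hW _ (isUVec_bv (by rw [Finset.mem_Icc]; omega)) f hf)

theorem sg_bv_generator {i : ℕ} (hi : i ∈ Finset.Icc 1 m) (l : ℕ) :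
    sg 𝕂 m (bv i) (vx 𝕂 m l) = (if l = i then (1 : 𝕂) else -1) • vx 𝕂 m l ∧
      sg 𝕂 m (bv i) (ve 𝕂 m l) = (if l = i then (1 : 𝕂) else -1) • ve 𝕂 m l := by
  have h := isUVec_bv hi
  have hv : ∀ A : ℕ → CPol 𝕂 m, vComb 𝕂 m (bv i) A = A i := fun A => by
    rw [vComb, Finset.sum_eq_single_of_mem i hi fun l _ hl => by
      rw [bv, if_neg hl, RCLike.ofReal_zero, zero_smul], bv, if_pos rfl, RCLike.ofReal_one, one_smul]
  rw [sg_vx le_rfl h, sg_ve le_rfl h, hv, hv]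
  by_cases hl : l = i
  · subst hl
    rw [bv, if_pos rfl, if_pos rfl, RCLike.ofReal_one]
    constructor <;> module
  · rw [bv, if_neg hl, if_neg hl, RCLike.ofReal_zero]
    constructor <;> module

/-- Each of the r factors fixes its own direction and reverses all others. A direction with index at
most r is thus reversed r − 1 times, any other one r times. -/
theorem omg_generator {r : ℕ} (hr : r ≤ m) (l : ℕ) (hl : 1 ≤ l) :
    omg 𝕂 m r (vx 𝕂 m l) = (if l ≤ r then (-1 : 𝕂) ^ (r + 1) else (-1) ^ r) • vx 𝕂 m l ∧
      omg 𝕂 m r (ve 𝕂 m l) = (if l ≤ r then (-1 : 𝕂) ^ (r + 1) else (-1) ^ r) • ve 𝕂 m l := by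
  induction r with
  | zero =>
    rw [if_neg (by omega), pow_zero, one_smul, one_smul]
    exact ⟨rfl, rfl⟩
  | succ r ih =>
    obtain ⟨h1, h2⟩ := sg_bv_generator (𝕂 := 𝕂) (i := r + 1) (m := m) (by rw [Finset.mem_Icc]; omega) l
    obtain ⟨h3, h4⟩ := ih (by omega)
    have key : (if l = r + 1 then (1 : 𝕂) else -1) * (if l ≤ r then (-1 : 𝕂) ^ (r + 1) else (-1) ^ r) =
        if l ≤ r + 1 then (-1 : 𝕂) ^ (r + 1 + 1) else (-1) ^ (r + 1) := by
      by_cases ha : l = r + 1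
      · rw [if_pos ha, if_neg (by omega), if_pos (by omega)]; ring
      · by_cases hb : l ≤ r
        · rw [if_neg ha, if_pos hb, if_pos (by omega)]; ring
        · rw [if_neg ha, if_neg hb, if_neg (by omega)]; ring
    rw [omg, AlgHom.comp_apply, AlgHom.comp_apply, h1, h2, map_smul, map_smul, h3, h4, smul_smul,
      smul_smul, key]
    exact ⟨rfl, rfl⟩

/-! ### Independent families of subspaces -/

/-- If the smaller spaces already span and the larger ones are independent, then nothing can be
added. This serves to identify concrete descriptions, such as homogeneity, with eigenspaces. -/
theorem eq_of_le_of_iSupIndep {ι M : Type*} [AddCommGroup M] [Module 𝕂 M]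
    {V W : ι → Submodule 𝕂 M} (hle : ∀ i, V i ≤ W i) (hW : iSupIndep W) (hV : ⨆ i, V i = ⊤) (i : ι) :
    W i = V i := by
  refine le_antisymm (fun f hf => ?_) (hle i)
  have h1 : f ∈ V i ⊔ ⨆ (j) (_ : j ≠ i), V j := by
    have : (⊤ : Submodule 𝕂 M) ≤ V i ⊔ ⨆ (j) (_ : j ≠ i), V j := by
      rw [← hV]
      refine iSup_le fun j => ?_
      by_cases h : j = i
      · subst h; exact le_sup_left
      · exact le_sup_of_le_right (le_iSup₂_of_le j h le_rfl)
    exact this trivial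
  obtain ⟨g, hg, g', hg', rfl⟩ := Submodule.mem_sup.1 h1
  have h2 : g' ∈ W i := by simpa using sub_mem hf (hle i hg)
  have h3 : g' = 0 := by
    have := (hW i).le_bot ⟨h2, (iSup₂_mono fun j _ => hle j) hg'⟩
    exact (Submodule.mem_bot 𝕂).1 this
  rw [h3, add_zero]
  exact hg

/-- A family of maps that is jointly injective reflects independence. Evaluation at all points is
such a family. -/
theorem iSupIndep_of_map_le {ι κ M N : Type*} [AddCommGroup M] [Module 𝕂 M] [AddCommGroup N]
    [Module 𝕂 N] (φ : κ → M →ₗ[𝕂] N) (hφ : ∀ f, (∀ p, φ p f = 0) → f = 0)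
    {V : ι → Submodule 𝕂 M} {W : ι → Submodule 𝕂 N} (hVW : ∀ p i, ∀ f ∈ V i, φ p f ∈ W i)
    (hW : iSupIndep W) : iSupIndep V := by
  intro i
  rw [Submodule.disjoint_def]
  intro f hf hf'
  refine hφ f fun p => ?_
  have h1 : (⨆ (j) (_ : j ≠ i), V j) ≤ (⨆ (j) (_ : j ≠ i), W j).comap (φ p) :=
    iSup₂_le fun j hj g hg => (le_iSup₂_of_le (f := fun j (_ : j ≠ i) => W j) j hj le_rfl) (hVW p j g hg)
  exact Submodule.disjoint_def.1 (hW i) _ (hVW p i f hf) (h1 hf')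

theorem iSupIndep_eigenspace {ι M : Type*} [AddCommGroup M] [Module 𝕂 M] (A : Module.End 𝕂 M)
    {c : ι → 𝕂} (hc : Function.Injective c) : iSupIndep fun i => Module.End.eigenspace A (c i) :=
  (Module.End.eigenspaces_iSupIndep A).comp hc

/-! ### The products of basis vectors -/

/-- The product `e_{i₁} ⋯ e_{i_s}` for `S = {i₁ < ⋯ < i_s}`. -/
def eProd (m : ℕ) (S : Finset ℕ) : RCl m := ((S.sort (· ≤ ·)).map (realE m)).prod

theorem eProd_empty : eProd m ∅ = 1 := by simp [eProd]

theorem eProd_insert {i : ℕ} {S : Finset ℕ} (h : ∀ j ∈ S, i < j) :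
    eProd m (insert i S) = realE m i * eProd m S := by
  rw [eProd, Finset.sort_insert _ (fun j hj => (h j hj).le) fun hi => lt_irrefl i (h i hi),
    List.map_cons, List.prod_cons, eProd]

/-- The span of the products of basis vectors `e_i`, `i > c`. -/
def eSpan (m c : ℕ) : Submodule ℝ (RCl m) :=
  Submodule.span ℝ {a | ∃ S : Finset ℕ, S ⊆ Finset.Icc (c + 1) m ∧ a = eProd m S}

theorem eProd_mem {c : ℕ} {S : Finset ℕ} (h : S ⊆ Finset.Icc (c + 1) m) : eProd m S ∈ eSpan m c :=
  Submodule.subset_span ⟨S, h, rfl⟩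

theorem eSpan_mono (c : ℕ) : eSpan m (c + 1) ≤ eSpan m c :=
  Submodule.span_mono fun _ ⟨S, h, ha⟩ =>
    ⟨S, h.trans (Finset.Icc_subset_Icc_left (by omega)), ha⟩

theorem mul_mem_eSpan {c : ℕ} {i : ℕ} {W : Submodule ℝ (RCl m)}
    (h : ∀ S : Finset ℕ, S ⊆ Finset.Icc (c + 1) m → realE m i * eProd m S ∈ W) {a : RCl m}
    (ha : a ∈ eSpan m c) : realE m i * a ∈ W := by
  have : eSpan m c ≤ W.comap (LinearMap.mulLeft ℝ (realE m i)) := by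
    refine Submodule.span_le.2 ?_
    rintro _ ⟨S, hS, rfl⟩
    exact h S hS
  exact this ha

theorem eq_insert_of_mem {c : ℕ} {S : Finset ℕ} (hS : S ⊆ Finset.Icc (c + 1) m) (h : c + 1 ∈ S) :
    ∃ S', S' ⊆ Finset.Icc (c + 2) m ∧ S = insert (c + 1) S' := by
  refine ⟨S.erase (c + 1), fun j hj => ?_, (Finset.insert_erase h).symm⟩
  rw [Finset.mem_erase] at hj
  have := Finset.mem_Icc.1 (hS hj.2)
  rw [Finset.mem_Icc]; omega

theorem subset_of_not_mem {c : ℕ} {S : Finset ℕ} (hS : S ⊆ Finset.Icc (c + 1) m) (h : c + 1 ∉ S) :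
    S ⊆ Finset.Icc (c + 2) m := by
  intro j hj
  have := Finset.mem_Icc.1 (hS hj)
  have : j ≠ c + 1 := by rintro rfl; exact h hj
  rw [Finset.mem_Icc]; omega

theorem lt_of_subset {c : ℕ} {S : Finset ℕ} (hS : S ⊆ Finset.Icc (c + 2) m) : ∀ j ∈ S, c + 1 < j :=
  fun j hj => by have := Finset.mem_Icc.1 (hS hj); omega

/-- In an ordered product the smallest index c + 1 stands first. Multiplying by e_{c+1} therefore
removes it or puts it in front, and any other e_i anticommutes past it into the products with larger
indices, where induction applies. -/
theorem realE_mul_mem_eSpan {c i : ℕ} (hi : i ∈ Finset.Icc (c + 1) m) {a : RCl m}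
    (ha : a ∈ eSpan m c) : realE m i * a ∈ eSpan m c := by
  obtain ⟨d, hd⟩ : ∃ d, m ≤ c + d := ⟨m, by omega⟩
  induction d generalizing c i a with
  | zero => rw [Finset.mem_Icc] at hi; omega
  | succ d ih =>
    have hi' := Finset.mem_Icc.1 hi
    have h1 : ∀ a ∈ eSpan m c, realE m (c + 1) * a ∈ eSpan m c := by
      intro a ha
      refine mul_mem_eSpan (fun S hS => ?_) ha
      by_cases h : c + 1 ∈ S
      · obtain ⟨S', hS', rfl⟩ := eq_insert_of_mem hS h
        rw [eProd_insert (lt_of_subset hS'), ← mul_assoc, realE_mul_self ⟨by omega, by omega⟩,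
          neg_one_mul]
        exact neg_mem (eProd_mem (hS'.trans (Finset.Icc_subset_Icc_left (by omega))))
      · have hS' := subset_of_not_mem hS h
        rw [← eProd_insert (lt_of_subset hS')]
        refine eProd_mem (Finset.insert_subset (by rw [Finset.mem_Icc]; omega) hS)
    by_cases hic : i = c + 1
    · rw [hic]; exact h1 a ha
    · have hi2 : i ∈ Finset.Icc (c + 1 + 1) m := by rw [Finset.mem_Icc]; omega
      refine mul_mem_eSpan (fun S hS => ?_) ha
      by_cases h : c + 1 ∈ S
      · obtain ⟨S', hS', rfl⟩ := eq_insert_of_mem hS h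
        rw [eProd_insert (lt_of_subset hS'), ← mul_assoc, realE_mul_realE hic, neg_mul, mul_assoc]
        exact neg_mem (h1 _ (eSpan_mono c (ih hi2 (eProd_mem hS') (by omega))))
      · exact eSpan_mono c (ih hi2 (eProd_mem (subset_of_not_mem hS h)) (by omega))

theorem eSpan_zero : eSpan m 0 = ⊤ := by
  rw [eq_top_iff]
  rintro a -
  induction a using CliffordAlgebra.left_induction with
  | algebraMap r =>
    rw [Algebra.algebraMap_eq_smul_one, ← eProd_empty]
    exact Submodule.smul_mem _ _ (eProd_mem (Finset.empty_subset _))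
  | add a b ha hb => exact add_mem ha hb
  | ι_mul a v ha =>
    rw [ι_eq_sum, Finset.sum_mul]
    refine sum_mem fun i _ => ?_
    rw [smul_mul_assoc]
    exact Submodule.smul_mem _ _ (realE_mul_mem_eSpan (by rw [Finset.mem_Icc]; omega) ha)

/-! ### The spaces of polynomials with values in the `s`-vectors -/

variable (𝕂 m) in
/-- The elements of the real Clifford algebra as constant polynomials. -/
def cst (a : RCl m) : CPol 𝕂 m := const 𝕂 m a

theorem cst_zero : cst 𝕂 m 0 = 0 := map_zero (constHom 𝕂 m)

theorem cst_add (a b : RCl m) : cst 𝕂 m (a + b) = cst 𝕂 m a + cst 𝕂 m b :=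
  map_add (constHom 𝕂 m) _ _

theorem cst_mul (a b : RCl m) : cst 𝕂 m (a * b) = cst 𝕂 m a * cst 𝕂 m b :=
  map_mul (constHom 𝕂 m) _ _

theorem cst_smul (c : ℝ) (a : RCl m) : cst 𝕂 m (c • a) = (c : 𝕂) • cst 𝕂 m a := by
  have := map_smul (constHom 𝕂 m) c a
  rw [constHom_apply] at this
  exact this.trans (algebraMap_smul 𝕂 c (constHom 𝕂 m a)).symm

variable (𝕂 m) in
/-- The products of basis vectors as constant polynomials. -/
def vS (S : Finset ℕ) : CPol 𝕂 m := cst 𝕂 m (eProd m S)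

theorem vS_empty : vS 𝕂 m ∅ = 1 := by rw [vS, eProd_empty]; rfl

theorem vS_insert {i : ℕ} {S : Finset ℕ} (h : ∀ j ∈ S, i < j) :
    vS 𝕂 m (insert i S) = ve 𝕂 m i * vS 𝕂 m S := by
  rw [vS, eProd_insert h, cst_mul]; rfl

theorem kap_ve_mul_of_ne {i j : ℕ} (h : i ≠ j) {f : CPol 𝕂 m} (hf : kap 𝕂 m i f = 0) :
    kap 𝕂 m i (ve 𝕂 m j * f) = 0 := by
  rw [ve_mul_eq, map_add, kap_eps_of_ne h, kap_kap i j, hf, map_zero, map_zero, neg_zero, add_zero]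

theorem kap_one (i : ℕ) : kap 𝕂 m i 1 = 0 := by
  rw [kap_eq_zero_iff, map_one, mul_one, one_mul]

theorem kap_vS {i : ℕ} {S : Finset ℕ} (h : i ∉ S) : kap 𝕂 m i (vS 𝕂 m S) = 0 := by
  induction S using Finset.induction_on_min with
  | empty => rw [vS_empty, kap_one]
  | insert j S hj ih =>
    rw [Finset.mem_insert, not_or] at h
    rw [vS_insert hj]
    exact kap_ve_mul_of_ne h.1 (ih h.2)

theorem grade_one (r : ℕ) : grade 𝕂 m r 1 = 0 := by
  rw [grade_apply, Finset.sum_eq_zero fun i _ => by rw [kap_one, map_zero], neg_zero]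

theorem grade_vS {S : Finset ℕ} (h : S ⊆ Finset.Icc 1 m) :
    grade 𝕂 m m (vS 𝕂 m S) = (S.card : 𝕂) • vS 𝕂 m S := by
  induction S using Finset.induction_on_min with
  | empty => rw [vS_empty, grade_one, Finset.card_empty, Nat.cast_zero, zero_smul]
  | insert j S hj ih =>
    have hjS : j ∉ S := fun h => lt_irrefl j (hj j h)
    rw [Finset.insert_subset_iff] at h
    rw [vS_insert hj, ve_mul_of_kap (kap_vS hjS), grade_eps le_rfl h.1, ih h.2,
      Finset.card_insert_of_notMem hjS, map_smul]
    push_cast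
    module

variable (𝕂 m) in
/-- The polynomials with values in the `s`-vectors. -/
def gSpan (s : ℕ) : Submodule 𝕂 (CPol 𝕂 m) :=
  Submodule.span 𝕂 {f | ∃ p, ∃ S : Finset ℕ, S ⊆ Finset.Icc 1 m ∧ S.card = s ∧
    f = ofS 𝕂 m p * vS 𝕂 m S}

theorem iSup_gSpan : ⨆ s, gSpan 𝕂 m s = ⊤ := by
  rw [eq_top_iff]
  rintro f -
  have key : ∀ (p : MvPolynomial (Fin m) 𝕂) (a : RCl m),
      (ofS 𝕂 m p * cst 𝕂 m a) ∈ ⨆ s, gSpan 𝕂 m s := by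
    intro p a
    have ha : a ∈ eSpan m 0 := by rw [eSpan_zero]; trivial
    induction ha using Submodule.span_induction with
    | mem a h =>
      obtain ⟨S, hS, rfl⟩ := h
      exact Submodule.mem_iSup_of_mem S.card (Submodule.subset_span ⟨p, S, hS, rfl, rfl⟩)
    | zero => rw [cst_zero, mul_zero]; exact zero_mem _
    | add a b _ _ ha hb => rw [cst_add, mul_add]; exact add_mem ha hb
    | smul c a _ ha => rw [cst_smul, mul_smul_comm]; exact Submodule.smul_mem _ _ ha
  induction f using TensorProduct.induction_on with
  | zero => exact zero_mem _
  | add f g hf hg => exact add_mem hf hg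
  | tmul p a =>
    induction a using TensorProduct.induction_on with
    | zero =>
      have : (p ⊗ₜ[𝕂] (0 : Cl 𝕂 m) : CPol 𝕂 m) = 0 := TensorProduct.tmul_zero _ _
      rw [this]; exact zero_mem _
    | add a b ha hb =>
      have : (p ⊗ₜ[𝕂] (a + b) : CPol 𝕂 m) = (p ⊗ₜ[𝕂] a : CPol 𝕂 m) + (p ⊗ₜ[𝕂] b : CPol 𝕂 m) :=
        TensorProduct.tmul_add _ _ _
      rw [this]; exact add_mem ha hb
    | tmul c a =>
      have : (p ⊗ₜ[𝕂] (c ⊗ₜ[ℝ] a) : CPol 𝕂 m) = c • (ofS 𝕂 m p * cst 𝕂 m a) := by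
        change p ⊗ₜ[𝕂] (c ⊗ₜ[ℝ] a) = c • (ofScalar 𝕂 m p * const 𝕂 m a)
        rw [const, ofScalar, Algebra.TensorProduct.includeLeft_apply,
          Algebra.TensorProduct.tmul_mul_tmul, mul_one, one_mul, ← TensorProduct.tmul_smul,
          TensorProduct.smul_tmul', smul_eq_mul, mul_one]
      rw [this]
      exact Submodule.smul_mem _ _ (key p a)

theorem eps_ofS_mul (i : ℕ) (p : MvPolynomial (Fin m) 𝕂) (f : CPol 𝕂 m) :
    eps 𝕂 m i (ofS 𝕂 m p * f) = ofS 𝕂 m p * eps 𝕂 m i f := by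
  rw [eps_apply, eps_apply, map_mul, inv_ofS, ← mul_assoc, ← ofS_mul_comm, mul_smul_comm, mul_add]
  simp only [mul_assoc]

theorem kap_ofS_mul (i : ℕ) (p : MvPolynomial (Fin m) 𝕂) (f : CPol 𝕂 m) :
    kap 𝕂 m i (ofS 𝕂 m p * f) = ofS 𝕂 m p * kap 𝕂 m i f := by
  rw [kap_apply, kap_apply, map_mul, inv_ofS, ← mul_assoc, ← ofS_mul_comm, mul_smul_comm, mul_sub]
  simp only [mul_assoc]

theorem grade_ofS_mul (r : ℕ) (p : MvPolynomial (Fin m) 𝕂) (f : CPol 𝕂 m) :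
    grade 𝕂 m r (ofS 𝕂 m p * f) = ofS 𝕂 m p * grade 𝕂 m r f := by
  rw [grade_apply, grade_apply]
  simp only [kap_ofS_mul, eps_ofS_mul]
  rw [← Finset.mul_sum, mul_neg]

/-- Each span consists of eigenvectors, eigenspaces are independent, and the spans exhaust the
space. -/
theorem eigenspace_grade (s : ℕ) :
    Module.End.eigenspace (grade 𝕂 m m) (s : 𝕂) = gSpan 𝕂 m s := by
  refine eq_of_le_of_iSupIndep (fun s => ?_) (iSupIndep_eigenspace _ Nat.cast_injective) iSup_gSpan s
  refine Submodule.span_le.2 ?_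
  rintro _ ⟨p, S, hS, rfl, rfl⟩
  exact Module.End.mem_eigenspace_iff.2 (by rw [grade_ofS_mul, grade_vS hS, mul_smul_comm])

/-! ### Evaluation -/

variable (𝕂 m) in
/-- The value of a polynomial at a point. -/
def evl (p : EuclideanSpace ℝ (Fin m)) : CPol 𝕂 m →ₐ[𝕂] Cl 𝕂 m := evalAt 𝕂 m p

theorem evalAt_tmul (p : EuclideanSpace ℝ (Fin m)) (q : MvPolynomial (Fin m) 𝕂) (a : Cl 𝕂 m) :
    evalAt 𝕂 m p (q ⊗ₜ[𝕂] a) = MvPolynomial.eval (fun i => algebraMap ℝ 𝕂 (p i)) q • a := by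
  rw [evalAt, AlgHom.comp_apply, Algebra.TensorProduct.map_tmul]
  change Algebra.TensorProduct.lid 𝕂 (Cl 𝕂 m) _ = _
  rw [Algebra.TensorProduct.lid_tmul]; rfl

/-- In coordinates with respect to a basis of the Clifford algebra this says that a polynomial over
𝕂 vanishing at all real points is zero, because ℝ is infinite. -/
theorem evalAt_injective {f : Pol 𝕂 m} (h : ∀ p, evalAt 𝕂 m p f = 0) : f = 0 := by
  let b := Module.Free.chooseBasis 𝕂 (Cl 𝕂 m)
  let B := Algebra.TensorProduct.basis (MvPolynomial (Fin m) 𝕂) b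
  have key : ∀ (p : EuclideanSpace ℝ (Fin m)) (f : Pol 𝕂 m) i, b.repr (evalAt 𝕂 m p f) i =
      MvPolynomial.eval (fun i => algebraMap ℝ 𝕂 (p i)) (B.repr f i) := by
    intro p f i
    induction f using TensorProduct.induction_on with
    | zero => simp
    | add f g hf hg => simp only [map_add, Finsupp.add_apply, hf, hg]
    | tmul q a =>
      rw [evalAt_tmul]
      simp [B, Algebra.TensorProduct.basis_repr_tmul]
  refine B.ext_elem fun i => ?_
  rw [map_zero, Finsupp.zero_apply]
  refine MvPolynomial.funext_set (fun _ : Fin m => Set.range (algebraMap ℝ 𝕂))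
    (fun _ => Set.infinite_range_of_injective (algebraMap ℝ 𝕂).injective) fun y hy => ?_
  choose z hz using fun i => hy i trivial
  have := key (WithLp.toLp 2 z) f i
  rw [h, map_zero, Finsupp.zero_apply] at this
  rw [map_zero, this]
  congr 2
  exact funext fun i => (hz i).symm

theorem evl_injective {f : CPol 𝕂 m} (h : ∀ p, evl 𝕂 m p f = 0) : f = 0 := evalAt_injective h

theorem evl_ofS (p : EuclideanSpace ℝ (Fin m)) (q : MvPolynomial (Fin m) 𝕂) :
    evl 𝕂 m p (ofS 𝕂 m q) = MvPolynomial.eval (fun i => algebraMap ℝ 𝕂 (p i)) q • 1 :=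
  evalAt_tmul p q 1

theorem evl_const (p : EuclideanSpace ℝ (Fin m)) (a : RCl m) :
    evl 𝕂 m p (cst 𝕂 m a) = 1 ⊗ₜ[ℝ] a := by
  refine (evalAt_tmul p 1 _).trans ?_
  rw [map_one, one_smul]

theorem evl_vx (p : EuclideanSpace ℝ (Fin m)) (i : Fin m) :
    evl 𝕂 m p (vx 𝕂 m (i + 1)) = (p i : 𝕂) • 1 := by
  rw [← ofS_coord, evl_ofS, coord, dif_pos ⟨by omega, by omega⟩, MvPolynomial.eval_X]
  rfl

/-! ### The space of solutions on `ℝ^m` -/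

variable (𝕂 m) in
/-- The constants as a linear map. -/
def constL : Cl 𝕂 m →ₗ[𝕂] CPol 𝕂 m :=
  (Algebra.TensorProduct.includeRight : Cl 𝕂 m →ₐ[𝕂] Pol 𝕂 m).toLinearMap

theorem evl_constL (p : EuclideanSpace ℝ (Fin m)) (a : Cl 𝕂 m) : evl 𝕂 m p (constL 𝕂 m a) = a := by
  refine (evalAt_tmul p 1 _).trans ?_
  rw [map_one, one_smul]

theorem iSupIndep_sVectors : iSupIndep fun s => sVectors 𝕂 m s := by
  refine iSupIndep_of_map_le (fun _ : Unit => constL 𝕂 m) (fun a ha => ?_) (fun _ s a ha => ?_)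
    (iSupIndep_eigenspace (grade 𝕂 m m) Nat.cast_injective)
  · rw [← evl_constL 0 a, ha (), map_zero]
  · have : sVectors 𝕂 m s ≤ (Module.End.eigenspace (grade 𝕂 m m) (s : 𝕂)).comap (constL 𝕂 m) := by
      refine Submodule.span_le.2 ?_
      rintro _ ⟨S, hS, rfl, rfl⟩
      exact Module.End.mem_eigenspace_iff.2 (grade_vS hS)
    exact this ha

/-- The spaces defined by pointwise values are independent and contain the spans of the products of
a polynomial and an e_S with s factors, so they are no larger than these eigenspaces. -/
theorem evl_mem_sVectors_iff {s : ℕ} {f : CPol 𝕂 m} :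
    (∀ p, evl 𝕂 m p f ∈ sVectors 𝕂 m s) ↔ grade 𝕂 m m f = (s : 𝕂) • f := by
  let W : ℕ → Submodule 𝕂 (CPol 𝕂 m) := fun s => ⨅ p, (sVectors 𝕂 m s).comap (evl 𝕂 m p).toLinearMap
  have hW : ∀ s (f : CPol 𝕂 m), f ∈ W s ↔ ∀ p, evl 𝕂 m p f ∈ sVectors 𝕂 m s := fun s f => by
    simp [W, Submodule.mem_iInf]
  have hind : iSupIndep W := iSupIndep_of_map_le (fun p => (evl 𝕂 m p).toLinearMap)
    (fun f hf => evl_injective hf) (fun p s f hf => (hW s f).1 hf p) iSupIndep_sVectors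
  have h := eq_of_le_of_iSupIndep (V := gSpan 𝕂 m) (W := W) (fun s => ?_) hind iSup_gSpan s
  · rw [← hW, h, ← eigenspace_grade, Module.End.mem_eigenspace_iff]
  · refine Submodule.span_le.2 ?_
    rintro _ ⟨q, S, hS, hs, rfl⟩
    refine (hW s _).2 fun p => ?_
    rw [map_mul, evl_ofS, smul_mul_assoc, one_mul]
    refine Submodule.smul_mem _ _ ?_
    rw [vS, evl_const]
    exact Submodule.subset_span ⟨S, hS, hs, rfl⟩

variable (𝕂 m) in
/-- The `k`-homogeneous polynomials. -/
def homog (k : ℕ) : Submodule 𝕂 (CPol 𝕂 m) where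
  carrier := {f | ∀ (c : ℝ) p, evl 𝕂 m (c • p) f = algebraMap ℝ 𝕂 (c ^ k) • evl 𝕂 m p f}
  add_mem' hf hg c p := by rw [map_add, map_add, hf, hg, smul_add]
  zero_mem' c p := by rw [map_zero, map_zero, smul_zero]
  smul_mem' a f hf c p := by rw [map_smul, map_smul, hf, smul_comm]

theorem homog_mul {k l : ℕ} {f g : CPol 𝕂 m} (hf : f ∈ homog 𝕂 m k) (hg : g ∈ homog 𝕂 m l) :
    f * g ∈ homog 𝕂 m (k + l) := fun c p => by
  rw [map_mul, map_mul, hf, hg, smul_mul_smul_comm, ← map_mul, pow_add]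

/-- On functions, degree k means eigenvalue 2^k of the dilation by 2, and these numbers are
distinct. -/
theorem iSupIndep_homog : iSupIndep fun k => homog 𝕂 m k := by
  let δ : Module.End 𝕂 (EuclideanSpace ℝ (Fin m) → Cl 𝕂 m) :=
    LinearMap.funLeft 𝕂 (Cl 𝕂 m) fun p => (2 : ℝ) • p
  let F : CPol 𝕂 m →ₗ[𝕂] (EuclideanSpace ℝ (Fin m) → Cl 𝕂 m) :=
    LinearMap.pi fun p => (evl 𝕂 m p).toLinearMap
  refine iSupIndep_of_map_le (W := fun k : ℕ => Module.End.eigenspace δ (algebraMap ℝ 𝕂 (2 ^ k)))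
    (fun _ : Unit => F) (fun f hf => evl_injective fun p => congrFun (hf ()) p)
    (fun _ k f hf => Module.End.mem_eigenspace_iff.2 (funext fun p => hf 2 p))
    (iSupIndep_eigenspace δ fun k l h => ?_)
  exact Nat.pow_right_injective le_rfl (by exact_mod_cast (algebraMap ℝ 𝕂).injective h)

/-- The intersections of Euler eigenspaces with the homogeneous spaces already span all polynomials,
and each of the two families is independent. Hence both families coincide with the intersections. -/
theorem mem_homog_iff {k : ℕ} {f : CPol 𝕂 m} :
    f ∈ homog 𝕂 m k ↔ euler 𝕂 m m f = (k : 𝕂) • f := by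
  let V : ℕ → Submodule 𝕂 (CPol 𝕂 m) := fun k =>
    Module.End.eigenspace (euler 𝕂 m m) (k : 𝕂) ⊓ homog 𝕂 m k
  have le : ∀ (k : ℕ) {f : CPol 𝕂 m}, euler 𝕂 m m f = (k : 𝕂) • f → f ∈ homog 𝕂 m k →
      f ∈ ⨆ k, V k := fun k f h h' =>
    Submodule.mem_iSup_of_mem k ⟨Module.End.mem_eigenspace_iff.2 h, h'⟩
  have hV : ⨆ k, V k = ⊤ := by
    rw [eq_top_iff]
    rintro f -
    induction f using cpol_induction with
    | scalar c =>
      refine le 0 (by rw [euler_algebraMap, Nat.cast_zero, zero_smul]) fun a p => ?_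
      rw [AlgHom.commutes, AlgHom.commutes, pow_zero, map_one, one_smul]
    | x i h1 h2 =>
      refine le 1 (by rw [euler_m_vx h1 h2, Nat.cast_one, one_smul]) fun a p => ?_
      obtain ⟨i, rfl⟩ := exists_fin ⟨h1, h2⟩
      rw [evl_vx, evl_vx, pow_one, smul_smul]
      congr 1
      exact RCLike.ofReal_mul _ _
    | e i h1 h2 =>
      refine le 0 (by rw [euler_ve, Nat.cast_zero, zero_smul]) fun a p => ?_
      rw [pow_zero, map_one, one_smul]
      exact (evl_const _ _).trans (evl_const _ _).symm
    | add f g hf hg => exact add_mem hf hg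
    | mul f g hf hg =>
      induction hf using Submodule.iSup_induction' with
      | mem k f hf =>
        induction hg using Submodule.iSup_induction' with
        | mem l g hg =>
          refine le (k + l) ?_ (homog_mul hf.2 hg.2)
          rw [euler_mul, Module.End.mem_eigenspace_iff.1 hf.1, Module.End.mem_eigenspace_iff.1 hg.1,
            smul_mul_assoc, mul_smul_comm]
          push_cast
          module
        | zero => rw [mul_zero]; exact zero_mem _
        | add g g' _ _ h h' => rw [mul_add]; exact add_mem h h'
      | zero => rw [zero_mul]; exact zero_mem _
      | add f f' _ _ h h' => rw [add_mul]; exact add_mem h h'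
  have h1 := eq_of_le_of_iSupIndep (V := V) (fun k => inf_le_left)
    (iSupIndep_eigenspace (euler 𝕂 m m) Nat.cast_injective) hV k
  have h2 := eq_of_le_of_iSupIndep (V := V) (fun k => inf_le_right) iSupIndep_homog hV k
  rw [h2, ← h1, Module.End.mem_eigenspace_iff]

variable (𝕂 m) in
/-- The space of homogeneous solutions on `ℝ^m`. -/
def cHdR (s k : ℕ) : Submodule 𝕂 (CPol 𝕂 m) := HdR 𝕂 m s k

/-- The pointwise definition is translated into operator equations: homogeneity into the Euler
eigenvalue, the values into the grade, and the Dirac equation into d and d*. -/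
theorem cHdR_eq (s k : ℕ) : cHdR 𝕂 m s k = Hr 𝕂 m m s k := by
  have hdir : ∀ f : CPol 𝕂 m, dirac 𝕂 m f = dirc 𝕂 m m f := fun f => by
    rw [dirc_apply]
    exact LinearMap.sum_apply _ _ _
  refine Submodule.ext fun f => ?_
  have h1 : f ∈ cHdR 𝕂 m s k ↔
      f ∈ homog 𝕂 m k ∧ (∀ p, evl 𝕂 m p f ∈ sVectors 𝕂 m s) ∧ dirc 𝕂 m m f = 0 := by
    rw [← hdir]; exact Iff.rfl
  rw [h1, mem_homog_iff, evl_mem_sVectors_iff, mem_Hr, Int.cast_natCast]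
  constructor
  · rintro ⟨h2, h3, h4⟩
    refine ⟨fun i hi => ?_, h2, h3, extD_coD_of_dirc le_rfl h3 h4⟩
    -- Beyond the dimension m the vector e_i and the derivative are zero by default, so independence
    -- of these directions holds automatically.
    have hi' : ¬ (1 ≤ i ∧ i ≤ m) := by omega
    rw [pD_of_not_mem hi', kap_apply, ve_of_not_mem hi', zero_mul, mul_zero, sub_zero, smul_zero]
    exact ⟨rfl, rfl⟩
  · rintro ⟨-, h2, h3, h4, h5⟩
    exact ⟨h2, h3, by rw [dirc, LinearMap.add_apply, h4, h5, add_zero]⟩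

theorem grade_eq_of_polSub {r : ℕ} (hr : r ≤ m) {f : CPol 𝕂 m} (hf : f ∈ polSub 𝕂 m r) :
    grade 𝕂 m m f = grade 𝕂 m r f := by
  rw [grade_apply, grade_apply]
  congr 1
  refine (Finset.sum_subset (Finset.Icc_subset_Icc_right hr) fun i hi hi' => ?_).symm
  rw [Finset.mem_Icc] at hi hi'
  rw [(hf i (by omega)).2, map_zero]

/-- A polynomial of degree and grade zero is a scalar. -/
theorem exists_scalar {f : CPol 𝕂 m} (h1 : euler 𝕂 m m f = 0) (h2 : grade 𝕂 m m f = 0) :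
    ∃ c : 𝕂, f = c • 1 := by
  have h3 : f ∈ gSpan 𝕂 m 0 := by
    rw [← eigenspace_grade, Module.End.mem_eigenspace_iff, h2, Nat.cast_zero, zero_smul]
  have h4 : f ∈ homog 𝕂 m 0 := mem_homog_iff.2 (by rw [h1, Nat.cast_zero, zero_smul])
  have h5 : gSpan 𝕂 m 0 ≤ LinearMap.range (ofS 𝕂 m).toLinearMap := by
    refine Submodule.span_le.2 ?_
    rintro _ ⟨p, S, -, hS, rfl⟩
    rw [Finset.card_eq_zero] at hS
    subst hS
    exact ⟨p, by rw [vS_empty, mul_one]; rfl⟩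
  obtain ⟨q, rfl⟩ := h5 h3
  refine ⟨MvPolynomial.eval (fun i => algebraMap ℝ 𝕂 ((0 : EuclideanSpace ℝ (Fin m)) i)) q, ?_⟩
  rw [← sub_eq_zero]
  refine evl_injective fun p => ?_
  have := h4 0 p
  rw [zero_smul, pow_zero, map_one, one_smul] at this
  rw [map_sub, ← this, map_smul, map_one, sub_eq_zero]
  exact evl_ofS 0 q

/-! ### Maps that are equivariant up to a sign -/

/-- `Ψ` commutes with the action of the unit vectors of `ℝ^n` up to the factor `ε`. -/
def SemiEq (n : ℕ) (ε : ℤ) (Ψ : Module.End 𝕂 (CPol 𝕂 m)) : Prop :=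
  (ε = 1 ∨ ε = -1) ∧ ∀ v, IsUVec n v → ∀ f, sg 𝕂 m v (Ψ f) = (ε : 𝕂) • Ψ (sg 𝕂 m v f)

theorem SemiEq.sq {n : ℕ} {ε : ℤ} {Ψ : Module.End 𝕂 (CPol 𝕂 m)} (h : SemiEq n ε Ψ) :
    (ε : 𝕂) * ε = 1 := by
  rcases h.1 with rfl | rfl <;> norm_num

theorem SemiEq.id (n : ℕ) : SemiEq n 1 (LinearMap.id : Module.End 𝕂 (CPol 𝕂 m)) :=
  ⟨.inl rfl, fun v _ f => by rw [Int.cast_one, one_smul]; rfl⟩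

theorem SemiEq.mono {n n' : ℕ} {ε : ℤ} {Ψ : Module.End 𝕂 (CPol 𝕂 m)} (h : SemiEq n' ε Ψ)
    (hn : n ≤ n') : SemiEq n ε Ψ := ⟨h.1, fun v hv => h.2 v (hv.mono hn)⟩

theorem SemiEq.comp {n : ℕ} {ε ε' : ℤ} {Φ Ψ : Module.End 𝕂 (CPol 𝕂 m)} (h : SemiEq n ε Φ)
    (h' : SemiEq n ε' Ψ) : SemiEq n (ε * ε') (Φ * Ψ) := by
  refine ⟨?_, fun v hv f => ?_⟩
  · rcases h.1 with rfl | rfl <;> rcases h'.1 with rfl | rfl <;> simp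
  · rw [Module.End.mul_apply, Module.End.mul_apply, h.2 v hv, h'.2 v hv, map_smul, smul_smul,
      Int.cast_mul]

/-- The sign `(-1)^z`. -/
def zsgn (z : ℤ) : ℤ := if Even z then 1 else -1

theorem zsgn_cast (z : ℤ) : ((zsgn z : ℤ) : 𝕂) = (-1) ^ z := by
  rw [zsgn]
  split_ifs with h
  · rw [h.neg_one_zpow, Int.cast_one]
  · rw [(Int.not_even_iff_odd.1 h).neg_one_zpow]; norm_num

theorem semiEq_embL {n : ℕ} (hm : n + 1 ≤ m) {s t : ℤ} {k j : ℕ} (hst : t = s - 1 ∨ t = s) :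
    SemiEq n (zsgn ((k : ℤ) - j + (s - t))) (embL 𝕂 m s t n k j) :=
  ⟨by rw [zsgn]; split_ifs <;> simp, fun v hv f => by rw [zsgn_cast]; exact sg_embL hm hv hst f⟩

/-- A rotation is a product of two unit vectors, so the sign occurs twice and disappears. The same
then holds for infinitesimal rotations and the Casimir operator. -/
theorem SemiEq.rot {n : ℕ} {ε : ℤ} {Ψ : Module.End 𝕂 (CPol 𝕂 m)} (h : SemiEq n ε Ψ) {i j : ℕ}
    (hi : i ∈ Finset.Icc 1 n) (hj : j ∈ Finset.Icc 1 n) (hij : i ≠ j) (θ : ℝ) (f : CPol 𝕂 m) :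
    rot 𝕂 m i j θ (Ψ f) = Ψ (rot 𝕂 m i j θ f) := by
  rw [HodgeDeRham.rot, AlgHom.comp_apply, AlgHom.comp_apply, h.2 _ (isUVec_rv hi hj hij 0), map_smul,
    h.2 _ (isUVec_rv hi hj hij θ), smul_smul, h.sq, one_smul]

theorem lie_self (i : ℕ) (f : CPol 𝕂 m) : lie 𝕂 m i i f = 0 := by rw [lie_apply]; abel

theorem SemiEq.lie {n : ℕ} (hn : n ≤ m) {ε : ℤ} {Ψ : Module.End 𝕂 (CPol 𝕂 m)} (h : SemiEq n ε Ψ)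
    {i j : ℕ} (hi : i ∈ Finset.Icc 1 n) (hj : j ∈ Finset.Icc 1 n) (f : CPol 𝕂 m) :
    lie 𝕂 m i j (Ψ f) = Ψ (lie 𝕂 m i j f) := by
  by_cases hij : i = j
  · subst hij; rw [lie_self, lie_self, map_zero]
  · have h1 := isDeriv_rot hi hj hij hn (Ψ f)
    have h2 := (isDeriv_rot hi hj hij hn f).linMap Ψ
    simp only [h.rot hi hj hij] at h1
    have h3 := h1.unique h2
    rw [map_smul] at h3
    exact smul_right_injective _ (two_ne_zero (α := 𝕂)) h3

theorem SemiEq.casimir {n : ℕ} (hn : n ≤ m) {ε : ℤ} {Ψ : Module.End 𝕂 (CPol 𝕂 m)} (h : SemiEq n ε Ψ)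
    (f : CPol 𝕂 m) : casimir 𝕂 m n (Ψ f) = Ψ (casimir 𝕂 m n f) := by
  rw [casimir_apply, casimir_apply, map_sum]
  refine Finset.sum_congr rfl fun i hi => ?_
  rw [map_sum]
  exact Finset.sum_congr rfl fun j hj => by rw [h.lie hn hi hj, h.lie hn hi hj]

theorem SemiEq.omg {n r : ℕ} (hr : r ≤ n) {ε : ℤ} {Ψ : Module.End 𝕂 (CPol 𝕂 m)} (h : SemiEq n ε Ψ)
    (f : CPol 𝕂 m) : omg 𝕂 m r (Ψ f) = ((ε : 𝕂) ^ r) • Ψ (omg 𝕂 m r f) := by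
  induction r generalizing f with
  | zero => rw [pow_zero, one_smul]; rfl
  | succ r ih =>
    have h1 : ∀ g, HodgeDeRham.omg 𝕂 m (r + 1) g = HodgeDeRham.omg 𝕂 m r (sg 𝕂 m (bv (r + 1)) g) :=
      fun _ => rfl
    rw [h1, h1, h.2 _ (isUVec_bv (by rw [Finset.mem_Icc]; omega)), map_smul, ih (by omega), smul_smul,
      pow_succ']

theorem omg_inv {r : ℕ} (hr : r ≤ m) (f : CPol 𝕂 m) :
    omg 𝕂 m r (inv 𝕂 m f) = inv 𝕂 m (omg 𝕂 m r f) := by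
  induction r generalizing f with
  | zero => rfl
  | succ r ih =>
    have h1 : ∀ g, omg 𝕂 m (r + 1) g = omg 𝕂 m r (sg 𝕂 m (bv (r + 1)) g) := fun _ => rfl
    rw [h1, h1, sg_inv le_rfl (isUVec_bv (by rw [Finset.mem_Icc]; omega)), ih (by omega)]

/-- For odd n the element e_1⋯e_n fixes all x_i and e_i with i ≤ n. The polynomial is rebuilt from
these, first by Euler's formula in the degree, then by the grade operator, down to scalars. -/
theorem omg_eq_self {n : ℕ} (hn : n ≤ m) (hodd : Odd n) (j t : ℕ) {f : CPol 𝕂 m}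
    (hf : f ∈ polSub 𝕂 m n) (hE : euler 𝕂 m n f = (j : 𝕂) • f) (hN : grade 𝕂 m n f = (t : 𝕂) • f) :
    omg 𝕂 m n f = f := by
  have hgen : ∀ i ∈ Finset.Icc 1 n, omg 𝕂 m n (vx 𝕂 m i) = vx 𝕂 m i ∧
      omg 𝕂 m n (ve 𝕂 m i) = ve 𝕂 m i := by
    intro i hi
    rw [Finset.mem_Icc] at hi
    have := omg_generator (𝕂 := 𝕂) hn i hi.1
    rwa [if_pos hi.2, hodd.add_one.neg_one_pow, one_smul, one_smul] at this
  induction j generalizing f with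
  | succ j ih =>
    have h1 : (((j + 1 : ℕ) : 𝕂)) ≠ 0 := Nat.cast_ne_zero.2 (Nat.succ_ne_zero j)
    refine smul_right_injective _ h1 ?_
    simp only
    rw [← map_smul, ← hE, euler_apply, map_sum]
    refine Finset.sum_congr rfl fun i hi => ?_
    rw [mulX_apply, map_mul, (hgen i hi).1]
    congr 1
    refine ih (fun l hl => ?_) ?_ ?_
    · rw [pD_comm, (hf l hl).1, ← pD_kap, (hf l hl).2, map_zero]; exact ⟨rfl, rfl⟩
    · rw [pD_euler hn hi, hE, map_smul]; push_cast; module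
    · rw [grade_pD, hN, map_smul]
  | zero =>
    induction t generalizing f with
    | succ t ih =>
      have h1 : (((t + 1 : ℕ) : 𝕂)) ≠ 0 := Nat.cast_ne_zero.2 (Nat.succ_ne_zero t)
      refine smul_right_injective _ h1 ?_
      simp only
      rw [← map_smul, ← hN, grade_apply, map_neg, map_sum]
      congr 1
      refine Finset.sum_congr rfl fun i hi => ?_
      have h2 : omg 𝕂 m n (kap 𝕂 m i f) = kap 𝕂 m i f := by
        refine ih (fun l hl => ?_) ?_ ?_
        · rw [pD_kap, (hf l hl).1, kap_kap, (hf l hl).2, map_zero, neg_zero]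
          exact ⟨rfl, rfl⟩
        · rw [euler_kap, hE, map_smul]
        · rw [grade_kap hn hi, hN, map_smul]; push_cast; module
      rw [eps_apply, map_smul, map_add, map_mul, map_mul, omg_inv hn, (hgen i hi).2, h2]
    | zero =>
      rw [Nat.cast_zero, zero_smul] at hE hN
      obtain ⟨c, rfl⟩ := exists_scalar (by rw [euler_eq_of_polSub hn hf, hE])
        (by rw [grade_eq_of_polSub hn hf, hN])
      rw [map_smul, map_one]

theorem omg_of_mem {n : ℕ} (hn : n ≤ m) (hodd : Odd n) {t : ℤ} {j : ℕ} {f : CPol 𝕂 m}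
    (hf : f ∈ Hr 𝕂 m n t j) : omg 𝕂 m n f = f := by
  by_cases h : f = 0
  · rw [h, map_zero]
  · obtain ⟨t, rfl⟩ := Int.eq_ofNat_of_zero_le (Hr_grade hn hf h).1
    exact omg_eq_self hn hodd j t (Hr_le_polSub hf) hf.2.1 (by simpa using hf.2.2.1)

/-! ### An operator that separates the branching components -/

variable (𝕂 m) in
/-- The operator `2 C + ω`, where `C` is the Casimir operator, and `ω` is the action of
`e_1 ⋯ e_n` if `n` is odd and zero otherwise. -/
def tOp (n : ℕ) : Module.End 𝕂 (CPol 𝕂 m) :=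
  (2 : 𝕂) • casimir 𝕂 m n + if Odd n then (omg 𝕂 m n).toLinearMap else 0

/-- The eigenvalues of the separating operator. -/
def tEig (n : ℕ) (ε t : ℤ) (j : ℕ) : ℤ :=
  -4 * (j * (j + n) + t * (n - t)) + if Odd n then ε else 0

theorem tOp_apply (n : ℕ) (f : CPol 𝕂 m) : tOp 𝕂 m n f =
    (2 : 𝕂) • casimir 𝕂 m n f + if Odd n then omg 𝕂 m n f else 0 := by
  rw [tOp, LinearMap.add_apply, LinearMap.smul_apply]
  split_ifs <;> rfl

/-- The Casimir operator does not see Ψ, whereas e_1⋯e_n picks up the sign of Ψ once per factor; for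
odd n this is the sign itself. -/
theorem tOp_of_mem {n : ℕ} (hn : n ≤ m) {ε : ℤ} {Ψ : Module.End 𝕂 (CPol 𝕂 m)} (h : SemiEq n ε Ψ)
    {t : ℤ} {j : ℕ} {f : CPol 𝕂 m} (hf : f ∈ Hr 𝕂 m n t j) :
    tOp 𝕂 m n (Ψ f) = (tEig n ε t j : 𝕂) • Ψ f := by
  rw [tOp_apply, h.casimir hn, casimir_of_mem hn hf, map_smul, tEig]
  split_ifs with ho
  · have h1 : (ε : 𝕂) ^ n = ε := by
      rcases h.1 with rfl | rfl
      · simp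
      · rw [Int.cast_neg, Int.cast_one, ho.neg_one_pow]
    rw [h.omg le_rfl, omg_of_mem hn ho hf, h1]
    push_cast
    module
  · push_cast
    module

/-- For equal t the Casimir value is strictly monotone in j. For different t the values agree only
if j = j' and n = 2s − 1; then n is odd, and the parities of k − j + s − t differ, so the signs of
e_1⋯e_n separate the two. -/
theorem tEig_injective {n : ℕ} (hn : 1 ≤ n) {ε : ℤ} (hε : ε = 1 ∨ ε = -1) {s : ℤ} {k : ℕ}
    {t t' : ℤ} {j j' : ℕ} (h : (t, j) ∈ N s (n + 1) k) (h' : (t', j') ∈ N s (n + 1) k)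
    (heq : tEig n (ε * zsgn ((k : ℤ) - j + (s - t))) t j =
      tEig n (ε * zsgn ((k : ℤ) - j' + (s - t'))) t' j') : (t, j) = (t', j') := by
  obtain ⟨h0, h1, hj, hst, -⟩ := mem_N_succ.1 h
  obtain ⟨h0', h1', hj', hst', -⟩ := mem_N_succ.1 h'
  have hz : ∀ z, ε * zsgn z = 1 ∨ ε * zsgn z = -1 := fun z => by
    rw [zsgn]; rcases hε with rfl | rfl <;> split_ifs <;> simp
  -- The Casimir parts are multiples of four, while the signs differ by at most two. Equality of
  -- eigenvalues thus forces equality of the Casimir parts; this is the purpose of doubling the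
  -- Casimir operator.
  have hc : (j : ℤ) * (j + n) + t * (n - t) = j' * (j' + n) + t' * (n - t') := by
    have := hz ((k : ℤ) - j + (s - t))
    have := hz ((k : ℤ) - j' + (s - t'))
    rw [tEig, tEig] at heq
    split_ifs at heq <;> omega
  have hsame : ∀ j j' : ℕ, (j : ℤ) * (j + n) = j' * (j' + n) → j = j' := by
    intro j j' hjj
    have : ((j : ℤ) - j') * (j + j' + n) = 0 := by linear_combination hjj
    rcases mul_eq_zero.1 this with h | h <;> omega
  have hdiff : ∀ j j' : ℕ, 1 ≤ s → s ≤ n → (j : ℤ) * (j + n) + s * (n - s) =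
      j' * (j' + n) + (s - 1) * (n - (s - 1)) → j = j' ∧ (n : ℤ) = 2 * s - 1 := by
    intro j j' hs hs' hjj
    have h2 : ((j : ℤ) - j') * (j + j' + n) = 2 * s - n - 1 := by linear_combination hjj
    have h3 : (j : ℤ) - j' = 0 := by
      by_contra hne
      have h4 : (1 : ℤ) ≤ |(j : ℤ) - j'| := Int.one_le_abs hne
      have h5 : |((j : ℤ) - j') * (j + j' + n)| = |(j : ℤ) - j'| * (j + j' + n) := by
        rw [abs_mul, abs_of_nonneg (by omega : (0 : ℤ) ≤ (j : ℤ) + j' + n)]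
      -- If j ≠ j', the product on the left of h2 is at least j + j' + n in absolute value, but the
      -- right side is at most n − 1.
      have h6 : |2 * s - n - 1| ≤ (n : ℤ) - 1 := abs_le.2 ⟨by omega, by omega⟩
      have h7 : (1 : ℤ) * (j + j' + n) ≤ |(j : ℤ) - j'| * (j + j' + n) :=
        mul_le_mul_of_nonneg_right h4 (by omega)
      rw [h2] at h5
      omega
    rw [h3, zero_mul] at h2
    omega
  have hodd : ∀ j : ℕ, (n : ℤ) = 2 * s - 1 → tEig n (ε * zsgn ((k : ℤ) - j + (s - s))) s j ≠
      tEig n (ε * zsgn ((k : ℤ) - j + (s - (s - 1)))) (s - 1) j := by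
    intro j hn2 he
    have ho : Odd n := by
      have : Odd (n : ℤ) := ⟨s - 1, by omega⟩
      exact_mod_cast this
    have hp : zsgn ((k : ℤ) - j + (s - s)) = -zsgn ((k : ℤ) - j + (s - (s - 1))) := by
      rw [zsgn, zsgn, sub_self, add_zero, sub_sub_cancel]
      simp only [Int.even_add_one]
      split_ifs <;> rfl
    rw [tEig, tEig, if_pos ho, if_pos ho, hp, hn2] at he
    have := hz ((k : ℤ) - j + (s - (s - 1)))
    ring_nf at he this
    omega
  rcases hst with rfl | rfl <;> rcases hst' with rfl | rfl
  · rw [hsame j j' (by linear_combination hc)]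
  · obtain ⟨rfl, h3⟩ := hdiff j' j (by omega) h1' hc.symm
    exact absurd heq.symm (hodd _ h3)
  · obtain ⟨rfl, h3⟩ := hdiff j j' (by omega) h1 hc
    exact absurd heq (hodd _ h3)
  · rw [hsame j j' (by linear_combination hc)]

theorem casimir_mem {n : ℕ} (hn : n ≤ m) {W : Submodule 𝕂 (CPol 𝕂 m)}
    (hW : ∀ v, IsUVec n v → ∀ f ∈ W, sg 𝕂 m v f ∈ W) {f : CPol 𝕂 m} (hf : f ∈ W) :
    casimir 𝕂 m n f ∈ W := by
  rw [casimir_apply]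
  exact sum_mem fun i hi => sum_mem fun j hj => lie_mem hi hj hn hW (lie_mem hi hj hn hW hf)

theorem tOp_mem {n : ℕ} (hn : n ≤ m) {W : Submodule 𝕂 (CPol 𝕂 m)}
    (hW : ∀ v, IsUVec n v → ∀ f ∈ W, sg 𝕂 m v f ∈ W) {f : CPol 𝕂 m} (hf : f ∈ W) :
    tOp 𝕂 m n f ∈ W := by
  rw [tOp_apply]
  refine add_mem (W.smul_mem _ (casimir_mem hn hW hf)) ?_
  split_ifs
  · exact omg_mem le_rfl hW hf
  · exact zero_mem _

/-! ### The scalar part and the conjugation -/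

/-- The basis is orthogonal, so contraction with e_i annihilates a product not containing e_i. Hence
the passage to the exterior algebra produces no correction terms for ordered products of distinct
basis vectors. -/
theorem ι_mul_changeForm_eProd {Q : QuadraticForm ℝ (Fin m → ℝ)} {B : LinearMap.BilinForm ℝ (Fin m → ℝ)}
    (h : B.toQuadraticMap = Q - negForm m)
    (hB : ∀ i j : Fin m, i ≠ j → B (Pi.single i 1) (Pi.single j 1) = 0) {S : Finset ℕ}
    (hS : S ⊆ Finset.Icc 1 m) (i : Fin m) (hi : (i : ℕ) + 1 ∉ S) :
    CliffordAlgebra.contractLeft (B (Pi.single i 1))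
      (CliffordAlgebra.changeForm h (eProd m S)) = 0 := by
  induction S using Finset.induction_on_min with
  | empty => rw [eProd_empty, CliffordAlgebra.changeForm_one, CliffordAlgebra.contractLeft_one]
  | insert j S hj ih =>
    rw [Finset.insert_subset_iff, Finset.mem_Icc] at hS
    rw [Finset.mem_insert, not_or] at hi
    obtain ⟨j, rfl⟩ := exists_fin hS.1
    have hji : i ≠ j := fun h => hi.1 (by rw [h])
    rw [eProd_insert hj, realE_succ, CliffordAlgebra.changeForm_ι_mul, map_sub,
      CliffordAlgebra.contractLeft_ι_mul, hB i j hji, ih hS.2 hi.2,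
      CliffordAlgebra.contractLeft_comm, ih hS.2 hi.2]
    simp

theorem realScalarPart_one : realScalarPart m 1 = 1 := by
  rw [realScalarPart, LinearMap.comp_apply, LinearEquiv.coe_coe, CliffordAlgebra.equivExterior,
    CliffordAlgebra.changeFormEquiv_apply, CliffordAlgebra.changeForm_one, AlgHom.toLinearMap_apply]
  exact map_one _

/-- In the exterior algebra the image is the first vector times something, and the projection to
scalars kills every vector. -/
theorem realScalarPart_eProd {S : Finset ℕ} (hS : S ⊆ Finset.Icc 1 m) (hne : S ≠ ∅) :
    realScalarPart m (eProd m S) = 0 := by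
  induction S using Finset.induction_on_min with
  | empty => exact absurd rfl hne
  | insert j S hj _ =>
    rw [Finset.insert_subset_iff, Finset.mem_Icc] at hS
    obtain ⟨j, rfl⟩ := exists_fin hS.1
    have hB : ∀ i j : Fin m, i ≠ j →
        QuadraticMap.associated (R := ℝ) (-negForm m) (Pi.single i 1) (Pi.single j 1) = 0 := by
      intro i j hij
      rw [map_neg, LinearMap.neg_apply, LinearMap.neg_apply, QuadraticMap.associated_apply,
        ← QuadraticMap.polar, polar_negForm]
      simp [Pi.single_apply, hij.symm]
    rw [eProd_insert hj, realE_succ, realScalarPart, LinearMap.comp_apply, LinearEquiv.coe_coe,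
      CliffordAlgebra.equivExterior, CliffordAlgebra.changeFormEquiv_apply,
      CliffordAlgebra.changeForm_ι_mul, ι_mul_changeForm_eProd _ hB hS.2 j
        (fun h => lt_irrefl _ (hj _ h)), sub_zero, AlgHom.toLinearMap_apply, map_mul]
    have h1 : ExteriorAlgebra.algebraMapInv (CliffordAlgebra.ι (0 : QuadraticForm ℝ (Fin m → ℝ))
        (Pi.single j 1)) = (0 : ℝ) := by
      rw [ExteriorAlgebra.algebraMapInv]
      exact ExteriorAlgebra.lift_ι_apply ℝ _ _ _
    rw [h1, zero_mul]

theorem involute_realE (i : ℕ) : CliffordAlgebra.involute (realE m i) = -realE m i := by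
  rw [realE]
  split_ifs
  · exact CliffordAlgebra.involute_ι _
  · simp

theorem involute_eProd (S : Finset ℕ) :
    CliffordAlgebra.involute (eProd m S) = (-1 : ℝ) ^ S.card • eProd m S := by
  induction S using Finset.induction_on_min with
  | empty => rw [eProd_empty, map_one]; simp
  | insert j S hj ih =>
    rw [eProd_insert hj, map_mul, ih, involute_realE,
      Finset.card_insert_of_notMem fun h => lt_irrefl j (hj j h), pow_succ, neg_mul, mul_smul_comm,
      mul_neg_one, neg_smul]

/-- The automorphism of the Clifford algebra that changes the sign of `e_i`. -/
def flipE (m i : ℕ) : RCl m →ₗ[ℝ] RCl m :=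
  LinearMap.mulLeft ℝ (realE m i) ∘ₗ LinearMap.mulRight ℝ (-realE m i) ∘ₗ
    (CliffordAlgebra.involute (Q := negForm m)).toLinearMap

theorem flipE_apply (i : ℕ) (a : RCl m) :
    flipE m i a = realE m i * (CliffordAlgebra.involute a * -realE m i) := rfl

theorem flipE_mul {i : ℕ} (hi : 1 ≤ i ∧ i ≤ m) (a b : RCl m) :
    flipE m i (a * b) = flipE m i a * flipE m i b := by
  have := realE_mul_self hi
  simp only [flipE_apply, map_mul, mul_assoc]
  rw [← mul_assoc (-realE m i) (realE m i), neg_mul, this, neg_neg, one_mul]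

theorem flipE_eProd {i : ℕ} (hi : 1 ≤ i ∧ i ≤ m) (S : Finset ℕ) :
    flipE m i (eProd m S) = (if i ∈ S then (-1 : ℝ) else 1) • eProd m S := by
  induction S using Finset.induction_on_min with
  | empty =>
    rw [eProd_empty, flipE_apply, map_one, one_mul, mul_neg, realE_mul_self hi]
    simp
  | insert j S hj ih =>
    have hjS : j ∉ S := fun h => lt_irrefl j (hj j h)
    have hE : flipE m i (realE m j) = (if i = j then (-1 : ℝ) else 1) • realE m j := by
      rw [flipE_apply, involute_realE, neg_mul_neg]
      split_ifs with h
      · subst h; rw [realE_mul_self hi]; simp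
      · rw [realE_mul_realE (Ne.symm h), mul_neg, ← mul_assoc, realE_mul_self hi]; simp
    rw [eProd_insert hj, flipE_mul hi, ih, hE, smul_mul_smul_comm]
    congr 1
    by_cases h : i = j
    · subst h; simp [hjS]
    · simp [h]

theorem realLinear_ext {M : Type*} [AddCommGroup M] [Module ℝ M] {φ ψ : RCl m →ₗ[ℝ] M}
    (h : ∀ S : Finset ℕ, S ⊆ Finset.Icc 1 m → φ (eProd m S) = ψ (eProd m S)) (a : RCl m) :
    φ a = ψ a := by
  have ha : a ∈ eSpan m 0 := by rw [eSpan_zero]; trivial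
  induction ha using Submodule.span_induction with
  | mem a h' => obtain ⟨S, hS, rfl⟩ := h'; exact h S hS
  | zero => rw [map_zero, map_zero]
  | add a b _ _ ha hb => rw [map_add, map_add, ha, hb]
  | smul c a _ ha => rw [map_smul, map_smul, ha]

theorem realScalarPart_flipE {i : ℕ} (hi : 1 ≤ i ∧ i ≤ m) (a : RCl m) :
    realScalarPart m (flipE m i a) = realScalarPart m a := by
  refine realLinear_ext (φ := realScalarPart m ∘ₗ flipE m i) (fun S hS => ?_) a
  rw [LinearMap.comp_apply, flipE_eProd hi, map_smul]
  by_cases h : S = ∅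
  · subst h; simp
  · rw [realScalarPart_eProd hS h, smul_zero]

theorem realScalarPart_involute (a : RCl m) :
    realScalarPart m (CliffordAlgebra.involute a) = realScalarPart m a := by
  refine realLinear_ext (φ := realScalarPart m ∘ₗ
    (CliffordAlgebra.involute (Q := negForm m)).toLinearMap) (fun S hS => ?_) a
  rw [LinearMap.comp_apply, AlgHom.toLinearMap_apply, involute_eProd, map_smul]
  by_cases h : S = ∅
  · subst h; simp
  · rw [realScalarPart_eProd hS h, smul_zero]

/-- The scalar part behaves like a trace. It is invariant under the sign change of e_i and under the
main involution, and composing the two turns e_i a into a e_i. -/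
theorem realScalarPart_realE_mul (i : ℕ) (a : RCl m) :
    realScalarPart m (realE m i * a) = realScalarPart m (a * realE m i) := by
  by_cases hi : 1 ≤ i ∧ i ≤ m
  · rw [← realScalarPart_flipE hi, flipE_apply, map_mul CliffordAlgebra.involute, involute_realE,
      ← realScalarPart_involute (a * realE m i), map_mul CliffordAlgebra.involute, involute_realE,
      show realE m i * (-realE m i * CliffordAlgebra.involute a * -realE m i) =
        -(realE m i * realE m i) * (CliffordAlgebra.involute a * -realE m i) by noncomm_ring,
      realE_mul_self hi, neg_neg, one_mul]
  · rw [realE, dif_neg hi, zero_mul, mul_zero]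

theorem realScalarPart_clVec_mul (v : ℕ → ℝ) (a : RCl m) :
    realScalarPart m (clVec m v * a) = realScalarPart m (a * clVec m v) := by
  rw [clVec_eq_sum, Finset.sum_mul, Finset.mul_sum, map_sum, map_sum]
  refine Finset.sum_congr rfl fun i _ => ?_
  rw [smul_mul_assoc, mul_smul_comm, map_smul, map_smul, realScalarPart_realE_mul]

/-- The conjugation of the real Clifford algebra. -/
def rConj (m : ℕ) : RCl m →ₗ[ℝ] RCl m :=
  CliffordAlgebra.reverse ∘ₗ (CliffordAlgebra.involute (Q := negForm m)).toLinearMap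

theorem rConj_apply (a : RCl m) :
    rConj m a = CliffordAlgebra.reverse (CliffordAlgebra.involute a) := rfl

theorem rConj_mul (a b : RCl m) : rConj m (a * b) = rConj m b * rConj m a := by
  simp only [rConj_apply, map_mul, CliffordAlgebra.reverse.map_mul]

theorem rConj_clVec (v : ℕ → ℝ) : rConj m (clVec m v) = -clVec m v := by
  rw [rConj_apply, clVec, CliffordAlgebra.involute_ι, map_neg, CliffordAlgebra.reverse_ι]

theorem rConj_realE (i : ℕ) : rConj m (realE m i) = -realE m i := by
  rw [realE_eq_clVec, rConj_clVec]

theorem rConj_flipE (i : ℕ) (a : RCl m) : rConj m (flipE m i a) = flipE m i (rConj m a) := by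
  rw [flipE_apply, flipE_apply, rConj_mul, rConj_mul, map_neg, rConj_realE, neg_neg, mul_assoc]
  congr 2
  rw [rConj_apply, CliffordAlgebra.reverse_involute]; rfl

theorem rConj_eProd_mul_self {S : Finset ℕ} (hS : S ⊆ Finset.Icc 1 m) :
    rConj m (eProd m S) * eProd m S = 1 := by
  induction S using Finset.induction_on_min with
  | empty => rw [eProd_empty, mul_one, rConj_apply, map_one, CliffordAlgebra.reverse.map_one]
  | insert j S hj ih =>
    rw [Finset.insert_subset_iff, Finset.mem_Icc] at hS
    rw [eProd_insert hj, rConj_mul, rConj_realE, mul_assoc, ← mul_assoc _ (realE m j), neg_mul,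
      realE_mul_self hS.1, neg_neg, one_mul, ih hS.2]

/-- If S ≠ T, choose an index in exactly one of them. Reversing that basis vector changes the sign
of the product but not its scalar part, which is therefore zero. -/
theorem realScalarPart_eProd_mul {S T : Finset ℕ} (hS : S ⊆ Finset.Icc 1 m)
    (hT : T ⊆ Finset.Icc 1 m) :
    realScalarPart m (rConj m (eProd m S) * eProd m T) = if S = T then 1 else 0 := by
  split_ifs with h
  · rw [← h, rConj_eProd_mul_self hS, realScalarPart_one]
  · obtain ⟨i, hi⟩ : ∃ i, ¬ (i ∈ S ↔ i ∈ T) := by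
      by_contra! h'
      exact h (Finset.ext h')
    have him : 1 ≤ i ∧ i ≤ m := by
      by_cases hiS : i ∈ S
      · exact Finset.mem_Icc.1 (hS hiS)
      · by_cases hiT : i ∈ T
        · exact Finset.mem_Icc.1 (hT hiT)
        · exact absurd (iff_of_false hiS hiT) hi
    have h1 := realScalarPart_flipE him (rConj m (eProd m S) * eProd m T)
    rw [flipE_mul him, ← rConj_flipE, flipE_eProd him, flipE_eProd him, map_smul,
      smul_mul_smul_comm, map_smul, smul_eq_mul] at h1
    by_cases hiS : i ∈ S <;> by_cases hiT : i ∈ T <;> simp [hiS, hiT] at hi h1 <;> linarith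

/-! ### The Hermitian form on the Clifford algebra -/

theorem scalarPart_tmul (c : 𝕂) (a : RCl m) :
    scalarPart 𝕂 m (c ⊗ₜ[ℝ] a) = (realScalarPart m a : 𝕂) * c := by
  rw [scalarPart, LinearMap.comp_apply, LinearMap.baseChange_tmul]
  change (TensorProduct.AlgebraTensorModule.rid ℝ 𝕂 𝕂) _ = _
  rw [TensorProduct.AlgebraTensorModule.rid_tmul, RCLike.real_smul_eq_coe_mul]

theorem cliffConj_tmul (c : 𝕂) (a : RCl m) :
    cliffConj 𝕂 m (c ⊗ₜ[ℝ] a) = (starRingEnd 𝕂 c) ⊗ₜ[ℝ] rConj m a := rfl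

theorem cliffConj_smul (c : 𝕂) (a : Cl 𝕂 m) :
    cliffConj 𝕂 m (c • a) = starRingEnd 𝕂 c • cliffConj 𝕂 m a := by
  induction a using TensorProduct.induction_on with
  | zero => simp
  | add a b ha hb => rw [smul_add, map_add, ha, hb, map_add, smul_add]
  | tmul d a =>
    rw [TensorProduct.smul_tmul', cliffConj_tmul, cliffConj_tmul, TensorProduct.smul_tmul',
      smul_eq_mul, map_mul, smul_eq_mul]

theorem cliffConj_mul (a b : Cl 𝕂 m) :
    cliffConj 𝕂 m (a * b) = cliffConj 𝕂 m b * cliffConj 𝕂 m a := by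
  induction a using TensorProduct.induction_on with
  | zero => simp
  | add a a' ha ha' => rw [add_mul, map_add, ha, ha', map_add, mul_add]
  | tmul c a =>
    induction b using TensorProduct.induction_on with
    | zero => simp
    | add b b' hb hb' => rw [mul_add, map_add, hb, hb', map_add, add_mul]
    | tmul d b =>
      rw [Algebra.TensorProduct.tmul_mul_tmul, cliffConj_tmul, cliffConj_tmul, cliffConj_tmul,
        Algebra.TensorProduct.tmul_mul_tmul, map_mul, rConj_mul, mul_comm]

variable (𝕂 m) in
/-- The vector `∑ v_i e_i` in the Clifford algebra with scalars `𝕂`. -/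
def kVec (v : ℕ → ℝ) : Cl 𝕂 m := 1 ⊗ₜ[ℝ] clVec m v

theorem scalarPart_kVec_mul (v : ℕ → ℝ) (a : Cl 𝕂 m) :
    scalarPart 𝕂 m (kVec 𝕂 m v * a) = scalarPart 𝕂 m (a * kVec 𝕂 m v) := by
  induction a using TensorProduct.induction_on with
  | zero => simp
  | add a b ha hb => rw [mul_add, map_add, ha, hb, add_mul, map_add]
  | tmul c a =>
    rw [kVec, Algebra.TensorProduct.tmul_mul_tmul, Algebra.TensorProduct.tmul_mul_tmul,
      scalarPart_tmul, scalarPart_tmul, realScalarPart_clVec_mul, mul_one, one_mul]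

theorem cliffConj_kVec (v : ℕ → ℝ) : cliffConj 𝕂 m (kVec 𝕂 m v) = -kVec 𝕂 m v := by
  rw [kVec, cliffConj_tmul, rConj_clVec, map_one, TensorProduct.tmul_neg]

theorem kVec_mul_self {v : ℕ → ℝ} (h : IsUVec m v) : kVec 𝕂 m v * kVec 𝕂 m v = -1 := by
  rw [kVec, Algebra.TensorProduct.tmul_mul_tmul, clVec_mul_self h, mul_one, TensorProduct.tmul_neg]
  rfl

variable (𝕂 m) in
/-- The Hermitian form `[ā b]₀` on the Clifford algebra. -/
def hForm : Cl 𝕂 m →ₗ⋆[𝕂] Cl 𝕂 m →ₗ[𝕂] 𝕂 :=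
  LinearMap.mk₂'ₛₗ (starRingEnd 𝕂) (RingHom.id 𝕂)
    (fun a b => scalarPart 𝕂 m (cliffConj 𝕂 m a * b))
    (fun a a' b => by rw [map_add, add_mul, map_add])
    (fun c a b => by rw [cliffConj_smul, smul_mul_assoc, map_smul])
    (fun a b b' => by rw [mul_add, map_add])
    (fun c a b => by rw [mul_smul_comm, map_smul]; rfl)

theorem hForm_apply (a b : Cl 𝕂 m) : hForm 𝕂 m a b = scalarPart 𝕂 m (cliffConj 𝕂 m a * b) := rfl

theorem hForm_smul_smul (c d : 𝕂) (a b : Cl 𝕂 m) :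
    hForm 𝕂 m (c • a) (d • b) = starRingEnd 𝕂 c * d * hForm 𝕂 m a b := by
  rw [hForm_apply, hForm_apply, cliffConj_smul, smul_mul_smul_comm, map_smul, smul_eq_mul]

/-- Conjugation sends v to −v = v⁻¹, so the inner pair of factors cancels; the trace property of the
scalar part cancels the outer pair. -/
theorem hForm_conj {v : ℕ → ℝ} (h : IsUVec m v) (a b : Cl 𝕂 m) :
    hForm 𝕂 m (kVec 𝕂 m v * a * -kVec 𝕂 m v) (kVec 𝕂 m v * b * -kVec 𝕂 m v) = hForm 𝕂 m a b := by
  rw [hForm_apply, hForm_apply, cliffConj_mul, cliffConj_mul, map_neg, cliffConj_kVec, neg_neg]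
  have h1 : kVec 𝕂 m v * (cliffConj 𝕂 m a * -kVec 𝕂 m v) * (kVec 𝕂 m v * b * -kVec 𝕂 m v) =
      kVec 𝕂 m v * (cliffConj 𝕂 m a * -(kVec 𝕂 m v * kVec 𝕂 m v) * b * -kVec 𝕂 m v) := by
    noncomm_ring
  rw [h1, scalarPart_kVec_mul, kVec_mul_self h, neg_neg, mul_one, mul_assoc, neg_mul,
    kVec_mul_self h, neg_neg, mul_one]

theorem hForm_eProd {S T : Finset ℕ} (hS : S ⊆ Finset.Icc 1 m) (hT : T ⊆ Finset.Icc 1 m) :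
    hForm 𝕂 m (1 ⊗ₜ[ℝ] eProd m S) (1 ⊗ₜ[ℝ] eProd m T) = if S = T then 1 else 0 := by
  rw [hForm_apply, cliffConj_tmul, Algebra.TensorProduct.tmul_mul_tmul, scalarPart_tmul,
    realScalarPart_eProd_mul hS hT]
  split_ifs <;> simp

/-! ### Coordinates of Clifford algebra valued polynomials -/

variable (𝕂 m) in
/-- The polynomial `∑ q_S e_S`. -/
def ofCoords (q : Finset ℕ → MvPolynomial (Fin m) 𝕂) : CPol 𝕂 m :=
  ∑ S ∈ (Finset.Icc 1 m).powerset, ofS 𝕂 m (q S) * vS 𝕂 m S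

theorem exists_ofCoords (f : CPol 𝕂 m) : ∃ q, f = ofCoords 𝕂 m q := by
  have h : f ∈ ⨆ s, gSpan 𝕂 m s := by rw [iSup_gSpan]; trivial
  induction h using Submodule.iSup_induction' with
  | mem s f hf =>
    induction hf using Submodule.span_induction with
    | mem f hf =>
      obtain ⟨p, S, hS, -, rfl⟩ := hf
      refine ⟨fun T => if T = S then p else 0, ?_⟩
      rw [ofCoords, Finset.sum_eq_single S]
      · rw [if_pos rfl]
      · intro T _ hT; rw [if_neg hT, map_zero, zero_mul]
      · intro h; exact absurd (Finset.mem_powerset.2 hS) h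
    | zero => exact ⟨0, by simp [ofCoords]⟩
    | add f g _ _ hf hg =>
      obtain ⟨q, rfl⟩ := hf
      obtain ⟨q', rfl⟩ := hg
      exact ⟨q + q', by simp [ofCoords, add_mul, Finset.sum_add_distrib]⟩
    | smul c f _ hf =>
      obtain ⟨q, rfl⟩ := hf
      exact ⟨c • q, by simp [ofCoords, Finset.smul_sum]⟩
  | zero => exact ⟨0, by simp [ofCoords]⟩
  | add f g _ _ hf hg =>
    obtain ⟨q, rfl⟩ := hf
    obtain ⟨q', rfl⟩ := hg
    exact ⟨q + q', by simp [ofCoords, add_mul, Finset.sum_add_distrib]⟩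

theorem evl_ofCoords (p : EuclideanSpace ℝ (Fin m)) (q : Finset ℕ → MvPolynomial (Fin m) 𝕂) :
    evl 𝕂 m p (ofCoords 𝕂 m q) = ∑ S ∈ (Finset.Icc 1 m).powerset,
      MvPolynomial.eval (fun i => algebraMap ℝ 𝕂 (p i)) (q S) • (1 ⊗ₜ[ℝ] eProd m S : Cl 𝕂 m) := by
  rw [ofCoords, map_sum]
  refine Finset.sum_congr rfl fun S _ => ?_
  rw [map_mul, evl_ofS, vS, evl_const, smul_mul_assoc, one_mul]

theorem hForm_evl (p : EuclideanSpace ℝ (Fin m)) (q q' : Finset ℕ → MvPolynomial (Fin m) 𝕂) :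
    hForm 𝕂 m (evl 𝕂 m p (ofCoords 𝕂 m q)) (evl 𝕂 m p (ofCoords 𝕂 m q')) =
      ∑ S ∈ (Finset.Icc 1 m).powerset,
        starRingEnd 𝕂 (MvPolynomial.eval (fun i => algebraMap ℝ 𝕂 (p i)) (q S)) *
          MvPolynomial.eval (fun i => algebraMap ℝ 𝕂 (p i)) (q' S) := by
  rw [evl_ofCoords, evl_ofCoords, map_sum (hForm 𝕂 m), LinearMap.sum_apply]
  refine Finset.sum_congr rfl fun S hS => ?_
  rw [map_sum, Finset.sum_eq_single S]
  · rw [hForm_smul_smul, hForm_eProd (Finset.mem_powerset.1 hS) (Finset.mem_powerset.1 hS),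
      if_pos rfl, mul_one]
  · intro T hT hTS
    rw [hForm_smul_smul, hForm_eProd (Finset.mem_powerset.1 hS) (Finset.mem_powerset.1 hT),
      if_neg (Ne.symm hTS), mul_zero]
  · intro h; exact absurd hS h

theorem continuous_hForm (f g : CPol 𝕂 m) :
    Continuous fun p => hForm 𝕂 m (evl 𝕂 m p f) (evl 𝕂 m p g) := by
  obtain ⟨q, rfl⟩ := exists_ofCoords f
  obtain ⟨q', rfl⟩ := exists_ofCoords g
  simp only [hForm_evl]
  have h : ∀ q : MvPolynomial (Fin m) 𝕂, Continuous fun p : EuclideanSpace ℝ (Fin m) =>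
      MvPolynomial.eval (fun i => algebraMap ℝ 𝕂 (p i)) q := fun q =>
    (MvPolynomial.continuous_eval q).comp (continuous_pi fun i =>
      RCLike.continuous_ofReal.comp (EuclideanSpace.proj i).continuous)
  exact continuous_finset_sum _ fun S _ => ((RCLike.continuous_conj).comp (h _)).mul (h _)

theorem exists_hForm_self (f : CPol 𝕂 m) (p : EuclideanSpace ℝ (Fin m)) :
    ∃ c : ℝ, 0 ≤ c ∧ hForm 𝕂 m (evl 𝕂 m p f) (evl 𝕂 m p f) = c ∧ (c = 0 → evl 𝕂 m p f = 0) := by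
  obtain ⟨q, rfl⟩ := exists_ofCoords f
  refine ⟨∑ S ∈ (Finset.Icc 1 m).powerset,
    ‖MvPolynomial.eval (fun i => algebraMap ℝ 𝕂 (p i)) (q S)‖ ^ 2,
    Finset.sum_nonneg fun _ _ => by positivity, ?_, fun h => ?_⟩
  · rw [hForm_evl, RCLike.ofReal_sum]
    exact Finset.sum_congr rfl fun S _ => by rw [RCLike.conj_mul, RCLike.ofReal_pow]
  · rw [Finset.sum_eq_zero_iff_of_nonneg fun _ _ => by positivity] at h
    rw [evl_ofCoords]
    refine Finset.sum_eq_zero fun S hS => ?_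
    rw [norm_eq_zero.1 (pow_eq_zero_iff two_ne_zero |>.1 (h S hS)), zero_smul]

/-! ### The inner product -/

theorem integrableOn_hForm (f g : CPol 𝕂 m) :
    MeasureTheory.IntegrableOn (fun p => hForm 𝕂 m (evl 𝕂 m p f) (evl 𝕂 m p g))
      (Metric.ball 0 1) :=
  ((continuous_hForm f g).continuousOn.integrableOn_compact
    (isCompact_closedBall 0 1)).mono_set Metric.ball_subset_closedBall

variable (𝕂 m) in
/-- The inner product as a sesquilinear form. -/
def iForm : CPol 𝕂 m →ₗ⋆[𝕂] CPol 𝕂 m →ₗ[𝕂] 𝕂 :=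
  LinearMap.mk₂'ₛₗ (starRingEnd 𝕂) (RingHom.id 𝕂)
    (fun f g => ∫ p in Metric.ball (0 : EuclideanSpace ℝ (Fin m)) 1,
      hForm 𝕂 m (evl 𝕂 m p f) (evl 𝕂 m p g))
    (fun f f' g => by
      simp only [map_add, LinearMap.add_apply]
      exact MeasureTheory.integral_add (integrableOn_hForm f g) (integrableOn_hForm f' g))
    (fun c f g => by
      have h := fun p => hForm_smul_smul c (1 : 𝕂) (evl 𝕂 m p f) (evl 𝕂 m p g)
      simp only [one_smul, mul_one] at h
      simp only [map_smul, h]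
      exact MeasureTheory.integral_const_mul _ _)
    (fun f g g' => by
      simp only [map_add]
      exact MeasureTheory.integral_add (integrableOn_hForm f g) (integrableOn_hForm f g'))
    (fun c f g => by
      simp only [map_smul]
      exact MeasureTheory.integral_smul _ _)

theorem iForm_apply (f g : CPol 𝕂 m) : iForm 𝕂 m f g =
    ∫ p in Metric.ball (0 : EuclideanSpace ℝ (Fin m)) 1,
      hForm 𝕂 m (evl 𝕂 m p f) (evl 𝕂 m p g) := rfl

theorem iForm_smul_left (c : 𝕂) (f g : CPol 𝕂 m) :
    iForm 𝕂 m (c • f) g = starRingEnd 𝕂 c * iForm 𝕂 m f g := by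
  rw [LinearMap.map_smulₛₗ (iForm 𝕂 m)]; rfl

theorem iForm_smul_right (c : 𝕂) (f g : CPol 𝕂 m) :
    iForm 𝕂 m f (c • g) = c * iForm 𝕂 m f g := map_smul (iForm 𝕂 m f) c g

/-- The vector of `ℝ^m` with the coordinates `v_1, …, v_m`. -/
def eVec (m : ℕ) (v : ℕ → ℝ) : EuclideanSpace ℝ (Fin m) := WithLp.toLp 2 fun i => v (i + 1)

theorem norm_eVec {v : ℕ → ℝ} (h : IsUVec m v) : ‖eVec m v‖ = 1 := by
  rw [EuclideanSpace.norm_eq]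
  have : ∀ i : Fin m, ‖(eVec m v) i‖ ^ 2 = v (i + 1) ^ 2 := fun i => by
    rw [Real.norm_eq_abs, sq_abs]; rfl
  rw [Finset.sum_congr rfl fun i _ => this i, sum_fin_eq_sum_Icc m fun i => v i ^ 2, h.2,
    Real.sqrt_one]

/-- The reflection `p ↦ 2 (v, p) v - p`. -/
def refl (m : ℕ) (v : ℕ → ℝ) : EuclideanSpace ℝ (Fin m) ≃ₗᵢ[ℝ] EuclideanSpace ℝ (Fin m) :=
  (Submodule.span ℝ {eVec m v}).reflection

theorem refl_apply {v : ℕ → ℝ} (h : IsUVec m v) (p : EuclideanSpace ℝ (Fin m)) (i : Fin m) :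
    refl m v p i = 2 * v (i + 1) * (∑ j : Fin m, v (j + 1) * p j) - p i := by
  rw [refl, Submodule.reflection_singleton_apply, norm_eVec h]
  simp only [PiLp.sub_apply, PiLp.smul_apply, PiLp.inner_apply, smul_eq_mul, RCLike.inner_apply]
  simp [eVec, mul_comm, mul_left_comm, mul_assoc]

/-- Both sides are multiplicative in f, so the generators suffice. This identifies the algebraic
action with an isometry of the space of points combined with a conjugation of values. -/
theorem evl_sg {v : ℕ → ℝ} (h : IsUVec m v) (p : EuclideanSpace ℝ (Fin m)) (f : CPol 𝕂 m) :
    evl 𝕂 m p (sg 𝕂 m v f) = kVec 𝕂 m v * evl 𝕂 m (refl m v p) f * -kVec 𝕂 m v := by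
  have hk : kVec 𝕂 m v * -kVec 𝕂 m v = 1 := by rw [mul_neg, kVec_mul_self h, neg_neg]
  have hk' : -kVec 𝕂 m v * kVec 𝕂 m v = 1 := by rw [neg_mul, kVec_mul_self h, neg_neg]
  induction f using cpol_induction with
  | scalar c =>
    rw [AlgHom.commutes, AlgHom.commutes, AlgHom.commutes, ← Algebra.commutes, mul_assoc, hk, mul_one]
  | x i h1 h2 =>
    obtain ⟨i, rfl⟩ := exists_fin ⟨h1, h2⟩
    rw [sg_vx le_rfl h, evl_vx, mul_smul_comm, mul_one, smul_mul_assoc, hk, map_sub, map_smul, vComb,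
      ← sum_fin_eq_sum_Icc m fun i => (v i : 𝕂) • vx 𝕂 m i, map_sum]
    simp only [map_smul, evl_vx, smul_smul]
    rw [← Finset.sum_smul, smul_smul, ← sub_smul, refl_apply h]
    push_cast
    rfl
  | e i h1 h2 =>
    have h3 : sg 𝕂 m v (ve 𝕂 m i) = cst 𝕂 m (clVec m v * realE m i * -clVec m v) := by
      refine (actA_const (uVec m v) (realE m i)).trans ?_
      rw [uVec_val h, uVec_inv_val h]; rfl
    have h4 : evl 𝕂 m (refl m v p) (ve 𝕂 m i) = 1 ⊗ₜ[ℝ] realE m i := evl_const _ _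
    rw [h3, h4, evl_const, kVec, ← TensorProduct.tmul_neg, Algebra.TensorProduct.tmul_mul_tmul,
      Algebra.TensorProduct.tmul_mul_tmul, mul_one, mul_one]
  | add f g hf hg => rw [map_add, map_add, hf, hg, map_add, mul_add, add_mul]
  | mul f g hf hg =>
    rw [map_mul, map_mul, hf, hg, map_mul]
    have h5 : ∀ a b : Cl 𝕂 m, kVec 𝕂 m v * a * -kVec 𝕂 m v * (kVec 𝕂 m v * b * -kVec 𝕂 m v) =
        kVec 𝕂 m v * (a * b) * -kVec 𝕂 m v := fun a b => by
      rw [← mul_assoc, ← mul_assoc, mul_assoc _ (-kVec 𝕂 m v) (kVec 𝕂 m v), hk', mul_one,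
        mul_assoc (kVec 𝕂 m v) a b]
    exact h5 _ _

/-- The Hermitian form on values is invariant under the conjugation, and the isometry preserves
Lebesgue measure and the ball. -/
theorem iForm_sg {v : ℕ → ℝ} (h : IsUVec m v) (f g : CPol 𝕂 m) :
    iForm 𝕂 m (sg 𝕂 m v f) (sg 𝕂 m v g) = iForm 𝕂 m f g := by
  rw [iForm_apply, iForm_apply]
  simp only [evl_sg h, hForm_conj h]
  have h1 := (refl m v).measurePreserving.setIntegral_preimage_emb
    (refl m v).toHomeomorph.measurableEmbedding
    (fun p => hForm 𝕂 m (evl 𝕂 m p f) (evl 𝕂 m p g)) (Metric.ball 0 1)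
  rw [LinearIsometryEquiv.preimage_ball, map_zero] at h1
  exact h1

/-- The integrand is continuous and nonnegative, so it vanishes on the ball; homogeneity carries
this to all points. -/
theorem eq_zero_of_iForm_self {k : ℕ} {f : CPol 𝕂 m} (hf : f ∈ homog 𝕂 m k)
    (h : iForm 𝕂 m f f = 0) : f = 0 := by
  choose c hc0 hc1 hc2 using exists_hForm_self f
  have hcc : Continuous c := by
    have h1 := RCLike.continuous_re.comp (continuous_hForm f f)
    have h2 : (RCLike.re ∘ fun p => hForm 𝕂 m (evl 𝕂 m p f) (evl 𝕂 m p f)) = c :=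
      funext fun p => by rw [Function.comp_apply, hc1, RCLike.ofReal_re]
    rwa [h2] at h1
  have hint : MeasureTheory.IntegrableOn c (Metric.ball 0 1) :=
    (hcc.continuousOn.integrableOn_compact
      (isCompact_closedBall 0 1)).mono_set Metric.ball_subset_closedBall
  have h0 : ∫ p in Metric.ball (0 : EuclideanSpace ℝ (Fin m)) 1, c p = 0 := by
    rw [iForm_apply] at h
    simp only [hc1] at h
    have h2 := integral_ofReal (𝕜 := 𝕂) (f := c)
      (μ := MeasureTheory.volume.restrict (Metric.ball (0 : EuclideanSpace ℝ (Fin m)) 1))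
    rw [h] at h2
    exact_mod_cast h2.symm
  rw [MeasureTheory.setIntegral_eq_zero_iff_of_nonneg_ae (Filter.Eventually.of_forall hc0) hint] at h0
  have h3 := MeasureTheory.Measure.eqOn_open_of_ae_eq h0 Metric.isOpen_ball hcc.continuousOn
    continuousOn_const
  refine evl_injective fun p => ?_
  have hp : 0 < 1 + ‖p‖ := by positivity
  -- Every point is a positive multiple of a point of the open ball.
  have h4 : (1 + ‖p‖)⁻¹ • p ∈ Metric.ball (0 : EuclideanSpace ℝ (Fin m)) 1 := by
    rw [mem_ball_zero_iff, norm_smul, norm_inv, Real.norm_of_nonneg hp.le, inv_mul_lt_iff₀ hp]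
    linarith
  have h5 := hc2 _ (h3 h4)
  rw [hf] at h5
  refine (smul_eq_zero.1 h5).resolve_left ?_
  exact (map_ne_zero _).2 (by positivity)

/-! ### Symmetry of the operators -/

/-- The form is only conjugate linear in the first argument, but real scalars pass through, and this
is all that the product rule for real curves needs. -/
theorem isDeriv_iForm {c d : ℝ → CPol 𝕂 m} {c' d' : CPol 𝕂 m} (hc : IsDeriv 𝕂 c c')
    (hd : IsDeriv 𝕂 d d') :
    IsDeriv 𝕂 (fun θ => iForm 𝕂 m (c θ) (d θ)) (iForm 𝕂 m c' (d 0) + iForm 𝕂 m (c 0) d') :=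
  hc.bilin hd (AddMonoidHom.mk' (fun f => (iForm 𝕂 m f).toAddMonoidHom)
      fun f g => by rw [map_add]; rfl)
    (fun r f g => by
      change iForm 𝕂 m ((r : 𝕂) • f) g = (r : 𝕂) • iForm 𝕂 m f g
      rw [iForm_smul_left, RCLike.conj_ofReal, smul_eq_mul])
    (fun r f g => by
      change iForm 𝕂 m f ((r : 𝕂) • g) = (r : 𝕂) • iForm 𝕂 m f g
      rw [iForm_smul_right, smul_eq_mul])

/-- Differentiating the invariance of the form under rotations gives skew symmetry of the
infinitesimal rotations. Their squares, hence the Casimir operator, are symmetric. -/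
theorem iForm_lie {i j : ℕ} (hi : i ∈ Finset.Icc 1 m) (hj : j ∈ Finset.Icc 1 m)
    (f g : CPol 𝕂 m) : iForm 𝕂 m (lie 𝕂 m i j f) g = -iForm 𝕂 m f (lie 𝕂 m i j g) := by
  by_cases hij : i = j
  · subst hij; rw [lie_self, lie_self]; simp
  · have h1 := isDeriv_iForm (isDeriv_rot hi hj hij le_rfl f) (isDeriv_rot hi hj hij le_rfl g)
    simp only [rot, AlgHom.comp_apply, iForm_sg (isUVec_rv hi hj hij _)] at h1
    have h2 := h1.unique (IsDeriv.const _)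
    have h3 : ∀ f : CPol 𝕂 m, sg 𝕂 m (rv i j 0) (sg 𝕂 m (rv i j 0) f) = f := fun f =>
      rot_zero hi hj hij le_rfl f
    rw [h3, h3, iForm_smul_left, iForm_smul_right, map_ofNat, ← mul_add] at h2
    exact eq_neg_of_add_eq_zero_left ((mul_eq_zero.1 h2).resolve_left two_ne_zero)

theorem iForm_casimir {n : ℕ} (hn : n ≤ m) (f g : CPol 𝕂 m) :
    iForm 𝕂 m (casimir 𝕂 m n f) g = iForm 𝕂 m f (casimir 𝕂 m n g) := by
  rw [casimir_apply, casimir_apply, map_sum, map_sum, LinearMap.sum_apply]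
  refine Finset.sum_congr rfl fun i hi => ?_
  rw [map_sum, map_sum, LinearMap.sum_apply]
  refine Finset.sum_congr rfl fun j hj => ?_
  have hi' := Finset.Icc_subset_Icc_right hn hi
  have hj' := Finset.Icc_subset_Icc_right hn hj
  rw [iForm_lie hi' hj', iForm_lie hi' hj', neg_neg]

theorem omg_omg {n : ℕ} (hn : n ≤ m) (f : CPol 𝕂 m) : omg 𝕂 m n (omg 𝕂 m n f) = f := by
  suffices H : (omg 𝕂 m n).comp (omg 𝕂 m n) = AlgHom.id 𝕂 _ from DFunLike.congr_fun H f
  refine cpol_algHom_ext (fun i h1 _ => ?_) (fun i h1 _ => ?_)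
  · rw [AlgHom.comp_apply, (omg_generator hn i h1).1, map_smul, (omg_generator hn i h1).1, smul_smul,
      AlgHom.id_apply]
    split_ifs <;> simp [← mul_pow]
  · rw [AlgHom.comp_apply, (omg_generator hn i h1).2, map_smul, (omg_generator hn i h1).2, smul_smul,
      AlgHom.id_apply]
    split_ifs <;> simp [← mul_pow]

theorem iForm_omg_omg {n : ℕ} (hn : n ≤ m) (f g : CPol 𝕂 m) :
    iForm 𝕂 m (omg 𝕂 m n f) (omg 𝕂 m n g) = iForm 𝕂 m f g := by
  induction n generalizing f g with
  | zero => rfl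
  | succ n ih =>
    have h1 : ∀ g, omg 𝕂 m (n + 1) g = omg 𝕂 m n (sg 𝕂 m (bv (n + 1)) g) := fun _ => rfl
    rw [h1, h1, ih (by omega), iForm_sg (isUVec_bv (by rw [Finset.mem_Icc]; omega))]

/-- The element e_1⋯e_n acts as an isometric involution, and such a map is symmetric. -/
theorem iForm_tOp {n : ℕ} (hn : n ≤ m) (f g : CPol 𝕂 m) :
    iForm 𝕂 m (tOp 𝕂 m n f) g = iForm 𝕂 m f (tOp 𝕂 m n g) := by
  rw [tOp_apply, tOp_apply, map_add, map_add, LinearMap.add_apply, iForm_smul_left,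
    iForm_casimir hn, iForm_smul_right, map_ofNat]
  split_ifs
  · rw [← iForm_omg_omg hn (omg 𝕂 m n f) g, omg_omg hn]
  · simp

/-- Eigenvectors of the separating operator for distinct eigenvalues are orthogonal. -/
theorem iForm_eq_zero_of_tOp {n : ℕ} (hn : n ≤ m) {f g : CPol 𝕂 m} {a b : ℤ} (hab : a ≠ b)
    (hf : tOp 𝕂 m n f = (a : 𝕂) • f) (hg : tOp 𝕂 m n g = (b : 𝕂) • g) : iForm 𝕂 m f g = 0 := by
  have h := iForm_tOp hn f g
  rw [hf, hg, iForm_smul_left, iForm_smul_right, map_intCast] at h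
  have h1 : ((a : 𝕂) - b) * iForm 𝕂 m f g = 0 := by rw [sub_mul, h, sub_self]
  refine (mul_eq_zero.1 h1).resolve_left ?_
  exact sub_ne_zero.2 (by exact_mod_cast hab)

/-! ### Invariant and irreducible subspaces -/

/-- `W` is stable under the action of the unit vectors of `ℝ^r`. -/
def SgStable (r : ℕ) (W : Submodule 𝕂 (CPol 𝕂 m)) : Prop :=
  ∀ v, IsUVec r v → ∀ f ∈ W, sg 𝕂 m v f ∈ W

/-- `W` is irreducible under the action of the unit vectors of `ℝ^r`. -/
def Irr (r : ℕ) (W : Submodule 𝕂 (CPol 𝕂 m)) : Prop :=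
  SgStable r W ∧ W ≠ ⊥ ∧ ∀ U : Submodule 𝕂 (CPol 𝕂 m), U ≤ W → SgStable r U → U = ⊥ ∨ U = W

theorem Irr.isIrred {r : ℕ} (hr : r ≤ m) {W : Submodule 𝕂 (CPol 𝕂 m)} (h : Irr r W) :
    IsIrred 𝕂 m r W :=
  ⟨(isInvariant_iff hr).2 h.1, h.2.1, fun U hU hU' => h.2.2 U hU ((isInvariant_iff hr).1 hU')⟩

theorem SgStable.mono {r r' : ℕ} (h : r ≤ r') {W : Submodule 𝕂 (CPol 𝕂 m)} (hW : SgStable r' W) :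
    SgStable r W := fun v hv => hW v (hv.mono h)

theorem SgStable.inf {r : ℕ} {U W : Submodule 𝕂 (CPol 𝕂 m)} (hU : SgStable r U)
    (hW : SgStable r W) : SgStable r (U ⊓ W) :=
  fun v hv f hf => ⟨hU v hv f hf.1, hW v hv f hf.2⟩

theorem sgStable_Hr {r : ℕ} (hr : r ≤ m) (s : ℤ) (k : ℕ) : SgStable r (Hr 𝕂 m r s k) :=
  fun _ hv _ hf => sg_mem_Hr hr hv hf

theorem SemiEq.map_sg {r : ℕ} {ε : ℤ} {Φ : Module.End 𝕂 (CPol 𝕂 m)} (h : SemiEq r ε Φ)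
    {v : ℕ → ℝ} (hv : IsUVec r v) (f : CPol 𝕂 m) :
    Φ (sg 𝕂 m v f) = (ε : 𝕂) • sg 𝕂 m v (Φ f) := by
  rw [h.2 v hv, smul_smul, h.sq, one_smul]

/-- The sign in the equivariance is harmless, since subspaces are closed under scalars: images and
preimages of stable subspaces remain stable. -/
theorem Irr.map {r : ℕ} {W : Submodule 𝕂 (CPol 𝕂 m)} (hW : Irr r W) {ε : ℤ}
    {Φ : Module.End 𝕂 (CPol 𝕂 m)} (hΦ : SemiEq r ε Φ) (hinj : ∀ f ∈ W, Φ f = 0 → f = 0) :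
    Irr r (W.map Φ) := by
  refine ⟨?_, fun h => hW.2.1 ?_, fun U hU hU' => ?_⟩
  · rintro v hv _ ⟨f, hf, rfl⟩
    rw [hΦ.2 v hv]
    exact Submodule.smul_mem _ _ (Submodule.mem_map_of_mem (hW.1 v hv f hf))
  · rw [eq_bot_iff]
    intro f hf
    refine (Submodule.mem_bot 𝕂).2 (hinj f hf ?_)
    have := Submodule.mem_map_of_mem (f := Φ) hf
    rwa [h, Submodule.mem_bot] at this
  · have hst : SgStable r (W ⊓ U.comap Φ) := fun v hv f hf => ⟨hW.1 v hv f hf.1, by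
      change Φ (sg 𝕂 m v f) ∈ U
      rw [hΦ.map_sg hv]
      exact U.smul_mem _ (hU' v hv _ hf.2)⟩
    rcases hW.2.2 _ inf_le_left hst with h | h
    · left
      rw [eq_bot_iff]
      intro g hg
      obtain ⟨f, hf, rfl⟩ := hU hg
      have : f ∈ W ⊓ U.comap Φ := ⟨hf, hg⟩
      rw [h, Submodule.mem_bot] at this
      rw [this, map_zero]
      exact zero_mem _
    · right
      refine le_antisymm hU ?_
      rintro _ ⟨f, hf, rfl⟩
      rw [← h] at hf
      exact hf.2

/-! ### Points of the sphere -/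

/-- The orbit of `e_r` meets all lines in `ℝ^r`. -/
theorem exists_refl {r : ℕ} (hr1 : 1 ≤ r) (hr : r ≤ m) {y : ℕ → ℝ}
    (hy : ∀ i, i ∉ Finset.Icc 1 r → y i = 0) (h0 : ∃ i, y i ≠ 0) :
    ∃ (v : ℕ → ℝ) (ρ : ℝ), IsUVec r v ∧ eVec m y = ρ • refl m v (eVec m (bv r)) := by
  have hrr : r ∈ Finset.Icc 1 r := by rw [Finset.mem_Icc]; omega
  set S := ∑ i ∈ Finset.Icc 1 r, y i ^ 2 with hS
  have hSpos : 0 < S := by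
    obtain ⟨i, hi⟩ := h0
    have hi' : i ∈ Finset.Icc 1 r := by by_contra h; exact hi (hy i h)
    exact Finset.sum_pos' (fun _ _ => sq_nonneg _) ⟨i, hi', by positivity⟩
  -- The bisector of y and ρ e_r degenerates if y = −ρ e_r; one of the two signs of ρ avoids this.
  obtain ⟨ρ, hρ, hne⟩ : ∃ ρ : ℝ, ρ ^ 2 = S ∧ y r + ρ ≠ 0 := by
    by_cases h : y r + √S = 0
    · refine ⟨-√S, by rw [neg_sq, Real.sq_sqrt hSpos.le], ?_⟩
      have := Real.sqrt_pos.2 hSpos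
      intro h'
      linarith
    · exact ⟨√S, Real.sq_sqrt hSpos.le, h⟩
  have hρ0 : ρ ≠ 0 := by rintro rfl; rw [zero_pow two_ne_zero] at hρ; linarith
  -- The axis is the bisector of y and ρ e_r, whose squared length is 2ρ(ρ + y_r).
  set w : ℕ → ℝ := fun i => y i + if i = r then ρ else 0 with hw
  have hsum : ∑ i ∈ Finset.Icc 1 r, w i ^ 2 = 2 * ρ * (ρ + y r) := by
    have : ∀ i, w i ^ 2 = y i ^ 2 + if i = r then 2 * ρ * y i + ρ ^ 2 else 0 := by
      intro i; rw [hw]; simp only; split_ifs <;> ring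
    rw [Finset.sum_congr rfl fun i _ => this i, Finset.sum_add_distrib, ← hS, ← hρ,
      Finset.sum_ite_eq', if_pos hrr]
    ring
  set D := 2 * ρ * (ρ + y r) with hD
  have hD0 : D ≠ 0 := mul_ne_zero (mul_ne_zero two_ne_zero hρ0) (by rwa [add_comm])
  have hDpos : 0 < D :=
    lt_of_le_of_ne (by rw [← hsum]; exact Finset.sum_nonneg fun _ _ => sq_nonneg _) hD0.symm
  have hv : IsUVec r fun i => w i / √D := by
    refine ⟨fun i hi => ?_, ?_⟩
    · have : i ≠ r := by rintro rfl; exact hi hrr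
      simp only [hw, hy i hi, if_neg this, add_zero, zero_div]
    · simp only [div_pow, Real.sq_sqrt hDpos.le]
      rw [← Finset.sum_div, hsum, div_self hD0]
  refine ⟨_, ρ, hv, ?_⟩
  ext i
  rw [PiLp.smul_apply, refl_apply (hv.mono hr), smul_eq_mul]
  have h1 : ∑ j : Fin m, w (j + 1) / √D * eVec m (bv r) j = w r / √D := by
    have : ∀ j : Fin m, eVec m (bv r) j = bv r (j + 1) := fun _ => rfl
    simp only [this]
    rw [sum_fin_eq_sum_Icc m fun j => w j / √D * bv r j, Finset.sum_eq_single r]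
    · simp [bv]
    · intro j _ hj; simp [bv, hj]
    · intro h; exact absurd (Finset.Icc_subset_Icc_right hr hrr) h
  rw [h1]
  have h2 : eVec m (bv r) i = if (i : ℕ) + 1 = r then 1 else 0 := rfl
  have h3 : eVec m y i = y (i + 1) := rfl
  have h4 : w r = ρ + y r := by simp [hw, add_comm]
  have h5 : √D * √D = D := Real.mul_self_sqrt hDpos.le
  rw [h2, h3, h4, show 2 * (w (i + 1) / √D) * ((ρ + y r) / √D) =
    2 * w (i + 1) * (ρ + y r) / (√D * √D) by ring, h5, hD]
  have h6 : ρ + y r ≠ 0 := by rwa [add_comm]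
  field_simp
  simp only [hw, mul_ite, mul_one, mul_zero]
  split_ifs <;> ring

/-- Vanishing of all transforms of h at e_r means vanishing of h on the orbit of e_r. Homogeneity
extends this to the lines through the orbit, hence to all of ℝ^r; the origin needs positive degree.
-/
theorem eq_zero_of_orbit {r k : ℕ} (hr1 : 1 ≤ r) (hr : r ≤ m) {h : CPol 𝕂 m}
    (hh : h ∈ homog 𝕂 m k) (hk : 1 ≤ k)
    (h0 : ∀ v, IsUVec r v → evl 𝕂 m (eVec m (bv r)) (sg 𝕂 m v h) = 0) {y : ℕ → ℝ}
    (hy : ∀ i, i ∉ Finset.Icc 1 r → y i = 0) : evl 𝕂 m (eVec m y) h = 0 := by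
  by_cases hy0 : ∃ i, y i ≠ 0
  · obtain ⟨v, ρ, hv, hyv⟩ := exists_refl hr1 hr hy hy0
    have h1 := h0 v hv
    rw [evl_sg (hv.mono hr)] at h1
    have hk1 := kVec_mul_self (𝕂 := 𝕂) (hv.mono hr)
    have h2 : evl 𝕂 m (refl m v (eVec m (bv r))) h = 0 := by
      have h3 := congrArg (fun a => -kVec 𝕂 m v * a * kVec 𝕂 m v) h1
      simp only [mul_zero, zero_mul] at h3
      rw [show ∀ a : Cl 𝕂 m, -kVec 𝕂 m v * (kVec 𝕂 m v * a * -kVec 𝕂 m v) * kVec 𝕂 m v =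
        (kVec 𝕂 m v * kVec 𝕂 m v) * a * (kVec 𝕂 m v * kVec 𝕂 m v) by intro a; noncomm_ring, hk1] at h3
      simpa using h3
    rw [hyv, hh, h2, smul_zero]
  · push Not at hy0
    have : eVec m y = (0 : ℝ) • eVec m y := by
      rw [zero_smul]; ext i; exact hy0 _
    rw [this, hh, zero_pow (by omega), map_zero, zero_smul]

/-- Values depend only on the first r coordinates. By Euler's formula a homogeneous polynomial is
recovered from these coordinates and its derivatives, so induction on the degree applies. -/
theorem evl_eq_of_polSub {r k : ℕ} (hr : r ≤ m) {h : CPol 𝕂 m} (hh : h ∈ homog 𝕂 m k)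
    (hp : h ∈ polSub 𝕂 m r) {y y' : ℕ → ℝ} (hy : ∀ i ∈ Finset.Icc 1 r, y i = y' i) :
    evl 𝕂 m (eVec m y) h = evl 𝕂 m (eVec m y') h := by
  induction k generalizing h with
  | zero =>
    have h1 : ∀ p, evl 𝕂 m p h = evl 𝕂 m 0 h := fun p => by
      have := hh 0 p
      rw [zero_smul, pow_zero, map_one, one_smul] at this
      exact this.symm
    rw [h1, h1 (eVec m y')]
  | succ k ih =>
    have h1 : ((k + 1 : ℕ) : 𝕂) ≠ 0 := Nat.cast_ne_zero.2 (Nat.succ_ne_zero k)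
    have h2 := mem_homog_iff.1 hh
    refine smul_right_injective _ h1 ?_
    simp only
    rw [← map_smul, ← map_smul, ← h2, euler_eq_of_polSub hr hp, euler_apply, map_sum, map_sum]
    refine Finset.sum_congr rfl fun i hi => ?_
    have hi' := Finset.mem_Icc.1 hi
    rw [mulX_apply, map_mul, map_mul, ih (h := pD 𝕂 m i h)]
    · obtain ⟨l, rfl⟩ := exists_fin (m := m) ⟨hi'.1, by omega⟩
      rw [evl_vx, evl_vx]
      have h3 : ∀ y : ℕ → ℝ, eVec m y l = y (l + 1) := fun _ => rfl
      rw [h3, h3, hy _ hi]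
    · rw [mem_homog_iff, pD_euler le_rfl (Finset.Icc_subset_Icc_right hr hi), h2, map_smul]
      push_cast; module
    · intro l hl
      rw [pD_comm, (hp l hl).1, ← pD_kap, (hp l hl).2, map_zero]; exact ⟨rfl, rfl⟩

theorem eq_zero_of_orbit_polSub {r k : ℕ} (hr1 : 1 ≤ r) (hr : r ≤ m) {h : CPol 𝕂 m}
    (hh : h ∈ homog 𝕂 m k) (hk : 1 ≤ k) (hp : h ∈ polSub 𝕂 m r)
    (h0 : ∀ v, IsUVec r v → evl 𝕂 m (eVec m (bv r)) (sg 𝕂 m v h) = 0) : h = 0 := by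
  refine evl_injective fun p => ?_
  let y : ℕ → ℝ := fun i => if hi : 1 ≤ i ∧ i ≤ m then p ⟨i - 1, by omega⟩ else 0
  have hy : p = eVec m y := by
    ext i
    change p i = y (i + 1)
    rw [show y (i + 1) = p ⟨i + 1 - 1, by omega⟩ from dif_pos ⟨by omega, by omega⟩]
    rfl
  rw [hy, evl_eq_of_polSub hr hh hp (y' := fun i => if i ∈ Finset.Icc 1 r then y i else 0)
    fun i hi => (if_pos hi).symm]
  exact eq_zero_of_orbit hr1 hr hh hk h0 fun i hi => if_neg hi

/-! ### The ideal of the polynomials that vanish on the last axis -/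

variable (𝕂 m) in
/-- The ideal generated by `x_1, …, x_n`. -/
def xIdeal (n : ℕ) : Submodule 𝕂 (CPol 𝕂 m) where
  carrier := {g | ∃ G : ℕ → CPol 𝕂 m, g = ∑ i ∈ Finset.Icc 1 n, vx 𝕂 m i * G i}
  add_mem' := by
    rintro _ _ ⟨G, rfl⟩ ⟨G', rfl⟩
    exact ⟨G + G', by simp only [Pi.add_apply, mul_add, Finset.sum_add_distrib]⟩
  zero_mem' := ⟨0, by simp⟩
  smul_mem' := by
    rintro c _ ⟨G, rfl⟩
    exact ⟨c • G, by simp only [Pi.smul_apply, mul_smul_comm, Finset.smul_sum]⟩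

theorem mul_left_mem_xIdeal {n : ℕ} (a : CPol 𝕂 m) {g : CPol 𝕂 m} (hg : g ∈ xIdeal 𝕂 m n) :
    a * g ∈ xIdeal 𝕂 m n := by
  obtain ⟨G, rfl⟩ := hg
  refine ⟨fun i => a * G i, ?_⟩
  rw [Finset.mul_sum]
  exact Finset.sum_congr rfl fun i _ => by rw [← mul_assoc, ← vx_mul_comm, mul_assoc]

theorem mul_right_mem_xIdeal {n : ℕ} (a : CPol 𝕂 m) {g : CPol 𝕂 m} (hg : g ∈ xIdeal 𝕂 m n) :
    g * a ∈ xIdeal 𝕂 m n := by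
  obtain ⟨G, rfl⟩ := hg
  refine ⟨fun i => G i * a, ?_⟩
  rw [Finset.sum_mul]
  exact Finset.sum_congr rfl fun i _ => by rw [mul_assoc]

theorem eps_mem_xIdeal {n : ℕ} (l : ℕ) {g : CPol 𝕂 m} (hg : g ∈ xIdeal 𝕂 m n) :
    eps 𝕂 m l g ∈ xIdeal 𝕂 m n := by
  obtain ⟨G, rfl⟩ := hg
  refine ⟨fun i => eps 𝕂 m l (G i), ?_⟩
  rw [map_sum]
  exact Finset.sum_congr rfl fun i _ => (mulX_eps i l (G i)).symm

theorem evl_xIdeal {n : ℕ} (hn : n + 1 ≤ m) {g : CPol 𝕂 m} (hg : g ∈ xIdeal 𝕂 m n) :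
    evl 𝕂 m (eVec m (bv (n + 1))) g = 0 := by
  obtain ⟨G, rfl⟩ := hg
  rw [map_sum]
  refine Finset.sum_eq_zero fun i hi => ?_
  have hi' := Finset.mem_Icc.1 hi
  obtain ⟨l, rfl⟩ := exists_fin (m := m) ⟨hi'.1, by omega⟩
  rw [map_mul, evl_vx]
  have h3 : eVec m (bv (n + 1)) l = if (l : ℕ) + 1 = n + 1 then 1 else 0 := rfl
  rw [h3, if_neg (by omega), RCLike.ofReal_zero, zero_smul, zero_mul]

theorem mem_xIdeal_of_mem_Hr {n : ℕ} {t : ℤ} {j : ℕ} (hj : j ≠ 0) {f : CPol 𝕂 m}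
    (hf : f ∈ Hr 𝕂 m n t j) : f ∈ xIdeal 𝕂 m n := by
  have h1 : (j : 𝕂) ≠ 0 := Nat.cast_ne_zero.2 hj
  have h2 : f = (j : 𝕂)⁻¹ • euler 𝕂 m n f := by rw [hf.2.1, smul_smul, inv_mul_cancel₀ h1, one_smul]
  rw [h2]
  refine Submodule.smul_mem _ _ ⟨fun i => pD 𝕂 m i f, ?_⟩
  rw [euler_apply]; rfl

theorem xWedge_mem_xIdeal (n : ℕ) (f : CPol 𝕂 m) : xWedge 𝕂 m n f ∈ xIdeal 𝕂 m n :=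
  ⟨fun i => eps 𝕂 m i f, by rw [xWedge_apply]; rfl⟩

theorem xDot_mem_xIdeal (n : ℕ) (f : CPol 𝕂 m) : xDot 𝕂 m n f ∈ xIdeal 𝕂 m n :=
  ⟨fun i => kap 𝕂 m i f, by rw [xDot_apply]; rfl⟩

/-- Every other term of the embedding factor contains the vector variable of ℝ^n. On the last axis
only the leading scalar term survives. -/
theorem embL_sub_mem_xIdeal (s t : ℤ) (n k j : ℕ) (f : CPol 𝕂 m) :
    embL 𝕂 m s t n k j f - cF 𝕂 m (n + 1) ((k : ℤ) - j) j * (ve 𝕂 m (n + 1) ^ (s - t).toNat * f) ∈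
      xIdeal 𝕂 m n := by
  have hx : xv 𝕂 m n ∈ xIdeal 𝕂 m n := ⟨fun i => ve 𝕂 m i, rfl⟩
  rw [embL_apply, XM_eq n ((k : ℤ) - j), add_mul, add_assoc, add_sub_cancel_left]
  refine add_mem (mul_right_mem_xIdeal _ (Submodule.smul_mem _ _ (mul_left_mem_xIdeal _
    (mul_right_mem_xIdeal _ hx)))) (Submodule.smul_mem _ _ (mul_left_mem_xIdeal _ (add_mem ?_ ?_)))
  · exact Submodule.smul_mem _ _ (xWedge_mem_xIdeal n _)
  · exact Submodule.smul_mem _ _ (xDot_mem_xIdeal n _)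

/-- On the last axis x∧ reduces to x_{n+1} e_{n+1}∧ applied to the leading term. For j > 0 that term
vanishes there, because f has positive degree on ℝ^n. For j = 0 one has t = s − 1, so the term
contains e_{n+1} and is killed by e_{n+1}∧. -/
theorem xWedge_embL_mem_xIdeal {s t : ℤ} {n k j : ℕ} (hN : (t, j) ∈ N s (n + 1) k)
    (hne : (t, j) ≠ (s, 0)) {f : CPol 𝕂 m} (hf : f ∈ Hr 𝕂 m n t j) :
    xWedge 𝕂 m (n + 1) (embL 𝕂 m s t n k j f) ∈ xIdeal 𝕂 m n := by
  have h1 : eps 𝕂 m (n + 1) (embL 𝕂 m s t n k j f) ∈ xIdeal 𝕂 m n := by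
    have h2 := embL_sub_mem_xIdeal s t n k j f
    set c := cF 𝕂 m (n + 1) ((k : ℤ) - j) j * (ve 𝕂 m (n + 1) ^ (s - t).toNat * f) with hc
    have h3 : eps 𝕂 m (n + 1) c ∈ xIdeal 𝕂 m n := by
      by_cases hj : j = 0
      · have ht : s - t = 1 := by
          obtain ⟨-, -, -, h, -⟩ := mem_N_succ.1 hN
          rcases h with h | h
          · omega
          · exact absurd (by rw [h, hj]) hne
        obtain ⟨p, hp⟩ := cF_eq_ofS (𝕂 := 𝕂) (m := m) (n + 1) ((k : ℤ) - j) j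
        have hk : kap 𝕂 m (n + 1) f = 0 := (Hr_le_polSub hf (n + 1) (by omega)).2
        rw [hc, hp, ht, Int.toNat_one, pow_one, eps_ofS_mul, ve_mul_of_kap hk, eps_eps_self, mul_zero]
        exact zero_mem _
      · exact eps_mem_xIdeal _ (mul_left_mem_xIdeal _ (mul_left_mem_xIdeal _
          (mem_xIdeal_of_mem_Hr hj hf)))
    have h4 := add_mem (eps_mem_xIdeal (n + 1) h2) h3
    rwa [← map_add, sub_add_cancel] at h4
  have h5 : xWedge 𝕂 m (n + 1) (embL 𝕂 m s t n k j f) = xWedge 𝕂 m n (embL 𝕂 m s t n k j f) +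
      vx 𝕂 m (n + 1) * eps 𝕂 m (n + 1) (embL 𝕂 m s t n k j f) := by
    rw [xWedge_apply, xWedge_apply, Finset.sum_Icc_succ_top (by omega)]; rfl
  rw [h5]
  exact add_mem (xWedge_mem_xIdeal n _) (mul_left_mem_xIdeal _ h1)

/-! ### The branching components -/

variable (𝕂 m) in
/-- The components of the restriction of the action to `ℝ^n`. -/
def brC (n : ℕ) (s : ℤ) (k : ℕ) (p : N s (n + 1) k) : Submodule 𝕂 (CPol 𝕂 m) :=
  (Hr 𝕂 m n p.1.1 p.1.2).map (embL 𝕂 m s p.1.1 n k p.1.2)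

/-- The eigenvalues of the separating operator on the components. -/
def brEig (n : ℕ) (ε s : ℤ) (k : ℕ) (p : N s (n + 1) k) : ℤ :=
  tEig n (ε * zsgn ((k : ℤ) - p.1.2 + (s - p.1.1))) p.1.1 p.1.2

theorem brEig_injective {n : ℕ} (hn : 1 ≤ n) {ε : ℤ} (hε : ε = 1 ∨ ε = -1) (s : ℤ) (k : ℕ) :
    Function.Injective (brEig n ε s k) :=
  fun p q h => Subtype.ext (tEig_injective hn hε p.2 q.2 h)

theorem mem_N_coe {s : ℤ} {n k : ℕ} (p : N s (n + 1) k) : 0 ≤ p.1.1 ∧ p.1.1 ≤ n ∧ p.1.2 ≤ k ∧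
    (p.1.1 = s - 1 ∨ p.1.1 = s) ∧ (p.1.1 = 0 ∨ p.1.1 = n → p.1.2 = 0) := mem_N_succ.1 p.2

theorem mem_N_cases {s : ℤ} {n k : ℕ} (p : N s (n + 1) k) : p.1.1 = s - 1 ∨ p.1.1 = s :=
  (mem_N_coe p).2.2.2.1

theorem iSup_brC {n : ℕ} (hn : 2 ≤ n) (hm : n + 1 ≤ m) {s : ℤ} {k : ℕ}
    (hs : ¬ ((s = 0 ∨ s = n + 1) ∧ 1 ≤ k)) : ⨆ p, brC 𝕂 m n s k p = Hr 𝕂 m (n + 1) s k := by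
  rw [Hr_eq_embSum hn hm hs, embSum, iSup_subtype']
  rfl

theorem tOp_of_mem_brC {n : ℕ} (hn : n + 1 ≤ m) {ε : ℤ} {Φ : Module.End 𝕂 (CPol 𝕂 m)}
    (hΦ : SemiEq n ε Φ) {s : ℤ} {k : ℕ} {p : N s (n + 1) k} {g : CPol 𝕂 m}
    (hg : g ∈ brC 𝕂 m n s k p) : tOp 𝕂 m n (Φ g) = (brEig n ε s k p : 𝕂) • Φ g := by
  obtain ⟨f, hf, rfl⟩ := hg
  exact tOp_of_mem (by omega) (hΦ.comp (semiEq_embL hn (mem_N_cases p))) hf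

theorem tOp_of_mem_brC' {n : ℕ} (hn : n + 1 ≤ m) {s : ℤ} {k : ℕ} {p : N s (n + 1) k} {g : CPol 𝕂 m}
    (hg : g ∈ brC 𝕂 m n s k p) : tOp 𝕂 m n g = (brEig n 1 s k p : 𝕂) • g :=
  tOp_of_mem_brC hn (SemiEq.id n) hg

/-- A stable subspace contains the components of its elements with respect to eigenspaces. -/
theorem mem_of_sum_mem {ι M : Type*} [AddCommGroup M] [Module 𝕂 M] (A : Module.End 𝕂 M) {c : ι → 𝕂}
    (hc : Function.Injective c) {U : Submodule 𝕂 M} (hU : ∀ f ∈ U, A f ∈ U) (S : Finset ι)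
    {g : ι → M} (hg : ∀ i ∈ S, A (g i) = c i • g i) (h : ∑ i ∈ S, g i ∈ U) : ∀ i ∈ S, g i ∈ U := by
  classical
  induction S using Finset.induction_on generalizing g with
  | empty => simp
  | insert a S ha ih =>
    have h1 : ∑ i ∈ S, (c i - c a) • g i ∈ U := by
      have h2 := sub_mem (hU _ h) (U.smul_mem (c a) h)
      rw [map_sum, Finset.smul_sum, ← Finset.sum_sub_distrib, Finset.sum_insert ha,
        hg a (Finset.mem_insert_self a S), sub_self, zero_add] at h2
      convert h2 using 1
      refine Finset.sum_congr rfl fun i hi => ?_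
      rw [hg i (Finset.mem_insert_of_mem hi), sub_smul]
    have h3 : ∀ i ∈ S, g i ∈ U := by
      intro i hi
      have h4 := ih (g := fun i => (c i - c a) • g i) (fun i hi => by
        rw [map_smul, hg i (Finset.mem_insert_of_mem hi), smul_comm]) h1 i hi
      have h5 : c i - c a ≠ 0 := sub_ne_zero.2 (hc.ne (by rintro rfl; exact ha hi))
      have h6 := U.smul_mem (c i - c a)⁻¹ h4
      rwa [smul_smul, inv_mul_cancel₀ h5, one_smul] at h6
    intro i hi
    rw [Finset.mem_insert] at hi
    rcases hi with rfl | hi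
    · rw [Finset.sum_insert ha] at h
      exact (U.add_mem_iff_left (sum_mem h3)).1 h
    · exact h3 i hi

/-- An invariant subspace is stable under `tOp`, which has distinct eigenvalues on the branching
components. -/
theorem exists_components {n : ℕ} (hn : 2 ≤ n) (hm : n + 1 ≤ m) {s : ℤ} {k : ℕ}
    (hs : ¬ ((s = 0 ∨ s = n + 1) ∧ 1 ≤ k)) {U : Submodule 𝕂 (CPol 𝕂 m)}
    (hU : U ≤ Hr 𝕂 m (n + 1) s k) (hst : SgStable (n + 1) U) {f : CPol 𝕂 m} (hf : f ∈ U) :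
    ∃ (S : Finset (N s (n + 1) k)) (g : N s (n + 1) k → CPol 𝕂 m),
      (∀ p, g p ∈ brC 𝕂 m n s k p) ∧ (∀ p ∈ S, g p ∈ U) ∧ ∑ p ∈ S, g p = f := by
  have h1 := hU hf
  rw [← iSup_brC hn hm hs, Submodule.mem_iSup_iff_exists_finsupp] at h1
  obtain ⟨g, hg, rfl⟩ := h1
  refine ⟨g.support, g, hg, ?_, rfl⟩
  refine mem_of_sum_mem (tOp 𝕂 m n) (c := fun p => (brEig n 1 s k p : 𝕂))
    (Int.cast_injective.comp (brEig_injective (by omega) (.inl rfl) s k))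
    (fun f hf => tOp_mem (by omega) (hst.mono (Nat.le_succ n)) hf) _
    (fun p _ => tOp_of_mem_brC' hm (hg p)) hf

theorem iForm_brC {n : ℕ} (hn : 1 ≤ n) (hm : n + 1 ≤ m) {s : ℤ} {k : ℕ} {p q : N s (n + 1) k}
    (hpq : p ≠ q) {f g : CPol 𝕂 m} (hf : f ∈ brC 𝕂 m n s k p) (hg : g ∈ brC 𝕂 m n s k q) :
    iForm 𝕂 m f g = 0 :=
  iForm_eq_zero_of_tOp (by omega) ((brEig_injective hn (.inl rfl) s k).ne hpq)
    (tOp_of_mem_brC' hm hf) (tOp_of_mem_brC' hm hg)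

theorem mem_homog_of_mem_Hr {r : ℕ} (hr : r ≤ m) {s : ℤ} {k : ℕ} {f : CPol 𝕂 m}
    (hf : f ∈ Hr 𝕂 m r s k) : f ∈ homog 𝕂 m k :=
  mem_homog_iff.2 (by rw [euler_eq_of_polSub hr (Hr_le_polSub hf), hf.2.1])

/-- The indices of the spaces of solutions that do not vanish. -/
def Adm (r : ℕ) (s : ℤ) (k : ℕ) : Prop := 0 ≤ s ∧ s ≤ r ∧ (s = 0 ∨ s = r → k = 0)

theorem Adm.not_extreme {n : ℕ} {s : ℤ} {k : ℕ} (h : Adm (n + 1) s k) :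
    ¬ ((s = 0 ∨ s = n + 1) ∧ 1 ≤ k) := by
  obtain ⟨-, -, h⟩ := h
  push_cast at h
  omega

theorem adm_of_mem_N {n : ℕ} {s : ℤ} {k : ℕ} (p : N s (n + 1) k) : Adm n p.1.1 p.1.2 := by
  obtain ⟨h0, h1, -, -, h⟩ := mem_N_coe p
  exact ⟨h0, h1, h⟩

theorem irr_brC {n : ℕ} (hn : 2 ≤ n) (hm : n + 1 ≤ m) {s : ℤ} {k : ℕ}
    (ih : ∀ t j, Adm n t j → Irr n (Hr 𝕂 m n t j)) (p : N s (n + 1) k) : Irr n (brC 𝕂 m n s k p) :=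
  (ih _ _ (adm_of_mem_N p)).map (semiEq_embL hm (mem_N_cases p)) fun _ hf h =>
    embL_injective hn hm p.2 (Hr_le_polSub hf) h

/-- A stable subspace that does not contain the distinguished component vanishes. -/
theorem eq_bot_of_not_le {n : ℕ} (hn : 2 ≤ n) (hm : n + 1 ≤ m) {s : ℤ} {k : ℕ}
    (hs : Adm (n + 1) s k) (ih : ∀ t j, Adm n t j → Irr n (Hr 𝕂 m n t j)) (p₀ : N s (n + 1) k)
    (hp₀ : p₀.1 = (s, 0) ∨ ∀ p, p = p₀) {U : Submodule 𝕂 (CPol 𝕂 m)}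
    (hU : U ≤ Hr 𝕂 m (n + 1) s k) (hst : SgStable (n + 1) U) (hnot : ¬ brC 𝕂 m n s k p₀ ≤ U) :
    U = ⊥ := by
  have hV : brC 𝕂 m n s k p₀ ⊓ U = ⊥ := by
    have hirr := irr_brC hn hm ih p₀
    refine (hirr.2.2 _ inf_le_left (hirr.1.inf (hst.mono (Nat.le_succ n)))).resolve_right ?_
    exact fun h => hnot (inf_eq_left.1 h)
  rw [eq_bot_iff]
  intro f hf
  rw [Submodule.mem_bot]
  rcases hp₀ with hp₀ | hp₀
  · have key : ∀ f ∈ U, xWedge 𝕂 m (n + 1) f ∈ xIdeal 𝕂 m n := by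
      intro f hf
      obtain ⟨S, g, hg, hgU, rfl⟩ := exists_components hn hm hs.not_extreme hU hst hf
      rw [map_sum]
      refine sum_mem fun p hp => ?_
      by_cases hpp : p = p₀
      · have : g p ∈ brC 𝕂 m n s k p₀ ⊓ U := ⟨hpp ▸ hg p, hgU p hp⟩
        rw [hV, Submodule.mem_bot] at this
        rw [this, map_zero]
        exact zero_mem _
      · obtain ⟨h, hh, hgh⟩ := hg p
        rw [← hgh]
        exact xWedge_embL_mem_xIdeal p.2 (fun h => hpp (Subtype.ext (by rw [hp₀]; exact h))) hh
    -- All transforms of f lie in U, and x∧ commutes with the action. So x∧f vanishes at every point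
    -- of the orbit of e_{n+1}.
    have hx : xWedge 𝕂 m (n + 1) f = 0 := by
      have hfH := hU hf
      have hpol := xWedge_mem_polSub le_rfl (Hr_le_polSub hfH)
      refine eq_zero_of_orbit_polSub (k := k + 1) (by omega) hm (mem_homog_iff.2 ?_) (by omega) hpol
        fun v hv => ?_
      · rw [euler_eq_of_polSub hm hpol, euler_xWedge hm, hfH.2.1, map_smul]
        push_cast
        module
      · rw [sg_xWedge hm hv]
        exact evl_xIdeal hm (key _ (hst v hv f hf))
    have h1 := coD_xWedge_of_mem hm (hU hf)
    rw [hx, map_zero] at h1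
    refine (smul_eq_zero.1 h1.symm).resolve_left ?_
    -- The distinguished index (s, 0) belongs to the index set, so s ≤ n.
    have h2 : s - ((n + 1 : ℕ) : ℤ) - k ≠ 0 := by
      have := (mem_N_coe p₀).2.1
      rw [hp₀] at this
      push_cast
      omega
    exact_mod_cast h2
  · obtain ⟨S, g, hg, hgU, rfl⟩ := exists_components hn hm hs.not_extreme hU hst hf
    refine Finset.sum_eq_zero fun p hp => ?_
    have : g p ∈ brC 𝕂 m n s k p₀ ⊓ U := ⟨hp₀ p ▸ hg p, hgU p hp⟩
    rwa [hV, Submodule.mem_bot] at this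

/-- The component (s, 0) exists unless s = n + 1. In that case k = 0, and (n, 0) is the only
component. -/
theorem exists_distinguished {n : ℕ} {s : ℤ} {k : ℕ} (hs : Adm (n + 1) s k) :
    ∃ p₀ : N s (n + 1) k, p₀.1 = (s, 0) ∨ ∀ p, p = p₀ := by
  obtain ⟨h0, h1, h2⟩ := hs
  push_cast at h1 h2
  by_cases h : s = n + 1
  · have hk := h2 (.inr h)
    refine ⟨⟨(n, 0), mem_N_succ.2 ⟨by omega, le_rfl, by omega, by omega, fun _ => rfl⟩⟩,
      .inr fun p => Subtype.ext (Prod.ext ?_ ?_)⟩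
    · obtain ⟨-, h4, -, h5, -⟩ := mem_N_coe p
      simp only
      omega
    · have := (mem_N_coe p).2.2.1
      simp only
      omega
  · exact ⟨⟨(s, 0), mem_N_succ.2 ⟨h0, by omega, by omega, .inr rfl, fun _ => rfl⟩⟩, .inl rfl⟩

/-- Every nonzero invariant subspace contains the distinguished component. Two orthogonal invariant
subspaces therefore cannot both be nonzero, so a nonzero one has no room for a complement. -/
theorem irr_Hr_succ {n : ℕ} (hn : 2 ≤ n) (hm : n + 1 ≤ m) {s : ℤ} {k : ℕ} (hs : Adm (n + 1) s k)
    (ih : ∀ t j, Adm n t j → Irr n (Hr 𝕂 m n t j)) : Irr (n + 1) (Hr 𝕂 m (n + 1) s k) := by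
  obtain ⟨p₀, hp₀⟩ := exists_distinguished hs
  have hle : ∀ p, brC 𝕂 m n s k p ≤ Hr 𝕂 m (n + 1) s k := fun p => by
    rw [← iSup_brC hn hm hs.not_extreme]; exact le_iSup _ p
  refine ⟨sgStable_Hr hm s k, fun h => ?_, fun U hU hst => ?_⟩
  · have := hle p₀
    rw [h, le_bot_iff] at this
    exact (irr_brC hn hm ih p₀).2.1 this
  · by_cases h0 : brC 𝕂 m n s k p₀ ≤ U
    · right
      by_contra hne
      obtain ⟨p, hp⟩ : ∃ p, ¬ brC 𝕂 m n s k p ≤ U := by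
        by_contra! h
        refine hne (le_antisymm hU ?_)
        rw [← iSup_brC hn hm hs.not_extreme]
        exact iSup_le h
      have hirr := irr_brC hn hm ih p
      have hpU : brC 𝕂 m n s k p ⊓ U = ⊥ :=
        (hirr.2.2 _ inf_le_left (hirr.1.inf (hst.mono (Nat.le_succ n)))).resolve_right
          fun h => hp (inf_eq_left.1 h)
      -- The orthogonal complement of U among the solutions. It contains the component p, since p
      -- meets U trivially and is orthogonal to the other components.
      let U' : Submodule 𝕂 (CPol 𝕂 m) := Hr 𝕂 m (n + 1) s k ⊓ ⨅ f ∈ U, LinearMap.ker (iForm 𝕂 m f)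
      have hU' : ∀ g, g ∈ U' ↔ g ∈ Hr 𝕂 m (n + 1) s k ∧ ∀ f ∈ U, iForm 𝕂 m f g = 0 := by
        intro g
        simp only [U', Submodule.mem_inf, Submodule.mem_iInf, LinearMap.mem_ker]
      have hpU' : brC 𝕂 m n s k p ≤ U' := by
        intro g hg
        refine (hU' g).2 ⟨hle p hg, fun f hf => ?_⟩
        obtain ⟨S, c, hc, hcU, rfl⟩ := exists_components hn hm hs.not_extreme hU hst hf
        rw [map_sum, LinearMap.sum_apply]
        refine Finset.sum_eq_zero fun q hq => ?_
        by_cases hqp : q = p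
        · have : c q ∈ brC 𝕂 m n s k p ⊓ U := ⟨hqp ▸ hc q, hcU q hq⟩
          rw [hpU, Submodule.mem_bot] at this
          rw [this, map_zero, LinearMap.zero_apply]
        · exact iForm_brC (by omega) hm hqp (hc q) hg
      have hst' : SgStable (n + 1) U' := by
        intro v hv g hg
        rw [hU'] at hg ⊢
        refine ⟨sg_mem_Hr hm hv hg.1, fun f hf => ?_⟩
        rw [← sg_sg hm hv f, iForm_sg (hv.mono hm)]
        exact hg.2 _ (hst v hv f hf)
      -- The distinguished component lies in U; if it lay in the complement too, its elements would
      -- be isotropic.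
      have hnot : ¬ brC 𝕂 m n s k p₀ ≤ U' := by
        intro h
        refine (irr_brC hn hm ih p₀).2.1 (eq_bot_iff.2 fun g hg => ?_)
        exact (Submodule.mem_bot 𝕂).2 (eq_zero_of_iForm_self
          (mem_homog_of_mem_Hr hm (hle p₀ hg)) (((hU' g).1 (h hg)).2 g (h0 hg)))
      have hbot := eq_bot_of_not_le hn hm hs ih p₀ hp₀ (fun g hg => ((hU' g).1 hg).1) hst' hnot
      rw [hbot, le_bot_iff] at hpU'
      exact hirr.2.1 hpU'
    · exact .inl (eq_bot_of_not_le hn hm hs ih p₀ hp₀ hU hst h0)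

/-! ### Solutions in dimension two -/

theorem one_ne_zero_cpol : (1 : CPol 𝕂 m) ≠ 0 := by
  intro h
  have h1 := congrArg (fun f => scalarPart 𝕂 m (evl 𝕂 m 0 f)) h
  simp only [map_one, map_zero] at h1
  have h2 : scalarPart 𝕂 m (1 : Cl 𝕂 m) = (realScalarPart m 1 : 𝕂) * 1 := scalarPart_tmul 1 1
  rw [h2, realScalarPart_one] at h1
  simp at h1

theorem one_mem_Hr (r : ℕ) : (1 : CPol 𝕂 m) ∈ Hr 𝕂 m r 0 0 := by
  refine ⟨fun i _ => ⟨pD_one i, kap_one i⟩, ?_, ?_, ?_, ?_⟩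
  · rw [euler_apply, Nat.cast_zero, zero_smul]
    exact Finset.sum_eq_zero fun i _ => by rw [pD_one, map_zero]
  · rw [grade_one, Int.cast_zero, zero_smul]
  · rw [extD_apply]; exact Finset.sum_eq_zero fun i _ => by rw [pD_one, map_zero]
  · rw [coD_apply]; exact Finset.sum_eq_zero fun i _ => by rw [pD_one, map_zero]

variable (𝕂 m) in
/-- The polynomial `x_1 - e_1 e_2 x_2`. -/
def pz : CPol 𝕂 m := vx 𝕂 m 1 - ve 𝕂 m 1 * ve 𝕂 m 2 * vx 𝕂 m 2

variable (𝕂 m) in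
/-- The solutions `(x_1 - e_1 e_2 x_2)^k e_1`. -/
def pA (k : ℕ) : CPol 𝕂 m := pz 𝕂 m ^ k * ve 𝕂 m 1

variable (𝕂 m) in
/-- The solutions `(x_1 - e_1 e_2 x_2)^k e_2`. -/
def pB (k : ℕ) : CPol 𝕂 m := pz 𝕂 m ^ k * ve 𝕂 m 2

theorem eTwo_ve_one (hm : 2 ≤ m) : ve 𝕂 m 1 * ve 𝕂 m 2 * ve 𝕂 m 1 = ve 𝕂 m 2 := by
  rw [mul_assoc, ve_mul_ve (by norm_num : (2 : ℕ) ≠ 1), mul_neg, ← mul_assoc,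
    ve_mul_self ⟨le_rfl, by omega⟩, neg_one_mul, neg_neg]

theorem eTwo_ve_two (hm : 2 ≤ m) : ve 𝕂 m 1 * ve 𝕂 m 2 * ve 𝕂 m 2 = -ve 𝕂 m 1 := by
  rw [mul_assoc, ve_mul_self ⟨by omega, hm⟩, mul_neg_one]

theorem eTwo_mul_pz : ve 𝕂 m 1 * ve 𝕂 m 2 * pz 𝕂 m = pz 𝕂 m * (ve 𝕂 m 1 * ve 𝕂 m 2) := by
  rw [pz, mul_sub, sub_mul, ← vx_mul_comm 1, mul_assoc (ve 𝕂 m 1 * ve 𝕂 m 2) (vx 𝕂 m 2),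
    vx_mul_comm 2]

theorem eTwo_mul_pz_pow (k : ℕ) :
    ve 𝕂 m 1 * ve 𝕂 m 2 * pz 𝕂 m ^ k = pz 𝕂 m ^ k * (ve 𝕂 m 1 * ve 𝕂 m 2) :=
  ((show Commute (ve 𝕂 m 1 * ve 𝕂 m 2) (pz 𝕂 m) from eTwo_mul_pz).pow_right k).eq

theorem eTwo_pA (hm : 2 ≤ m) (k : ℕ) : ve 𝕂 m 1 * ve 𝕂 m 2 * pA 𝕂 m k = pB 𝕂 m k := by
  rw [pA, ← mul_assoc, eTwo_mul_pz_pow, mul_assoc, eTwo_ve_one hm, pB]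

theorem eTwo_pB (hm : 2 ≤ m) (k : ℕ) : ve 𝕂 m 1 * ve 𝕂 m 2 * pB 𝕂 m k = -pA 𝕂 m k := by
  rw [pB, ← mul_assoc, eTwo_mul_pz_pow, mul_assoc, eTwo_ve_two hm, pA, mul_neg]

theorem pz_mul (f : CPol 𝕂 m) :
    pz 𝕂 m * f = mulX 𝕂 m 1 f - mulX 𝕂 m 2 (ve 𝕂 m 1 * ve 𝕂 m 2 * f) := by
  rw [pz, sub_mul, ← vx_mul_comm 2, mulX_apply, mulX_apply, mul_assoc (vx 𝕂 m 2)]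

theorem pA_succ (hm : 2 ≤ m) (k : ℕ) : pA 𝕂 m (k + 1) = mulX 𝕂 m 1 (pA 𝕂 m k) - mulX 𝕂 m 2 (pB 𝕂 m k) := by
  rw [pA, pow_succ', mul_assoc, ← pA, pz_mul, eTwo_pA hm]

theorem pB_succ (hm : 2 ≤ m) (k : ℕ) : pB 𝕂 m (k + 1) = mulX 𝕂 m 1 (pB 𝕂 m k) + mulX 𝕂 m 2 (pA 𝕂 m k) := by
  rw [pB, pow_succ', mul_assoc, ← pB, pz_mul, eTwo_pB hm, map_neg, sub_neg_eq_add]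

theorem pA_zero : pA 𝕂 m 0 = ve 𝕂 m 1 := by rw [pA, pow_zero, one_mul]

theorem pB_zero : pB 𝕂 m 0 = ve 𝕂 m 2 := by rw [pB, pow_zero, one_mul]

/-- Here e_1 e_2 plays the role of an imaginary unit and x_1 − e_1 e_2 x_2 that of a complex
variable; these are the derivatives of its powers, applied to e_1 and e_2. -/
theorem pD_planar (hm : 2 ≤ m) (k : ℕ) :
    pD 𝕂 m 1 (pA 𝕂 m (k + 1)) = ((k : 𝕂) + 1) • pA 𝕂 m k ∧
    pD 𝕂 m 2 (pA 𝕂 m (k + 1)) = -((k : 𝕂) + 1) • pB 𝕂 m k ∧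
    pD 𝕂 m 1 (pB 𝕂 m (k + 1)) = ((k : 𝕂) + 1) • pB 𝕂 m k ∧
    pD 𝕂 m 2 (pB 𝕂 m (k + 1)) = ((k : 𝕂) + 1) • pA 𝕂 m k := by
  have k11 : kron 𝕂 m 1 1 = 1 := kron_self le_rfl (by omega)
  have k22 : kron 𝕂 m 2 2 = 1 := kron_self (by omega) hm
  have k12 : kron 𝕂 m 1 2 = 0 := kron_of_ne (by norm_num)
  have k21 : kron 𝕂 m 2 1 = 0 := kron_of_ne (by norm_num)
  induction k with
  | zero =>
    simp only [pA_succ hm, pB_succ hm, pA_zero, pB_zero, map_sub, map_add, pD_mulX, pD_ve, map_zero,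
      k11, k22, k12, k21]
    refine ⟨?_, ?_, ?_, ?_⟩ <;> push_cast <;> module
  | succ k ih =>
    obtain ⟨h1, h2, h3, h4⟩ := ih
    rw [pA_succ hm (k + 1), pB_succ hm (k + 1)]
    simp only [map_sub, map_add, pD_mulX, h1, h2, h3, h4, k11, k22, k12, k21, map_smul]
    rw [pA_succ hm k, pB_succ hm k]
    push_cast
    refine ⟨?_, ?_, ?_, ?_⟩ <;> module

theorem ve_two_mul (hm : 2 ≤ m) (f : CPol 𝕂 m) : ve 𝕂 m 2 * f = -(ve 𝕂 m 1 * (ve 𝕂 m 1 * ve 𝕂 m 2 * f)) := by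
  rw [← mul_assoc, ← mul_assoc, ve_mul_self ⟨le_rfl, by omega⟩, neg_one_mul, neg_mul, neg_neg]

theorem grade_ve {r i : ℕ} (hr : r ≤ m) (hi : i ∈ Finset.Icc 1 r) :
    grade 𝕂 m r (ve 𝕂 m i) = ve 𝕂 m i := by
  have h : ve 𝕂 m i = eps 𝕂 m i 1 := by rw [← ve_mul_of_kap (kap_one i), mul_one]
  rw [h, grade_eps hr hi, grade_one, map_zero, zero_add]

theorem grade_planar (hm : 2 ≤ m) (k : ℕ) : grade 𝕂 m 2 (pA 𝕂 m k) = pA 𝕂 m k ∧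
    grade 𝕂 m 2 (pB 𝕂 m k) = pB 𝕂 m k := by
  induction k with
  | zero => exact ⟨by rw [pA_zero, grade_ve hm (by simp)], by rw [pB_zero, grade_ve hm (by simp)]⟩
  | succ k ih =>
    rw [pA_succ hm, pB_succ hm, map_sub, map_add, grade_mulX, grade_mulX, grade_mulX, grade_mulX,
      ih.1, ih.2]
    exact ⟨rfl, rfl⟩

theorem planar_mem_polSub (k : ℕ) : pA 𝕂 m k ∈ polSub 𝕂 m 2 ∧ pB 𝕂 m k ∈ polSub 𝕂 m 2 := by
  have h : pz 𝕂 m ∈ polSub 𝕂 m 2 := sub_mem (vx_mem_polSub (by omega))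
    (mul_mem (mul_mem (ve_mem_polSub (by omega)) (ve_mem_polSub (by omega)))
      (vx_mem_polSub (by omega)))
  exact ⟨mul_mem (pow_mem h k) (ve_mem_polSub (by omega)),
    mul_mem (pow_mem h k) (ve_mem_polSub (by omega))⟩

theorem sum_Icc_two {M : Type*} [AddCommMonoid M] (g : ℕ → M) :
    ∑ i ∈ Finset.Icc 1 2, g i = g 1 + g 2 := by
  rw [Finset.sum_Icc_succ_top (by omega), Finset.Icc_self, Finset.sum_singleton]

theorem planar_mem (hm : 2 ≤ m) (k : ℕ) : pA 𝕂 m k ∈ Hr 𝕂 m 2 1 k ∧ pB 𝕂 m k ∈ Hr 𝕂 m 2 1 k := by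
  have key : ∀ f : CPol 𝕂 m, f ∈ polSub 𝕂 m 2 → euler 𝕂 m 2 f = (k : 𝕂) • f →
      grade 𝕂 m 2 f = f → dirc 𝕂 m 2 f = 0 → f ∈ Hr 𝕂 m 2 1 k := by
    intro f h1 h2 h3 h4
    have h5 : grade 𝕂 m 2 f = (((1 : ℤ) : 𝕂)) • f := by rw [Int.cast_one, one_smul, h3]
    exact ⟨h1, h2, h5, extD_coD_of_dirc hm h5 h4⟩
  obtain ⟨hp1, hp2⟩ := planar_mem_polSub (𝕂 := 𝕂) (m := m) k
  obtain ⟨hg1, hg2⟩ := grade_planar (𝕂 := 𝕂) hm k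
  cases k with
  | zero =>
    refine ⟨key _ hp1 ?_ hg1 ?_, key _ hp2 ?_ hg2 ?_⟩
    · rw [pA_zero, euler_ve, Nat.cast_zero, zero_smul]
    · rw [pA_zero, dirc_apply]; exact Finset.sum_eq_zero fun i _ => by rw [pD_ve, mul_zero]
    · rw [pB_zero, euler_ve, Nat.cast_zero, zero_smul]
    · rw [pB_zero, dirc_apply]; exact Finset.sum_eq_zero fun i _ => by rw [pD_ve, mul_zero]
  | succ k =>
    obtain ⟨h1, h2, h3, h4⟩ := pD_planar (𝕂 := 𝕂) hm k
    refine ⟨key _ hp1 ?_ hg1 ?_, key _ hp2 ?_ hg2 ?_⟩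
    · rw [euler_apply, sum_Icc_two, h1, h2, map_smul, map_smul, pA_succ hm]; push_cast; module
    · rw [dirc_apply, sum_Icc_two, h1, h2, mul_smul_comm, mul_smul_comm, ve_two_mul hm, eTwo_pB hm,
        mul_neg]
      module
    · rw [euler_apply, sum_Icc_two, h3, h4, map_smul, map_smul, pB_succ hm]; push_cast; module
    · rw [dirc_apply, sum_Icc_two, h3, h4, mul_smul_comm, mul_smul_comm, ve_two_mul hm, eTwo_pA hm]
      module

theorem planar_ne_zero (hm : 2 ≤ m) (k : ℕ) : pA 𝕂 m k ≠ 0 ∧ pB 𝕂 m k ≠ 0 := by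
  induction k with
  | zero =>
    rw [pA_zero, pB_zero]
    refine ⟨fun h => one_ne_zero_cpol (𝕂 := 𝕂) (m := m) (ve_mul_eq_zero (i := 1) ⟨le_rfl, by omega⟩ ?_),
      fun h => one_ne_zero_cpol (𝕂 := 𝕂) (m := m) (ve_mul_eq_zero (i := 2) ⟨by omega, hm⟩ ?_)⟩ <;>
      rw [mul_one, h]
  | succ k ih =>
    obtain ⟨h1, -, h3, -⟩ := pD_planar (𝕂 := 𝕂) hm k
    have hk : (k : 𝕂) + 1 ≠ 0 := by exact_mod_cast Nat.succ_ne_zero k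
    refine ⟨fun h => ih.1 ?_, fun h => ih.2 ?_⟩
    · rw [h, map_zero] at h1
      exact (smul_eq_zero.1 h1.symm).resolve_left hk
    · rw [h, map_zero] at h3
      exact (smul_eq_zero.1 h3.symm).resolve_left hk

/-! ### Spanning and irreducibility in dimension two -/

theorem exists_vector (hm : 2 ≤ m) {f : CPol 𝕂 m} (hp : f ∈ polSub 𝕂 m 2) (h1 : euler 𝕂 m 2 f = 0)
    (h2 : grade 𝕂 m 2 f = f) : ∃ a b : 𝕂, f = a • ve 𝕂 m 1 + b • ve 𝕂 m 2 := by
  have h3 : ∀ i ∈ Finset.Icc 1 2, ∃ c : 𝕂, kap 𝕂 m i f = c • 1 := by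
    intro i hi
    refine exists_scalar ?_ ?_
    · rw [euler_kap, euler_eq_of_polSub hm hp, h1, map_zero]
    · rw [grade_kap le_rfl (Finset.Icc_subset_Icc_right hm hi), grade_eq_of_polSub hm hp, h2, sub_self]
  obtain ⟨a, ha⟩ := h3 1 (by simp)
  obtain ⟨b, hb⟩ := h3 2 (by simp)
  refine ⟨-a, -b, ?_⟩
  have h : ∀ i, eps 𝕂 m i 1 = ve 𝕂 m i := fun i => by rw [← ve_mul_of_kap (kap_one i), mul_one]
  rw [grade_apply, sum_Icc_two, ha, hb, map_smul, map_smul, h, h] at h2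
  rw [← h2]
  module

/-- Induction on the degree: after subtracting a combination with the same derivative in x_2, the
remainder has no derivative in x_2, by the Dirac equation none in x_1, and so vanishes. -/
theorem Hr_two_one (hm : 2 ≤ m) (k : ℕ) : Hr 𝕂 m 2 1 k = Submodule.span 𝕂 {pA 𝕂 m k, pB 𝕂 m k} := by
  refine le_antisymm ?_ (Submodule.span_le.2 ?_)
  · induction k with
    | zero =>
      intro f hf
      obtain ⟨a, b, rfl⟩ := exists_vector hm (Hr_le_polSub hf)
        (by rw [hf.2.1, Nat.cast_zero, zero_smul]) (by rw [hf.2.2.1, Int.cast_one, one_smul])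
      rw [Submodule.mem_span_pair, pA_zero, pB_zero]
      exact ⟨a, b, rfl⟩
    | succ k ih =>
      intro f hf
      have h1 := ih (pD_mem_Hr hm (i := 2) (by simp) hf)
      obtain ⟨a, b, hab⟩ := Submodule.mem_span_pair.1 h1
      obtain ⟨-, e2, -, e4⟩ := pD_planar (𝕂 := 𝕂) hm k
      have hk : (k : 𝕂) + 1 ≠ 0 := by exact_mod_cast Nat.succ_ne_zero k
      -- The coefficients integrate a `pA` + b `pB` with respect to x_2.
      set g := f - ((a / ((k : 𝕂) + 1)) • pB 𝕂 m (k + 1) - (b / ((k : 𝕂) + 1)) • pA 𝕂 m (k + 1))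
        with hg
      have hgH : g ∈ Hr 𝕂 m 2 1 (k + 1) := sub_mem hf (sub_mem
        (Submodule.smul_mem _ _ (planar_mem hm _).2) (Submodule.smul_mem _ _ (planar_mem hm _).1))
      have hg2 : pD 𝕂 m 2 g = 0 := by
        rw [hg, map_sub, map_sub, map_smul, map_smul, e2, e4, ← hab, smul_smul, smul_smul, mul_neg,
          div_mul_cancel₀ _ hk, div_mul_cancel₀ _ hk]
        module
      have hg1 : pD 𝕂 m 1 g = 0 := by
        have h3 := dirc_of_mem hgH
        rw [dirc_apply, sum_Icc_two, hg2, mul_zero, add_zero] at h3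
        exact ve_mul_eq_zero ⟨le_rfl, by omega⟩ h3
      have hg0 : g = 0 := by
        have h3 := hgH.2.1
        rw [euler_apply, sum_Icc_two, hg1, hg2, map_zero, map_zero, add_zero] at h3
        exact (smul_eq_zero.1 h3.symm).resolve_left (Nat.cast_ne_zero.2 (Nat.succ_ne_zero k))
      rw [Submodule.mem_span_pair]
      refine ⟨-(b / ((k : 𝕂) + 1)), a / ((k : 𝕂) + 1), ?_⟩
      rw [← sub_eq_zero, ← neg_eq_zero, ← hg0, hg]
      module
  · rintro f (rfl | rfl)
    · exact (planar_mem hm k).1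
    · exact (planar_mem hm k).2

theorem Hr_two_zero (hm : 2 ≤ m) : Hr 𝕂 m 2 0 0 = Submodule.span 𝕂 {1} := by
  refine le_antisymm (fun f hf => ?_) (Submodule.span_le.2 (by rintro _ rfl; exact one_mem_Hr 2))
  obtain ⟨c, rfl⟩ := exists_scalar
    (by rw [euler_eq_of_polSub hm (Hr_le_polSub hf), hf.2.1, Nat.cast_zero, zero_smul])
    (by rw [grade_eq_of_polSub hm (Hr_le_polSub hf), hf.2.2.1, Int.cast_zero, zero_smul])
  exact Submodule.smul_mem _ _ (Submodule.mem_span_singleton_self 1)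

theorem Hr_two_two (hm : 2 ≤ m) : Hr 𝕂 m 2 2 0 = Submodule.span 𝕂 {ve 𝕂 m 2 * ve 𝕂 m 1} := by
  refine le_antisymm (fun f hf => ?_) (Submodule.span_le.2 ?_)
  · have hp := Hr_le_polSub hf
    have hE : euler 𝕂 m 2 f = 0 := by rw [hf.2.1, Nat.cast_zero, zero_smul]
    have h3 : ∀ i ∈ Finset.Icc 1 2, ∃ a b : 𝕂, kap 𝕂 m i f = a • ve 𝕂 m 1 + b • ve 𝕂 m 2 := by
      intro i hi
      refine exists_vector hm (fun l hl => ?_) ?_ ?_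
      · rw [pD_kap, (hp l hl).1, kap_kap, (hp l hl).2, map_zero, neg_zero]; exact ⟨rfl, rfl⟩
      · rw [euler_kap, hE, map_zero]
      · rw [grade_kap hm hi, hf.2.2.1, map_smul]
        push_cast
        module
    obtain ⟨a, b, hab⟩ := h3 1 (by simp)
    obtain ⟨c, d, hcd⟩ := h3 2 (by simp)
    have h : ∀ i, ve 𝕂 m i = eps 𝕂 m i 1 := fun i => by rw [← ve_mul_of_kap (kap_one i), mul_one]
    have h21 : ve 𝕂 m 2 * ve 𝕂 m 1 = eps 𝕂 m 2 (eps 𝕂 m 1 1) := by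
      rw [ve_mul_of_kap, h 1]
      rw [h 1, kap_eps_of_ne (by norm_num), kap_one, map_zero, neg_zero]
    have h4 := hf.2.2.1
    rw [grade_apply, sum_Icc_two, hab, hcd, map_add, map_add, map_smul, map_smul, map_smul, map_smul,
      h, h, eps_eps_self, eps_eps_self, eps_eps 1 2, ← h21] at h4
    rw [Submodule.mem_span_singleton]
    refine ⟨(2 : 𝕂)⁻¹ * (b - c), ?_⟩
    have h5 : f = (2 : 𝕂)⁻¹ • (((2 : ℤ) : 𝕂) • f) := by
      rw [smul_smul, Int.cast_ofNat, inv_mul_cancel₀ two_ne_zero, one_smul]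
    rw [h5, ← h4]
    module
  · rintro _ rfl
    have h1 := ve_mul_mem_Hr_succ (n := 0) (by omega) (one_mem_Hr (𝕂 := 𝕂) (m := m) 0)
    have h2 := ve_mul_mem_Hr_succ (n := 1) (by omega) h1
    rwa [mul_one] at h2

theorem sg_planar (hm : 2 ≤ m) (k : ℕ) : sg 𝕂 m (bv 1) (pA 𝕂 m k) = pA 𝕂 m k ∧
    sg 𝕂 m (bv 1) (pB 𝕂 m k) = -pB 𝕂 m k := by
  have h := fun l => sg_bv_generator (𝕂 := 𝕂) (m := m) (i := 1) (by rw [Finset.mem_Icc]; omega) l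
  have h1 := h 1
  have h2 := h 2
  rw [if_pos rfl, one_smul, one_smul] at h1
  rw [if_neg (by norm_num), neg_one_smul, neg_one_smul] at h2
  have hz : sg 𝕂 m (bv 1) (pz 𝕂 m) = pz 𝕂 m := by
    rw [pz, map_sub, map_mul, map_mul, h1.1, h1.2, h2.1, h2.2]
    noncomm_ring
  exact ⟨by rw [pA, map_mul, map_pow, hz, h1.2], by rw [pB, map_mul, map_pow, hz, h2.2, mul_neg]⟩

theorem lie_planar (hm : 2 ≤ m) (k : ℕ) : lie 𝕂 m 1 2 (pA 𝕂 m k) = ((k : 𝕂) + 1) • pB 𝕂 m k ∧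
    lie 𝕂 m 1 2 (pB 𝕂 m k) = -((k : 𝕂) + 1) • pA 𝕂 m k := by
  have k11 : kron 𝕂 m 1 1 = 1 := kron_self le_rfl (by omega)
  have k22 : kron 𝕂 m 2 2 = 1 := kron_self (by omega) hm
  have k12 : kron 𝕂 m 1 2 = 0 := kron_of_ne (by norm_num)
  have k21 : kron 𝕂 m 2 1 = 0 := kron_of_ne (by norm_num)
  have h12 : (1 : ℕ) ≠ 2 := by norm_num
  induction k with
  | zero =>
    rw [pA_zero, pB_zero, lie_ve h12, lie_ve h12, k11, k22, k12, k21, Nat.cast_zero]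
    constructor <;> module
  | succ k ih =>
    have hx : ∀ i f, lie 𝕂 m 1 2 (mulX 𝕂 m i f) =
        kron 𝕂 m 1 i • mulX 𝕂 m 2 f - kron 𝕂 m 2 i • mulX 𝕂 m 1 f + mulX 𝕂 m i (lie 𝕂 m 1 2 f) := by
      intro i f
      rw [mulX_apply, lie_mul h12, lie_vx h12, sub_mul, smul_mul_assoc, smul_mul_assoc]; rfl
    rw [pA_succ hm, pB_succ hm, map_sub, map_add, hx, hx, hx, hx, ih.1, ih.2, k11, k22, k12, k21,
      map_smul, map_smul, map_smul, map_smul]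
    push_cast
    constructor <;> module

theorem irr_span_singleton {r : ℕ} {s : ℤ} {k : ℕ} (hr : r ≤ m) {w : CPol 𝕂 m} (hw : w ≠ 0)
    (h : Hr 𝕂 m r s k = Submodule.span 𝕂 {w}) : Irr r (Hr 𝕂 m r s k) := by
  refine ⟨sgStable_Hr hr s k, fun h' => hw ?_, fun U hU _ => ?_⟩
  · rw [h, Submodule.span_singleton_eq_bot] at h'
    exact h'
  · by_cases h0 : U = ⊥
    · exact .inl h0
    · right
      obtain ⟨u, hu, hu0⟩ := U.ne_bot_iff.1 h0
      refine le_antisymm hU ?_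
      rw [h, Submodule.span_singleton_le_iff_mem]
      have h1 := hU hu
      rw [h, Submodule.mem_span_singleton] at h1
      obtain ⟨c, rfl⟩ := h1
      have hc : c ≠ 0 := by rintro rfl; exact hu0 (zero_smul _ _)
      have h2 := U.smul_mem c⁻¹ hu
      rwa [smul_smul, inv_mul_cancel₀ hc, one_smul] at h2

/-- The action of e_1 has the two spanning elements as eigenvectors for 1 and −1, so a nonzero
stable subspace contains one of them. The infinitesimal rotation maps each to a nonzero multiple of
the other. This argument works over ℝ and ℂ alike. -/
theorem irr_Hr_two_one (hm : 2 ≤ m) (k : ℕ) : Irr 2 (Hr 𝕂 m 2 1 k) := by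
  refine ⟨sgStable_Hr hm 1 k, fun h => ?_, fun U hU hst => ?_⟩
  · have := (planar_mem (𝕂 := 𝕂) hm k).1
    rw [h, Submodule.mem_bot] at this
    exact (planar_ne_zero hm k).1 this
  · by_cases h0 : U = ⊥
    · exact .inl h0
    · right
      have hk : (k : 𝕂) + 1 ≠ 0 := by exact_mod_cast Nat.succ_ne_zero k
      have hlie : ∀ f ∈ U, lie 𝕂 m 1 2 f ∈ U := fun f hf => lie_mem (by simp) (by simp) hm hst hf
      have hsm : ∀ (c : 𝕂) (f : CPol 𝕂 m), c ≠ 0 → c • f ∈ U → f ∈ U := by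
        intro c f hc hf
        have := U.smul_mem c⁻¹ hf
        rwa [smul_smul, inv_mul_cancel₀ hc, one_smul] at this
      have hAB : pA 𝕂 m k ∈ U → pB 𝕂 m k ∈ U := fun h =>
        hsm _ _ hk (by rw [← (lie_planar hm k).1]; exact hlie _ h)
      have hBA : pB 𝕂 m k ∈ U → pA 𝕂 m k ∈ U := fun h =>
        hsm _ _ (neg_ne_zero.2 hk) (by rw [← (lie_planar hm k).2]; exact hlie _ h)
      have hor : pA 𝕂 m k ∈ U ∨ pB 𝕂 m k ∈ U := by
        obtain ⟨u, hu, hu0⟩ := U.ne_bot_iff.1 h0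
        have h1 := hU hu
        rw [Hr_two_one hm, Submodule.mem_span_pair] at h1
        obtain ⟨a, b, rfl⟩ := h1
        have h2 := hst (bv 1) (isUVec_bv (by simp)) _ hu
        rw [map_add, map_smul, map_smul, (sg_planar hm k).1, (sg_planar hm k).2] at h2
        by_cases ha : a = 0
        · right
          have hb : b ≠ 0 := by rintro rfl; exact hu0 (by rw [ha, zero_smul, zero_smul, add_zero])
          rw [ha, zero_smul, zero_add] at hu
          exact hsm b _ hb hu
        · left
          have h3 := add_mem hu h2
          refine hsm (2 * a) _ (mul_ne_zero two_ne_zero ha) ?_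
          convert h3 using 1
          module
      refine le_antisymm hU ?_
      rw [Hr_two_one hm, Submodule.span_le]
      rintro f (rfl | rfl)
      · exact hor.elim id hBA
      · exact hor.elim hAB id

/-- The spaces of solutions are irreducible. -/
theorem irr_Hr_two (hm : 2 ≤ m) {s : ℤ} {k : ℕ} (hs : Adm 2 s k) : Irr 2 (Hr 𝕂 m 2 s k) := by
  obtain ⟨h0, h2, h⟩ := hs
  push_cast at h2 h
  obtain rfl | rfl | rfl : s = 0 ∨ s = 1 ∨ s = 2 := by omega
  · rw [h (.inl rfl)]
    exact irr_span_singleton hm one_ne_zero_cpol (Hr_two_zero hm)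
  · exact irr_Hr_two_one hm k
  · rw [h (.inr rfl)]
    refine irr_span_singleton hm (fun h => ?_) (Hr_two_two hm)
    exact (planar_ne_zero (𝕂 := 𝕂) hm 0).1 (by rw [pA_zero]; exact ve_mul_eq_zero ⟨by omega, hm⟩ h)

theorem irr_Hr {n : ℕ} (hm : n + 2 ≤ m) {s : ℤ} {k : ℕ} (hs : Adm (n + 2) s k) :
    Irr (n + 2) (Hr 𝕂 m (n + 2) s k) := by
  induction n generalizing s k with
  | zero => exact irr_Hr_two hm hs
  | succ n ih => exact irr_Hr_succ (by omega) hm hs fun t j h => ih (by omega) h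

/-! ### Inequivalence of modules -/

/-- A map that is equivariant on a stable subspace commutes there with the separating operator. -/
theorem tOp_of_equivariant {n : ℕ} (hn : n ≤ m) {U : Submodule 𝕂 (CPol 𝕂 m)} (hU : SgStable n U)
    {F : Module.End 𝕂 (CPol 𝕂 m)}
    (hF : ∀ v, IsUVec n v → ∀ f ∈ U, sg 𝕂 m v (F f) = F (sg 𝕂 m v f)) {f : CPol 𝕂 m} (hf : f ∈ U) :
    tOp 𝕂 m n (F f) = F (tOp 𝕂 m n f) := by
  have hlie : ∀ i ∈ Finset.Icc 1 n, ∀ j ∈ Finset.Icc 1 n, ∀ f ∈ U,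
      lie 𝕂 m i j (F f) = F (lie 𝕂 m i j f) := by
    intro i hi j hj f hf
    by_cases hij : i = j
    · subst hij; rw [lie_self, lie_self, map_zero]
    · have hrot : ∀ θ, rot 𝕂 m i j θ (F f) = F (rot 𝕂 m i j θ f) := by
        intro θ
        rw [rot, AlgHom.comp_apply, AlgHom.comp_apply, hF _ (isUVec_rv hi hj hij 0) f hf,
          hF _ (isUVec_rv hi hj hij θ) _ (hU _ (isUVec_rv hi hj hij 0) f hf)]
      have h1 := isDeriv_rot hi hj hij hn (F f)
      have h2 := (isDeriv_rot hi hj hij hn f).linMap F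
      simp only [hrot] at h1
      have h3 := h1.unique h2
      rw [map_smul] at h3
      exact smul_right_injective _ (two_ne_zero (α := 𝕂)) h3
  have homg : ∀ r ≤ n, ∀ f ∈ U, omg 𝕂 m r (F f) = F (omg 𝕂 m r f) := by
    intro r
    induction r with
    | zero => exact fun _ _ _ => rfl
    | succ r ih =>
      intro hr f hf
      have h1 : ∀ g, omg 𝕂 m (r + 1) g = omg 𝕂 m r (sg 𝕂 m (bv (r + 1)) g) := fun _ => rfl
      have hv : IsUVec n (bv (r + 1)) := isUVec_bv (by rw [Finset.mem_Icc]; omega)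
      rw [h1, h1, hF _ hv f hf, ih (by omega) _ (hU _ hv f hf)]
  have hcas : casimir 𝕂 m n (F f) = F (casimir 𝕂 m n f) := by
    rw [casimir_apply, casimir_apply, map_sum]
    refine Finset.sum_congr rfl fun i hi => ?_
    rw [map_sum]
    exact Finset.sum_congr rfl fun j hj => by
      rw [hlie i hi j hj f hf, hlie i hi j hj _ (lie_mem hi hj hn hU hf)]
  rw [tOp_apply, tOp_apply, hcas, map_add, map_smul]
  congr 1
  split_ifs
  · exact homg n le_rfl f hf
  · rw [map_zero]

/-- An equivalence would intertwine `tOp`, which acts on the two modules by different scalars. -/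
theorem not_areEquivalent {n : ℕ} (hn : n ≤ m) {a b : ℤ} (hab : a ≠ b)
    {U V : Submodule 𝕂 (CPol 𝕂 m)} (hU : SgStable n U) (hU0 : U ≠ ⊥)
    (hUa : ∀ f ∈ U, tOp 𝕂 m n f = (a : 𝕂) • f) (hVb : ∀ f ∈ V, tOp 𝕂 m n f = (b : 𝕂) • f) :
    ¬ AreEquivalent 𝕂 m n U V := by
  intro h
  obtain ⟨φ, hφ⟩ : ∃ φ : U ≃ₗ[𝕂] V, ∀ v, IsUVec n v → ∀ u u' : U,
      (u' : CPol 𝕂 m) = sg 𝕂 m v u → (φ u' : CPol 𝕂 m) = sg 𝕂 m v (φ u) := by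
    obtain ⟨φ, hφ⟩ := h
    exact ⟨φ, fun v hv => hφ _ (uVec_mem_Pin hn hv)⟩
  -- The extension to the whole space is arbitrary; only its equivariance on U matters.
  obtain ⟨F, hF⟩ := LinearMap.exists_extend (V.subtype ∘ₗ (φ : U →ₗ[𝕂] V))
  have hF' : ∀ u : U, F (u : CPol 𝕂 m) = (φ u : CPol 𝕂 m) := fun u => LinearMap.congr_fun hF u
  have heq : ∀ v, IsUVec n v → ∀ f ∈ U, sg 𝕂 m v (F f) = F (sg 𝕂 m v f) := by
    intro v hv f hf
    have h1 := hφ v hv ⟨f, hf⟩ ⟨sg 𝕂 m v f, hU v hv f hf⟩ rfl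
    exact ((hF' ⟨sg 𝕂 m v f, hU v hv f hf⟩).trans (h1.trans
      (congrArg (sg 𝕂 m v) (hF' ⟨f, hf⟩).symm))).symm
  refine hU0 (eq_bot_iff.2 fun f hf => (Submodule.mem_bot 𝕂).2 ?_)
  have h1 := tOp_of_equivariant hn hU heq hf
  have hfV : F f ∈ V := by
    have := hF' ⟨f, hf⟩
    exact this ▸ (φ ⟨f, hf⟩).2
  rw [hUa f hf, hVb _ hfV, map_smul, ← sub_eq_zero, ← sub_smul] at h1
  have h2 : F f = 0 := (smul_eq_zero.1 h1).resolve_left (sub_ne_zero.2 (by exact_mod_cast hab.symm))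
  have h3 : φ ⟨f, hf⟩ = 0 := Subtype.ext ((hF' ⟨f, hf⟩).symm.trans h2)
  exact congrArg Subtype.val (φ.map_eq_zero_iff.1 h3)

/-! ### The bases in dimension two -/

/-- The properties of the bases in dimension two that the construction depends on. -/
structure IsPlanarFamily (planar : ℤ → ℕ → CPol 𝕂 m) : Prop where
  zero : planar 0 0 = 1
  two : planar 2 0 = ve 𝕂 m 2 * ve 𝕂 m 1
  ne_zero : ∀ t k, t = 1 ∨ t = -1 → planar t k ≠ 0
  span : ∀ k, Submodule.span 𝕂 {planar 1 k, planar (-1) k} = Hr 𝕂 m 2 1 k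
  -- Orthogonality is demanded after every sign-equivariant map, because the planar elements enter
  -- the basis only through products of embedding factors.
  orth : ∀ (k : ℕ) (ε : ℤ) (Φ : Module.End 𝕂 (CPol 𝕂 m)), SemiEq 2 ε Φ → ∀ t, t = 1 ∨ t = -1 →
    iForm 𝕂 m (Φ (planar t k)) (Φ (planar (-t) k)) = 0

/-- The action of e_1 fixes one element, negates the other and preserves the form. The sign of Φ
enters twice, so the product equals its negative. -/
theorem iForm_planar (hm : 2 ≤ m) (k : ℕ) {ε : ℤ} {Φ : Module.End 𝕂 (CPol 𝕂 m)} (hΦ : SemiEq 2 ε Φ) :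
    iForm 𝕂 m (Φ (pA 𝕂 m k)) (Φ (pB 𝕂 m k)) = 0 ∧
      iForm 𝕂 m (Φ (pB 𝕂 m k)) (Φ (pA 𝕂 m k)) = 0 := by
  have hv : IsUVec 2 (bv 1) := isUVec_bv (by simp)
  obtain ⟨hA, hB⟩ := sg_planar (𝕂 := 𝕂) hm k
  have hεε : starRingEnd 𝕂 (ε : 𝕂) * (ε : 𝕂) = 1 := by rw [map_intCast, hΦ.sq]
  have key : ∀ f g : CPol 𝕂 m, iForm 𝕂 m (Φ (sg 𝕂 m (bv 1) f)) (Φ (sg 𝕂 m (bv 1) g)) =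
      iForm 𝕂 m (Φ f) (Φ g) := by
    intro f g
    rw [← iForm_sg (hv.mono hm) (Φ f), hΦ.2 _ hv, hΦ.2 _ hv, iForm_smul_left, iForm_smul_right,
      ← mul_assoc, hεε, one_mul]
  have h1 := key (pA 𝕂 m k) (pB 𝕂 m k)
  have h2 := key (pB 𝕂 m k) (pA 𝕂 m k)
  rw [hA, hB, map_neg] at h1 h2
  rw [map_neg] at h1
  rw [map_neg, LinearMap.neg_apply] at h2
  exact ⟨self_eq_neg.1 h1.symm, self_eq_neg.1 h2.symm⟩

theorem isPlanarFamily_real (hm : 2 ≤ m) : IsPlanarFamily (planarReal m : ℤ → ℕ → CPol ℝ m) where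
  zero := rfl
  two := rfl
  ne_zero t k ht := by
    rcases ht with rfl | rfl
    · exact (planar_ne_zero hm k).1
    · exact (planar_ne_zero hm k).2
  span k := (Hr_two_one hm k).symm
  orth k ε Φ hΦ t ht := by
    rcases ht with rfl | rfl
    · exact (iForm_planar hm k hΦ).1
    · exact (iForm_planar hm k hΦ).2

variable (m) in
/-- The basis elements in dimension two for complex scalars. -/
def pC (t : ℤ) (k : ℕ) : CPol ℂ m := planarComplex m t k

/-- Let c = ±i. Since c² = −1, multiplying A_k − cB_k by x_1 − c x_2 gives the same recursion as for
the real elements, so the complex element is A_k − cB_k. -/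
theorem pC_eq (hm : 2 ≤ m) {t : ℤ} (ht : t = 1 ∨ t = -1) (k : ℕ) :
    pC m t k = pA ℂ m k - ((t : ℂ) * Complex.I) • pB ℂ m k := by
  have h0 : ∀ k, pC m t k = (vx ℂ m 1 - ((t : ℂ) * Complex.I) • vx ℂ m 2) ^ k *
      (ve ℂ m 1 - ((t : ℂ) * Complex.I) • ve ℂ m 2) := by
    intro k
    rcases ht with rfl | rfl <;> rfl
  have hc : ((t : ℂ) * Complex.I) * ((t : ℂ) * Complex.I) = -1 := by
    rcases ht with rfl | rfl <;> simp
  induction k with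
  | zero => rw [h0, pow_zero, one_mul, pA_zero, pB_zero]
  | succ k ih =>
    rw [h0, pow_succ', mul_assoc, ← h0, ih, pA_succ hm, pB_succ hm, mulX_apply, mulX_apply, mulX_apply,
      mulX_apply]
    generalize (t : ℂ) * Complex.I = c at hc
    rw [sub_mul, smul_mul_assoc, mul_sub, mul_sub, mul_smul_comm, mul_smul_comm, smul_sub, smul_smul, hc]
    module

theorem isPlanarFamily_complex (hm : 2 ≤ m) :
    IsPlanarFamily (pC m) where
  zero := rfl
  two := rfl
  ne_zero t k ht := by
    rw [pC_eq hm ht]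
    intro h
    have h1 := congrArg (iForm ℂ m (pA ℂ m k)) h
    rw [map_sub, map_smul, map_zero, show iForm ℂ m (pA ℂ m k) (pB ℂ m k) = 0 from
      (iForm_planar hm k (SemiEq.id 2)).1, smul_zero, sub_zero] at h1
    exact (planar_ne_zero hm k).1 (eq_zero_of_iForm_self
      (mem_homog_of_mem_Hr hm (planar_mem hm k).1) h1)
  span k := by
    rw [Hr_two_one hm, pC_eq hm (.inl rfl), pC_eq hm (.inr rfl)]
    apply le_antisymm
    · rw [Submodule.span_le]
      have hA : pA ℂ m k ∈ Submodule.span ℂ {pA ℂ m k, pB ℂ m k} := Submodule.subset_span (by simp)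
      have hB : pB ℂ m k ∈ Submodule.span ℂ {pA ℂ m k, pB ℂ m k} := Submodule.subset_span (by simp)
      rintro _ (rfl | rfl)
      · exact sub_mem hA (Submodule.smul_mem _ _ hB)
      · exact sub_mem hA (Submodule.smul_mem _ _ hB)
    · rw [Submodule.span_le]
      set S := Submodule.span ℂ {pA ℂ m k - (((1 : ℤ) : ℂ) * Complex.I) • pB ℂ m k,
        pA ℂ m k - (((-1 : ℤ) : ℂ) * Complex.I) • pB ℂ m k}
      have h1 : pA ℂ m k - (((1 : ℤ) : ℂ) * Complex.I) • pB ℂ m k ∈ S := Submodule.subset_span (by simp)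
      have h2 : pA ℂ m k - (((-1 : ℤ) : ℂ) * Complex.I) • pB ℂ m k ∈ S := Submodule.subset_span (by simp)
      rintro _ (rfl | rfl)
      · have h3 := S.smul_mem (1 / 2 : ℂ) (add_mem h1 h2)
        rw [SetLike.mem_coe]
        convert h3 using 1
        push_cast
        module
      · have h3 := S.smul_mem (Complex.I / 2) (sub_mem h1 h2)
        rw [SetLike.mem_coe]
        convert h3 using 1
        have hI := Complex.I_mul_I
        push_cast
        match_scalars
        · linear_combination hI
        · ring
  orth k ε Φ hΦ t ht := by
    have ht' : -t = 1 ∨ -t = -1 := by omega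
    have hc : ((t : ℂ) * Complex.I) * ((t : ℂ) * Complex.I) = -1 := by
      rcases ht with rfl | rfl <;> simp
    -- The two complex elements are weight vectors of the rotation with weights ±i(k + 1). The
    -- rotation is skew, so distinct imaginary weights force orthogonality.
    have hl : ∀ t : ℤ, t = 1 ∨ t = -1 → lie ℂ m 1 2 (Φ (pC m t k)) =
        ((t : ℂ) * Complex.I * ((k : ℂ) + 1)) • Φ (pC m t k) := by
      intro t ht
      have hc : ((t : ℂ) * Complex.I) * ((t : ℂ) * Complex.I) = -1 := by
        rcases ht with rfl | rfl <;> simp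
      rw [hΦ.lie hm (i := 1) (j := 2) (by simp) (by simp), pC_eq hm ht, map_sub, map_smul, (lie_planar hm k).1,
        (lie_planar hm k).2, ← map_smul]
      congr 1
      generalize (t : ℂ) * Complex.I = c at hc
      match_scalars
      · linear_combination ((k : ℂ) + 1) * hc
      · ring
    have h1 := iForm_lie (by rw [Finset.mem_Icc]; omega) (by rw [Finset.mem_Icc]; omega)
      (Φ (pC m t k)) (Φ (pC m (-t) k)) (i := 1) (j := 2) (𝕂 := ℂ) (m := m)
    rw [hl t ht, hl _ ht', iForm_smul_left, iForm_smul_right] at h1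
    have hI : t ≠ 0 := by omega
    have hk : (k : ℂ) + 1 ≠ 0 := by exact_mod_cast Nat.succ_ne_zero k
    simp only [map_mul, map_add, map_one, map_natCast, map_intCast, Complex.conj_I] at h1
    have h2 : (2 * (t : ℂ) * Complex.I * ((k : ℂ) + 1)) *
        iForm ℂ m (Φ (pC m t k)) (Φ (pC m (-t) k)) = 0 := by
      push_cast at h1
      linear_combination -h1
    refine (mul_eq_zero.1 h2).resolve_left ?_
    simp only [ne_eq, mul_eq_zero, not_or]
    exact ⟨⟨⟨two_ne_zero, by exact_mod_cast hI⟩, Complex.I_ne_zero⟩, hk⟩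

/-! ### The index sequences -/

theorem sSeq_top (m s : ℕ) (ν : Set.Ico 2 m → ℤ) : sSeq m s ν m = s := by simp [sSeq]

theorem kSeq_top (m k : ℕ) (μ : Set.Ico 2 m → ℕ) : kSeq m k μ m = k := by simp [kSeq]

theorem sSeq_two (hm : 3 ≤ m) (s : ℕ) (ν : Set.Ico 2 m → ℤ) : sSeq m s ν 2 = |tTwo m ν| := by
  have h : (2 : ℕ) ∈ Set.Ico 2 m := ⟨le_rfl, by omega⟩
  rw [sSeq, tTwo, dif_pos h, dif_pos h, if_pos rfl]

theorem index_mem_N {s k : ℕ} (i : indexSet m s k) {n : ℕ} (hn : n + 3 ≤ m) :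
    (sSeq m s i.1.1 (n + 2), kSeq m k i.1.2 (n + 2)) ∈
      N (sSeq m s i.1.1 (n + 3)) (n + 3) (kSeq m k i.1.2 (n + 3)) :=
  i.2.2 (n + 3) (by omega) hn

theorem adm_mem_N {n : ℕ} {s t : ℤ} {k j : ℕ} (h : (t, j) ∈ N s (n + 1) k) : Adm n t j :=
  adm_of_mem_N ⟨(t, j), h⟩

theorem index_adm {s k : ℕ} (hs : Adm m s k) (i : indexSet m s k) {n : ℕ} (hn : n + 2 ≤ m) :
    Adm (n + 2) (sSeq m s i.1.1 (n + 2)) (kSeq m k i.1.2 (n + 2)) := by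
  rcases hn.eq_or_lt with h | h
  · rw [h, sSeq_top, kSeq_top]; exact hs
  · exact adm_mem_N (index_mem_N i h)

theorem index_ext {s k : ℕ} {i i' : indexSet m s k} (ht : tTwo m i.1.1 = tTwo m i'.1.1)
    (hs : ∀ r, 2 ≤ r → r ≤ m → sSeq m s i.1.1 r = sSeq m s i'.1.1 r ∧
      kSeq m k i.1.2 r = kSeq m k i'.1.2 r) : i = i' := by
  refine Subtype.ext (Prod.ext (funext ?_) (funext ?_))
  · rintro ⟨r, hr⟩
    by_cases h : r = 2
    · subst h
      rwa [tTwo, tTwo, dif_pos hr, dif_pos hr] at ht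
    · have := (hs r hr.1 hr.2.le).1
      rwa [sSeq, sSeq, dif_pos hr, dif_pos hr, if_neg h, if_neg h] at this
  · rintro ⟨r, hr⟩
    have := (hs r hr.1 hr.2.le).2
    rwa [kSeq, kSeq, dif_pos hr, dif_pos hr] at this

/-- The sequences that satisfy the conditions on the indices above the level `n`. -/
def IsPath (m s k n : ℕ) (σ : ℕ → ℤ) (κ : ℕ → ℕ) : Prop :=
  σ m = s ∧ κ m = k ∧ ∀ r, n ≤ r → r + 1 ≤ m → (σ r, κ r) ∈ N (σ (r + 1)) (r + 1) (κ (r + 1))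

theorem IsPath.adm {s k n : ℕ} (hs : Adm m s k) {σ : ℕ → ℤ} {κ : ℕ → ℕ} (h : IsPath m s k n σ κ)
    (hn : n ≤ m) : Adm n (σ n) (κ n) := by
  rcases hn.eq_or_lt with rfl | h'
  · rw [h.1, h.2.1]; exact hs
  · exact adm_mem_N (h.2.2 n le_rfl h')

theorem IsPath.update {s k n : ℕ} {σ : ℕ → ℤ} {κ : ℕ → ℕ} (h : IsPath m s k (n + 1) σ κ)
    (hn : n + 1 ≤ m) {t : ℤ} {j : ℕ} (hN : (t, j) ∈ N (σ (n + 1)) (n + 1) (κ (n + 1))) :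
    IsPath m s k n (Function.update σ n t) (Function.update κ n j) := by
  refine ⟨?_, ?_, fun r hr hrm => ?_⟩
  · rw [Function.update_of_ne (by omega), h.1]
  · rw [Function.update_of_ne (by omega), h.2.1]
  · rw [Function.update_of_ne (by omega : r + 1 ≠ n), Function.update_of_ne (by omega : r + 1 ≠ n)]
    by_cases hrn : r = n
    · subst hrn
      rwa [Function.update_self, Function.update_self]
    · rw [Function.update_of_ne hrn, Function.update_of_ne hrn]
      exact h.2.2 r (by omega) hrm

theorem exists_index (hm : 3 ≤ m) {s k : ℕ} {σ : ℕ → ℤ} {κ : ℕ → ℕ} (h : IsPath m s k 2 σ κ) {t : ℤ}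
    (ht : |t| = σ 2) (ht' : (t = 0 ∧ κ 2 = 0) ∨ (t = 2 ∧ κ 2 = 0) ∨ t = 1 ∨ t = -1) :
    ∃ i : indexSet m s k, tTwo m i.1.1 = t ∧ ∀ r, 2 ≤ r → r ≤ m →
      sSeq m s i.1.1 r = σ r ∧ kSeq m k i.1.2 r = κ r := by
  have h2 : (2 : ℕ) ∈ Set.Ico 2 m := ⟨le_rfl, by omega⟩
  let ν : Set.Ico 2 m → ℤ := fun r => if r.1 = 2 then t else σ r
  let μ : Set.Ico 2 m → ℕ := fun r => κ r
  have ht2 : tTwo m ν = t := by rw [tTwo, dif_pos h2]; rfl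
  have hσ : ∀ r, 2 ≤ r → r ≤ m → sSeq m s ν r = σ r := by
    intro r hr hrm
    rcases hrm.eq_or_lt with rfl | hrm
    · rw [sSeq_top, h.1]
    · have hr' : r ∈ Set.Ico 2 m := ⟨hr, hrm⟩
      rw [sSeq, dif_pos hr']
      by_cases hr2 : r = 2
      · subst hr2
        rw [if_pos rfl, ← ht]; rfl
      · rw [if_neg hr2]
        exact if_neg hr2
  have hκ : ∀ r, 2 ≤ r → r ≤ m → kSeq m k μ r = κ r := by
    intro r hr hrm
    rcases hrm.eq_or_lt with rfl | hrm
    · rw [kSeq_top, h.2.1]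
    · have hr' : r ∈ Set.Ico 2 m := ⟨hr, hrm⟩
      rw [kSeq, dif_pos hr']
  refine ⟨⟨(ν, μ), ?_, fun r hr hrm => ?_⟩, ht2, fun r hr hrm => ⟨hσ r hr hrm, hκ r hr hrm⟩⟩
  · simp only
    rwa [ht2, hκ 2 le_rfl (by omega)]
  · simp only
    obtain ⟨r, rfl⟩ := Nat.exists_eq_add_of_le' (show 1 ≤ r by omega)
    rw [Nat.add_sub_cancel, hσ r (by omega) (by omega), hκ r (by omega) (by omega),
      hσ _ (by omega) hrm, hκ _ (by omega) hrm]
    exact h.2.2 r (by omega) hrm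

/-! ### The basis elements -/

theorem IsPlanarFamily.mem_and_ne_zero {planar : ℤ → ℕ → CPol 𝕂 m} (h : IsPlanarFamily planar)
    (hm : 2 ≤ m) {t : ℤ} {k : ℕ} (ht : (t = 0 ∧ k = 0) ∨ (t = 2 ∧ k = 0) ∨ t = 1 ∨ t = -1) :
    planar t k ∈ Hr 𝕂 m 2 |t| k ∧ planar t k ≠ 0 := by
  rcases ht with ⟨rfl, rfl⟩ | ⟨rfl, rfl⟩ | rfl | rfl
  · rw [h.zero]
    exact ⟨one_mem_Hr 2, one_ne_zero_cpol⟩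
  · rw [h.two]
    refine ⟨?_, fun h0 => (irr_Hr_two (𝕂 := 𝕂) (s := 2) (k := 0) hm ⟨by simp, by simp, by simp⟩).2.1 ?_⟩
    · rw [show |(2 : ℤ)| = 2 from rfl, Hr_two_two hm]
      exact Submodule.mem_span_singleton_self _
    · rw [Hr_two_two hm, h0, Submodule.span_zero_singleton]
  · refine ⟨?_, h.ne_zero _ _ (.inl rfl)⟩
    rw [show |(1 : ℤ)| = 1 from rfl, ← h.span]
    exact Submodule.subset_span (by simp)
  · refine ⟨?_, h.ne_zero _ _ (.inr rfl)⟩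
    rw [show |(-1 : ℤ)| = 1 from rfl, ← h.span]
    exact Submodule.subset_span (by simp)

/-- The partial products of embedding factors. -/
def cch {s k : ℕ} (planar : ℤ → ℕ → CPol 𝕂 m) (i : indexSet m s k) (n : ℕ) : CPol 𝕂 m :=
  chain 𝕂 m (sSeq m s i.1.1) (kSeq m k i.1.2) (planar (tTwo m i.1.1) (kSeq m k i.1.2 2)) n

theorem cch_zero {s k : ℕ} (planar : ℤ → ℕ → CPol 𝕂 m) (i : indexSet m s k) :
    cch planar i 0 = planar (tTwo m i.1.1) (kSeq m k i.1.2 2) := rfl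

theorem cch_succ {s k : ℕ} (planar : ℤ → ℕ → CPol 𝕂 m) (i : indexSet m s k) (n : ℕ) :
    cch planar i (n + 1) = embL 𝕂 m (sSeq m s i.1.1 (n + 3)) (sSeq m s i.1.1 (n + 2)) (n + 2)
      (kSeq m k i.1.2 (n + 3)) (kSeq m k i.1.2 (n + 2)) (cch planar i n) :=
  embX_eq_embL _ _ (n + 2) _ _ _

theorem cch_mem_and_ne_zero {planar : ℤ → ℕ → CPol 𝕂 m} (hp : IsPlanarFamily planar) (hm : 3 ≤ m)
    {s k : ℕ} (hs : Adm m s k) (i : indexSet m s k) {n : ℕ} (hn : n + 2 ≤ m) :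
    cch planar i n ∈ Hr 𝕂 m (n + 2) (sSeq m s i.1.1 (n + 2)) (kSeq m k i.1.2 (n + 2)) ∧
      cch planar i n ≠ 0 := by
  induction n with
  | zero =>
    rw [cch_zero, zero_add, sSeq_two hm]
    exact hp.mem_and_ne_zero (by omega) i.2.1
  | succ n ih =>
    obtain ⟨h1, h2⟩ := ih (by omega)
    rw [cch_succ]
    refine ⟨embL_mem (by omega) hn (index_mem_N i hn) (index_adm hs i hn).not_extreme h1, fun h => h2 ?_⟩
    exact embL_injective (by omega) hn (index_mem_N i hn) (Hr_le_polSub h1) h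

/-! ### Orthogonality -/

/-- The map Φ collects the common embedding factors above the level considered. If the next indices
differ, `tOp` separates the two elements; if they agree, one more factor is absorbed into Φ. At the
bottom the indices can differ only in the sign of t₂. -/
theorem iForm_cch {planar : ℤ → ℕ → CPol 𝕂 m} (hp : IsPlanarFamily planar) (hm : 3 ≤ m)
    {s k : ℕ} (hs : Adm m s k) {i i' : indexSet m s k} (hii : i ≠ i') {n : ℕ} (hn : n + 2 ≤ m)
    (h : ∀ r, n + 2 ≤ r → r ≤ m → sSeq m s i.1.1 r = sSeq m s i'.1.1 r ∧
      kSeq m k i.1.2 r = kSeq m k i'.1.2 r) {ε : ℤ} {Φ : Module.End 𝕂 (CPol 𝕂 m)}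
    (hΦ : SemiEq (n + 2) ε Φ) : iForm 𝕂 m (Φ (cch planar i n)) (Φ (cch planar i' n)) = 0 := by
  induction n generalizing ε Φ with
  | zero =>
    obtain ⟨h1, h2⟩ := h 2 le_rfl (by omega)
    have h3 : tTwo m i.1.1 ≠ tTwo m i'.1.1 := fun h3 => hii (index_ext h3 h)
    rw [sSeq_two hm, sSeq_two hm, abs_eq_abs] at h1
    have h4 := h1.resolve_left h3
    have h5 : tTwo m i.1.1 = 1 ∨ tTwo m i.1.1 = -1 := by
      have := i.2.1
      have := i'.2.1
      omega
    have h6 : tTwo m i'.1.1 = -tTwo m i.1.1 := by omega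
    rw [cch_zero, cch_zero, ← h2, h6]
    exact hp.orth _ ε Φ hΦ _ h5
  | succ n ih =>
    obtain ⟨h1, h2⟩ := h (n + 3) le_rfl hn
    have hN := index_mem_N i hn
    have hN' := index_mem_N i' hn
    have hmem := (cch_mem_and_ne_zero hp hm hs i (n := n) (by omega)).1
    have hmem' := (cch_mem_and_ne_zero hp hm hs i' (n := n) (by omega)).1
    rw [cch_succ, cch_succ, ← h1, ← h2]
    rw [← h1, ← h2] at hN'
    have hΦ' := hΦ.mono (Nat.le_succ (n + 2))
    by_cases hpp : (sSeq m s i.1.1 (n + 2), kSeq m k i.1.2 (n + 2)) =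
        (sSeq m s i'.1.1 (n + 2), kSeq m k i'.1.2 (n + 2))
    · obtain ⟨h3, h4⟩ := Prod.mk.injEq _ _ _ _ ▸ hpp
      rw [← h3, ← h4]
      have h5 : ∀ r, n + 2 ≤ r → r ≤ m → sSeq m s i.1.1 r = sSeq m s i'.1.1 r ∧
          kSeq m k i.1.2 r = kSeq m k i'.1.2 r := by
        intro r hr hrm
        rcases hr.eq_or_lt with rfl | hr
        · exact ⟨h3, h4⟩
        · exact h r hr hrm
      have h6 := ih (by omega) h5
        (hΦ'.comp (semiEq_embL (k := kSeq m k i.1.2 (n + 3)) (j := kSeq m k i.1.2 (n + 2)) hn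
          (mem_N_succ.1 hN).2.2.2.1))
      rwa [Module.End.mul_apply, Module.End.mul_apply] at h6
    · refine iForm_eq_zero_of_tOp (n := n + 2) (by omega)
        ((brEig_injective (by omega) hΦ.1 (sSeq m s i.1.1 (n + 3)) (kSeq m k i.1.2 (n + 3))).ne
          (a₁ := ⟨_, hN⟩) (a₂ := ⟨_, hN'⟩) (fun h => hpp (congrArg Subtype.val h)))
        (tOp_of_mem_brC hn hΦ' (Submodule.mem_map_of_mem hmem))
        (tOp_of_mem_brC hn hΦ' (Submodule.mem_map_of_mem hmem'))

/-- Pairwise orthogonal elements that are not isotropic are linearly independent. -/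
theorem linearIndependent_of_iForm {I : Type} {f : I → CPol 𝕂 m}
    (h0 : ∀ i, iForm 𝕂 m (f i) (f i) ≠ 0) (h : ∀ i j, i ≠ j → iForm 𝕂 m (f i) (f j) = 0) :
    LinearIndependent 𝕂 f := by
  rw [linearIndependent_iff']
  intro S c hc i hi
  have h1 := congrArg (iForm 𝕂 m (f i)) hc
  rw [map_sum, map_zero, Finset.sum_eq_single i (fun j _ hj => by
    rw [iForm_smul_right, h i j hj.symm, mul_zero]) (fun hi' => absurd hi hi'), iForm_smul_right] at h1
  exact (mul_eq_zero.1 h1).resolve_right (h0 i)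

/-! ### The Gelfand-Tsetlin property -/

/-- The indices that agree with the given sequences above the level `n`. -/
def pathSet (m s k n : ℕ) (σ : ℕ → ℤ) (κ : ℕ → ℕ) : Set (indexSet m s k) :=
  {i | ∀ r, n ≤ r → r ≤ m → sSeq m s i.1.1 r = σ r ∧ kSeq m k i.1.2 r = κ r}

theorem mem_pathSet_update {s k n : ℕ} {σ : ℕ → ℤ} {κ : ℕ → ℕ} (hn : n + 1 ≤ m) {t : ℤ} {j : ℕ}
    {i : indexSet m s k} :
    i ∈ pathSet m s k n (Function.update σ n t) (Function.update κ n j) ↔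
      i ∈ pathSet m s k (n + 1) σ κ ∧ sSeq m s i.1.1 n = t ∧ kSeq m k i.1.2 n = j := by
  constructor
  · intro h
    refine ⟨fun r hr hrm => ?_, ?_⟩
    · have := h r (by omega) hrm
      rwa [Function.update_of_ne (by omega), Function.update_of_ne (by omega)] at this
    · have := h n le_rfl (by omega)
      rwa [Function.update_self, Function.update_self] at this
  · rintro ⟨h1, h2⟩ r hr hrm
    by_cases hrn : r = n
    · subst hrn
      rwa [Function.update_self, Function.update_self]
    · rw [Function.update_of_ne hrn, Function.update_of_ne hrn]
      exact h1 r (by omega) hrm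

theorem span_image_pathSet {planar : ℤ → ℕ → CPol 𝕂 m} (hp : IsPlanarFamily planar) (hm : 3 ≤ m)
    {s k : ℕ} (hs : Adm m s k) {f : indexSet m s k → CPol 𝕂 m} {σ : ℕ → ℤ} {κ : ℕ → ℕ}
    (hσ : IsPath m s k 2 σ κ) {Φ : Module.End 𝕂 (CPol 𝕂 m)}
    (hfΦ : ∀ i ∈ pathSet m s k 2 σ κ, f i = Φ (cch planar i 0)) :
    Submodule.span 𝕂 (f '' pathSet m s k 2 σ κ) = (Hr 𝕂 m 2 (σ 2) (κ 2)).map Φ := by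
  apply le_antisymm
  · rw [Submodule.span_le]
    rintro _ ⟨i, hi, rfl⟩
    rw [SetLike.mem_coe, hfΦ i hi]
    have h1 := (cch_mem_and_ne_zero hp hm hs i (n := 0) (by omega)).1
    obtain ⟨h2, h3⟩ := hi 2 le_rfl (by omega)
    rw [zero_add, h2, h3] at h1
    exact Submodule.mem_map_of_mem h1
  · have key : ∀ t : ℤ, |t| = σ 2 → ((t = 0 ∧ κ 2 = 0) ∨ (t = 2 ∧ κ 2 = 0) ∨ t = 1 ∨ t = -1) →
        Φ (planar t (κ 2)) ∈ Submodule.span 𝕂 (f '' pathSet m s k 2 σ κ) := by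
      intro t ht ht'
      obtain ⟨i, hi, hi'⟩ := exists_index hm hσ ht ht'
      have h1 := hfΦ i hi'
      rw [cch_zero, hi, (hi' 2 le_rfl (by omega)).2] at h1
      rw [← h1]
      exact Submodule.subset_span ⟨i, hi', rfl⟩
    obtain ⟨h0, h1, h2⟩ := hσ.adm hs (by omega)
    push_cast at h1 h2
    have h3 : σ 2 = 0 ∨ σ 2 = 1 ∨ σ 2 = 2 := by omega
    rcases h3 with h3 | h3 | h3
    · have hκ := h2 (.inl h3)
      have h4 := key 0 (by rw [h3, abs_zero]) (.inl ⟨rfl, hκ⟩)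
      rw [hκ, hp.zero] at h4
      rw [h3, hκ, Hr_two_zero (by omega), Submodule.map_span, Set.image_singleton, Submodule.span_le]
      exact Set.singleton_subset_iff.2 h4
    · have h4 := key 1 (by rw [h3, abs_one]) (by omega)
      have h5 := key (-1) (by rw [h3, abs_neg, abs_one]) (by omega)
      rw [h3, ← hp.span, Submodule.map_span, Set.image_pair, Submodule.span_le]
      rintro _ (rfl | rfl)
      · exact h4
      · exact h5
    · have hκ := h2 (.inr h3)
      have h4 := key 2 (by rw [h3]; rfl) (.inr (.inl ⟨rfl, hκ⟩))
      rw [hκ, hp.two] at h4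
      rw [h3, hκ, Hr_two_two (by omega), Submodule.map_span, Set.image_singleton, Submodule.span_le]
      exact Set.singleton_subset_iff.2 h4

/-- The statement is generalised to the elements with prescribed indices from level n + 2 upwards,
with Φ the product of the embedding factors fixed by these indices. Fixing one more index selects a
branching component, to which the induction hypothesis applies with Φ extended by one factor. -/
theorem isGelfandTsetlin_pathSet {planar : ℤ → ℕ → CPol 𝕂 m} (hp : IsPlanarFamily planar) (hm : 3 ≤ m)
    {s k : ℕ} (hs : Adm m s k) {f : indexSet m s k → CPol 𝕂 m} (hf : LinearIndependent 𝕂 f) {n : ℕ}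
    (hn : n + 2 ≤ m) {σ : ℕ → ℤ} {κ : ℕ → ℕ} (hσ : IsPath m s k (n + 2) σ κ) {ε : ℤ}
    {Φ : Module.End 𝕂 (CPol 𝕂 m)} (hΦ : SemiEq (n + 2) ε Φ)
    (hinj : ∀ g ∈ Hr 𝕂 m (n + 2) (σ (n + 2)) (κ (n + 2)), Φ g = 0 → g = 0)
    (hfΦ : ∀ i ∈ pathSet m s k (n + 2) σ κ, f i = Φ (cch planar i n)) :
    IsGelfandTsetlin 𝕂 m f n (pathSet m s k (n + 2) σ κ)
      ((Hr 𝕂 m (n + 2) (σ (n + 2)) (κ (n + 2))).map Φ) := by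
  have hirr := ((irr_Hr hn (hσ.adm hs hn)).map hΦ hinj).isIrred hn
  induction n generalizing σ κ ε Φ with
  | zero =>
    have h1 : LinearIndepOn 𝕂 f (pathSet m s k 2 σ κ) := hf.linearIndepOn_univ.mono (Set.subset_univ _)
    exact ⟨hirr, h1, span_image_pathSet hp hm hs hσ hfΦ⟩
  | succ n ih =>
    have hadm := hσ.adm hs hn
    have hΦ' : SemiEq (n + 2) ε Φ := hΦ.mono (Nat.le_succ _)
    let V : N (σ (n + 3)) (n + 2 + 1) (κ (n + 3)) → Submodule 𝕂 (CPol 𝕂 m) :=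
      fun p => (brC 𝕂 m (n + 2) (σ (n + 3)) (κ (n + 3)) p).map Φ
    have hbr : ∀ p, brC 𝕂 m (n + 2) (σ (n + 3)) (κ (n + 3)) p ≤ Hr 𝕂 m (n + 3) (σ (n + 3)) (κ (n + 3)) := by
      intro p
      rw [← iSup_brC (by omega) hn hadm.not_extreme]
      exact le_iSup _ p
    have hVeig : ∀ p, ∀ g ∈ V p,
        tOp 𝕂 m (n + 2) g = (brEig (n + 2) ε (σ (n + 3)) (κ (n + 3)) p : 𝕂) • g := by
      rintro p _ ⟨g, hg, rfl⟩
      exact tOp_of_mem_brC hn hΦ' hg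
    have hVirr : ∀ p, Irr (n + 2) (V p) := fun p =>
      (irr_brC (by omega) hn (fun _ _ h => irr_Hr (by omega) h) p).map hΦ' fun g hg => hinj g (hbr p hg)
    have hVind : iSupIndep V :=
      (iSupIndep_eigenspace (tOp 𝕂 m (n + 2)) (Int.cast_injective.comp
        (brEig_injective (by omega) hΦ.1 (σ (n + 3)) (κ (n + 3))))).mono
        fun p g hg => Module.End.mem_eigenspace_iff.2 (hVeig p g hg)
    have hVmem : ∀ i ∈ pathSet m s k (n + 3) σ κ,
        ∃ p, p.1 = (sSeq m s i.1.1 (n + 2), kSeq m k i.1.2 (n + 2)) ∧ f i ∈ V p := by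
      intro i hi
      obtain ⟨h1, h2⟩ := hi (n + 3) le_rfl hn
      have hN := index_mem_N i hn
      rw [h1, h2] at hN
      refine ⟨⟨_, hN⟩, rfl, ?_⟩
      rw [hfΦ i hi, cch_succ, h1, h2]
      exact Submodule.mem_map_of_mem (Submodule.mem_map_of_mem
        (cch_mem_and_ne_zero hp hm hs i (by omega)).1)
    -- A basis element lies in the component given by its own index; it is nonzero and the
    -- components are independent, so it lies in no other.
    have hVset : ∀ p, {i ∈ pathSet m s k (n + 3) σ κ | f i ∈ V p} = pathSet m s k (n + 2)
        (Function.update σ (n + 2) p.1.1) (Function.update κ (n + 2) p.1.2) := by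
      intro p
      ext i
      rw [mem_pathSet_update hn]
      refine and_congr_right fun hi => ?_
      obtain ⟨q, hq, hq'⟩ := hVmem i hi
      constructor
      · intro hip
        have hpq : p = q := by
          by_contra hpq
          exact hf.ne_zero i ((hVind.pairwiseDisjoint hpq).le_bot ⟨hip, hq'⟩)
        rw [hpq, hq]
        exact ⟨rfl, rfl⟩
      · rintro ⟨h1, h2⟩
        have hpq : p = q := Subtype.ext (by rw [hq, h1, h2])
        rwa [hpq]
    have h1 : sSupIndep (Set.range V) := hVind.sSupIndep_range
    have h2 : sSup (Set.range V) = (Hr 𝕂 m (n + 3) (σ (n + 3)) (κ (n + 3))).map Φ := by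
      rw [sSup_range, ← iSup_brC (by omega) hn hadm.not_extreme, Submodule.map_iSup]
    have h3 : ∀ U ∈ Set.range V, ∀ V' ∈ Set.range V, U ≠ V' → ¬ AreEquivalent 𝕂 m (n + 2) U V' := by
      rintro _ ⟨p, rfl⟩ _ ⟨q, rfl⟩ hpq
      have hne : p ≠ q := fun h => hpq (by rw [h])
      exact not_areEquivalent (by omega)
        ((brEig_injective (by omega) hΦ.1 (σ (n + 3)) (κ (n + 3))).ne hne) (hVirr p).1 (hVirr p).2.1
        (hVeig p) (hVeig q)
    have h4 : ∀ i ∈ pathSet m s k (n + 3) σ κ, ∃ V' ∈ Set.range V, f i ∈ V' := by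
      intro i hi
      obtain ⟨p, -, hp'⟩ := hVmem i hi
      exact ⟨V p, ⟨p, rfl⟩, hp'⟩
    have h5 : ∀ V' ∈ Set.range V,
        IsGelfandTsetlin 𝕂 m f n {i ∈ pathSet m s k (n + 3) σ κ | f i ∈ V'} V' := by
      rintro _ ⟨p, rfl⟩
      have hpath := hσ.update hn p.2
      have h6 := hΦ'.comp (semiEq_embL (𝕂 := 𝕂) (k := κ (n + 3)) (j := p.1.2) hn (mem_N_cases p))
      have hW : V p = (Hr 𝕂 m (n + 2) (Function.update σ (n + 2) p.1.1 (n + 2))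
          (Function.update κ (n + 2) p.1.2 (n + 2))).map
            (Φ * embL 𝕂 m (σ (n + 3)) p.1.1 (n + 2) (κ (n + 3)) p.1.2) := by
        rw [Function.update_self, Function.update_self]
        exact (Submodule.map_comp _ _ _).symm
      have h7 : ∀ g ∈ Hr 𝕂 m (n + 2) (Function.update σ (n + 2) p.1.1 (n + 2))
          (Function.update κ (n + 2) p.1.2 (n + 2)),
          (Φ * embL 𝕂 m (σ (n + 3)) p.1.1 (n + 2) (κ (n + 3)) p.1.2) g = 0 → g = 0 := by
        intro g hg hg0
        rw [Function.update_self, Function.update_self] at hg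
        exact embL_injective (by omega) hn p.2 (Hr_le_polSub hg)
          (hinj _ (hbr p (Submodule.mem_map_of_mem hg)) hg0)
      have h8 : ∀ i ∈ pathSet m s k (n + 2) (Function.update σ (n + 2) p.1.1)
          (Function.update κ (n + 2) p.1.2), f i =
            (Φ * embL 𝕂 m (σ (n + 3)) p.1.1 (n + 2) (κ (n + 3)) p.1.2) (cch planar i n) := by
        intro i hi
        obtain ⟨hi, h9, h10⟩ := (mem_pathSet_update hn).1 hi
        obtain ⟨h11, h12⟩ := hi (n + 3) le_rfl hn
        rw [hfΦ i hi, cch_succ, h9, h10, h11, h12, Module.End.mul_apply]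
      rw [hVset p, hW]
      exact ih (by omega) hpath h6 h7 h8
        (((irr_Hr (by omega) (hpath.adm hs (by omega))).map h6 h7).isIrred (by omega))
    exact ⟨hirr, Set.range V, h1, h2, h3, h4, h5⟩

/-- The decompositions along the chain reduce spanning to the planar level, where it is part of the
definition. -/
theorem IsGelfandTsetlin.span {I : Type} {f : I → CPol 𝕂 m} {n : ℕ} {J : Set I}
    {W : Submodule 𝕂 (CPol 𝕂 m)} (h : IsGelfandTsetlin 𝕂 m f n J W) :
    Submodule.span 𝕂 (f '' J) = W := by
  induction n generalizing J W with
  | zero => exact h.2.2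
  | succ n ih =>
    obtain ⟨𝒱, h2, h4, h5⟩ : ∃ 𝒱 : Set (Submodule 𝕂 (CPol 𝕂 m)), sSup 𝒱 = W ∧
        (∀ i ∈ J, ∃ V ∈ 𝒱, f i ∈ V) ∧
        ∀ V ∈ 𝒱, IsGelfandTsetlin 𝕂 m f n {i ∈ J | f i ∈ V} V := by
      obtain ⟨-, 𝒱, -, h2, -, h4, h5⟩ := h
      exact ⟨𝒱, h2, h4, h5⟩
    apply le_antisymm
    · rw [Submodule.span_le]
      rintro _ ⟨i, hi, rfl⟩
      obtain ⟨V, hV, hiV⟩ := h4 i hi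
      exact h2 ▸ le_sSup hV hiV
    · rw [← h2]
      refine sSup_le fun V hV => ?_
      rw [← ih (h5 V hV)]
      exact Submodule.span_mono (Set.image_mono fun i hi => hi.1)

/-! ### The main result -/

/-- At the top level no embedding factor has been fixed, so Φ is the identity and all indices are
admitted. Independence comes from orthogonality and definiteness, spanning from the adapted
decomposition. -/
theorem gtElement_basis {planar : ℤ → ℕ → CPol 𝕂 m} (hp : IsPlanarFamily planar) (hm : 3 ≤ m)
    {s k : ℕ} (hs : Adm m s k) :
    IsOrthogonalBasis 𝕂 m (gtElement 𝕂 m s k planar) (HdR 𝕂 m s k) ∧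
      IsGelfandTsetlinBasis 𝕂 m (gtElement 𝕂 m s k planar) (HdR 𝕂 m s k) := by
  obtain ⟨n, rfl⟩ := Nat.exists_eq_add_of_le' (show 2 ≤ m by omega)
  have horth : ∀ i j : indexSet (n + 2) s k, i ≠ j →
      iForm 𝕂 (n + 2) (cch planar i n) (cch planar j n) = 0 := by
    intro i j hij
    have h := iForm_cch hp hm hs hij (le_refl (n + 2)) (fun r hr hrm => by
      obtain rfl : r = n + 2 := by omega
      rw [sSeq_top, sSeq_top, kSeq_top, kSeq_top]
      exact ⟨rfl, rfl⟩) (SemiEq.id (n + 2))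
    rwa [LinearMap.id_apply, LinearMap.id_apply] at h
  have hli : LinearIndependent 𝕂 fun i : indexSet (n + 2) s k => cch planar i n := by
    refine linearIndependent_of_iForm (fun i h => ?_) horth
    obtain ⟨h1, h2⟩ := cch_mem_and_ne_zero hp hm hs i le_rfl
    exact h2 (eq_zero_of_iForm_self (mem_homog_of_mem_Hr le_rfl h1) h)
  have hpath : IsPath (n + 2) s k (n + 2) (fun _ => s) (fun _ => k) :=
    ⟨rfl, rfl, fun r hr hrm => by omega⟩
  have hJ : pathSet (n + 2) s k (n + 2) (fun _ => s) (fun _ => k) = Set.univ := by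
    refine Set.eq_univ_of_forall fun i r hr hrm => ?_
    obtain rfl : r = n + 2 := by omega
    exact ⟨sSeq_top _ _ _, kSeq_top _ _ _⟩
  have hGT : IsGelfandTsetlin 𝕂 (n + 2) (fun i : indexSet (n + 2) s k => cch planar i n) n Set.univ
      (cHdR 𝕂 (n + 2) s k) := by
    have h1 := isGelfandTsetlin_pathSet hp hm hs hli le_rfl hpath (SemiEq.id (n + 2)) (fun _ _ h => h)
      (fun _ _ => rfl)
    have h2 : cHdR 𝕂 (n + 2) s k = (Hr 𝕂 (n + 2) (n + 2) s k).map LinearMap.id := by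
      rw [cHdR_eq, Submodule.map_id]
    rw [hJ] at h1
    exact h2 ▸ h1
  have hspan : Submodule.span 𝕂 (Set.range fun i : indexSet (n + 2) s k => cch planar i n) =
      cHdR 𝕂 (n + 2) s k := by
    rw [← Set.image_univ]
    exact hGT.span
  exact ⟨⟨hli, hspan, horth⟩, hGT⟩

theorem HdR_eq_bot {s k : ℕ} (hs : s = 0 ∨ s = m) (hk : 1 ≤ k) : HdR 𝕂 m s k = ⊥ := by
  have h : cHdR 𝕂 m s k = ⊥ := by
    rw [cHdR_eq, eq_bot_iff]
    intro f hf
    exact (Submodule.mem_bot 𝕂).2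
      (Hr_eq_zero_of_extreme le_rfl hf (by exact_mod_cast hs) (by omega))
  exact h

end

end HodgeDeRham

theorem theorem4p4 (m s k : ℕ) (hm : 3 ≤ m) (hs : s ≤ m) :
    ((s = 0 ∨ s = m) ∧ 1 ≤ k → HodgeDeRham.HdR ℝ m s k = ⊥ ∧ HodgeDeRham.HdR ℂ m s k = ⊥) ∧
    (¬ ((s = 0 ∨ s = m) ∧ 1 ≤ k) →
      (HodgeDeRham.IsOrthogonalBasis ℝ m
          (HodgeDeRham.gtElement ℝ m s k (HodgeDeRham.planarReal m)) (HodgeDeRham.HdR ℝ m s k) ∧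
        HodgeDeRham.IsGelfandTsetlinBasis ℝ m
          (HodgeDeRham.gtElement ℝ m s k (HodgeDeRham.planarReal m)) (HodgeDeRham.HdR ℝ m s k)) ∧
      (HodgeDeRham.IsOrthogonalBasis ℂ m
          (HodgeDeRham.gtElement ℂ m s k (HodgeDeRham.planarComplex m)) (HodgeDeRham.HdR ℂ m s k) ∧
        HodgeDeRham.IsGelfandTsetlinBasis ℂ m
          (HodgeDeRham.gtElement ℂ m s k (HodgeDeRham.planarComplex m))
          (HodgeDeRham.HdR ℂ m s k))) := by
  refine ⟨fun h => ⟨HodgeDeRham.HdR_eq_bot h.1 h.2, HodgeDeRham.HdR_eq_bot h.1 h.2⟩, fun h => ?_⟩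
  have hadm : HodgeDeRham.Adm m s k := by
    refine ⟨by omega, by exact_mod_cast hs, fun h' => ?_⟩
    have : s = 0 ∨ s = m := by exact_mod_cast h'
    omega
  exact ⟨HodgeDeRham.gtElement_basis (HodgeDeRham.isPlanarFamily_real (by omega)) hm hadm,
    HodgeDeRham.gtElement_basis (HodgeDeRham.isPlanarFamily_complex (by omega)) hm hadm⟩
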